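/- **Setting.** Let $(M,d,\mu)$ be a complete, volume doubling metric measure space (e.g. a complete volume doubling measured Riemannian manifold; balls are relatively compact and have positive finite measure). Let $V_1,\dots,V_{\ell_0}$ be operators on $L^2(M)$ and $L=-\sum_i V_i^2$, with $\mathcal D(L)\subseteq\mathcal D(V_i^2)$, the $V_i$ satisfying the Leibniz rule on $\mathcal D(L)$. Suppose that $-L$ generates a holomorphic semigroup $(e^{-tL})_{t>0}$ on $L^2(M)$ which is conservative ($e^{-tL}\mathbf 1=\mathbf 1$), and that for every tuple $I$ and all $t>0$ the operators $t^{|I|/2}V_Ie^{-tL}$ and $e^{-tL}t^{|I|/2}V_I$ have kernels (jointly measurable in $(t,x,y)$) satisfying, with constants depending on $I$, $$|K_t(x,y)|\lesssim \frac{e^{-c\,d(x,y)^2/t}}{\mu(B(x,\sqrt t))},\qquad |K_t(x,y)-K_t(z,y)|\lesssim\frac{d(x,z)}{\sqrt t}\,\frac{e^{-c\,d(x,y)^2/t}}{\mu(B(x,\sqrt t))}\quad\text{if } d(x,z)\le\sqrt t .$$ Here $V_I$ is the composition of the $V_i$ along $I$ and $|I|$ is the length of $I$. Operators act on functions on $M\times[0,\infty)$,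 with measure $\nu=\mu\otimes d\tau$; put $\rho((x,\tau),(y,\sigma))=d(x,y)+\sqrt{|\tau-\sigma|}$, $\mathscr L=\partial_\tau+L$ and $\mathscr L^{-1}(v)_\tau=\int_0^\tau e^{-(\tau-\sigma)L}v_\sigma\,d\sigma$. **Gaussian kernels.** Given $\ell_1\in\mathbb N$ and $c>0$, let $\mathcal G_t((x,\tau),(y,\sigma))$ be $0$ if $\tau\le\sigma$, and otherwise $$\frac{1}{\nu(B_\rho((x,\tau),\sqrt t))}\Big(1+\frac{\rho^2}{t}\Big)^{-\ell_1}\ \text{ if } d(x,y)\le 1,\qquad \frac{1}{\nu(B_\rho((x,\tau),1))}\Big(1+\frac{|\tau-\sigma|}{t}\Big)^{-\ell_1}\Big(1+\frac{d(x,y)^2}{t}\Big)^{-\ell_1}e^{-c\,d(x,y)^2}\ \text{ if } d(x,y)>1 .$$ $\mathsf G$ is the set of families $(\mathcal Q_t)_{0<t\le1}$ of operators with kernels satisfying $|K_{\mathcal Q_t}|\lesssim\mathcal G_t$ almost everywhere, uniformly in $t$, for some $c>0$. **Standard families.** Let $P^{(c)}_t=\sum_{i<c}\frac{(tL)^i}{i!}e^{-tL}$,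 $m_t(r)=t^{-1}m(r/t)$ and $m_t^\star f(\tau)=\int_0^\infty m_t(\tau-\sigma)f(\sigma)\,d\sigma$. For an integer $0\le a\le 2b$, $\mathsf{StGC}^a$ is the set of families $\big((t^{|J|/2}V_J)(tL)^{n}P^{(c)}_t\otimes m_t^\star\big)_{0<t\le1}$ with integers $n,k\ge0$, $|J|+2n+2k=a$, $1\le c\le b$, and $m$ smooth, supported in $[\frac12,2]$, with $\int\tau^im(\tau)\,d\tau=0$ for $0\le i<k$ and $|m'|,\dots,|m^{(b)}|\le1$. The formal dual of an operator family given by $(\mathcal Q_tF)_\tau=\int_0^\tau V_I\,\phi_{t,\tau-\sigma}(L)F_\sigma\,d\sigma$ is $(\mathcal Q^\bullet_tF)_\tau=\int_0^\tau \phi_{t,\tau-\sigma}(L)V_I\,F_\sigma\,d\sigma$, the functions $\phi_{t,r}(L)$ of $L$ being norm limits of linear combinations of the $e^{-uL}$, $u>0$; in particular $(V_J\phi(L)\otimes m^\star)^\bullet=\phi(L)V_J\otimes m^\star$. $\mathsf{GC}^a$ is the set of $\mathcal Q\in\mathsf G$ such that, for some $c>0$, uniformly in $s,t\in(0,1]$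 and $\mathcal S\in\bigcup_{a\le a'\le2b}\mathsf{StGC}^{a'}$, one has $|K_{\mathcal Q_t\circ\mathcal S_s^\bullet}|\lesssim\big(\frac{st}{(s+t)^2}\big)^{a/2}\mathcal G_{t+s}$ almost everywhere. For $s\in(0,1)$, $\mathcal C^s$ is the set of bounded measurable $h$ with $\|\mathcal Q_1h\|_\infty\lesssim 1$ uniformly in $\mathcal Q\in\bigcup_{0\le k\le2b}\mathsf{StGC}^k$ and $\|\mathcal Q_th\|_{\infty}\lesssim t^{s/2}$ uniformly in $\mathcal Q\in\bigcup_{s<k\le2b}\mathsf{StGC}^k$ and $t\in(0,1]$. **Paraproducts.** Let $b$ be divisible by $8$, let $\varphi$ be smooth, supported in $[\frac12,2]$, with $\int\varphi=1$ and $\int\tau^k\varphi=0$ for $1\le k\le b$, and let $\mathcal P^{(b)}_t=P^{(b)}_t\otimes\varphi^\star_t$. A paraproduct is $$\Pi_g(h)=\int_0^1\Big\{\sum a\,\mathcal A(h,g)+\sum a'\,\mathcal B(h,g)\Big\}\frac{dt}{t},$$ with finite sums, real coefficients, and $$\mathcal A(h,g)=\mathcal P^{(b)}_t\big(t^{\frac{|I|}2+k}V_I\partial_\tau^k\big)\Big(\mathcal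 S_th\cdot\big(t^{\frac{|J|}2+\ell}V_J\partial_\tau^\ell\big)\mathcal P^{(b)}_tg\Big),$$ $$\mathcal B(h,g)=\mathcal S^\bullet_t\Big(\big(t^{\frac{|I|}2+k}V_I\partial_\tau^k\big)\mathcal P^{(b)}_th\cdot\big(t^{\frac{|J|}2+\ell}V_J\partial_\tau^\ell\big)\mathcal P^{(b)}_tg\Big),$$ where $(I,J,k,\ell)$ and $\mathcal S$ depend on the term, $\frac{|I|+|J|}2+k+\ell=\frac b2$, $\frac{|I|}2+k>\frac b4$, and $\mathcal S$ is a multiple of a standard family with cancellation of some order in $[\frac b2,b]$. (Such terms arise from $\mathcal P_t^{(b)}(\mathcal Q_t^{(b)}h\cdot\mathcal P_t^{(b)}g)$ and $\mathcal Q_t^{(b)}(\mathcal P_t^{(b)}h\cdot\mathcal P_t^{(b)}g)$, $\mathcal Q^{(b)}_t=-t\partial_t\mathcal P^{(b)}_t$, by the Leibniz rule.) The modified paraproduct is $\widetilde\Pi_g(f)=\mathscr L^{-1}\big(\Pi_g(\mathscr Lf)\big)$, for $g\in L^\infty$ and $f$ with $f|_{\tau=0}=0$ and $\mathscr Lf\in\bigcup_{0<s<1}\mathcal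 C^s$, i.e. $f=\mathscr L^{-1}h$ with $h=\mathscr Lf\in\bigcup_{0<s<1}\mathcal C^s$. **Proposition.** For every large enough $\ell_1$, and then every large enough $b$ divisible by $8$ (depending on $\ell_1$), every $\varphi$ and every paraproduct as above, there are finitely many real numbers $a_j$ and families $\mathcal Q^{1,j}$ having formal duals $\mathcal Q^{1,j\,\bullet}$, $\mathcal Q^{2,j}\in\bigcup_{\frac b4\le a\le2b}\mathsf{StGC}^{a}$, $\mathcal P^{1,j}\in\bigcup_{0\le a\le2b}\mathsf{StGC}^a$, with the following properties. 1. If $M$ is bounded, then $\mathcal Q^{1,j}\in\mathsf{GC}^{\frac b8-2}$ and, for all $g$ and $f$ as above, almost everywhere on $M\times[0,\infty)$ and with absolutely convergent integrals, $$\widetilde\Pi_g(f)=\sum_ja_j\int_0^1\mathcal Q^{1,j\,\bullet}_t\big(\mathcal Q^{2,j}_tf\cdot\mathcal P^{1,j}_tg\big)\frac{dt}t .$$ 2. Whether $M$ is bounded or not, for every $T>0$ the same holds on $M\times[0,T]$ (with $\mathsf{GC}^{\frac b8-2}$, $\mathcal C^s$ and the identity restricted to times in $[0,T]$), the constants in the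 definition of $\mathsf{GC}^{\frac b8-2}$ depending on $T$. -/

import Mathlib

open MeasureTheory Filter Topology Set
open scoped ContDiff

noncomputable section

namespace Paracontrolled

/-! ### The space, the vector fields and the heat semigroup -/

/-- The complex Hilbert space `L²(M, μ)`. -/
abbrev L2 (M : Type*) [MeasurableSpace M] (μ : Measure M) := Lp ℂ 2 μ

/-- Volume doubling: balls have positive finite measure, and `μ(B(x,2r)) ≤ C μ(B(x,r))`. -/
def VolumeDoubling {M : Type*} [MetricSpace M] [MeasurableSpace M] (μ : Measure M) : Prop :=
  (∀ (x : M) (r : ℝ), 0 < r → 0 < μ (Metric.ball x r) ∧ μ (Metric.ball x r) < ⊤) ∧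
  ∃ C : ℝ, ∀ (x : M) (r : ℝ), 0 < r → μ.real (Metric.ball x (2 * r)) ≤ C * μ.real (Metric.ball x r)

/-- First order operators `V₁, …, V_d` on `L²(M)`, an operator `L`, operators `heat t` (to be
`e^{-tL}`), and, for every tuple `I`, measurable functions `left I t`, `right I t` on `M × M` (to be
kernels of `V_I e^{-tL}` and of `e^{-tL} V_I`). All the relations between them are in
`HeatSystem.AssumptionA`, which leaves no freedom in `L`, `heat`, `left`, `right` once the `V_i` and
the domain of `L` are chosen, except for the choice of representatives of the kernels.

A tuple is a list `I = [i₁, …, i_k]`, and `V_I = V_{i₁} ∘ ⋯ ∘ V_{i_k}`, `|I| = k`. -/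
structure HeatSystem (M : Type*) [MeasurableSpace M] (μ : Measure M) (d : ℕ) where
  V : Fin d → (L2 M μ →ₗ.[ℂ] L2 M μ)
  L : L2 M μ →ₗ.[ℂ] L2 M μ
  heat : ℝ → (L2 M μ →L[ℂ] L2 M μ)
  left : List (Fin d) → ℝ → M → M → ℂ
  right : List (Fin d) → ℝ → M → M → ℂ

/-- `w = ∫ k(·,y) u(y) μ(dy)` almost everywhere, with convergent integrals. -/
def KernelMaps {M : Type*} [MeasurableSpace M] {μ : Measure M} (k : M → M → ℂ) (u w : L2 M μ) :
    Prop :=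
  (∀ᵐ x ∂μ, Integrable (fun y => k x y * u y) μ) ∧ ∀ᵐ x ∂μ, w x = ∫ y, k x y * u y ∂μ

/-- The Gaussian upper bound, for all `t > 0`, for the kernels `t^{j/2} K_t`, and their
regularity in the first variable at scale `√t`. -/
def GaussianRegular {M : Type*} [MetricSpace M] [MeasurableSpace M] (μ : Measure M) (j : ℕ)
    (K : ℝ → M → M → ℂ) : Prop :=
  ∃ C c : ℝ, 0 < c ∧ ∀ t : ℝ, 0 < t → ∀ x y : M,
    √t ^ j * ‖K t x y‖
      ≤ C * (μ.real (Metric.ball x √t))⁻¹ * Real.exp (-c * (dist x y ^ 2 / t)) ∧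
    ∀ z : M, dist x z ≤ √t →
      √t ^ j * ‖K t x y - K t z y‖
        ≤ C * (dist x z / √t) * (μ.real (Metric.ball x √t))⁻¹
            * Real.exp (-c * (dist x y ^ 2 / t))

namespace HeatSystem

variable {M : Type*} [MeasurableSpace M] {μ : Measure M} {d : ℕ}

/-- `H.VRel I u w`: `u` is in the domain of `V_I` and `V_I u = w`. -/
def VRel (H : HeatSystem M μ d) : List (Fin d) → L2 M μ → L2 M μ → Prop
  | [], u, w => w = u
  | i :: I, u, w => ∃ v, H.VRel I u v ∧ (v, w) ∈ (H.V i).graph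

/-- The standing assumptions on `L = -∑ V_i²` and on its heat semigroup. -/
structure AssumptionA {M : Type*} [MetricSpace M] [MeasurableSpace M] {μ : Measure M} {d : ℕ}
    (H : HeatSystem M μ d) : Prop where
  /-- `(e^{-tL})_{t ≥ 0}` is a strongly continuous semigroup … -/
  heat_zero : H.heat 0 = 1
  heat_add : ∀ s t : ℝ, 0 ≤ s → 0 ≤ t → H.heat (s + t) = (H.heat s).comp (H.heat t)
  heat_continuous : ∀ u, Tendsto (fun t => H.heat t u) (𝓝[>] 0) (𝓝 u)
  /-- … generated by `-L` … -/
  generator : ∀ u w, (u, w) ∈ H.L.graph ↔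
    Tendsto (fun t : ℝ => ((t⁻¹ : ℝ) : ℂ) • (u - H.heat t u)) (𝓝[>] 0) (𝓝 w)
  /-- … and holomorphic in a sector. -/
  holomorphic : ∃ θ : ℝ, 0 < θ ∧ ∃ F : ℂ → (L2 M μ →L[ℂ] L2 M μ),
    DifferentiableOn ℂ F {z | z ≠ 0 ∧ |z.arg| < θ} ∧ ∀ t : ℝ, 0 < t → F t = H.heat t
  /-- `D(L) ⊆ D(V_i²)` and `L = -∑ V_i²`. -/
  sum_squares : ∀ u w, (u, w) ∈ H.L.graph →
    ∃ v : Fin d → L2 M μ, (∀ i, H.VRel [i, i] u (v i)) ∧ w = -∑ i, v i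
  /-- The Leibniz rule on `D(L)`. -/
  leibniz : ∀ (i : Fin d) (u v w u' v' w' : L2 M μ),
    u ∈ H.L.domain → v ∈ H.L.domain → w ∈ H.L.domain →
    (u, u') ∈ (H.V i).graph → (v, v') ∈ (H.V i).graph → (w, w') ∈ (H.V i).graph →
    (∀ᵐ x ∂μ, w x = u x * v x) → ∀ᵐ x ∂μ, w' x = u x * v' x + v x * u' x
  /-- `left I t` is a kernel of `V_I e^{-tL}`, in particular `e^{-tL}` maps into `D(V_I)`. -/
  left_kernel : ∀ (I : List (Fin d)) (t : ℝ), 0 < t → ∀ u,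
    ∃ w, H.VRel I (H.heat t u) w ∧ KernelMaps (H.left I t) u w
  /-- `right I t` is a kernel of `e^{-tL} V_I`. -/
  right_kernel : ∀ (I : List (Fin d)) (t : ℝ), 0 < t → ∀ u v,
    H.VRel I u v → KernelMaps (H.right I t) u (H.heat t v)
  left_measurable : ∀ I, Measurable (fun p : ℝ × M × M => H.left I p.1 p.2.1 p.2.2)
  right_measurable : ∀ I, Measurable (fun p : ℝ × M × M => H.right I p.1 p.2.1 p.2.2)
  /-- Regularity estimates at any order. -/
  left_gaussian : ∀ I, GaussianRegular μ I.length (H.left I)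
  right_gaussian : ∀ I, GaussianRegular μ I.length (H.right I)
  /-- Conservativity, `e^{-tL} 1 = 1`. -/
  conservative : ∀ t : ℝ, 0 < t → ∀ᵐ x ∂μ, ∫ y, H.left [] t x y ∂μ = 1

/-- The tuple `[i₁, i₁, i₂, i₂, …, i_j, i_j]`. -/
def doubled {d j : ℕ} (w : Fin j → Fin d) : List (Fin d) :=
  (List.ofFn w).flatMap fun i => [i, i]

/-- Kernel of `V_J L^j e^{-tL}`, where `L^j = (-1)^j ∑ V_{i₁}² ⋯ V_{i_j}²`. -/
def leftPow (H : HeatSystem M μ d) (J : List (Fin d)) (j : ℕ) (t : ℝ) (x y : M) : ℂ :=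
  (-1) ^ j * ∑ w : Fin j → Fin d, H.left (J ++ doubled w) t x y

/-- Kernel of `L^j e^{-tL} V_J = (L^j e^{-(t/2)L}) ∘ (e^{-(t/2)L} V_J)`. -/
def rightPow (H : HeatSystem M μ d) (J : List (Fin d)) (j : ℕ) (t : ℝ) (x y : M) : ℂ :=
  ∫ z, H.leftPow [] j (t / 2) x z * H.right J (t / 2) z y ∂μ

end HeatSystem

/-! ### Space-time operators

Points of `M × ℝ` are written `e = (x, τ)`; the measure is `ν = μ ⊗ dτ`. Operators are given by
kernels and act on functions on `M × [0,∞)`. -/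

/-- Families, indexed by the scale `t ∈ (0,1]`, of kernels on `M × ℝ`. -/
abbrev Family (M : Type*) := ℝ → M × ℝ → M × ℝ → ℂ

/-- Joint measurability of a family in all its variables. -/
def Family.IsMeasurable {M : Type*} [MeasurableSpace M] (Q : Family M) : Prop :=
  Measurable fun p : ℝ × (M × ℝ) × (M × ℝ) => Q p.1 p.2.1 p.2.2

/-- The measure `μ ⊗ dτ` on `M × [0,∞)`. -/
def posMeasure {M : Type*} [MeasurableSpace M] (μ : Measure M) : Measure (M × ℝ) :=
  μ.prod (volume.restrict (Ici 0))

/-- Action of a kernel on a function. -/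
def act {M : Type*} [MeasurableSpace M] (μ : Measure M) (K : M × ℝ → M × ℝ → ℂ)
    (F : M × ℝ → ℂ) (e : M × ℝ) : ℂ :=
  ∫ e', K e e' * F e' ∂(posMeasure μ)

/-- Kernel of a composition of operators. -/
def compKernel {M : Type*} [MeasurableSpace M] (μ : Measure M) (K K' : M × ℝ → M × ℝ → ℂ)
    (e e' : M × ℝ) : ℂ :=
  ∫ z, K e z * K' z e' ∂(posMeasure μ)

/-- The rescaled function `m_t(r) = t⁻¹ m(r/t)`. -/
def rescale (m : ℝ → ℝ) (t r : ℝ) : ℝ := t⁻¹ * m (r / t)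

/-- The parabolic metric `ρ((x,τ),(y,σ)) = d(x,y) + √|τ-σ|`. -/
def pdist {M : Type*} [MetricSpace M] (e e' : M × ℝ) : ℝ :=
  dist e.1 e'.1 + √|e.2 - e'.2|

/-- The `ν`-measure of the ball of centre `e` and radius `r` of the parabolic metric. -/
def pvol {M : Type*} [MetricSpace M] [MeasurableSpace M] (μ : Measure M) (e : M × ℝ) (r : ℝ) : ℝ :=
  (μ.prod volume).real {e' | pdist e e' < r}

/-- The reference parabolic kernel `G_t`, with decay exponent `ℓ` and constant `c`. -/
def refKernel {M : Type*} [MetricSpace M] [MeasurableSpace M] (μ : Measure M) (ℓ : ℕ) (c t : ℝ)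
    (e e' : M × ℝ) : ℝ :=
  if e.2 ≤ e'.2 then 0
  else if dist e.1 e'.1 ≤ 1 then
    (pvol μ e √t)⁻¹ * ((1 + pdist e e' ^ 2 / t) ^ ℓ)⁻¹
  else
    (pvol μ e 1)⁻¹ * ((1 + |e.2 - e'.2| / t) ^ ℓ)⁻¹ * ((1 + dist e.1 e'.1 ^ 2 / t) ^ ℓ)⁻¹
      * Real.exp (-c * dist e.1 e'.1 ^ 2)

/-- `|K(e,e')| ≤ B G_t(e,e')` for almost all `e, e'` with times in `J`. -/
def KernelBound {M : Type*} [MetricSpace M] [MeasurableSpace M] (μ : Measure M) (ℓ : ℕ) (c t : ℝ)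
    (J : Set ℝ) (B : ℝ) (K : M × ℝ → M × ℝ → ℂ) : Prop :=
  ∀ᵐ p ∂((μ.prod volume).prod (μ.prod (volume : Measure ℝ))), p.1.2 ∈ J → p.2.2 ∈ J →
    ‖K p.1 p.2‖ ≤ B * refKernel μ ℓ c t p.1 p.2

/-- The class `G` of families with Gaussian-like bounds, over the time set `J`. -/
def InG {M : Type*} [MetricSpace M] [MeasurableSpace M] (μ : Measure M) (ℓ : ℕ) (J : Set ℝ)
    (Q : Family M) : Prop :=
  ∃ C c : ℝ, 0 < c ∧ ∀ t ∈ Ioc (0 : ℝ) 1, KernelBound μ ℓ c t J C (Q t)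

/-! ### Standard families -/

/-- The data of the space-time operators
`(t^{|J|/2} V_J) (tL)^n P_t^{(c)} ⊗ m_t^⋆`, `0 < t ≤ 1`, with `m` smooth and supported
in `[1/2, 2]` and with vanishing moments of orders `0, …, k-1`. -/
structure StdFamily (d : ℕ) where
  J : List (Fin d)
  n : ℕ
  k : ℕ
  c : ℕ
  m : ℝ → ℝ
  smooth : ContDiff ℝ ∞ m
  supp : Function.support m ⊆ Icc (1 / 2) 2
  moments : ∀ i < k, ∫ r, r ^ i * m r = 0

namespace StdFamily

/-- The order of cancellation `a = |J| + 2n + 2k`. -/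
def order {d : ℕ} (S : StdFamily d) : ℕ := S.J.length + 2 * S.n + 2 * S.k

/-- The normalization `1 ≤ c ≤ b`, `|m'|, …, |m^{(b)}| ≤ 1`. -/
def Normalized {d : ℕ} (b : ℕ) (S : StdFamily d) : Prop :=
  1 ≤ S.c ∧ S.c ≤ b ∧ ∀ i, 1 ≤ i → i ≤ b → ∀ r, |iteratedDeriv i S.m r| ≤ 1

/-- `S` belongs to the collection `StGC^a`. -/
def InStGC {d : ℕ} (b a : ℕ) (S : StdFamily d) : Prop :=
  S.Normalized b ∧ S.order = a

end StdFamily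

namespace HeatSystem

variable {M : Type*} [MeasurableSpace M] {μ : Measure M} {d : ℕ}

/-- The kernels of `(t^{|J|/2} V_J) (tL)^n P_t^{(c)} ⊗ m_t^⋆`, where
`P_t^{(c)} = ∑_{i<c} (tL)^i e^{-tL} / i!`, so that
`-t ∂_t P_t^{(c)} = (tL)^c e^{-tL} / (c-1)!` and `P_0^{(c)} = Id`. -/
def family (H : HeatSystem M μ d) (J : List (Fin d)) (n c : ℕ) (m : ℝ → ℝ) : Family M :=
  fun t e e' => ((√t ^ J.length * rescale m t (e.2 - e'.2) : ℝ) : ℂ) *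
    ∑ i ∈ Finset.range c, ((t ^ (n + i) / i.factorial : ℝ) : ℂ) * H.leftPow J (n + i) t e.1 e'.1

/-- The kernels of the formal duals `(tL)^n P_t^{(c)} (t^{|J|/2} V_J) ⊗ m_t^⋆`. -/
def dualFamily (H : HeatSystem M μ d) (J : List (Fin d)) (n c : ℕ) (m : ℝ → ℝ) : Family M :=
  fun t e e' => ((√t ^ J.length * rescale m t (e.2 - e'.2) : ℝ) : ℂ) *
    ∑ i ∈ Finset.range c, ((t ^ (n + i) / i.factorial : ℝ) : ℂ) * H.rightPow J (n + i) t e.1 e'.1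

/-- The operators of a standard family. -/
def std (H : HeatSystem M μ d) (S : StdFamily d) : Family M := H.family S.J S.n S.c S.m

/-- The formal duals of the operators of a standard family. -/
def stdDual (H : HeatSystem M μ d) (S : StdFamily d) : Family M := H.dualFamily S.J S.n S.c S.m

/-- `R = φ(L)` for some function `φ`: `R` is a norm limit of linear combinations of the
`e^{-uL}`, `u > 0`. -/
def IsFunctionOfL (H : HeatSystem M μ d) (R : L2 M μ →L[ℂ] L2 M μ) : Prop :=
  R ∈ (Submodule.span ℂ (H.heat '' Ioi 0)).topologicalClosure

/-- `Q' = Q^•`, formal duality. The operators `Q_t` are of the form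
`(Q_t F)(τ) = ∫_{0 ≤ σ < τ} V_I φ_{t,τ-σ}(L) F(σ) dσ`, and
`(Q_t^• F)(τ) = ∫_{0 ≤ σ < τ} φ_{t,τ-σ}(L) V_I F(σ) dσ`. -/
def IsFormalDual (H : HeatSystem M μ d) (Q Q' : Family M) : Prop :=
  ∃ (I : List (Fin d)) (R : ℝ → ℝ → (L2 M μ →L[ℂ] L2 M μ)) (k k' : ℝ → ℝ → M → M → ℂ),
    (∀ t ∈ Ioc (0 : ℝ) 1, ∀ r > 0,
      H.IsFunctionOfL (R t r) ∧
      (∀ u, ∃ w, H.VRel I (R t r u) w ∧ KernelMaps (k t r) u w) ∧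
      (∀ u v, H.VRel I u v → KernelMaps (k' t r) u (R t r v))) ∧
    (∀ t e e', Q t e e' = if e'.2 < e.2 then k t (e.2 - e'.2) e.1 e'.1 else 0) ∧
    (∀ t e e', Q' t e e' = if e'.2 < e.2 then k' t (e.2 - e'.2) e.1 e'.1 else 0)

/-- The class `GC^a` of families of operators with cancellation of order `a`, over the time set
`J`. -/
def InGC {M : Type*} [MetricSpace M] [MeasurableSpace M] {μ : Measure M} {d : ℕ}
    (H : HeatSystem M μ d) (ℓ b a : ℕ) (J : Set ℝ) (Q : Family M) : Prop :=
  InG μ ℓ J Q ∧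
  ∃ C c : ℝ, 0 < c ∧ ∀ t ∈ Ioc (0 : ℝ) 1, ∀ s ∈ Ioc (0 : ℝ) 1, ∀ a' : ℕ, a ≤ a' → a' ≤ 2 * b →
    ∀ S : StdFamily d, S.InStGC b a' →
      KernelBound μ ℓ c (t + s) J (C * (s * t / (s + t) ^ 2) ^ ((a : ℝ) / 2))
        (compKernel μ (Q t) (H.stdDual S s))

/-- The resolution operator `(ℒ⁻¹ v)(τ) = ∫_0^τ e^{-(τ-σ)L} v(σ) dσ`, for `ℒ = ∂_τ + L`. -/
def resolution (H : HeatSystem M μ d) (v : M × ℝ → ℂ) : M × ℝ → ℂ :=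
  act μ (fun e e' => if e'.2 < e.2 then H.left [] (e.2 - e'.2) e.1 e'.1 else 0) v

/-- The function `h` belongs to the parabolic Hölder space of exponent `s ∈ (0,1)` over the time
set `J`; only the values of `h` at times in `J` matter, besides measurability. -/
def MemHolder (H : HeatSystem M μ d) (b : ℕ) (J : Set ℝ) (s : ℝ) (h : M × ℝ → ℂ) : Prop :=
  Measurable h ∧ (∃ C : ℝ, ∀ e, ‖h e‖ ≤ C) ∧
  ∃ C : ℝ,
    (∀ k : ℕ, k ≤ 2 * b → ∀ S : StdFamily d, S.InStGC b k →
      ∀ᵐ e ∂(μ.prod volume), e.2 ∈ J → ‖act μ (H.std S 1) h e‖ ≤ C) ∧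
    ∀ k : ℕ, s < k → k ≤ 2 * b → ∀ S : StdFamily d, S.InStGC b k →
      ∀ t ∈ Ioc (0 : ℝ) 1,
        ∀ᵐ e ∂(μ.prod volume), e.2 ∈ J → ‖act μ (H.std S t) h e‖ ≤ C * t ^ (s / 2)

end HeatSystem

/-! ### Paraproducts -/

/-- The functions `φ` used to regularize in time. -/
def IsMollifier (b : ℕ) (φ : ℝ → ℝ) : Prop :=
  ContDiff ℝ ∞ φ ∧ Function.support φ ⊆ Icc (1 / 2) 2 ∧ ∫ r, φ r = 1 ∧
  ∀ k : ℕ, 1 ≤ k → k ≤ b → ∫ r, r ^ k * φ r = 0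

/-- The data of a term of the Leibniz expansion of a product: a coefficient, tuples `I, J` and
integers `k, l` with `|I|/2 + |J|/2 + k + l = b/2`, and a standard family (up to normalization)
with a cancellation of order between `b/2` and `b`. -/
structure LeibnizTerm (d b : ℕ) where
  coeff : ℝ
  I : List (Fin d)
  J : List (Fin d)
  k : ℕ
  l : ℕ
  balance : I.length + J.length + 2 * k + 2 * l = b
  S : StdFamily d
  one_le_c : 1 ≤ S.c
  c_le : S.c ≤ b
  le_order : b ≤ 2 * S.order
  order_le : S.order ≤ b

/-- `|I|/2 + k > b/4`. -/
def LeibnizTerm.IsHigh {d b : ℕ} (A : LeibnizTerm d b) : Prop := b < 2 * A.I.length + 4 * A.k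

/-- A finite expansion of the products: terms of type `𝒜`, coming from
`𝒫_t^{(b)}(𝒬_t^{(b)} f · 𝒫_t^{(b)} g)`, and terms of type `ℬ`, coming from
`𝒬_t^{(b)}(𝒫_t^{(b)} f · 𝒫_t^{(b)} g)`. Such an expansion results from the repeated use of
the Leibniz rules for the `V_i` and `∂_τ`; it is not unique, and no particular one is singled out
here. -/
structure LeibnizExpansion (d b : ℕ) where
  nA : ℕ
  A : Fin nA → LeibnizTerm d b
  nB : ℕ
  B : Fin nB → LeibnizTerm d b

namespace HeatSystem

variable {M : Type*} [MeasurableSpace M] {μ : Measure M} {d b : ℕ}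

/-- The kernels of `(t^{|I|/2 + k} V_I ∂_τ^k) 𝒫_t^{(b)}`, with
`𝒫_t^{(b)} = P_t^{(b)} ⊗ φ_t^⋆`; here `(t∂_τ)^k φ_t^⋆ = (φ^{(k)})_t^⋆`. -/
def VP (H : HeatSystem M μ d) (b : ℕ) (φ : ℝ → ℝ) (I : List (Fin d)) (k : ℕ) : Family M :=
  H.family I 0 b (iteratedDeriv k φ)

/-- The kernels of `𝒫_t^{(b)} (t^{|I|/2 + k} V_I ∂_τ^k)`, on functions that vanish near time 0. -/
def PV (H : HeatSystem M μ d) (b : ℕ) (φ : ℝ → ℝ) (I : List (Fin d)) (k : ℕ) : Family M :=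
  H.dualFamily I 0 b (iteratedDeriv k φ)

/-- `𝒜(f,g) = 𝒫_t^{(b)} (t^{|I|/2+k} V_I ∂_τ^k) (S_t f · (t^{|J|/2+l} V_J ∂_τ^l) 𝒫_t^{(b)} g)`. -/
def termA (H : HeatSystem M μ d) (φ : ℝ → ℝ) (A : LeibnizTerm d b) (f g : M × ℝ → ℂ) (t : ℝ) :
    M × ℝ → ℂ :=
  act μ (H.PV b φ A.I A.k t) fun e =>
    act μ (H.std A.S t) f e * act μ (H.VP b φ A.J A.l t) g e

/-- `ℬ(f,g) = S_t^• ((t^{|I|/2+k} V_I ∂_τ^k) 𝒫_t^{(b)} f · (t^{|J|/2+l} V_J ∂_τ^l) 𝒫_t^{(b)} g)`. -/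
def termB (H : HeatSystem M μ d) (φ : ℝ → ℝ) (A : LeibnizTerm d b) (f g : M × ℝ → ℂ) (t : ℝ) :
    M × ℝ → ℂ :=
  act μ (H.stdDual A.S t) fun e =>
    act μ (H.VP b φ A.I A.k t) f e * act μ (H.VP b φ A.J A.l t) g e

open Classical in
/-- The paraproduct `Π_g(f)`: the terms of the expansion with `|I|/2 + k > b/4`, integrated
against `dt/t`. -/
def paraproduct (H : HeatSystem M μ d) (φ : ℝ → ℝ) (E : LeibnizExpansion d b)
    (g f : M × ℝ → ℂ) (e : M × ℝ) : ℂ :=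
  ∫ t in Ioc (0 : ℝ) 1, ((t⁻¹ : ℝ) : ℂ) *
    ((∑ i, if (E.A i).IsHigh then ((E.A i).coeff : ℂ) * H.termA φ (E.A i) f g t e else 0) +
      ∑ i, if (E.B i).IsHigh then ((E.B i).coeff : ℂ) * H.termB φ (E.B i) f g t e else 0)

/-- `u` is the modified paraproduct `ℒ⁻¹(Π_g(ℒ f))` over the time set `J`. Paraproducts being
defined on parabolic Hölder spaces of exponent in `(0,1)`, this supposes that `f` solves
`ℒ f = h`, `f = 0` at time `0` (in the mild sense), for some `h` in such a space. -/
def IsModifiedParaproduct (H : HeatSystem M μ d) (φ : ℝ → ℝ) (E : LeibnizExpansion d b)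
    (J : Set ℝ) (g f u : M × ℝ → ℂ) : Prop :=
  ∃ s ∈ Ioo (0 : ℝ) 1, ∃ h : M × ℝ → ℂ, H.MemHolder b J s h ∧
    (∀ᵐ e ∂(μ.prod volume), e.2 ∈ J → f e = H.resolution h e) ∧
    ∀ᵐ e ∂(μ.prod volume), e.2 ∈ J → u e = H.resolution (H.paraproduct φ E g h) e

/-- `Q_t^{1•}(Q_t² f · P_t¹ g)`. -/
def bilinear (H : HeatSystem M μ d) (Q1dual : Family M) (Q2 P1 : StdFamily d)
    (f g : M × ℝ → ℂ) (t : ℝ) : M × ℝ → ℂ :=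
  act μ (Q1dual t) fun e => act μ (H.std Q2 t) f e * act μ (H.std P1 t) g e

/-- Over the time set `J`, for every `g ∈ L^∞` and every `f`, the modified paraproduct is
`∑_j a_j ∫_0^1 Q_t^{1•}(Q_t² f · P_t¹ g) dt/t`, with absolutely convergent integrals. -/
def Represents (H : HeatSystem M μ d) (φ : ℝ → ℝ) (E : LeibnizExpansion d b) (J : Set ℝ) {N : ℕ}
    (a : Fin N → ℝ) (Q1dual : Fin N → Family M) (Q2 P1 : Fin N → StdFamily d) : Prop :=
  ∀ f g u : M × ℝ → ℂ, Measurable g → (∃ C : ℝ, ∀ e, ‖g e‖ ≤ C) →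
    H.IsModifiedParaproduct φ E J g f u →
    ∀ᵐ e ∂(μ.prod volume), e.2 ∈ J →
      (∀ j, Integrable
        (fun p : ℝ × (M × ℝ) => ((p.1⁻¹ : ℝ) : ℂ) * (Q1dual j p.1 e p.2 *
          (act μ (H.std (Q2 j) p.1) f p.2 * act μ (H.std (P1 j) p.1) g p.2)))
        ((volume.restrict (Ioc 0 1)).prod (posMeasure μ))) ∧
      u e = ∑ j, (a j : ℂ) *
        ∫ t in Ioc (0 : ℝ) 1, ((t⁻¹ : ℝ) : ℂ) * H.bilinear (Q1dual j) (Q2 j) (P1 j) f g t e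

end HeatSystem

end Paracontrolled

end

/-!
Let `ℒ = ∂_τ + L` and `f = ℒ⁻¹ h`. Every term of a paraproduct `Π_g(h)`, of type `𝒜` or `ℬ`, is of
the form `X_t^•(Y_t h · Z_t g)` for standard families `X, Y, Z`, where `X` and `Y` have cancellation
of order at least `b/2` (`LeibnizExpansion.term`, `paraproduct_eq`). The representation follows
from two identities.

* Since `t h = t ℒ f`, the family acting on `h` can be made to act on `f`:
  `t Y_t h = (t∂_τ Y_t) f + (tL Y_t) f`, and both families on the right are standard, with two more
  orders of cancellation (`Setting.mul_act_std_eq`).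
* `ℒ⁻¹ X_t^• = t Q_t^•`, where `Q_t = t⁻¹ X_t ℒ⁻¹` has an explicit kernel, an integral of the
  semigroup against the profile of `X` (`duhamel`, `Setting.compKernel_heat_stdDual`), and `Q_t^•`
  is its formal dual (`Setting.isFormalDual_duhamel`).

The factor `t` of the second identity is used up by the first one, so that
`ℒ⁻¹ Π_g(h) = ∑ ∫_0^1 Q_t^•((t∂_τ Y_t + tL Y_t) f · Z_t g) dt/t`. Exchanging `ℒ⁻¹` and the integral
over the scales is legitimate because `‖Y_t h‖_∞ ≲ t^{s/2}` for `h` in the Hölder space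
(`Setting.integrable_heat_mul_term`). The new integrals converge absolutely because
the families `Q_t^•` are bounded on `L^∞` and the families `t∂_τ Y_t`, `tL Y_t` gain a factor `t`
on `f = ℒ⁻¹ h` (`Setting.integrable_representation`).

It remains to see that `Q` belongs to `GC^{b/8-2}` (`Setting.inGC_duhamel`). Applying `ℒ⁻¹` destroys
the localization in time, since `ℒ⁻¹` has a memory; it is restored by cancellation. A profile `m`
with `k` vanishing moments is the `k`-th derivative of another profile, and integrating by parts in
time turns these derivatives into powers of `L`. Together with the `|J| + 2n` derivatives in space,
a kernel with elapsed time `r` gains the factor `(t/(t+r))^{|J|/2+n+k}`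
(`Setting.exists_duhamel_le`). The compositions `Q_t S_s^•` are treated in the same manner, the
convolution of the two profiles taking the place of `m`
(`exists_convProfile_primitive`, `Setting.exists_timeConv_le`). What is left is a Gaussian at the
larger scale `√(t+r)`. It is bounded by the reference kernel at scale `√t` at the expense of
some powers of `(t+r)/t`, but the reference kernel decays like `exp(-c d(x,y)²)` for `d(x,y) > 1`,
so a bound on either the elapsed times or the distances is necessary here
(`VolGrowth.exists_le_refKernel`). This is the reason for the two cases of the theorem.

Identities between operators are transferred to their kernels by means of the sesquilinear
form: two kernels that satisfy Schur's condition and have the same form are equal almost everywhere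
(`SchurBound.ae_eq_of_form`). Under the form, the composition of operators, the integrals in time
and the integration by parts take place on matrix coefficients, where the bounded extensions of
the operators `V_I L^N e^{-uL} V_J` obey the expected algebra (`sandwichOp`, `matCoef`).
-/

noncomputable section

open scoped NNReal ENNReal ComplexConjugate

namespace Paracontrolled

set_option linter.unusedSectionVars false

/-! ### Kernels satisfying Schur's condition -/

/-- Schur's condition: the kernel is measurable and its rows and columns are bounded in `L¹`. -/
structure SchurBound {M : Type*} [MeasurableSpace M] (μ : Measure M) (C : ℝ≥0) (K : M → M → ℂ) :
    Prop where
  meas : Measurable fun p : M × M => K p.1 p.2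
  row : ∀ x, ∫⁻ y, ‖K x y‖ₑ ∂μ ≤ C
  col : ∀ y, ∫⁻ x, ‖K x y‖ₑ ∂μ ≤ C

/-- The bounded operator `T` is given by the kernel `K`. -/
def HasKernel {M : Type*} [MeasurableSpace M] {μ : Measure M} (T : L2 M μ →L[ℂ] L2 M μ)
    (K : M → M → ℂ) : Prop :=
  ∀ u, KernelMaps K u (T u)

/-- The sesquilinear form `∬ v̄(x) K(x,y) u(y)` of a kernel. -/
def kform {M : Type*} [MeasurableSpace M] {μ : Measure M} (K : M → M → ℂ) (v u : L2 M μ) : ℂ :=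
  ∫ p : M × M, conj (v p.1) * (K p.1 p.2 * u p.2) ∂(μ.prod μ)

section Schur

variable {M : Type*} [MeasurableSpace M] {μ : Measure M} [SigmaFinite μ]

lemma L2.lintegral_sq (u : L2 M μ) : ∫⁻ x, ‖u x‖ₑ ^ 2 ∂μ = ‖u‖ₑ ^ 2 := by
  have h := Lp.enorm_def u
  rw [h, eLpNorm_eq_lintegral_rpow_enorm_toReal (by norm_num) (by norm_num)]
  simp only [ENNReal.toReal_ofNat, ENNReal.rpow_ofNat, one_div]
  rw [← ENNReal.rpow_natCast, ← ENNReal.rpow_mul]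
  norm_num

/-- Cauchy–Schwarz for lower integrals. -/
lemma lintegral_mul_sq_le {α : Type*} [MeasurableSpace α] (ν : Measure α) {f g : α → ℝ≥0∞}
    (hf : AEMeasurable f ν) (hg : AEMeasurable g ν) :
    (∫⁻ a, f a * g a ∂ν) ^ 2 ≤ (∫⁻ a, f a ^ 2 ∂ν) * ∫⁻ a, g a ^ 2 ∂ν := by
  have h := ENNReal.lintegral_mul_le_Lp_mul_Lq ν Real.HolderConjugate.two_two hf hg
  calc (∫⁻ a, f a * g a ∂ν) ^ 2
      ≤ ((∫⁻ a, f a ^ (2 : ℝ) ∂ν) ^ (1 / (2 : ℝ)) * (∫⁻ a, g a ^ (2 : ℝ) ∂ν) ^ (1 / (2 : ℝ))) ^ 2 := by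
        gcongr; exact h
    _ = _ := by
        rw [mul_pow, ← ENNReal.rpow_natCast, ← ENNReal.rpow_natCast, ← ENNReal.rpow_mul,
          ← ENNReal.rpow_mul]
        simp

lemma SchurBound.measurable_row {C : ℝ≥0} {K : M → M → ℂ} (hK : SchurBound μ C K) (x : M) :
    Measurable fun y => K x y := hK.meas.comp measurable_prodMk_left

lemma SchurBound.measurable_col {C : ℝ≥0} {K : M → M → ℂ} (hK : SchurBound μ C K) (y : M) :
    Measurable fun x => K x y := hK.meas.comp measurable_prodMk_right

lemma SchurBound.lintegral_sq_le {C : ℝ≥0} {K : M → M → ℂ} (hK : SchurBound μ C K)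
    {F : M → ℝ≥0∞} (hF : Measurable F) :
    ∫⁻ x, (∫⁻ y, ‖K x y‖ₑ * F y ∂μ) ^ 2 ∂μ ≤ C ^ 2 * ∫⁻ y, F y ^ 2 ∂μ := by
  have hm : Measurable fun p : M × M => ‖K p.1 p.2‖ₑ := hK.meas.enorm
  have hmx : ∀ x, Measurable fun y => ‖K x y‖ₑ := fun x => hm.comp measurable_prodMk_left
  have h1 : ∀ x, (∫⁻ y, ‖K x y‖ₑ * F y ∂μ) ^ 2 ≤ C * ∫⁻ y, ‖K x y‖ₑ * F y ^ 2 ∂μ := by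
    intro x
    have := lintegral_mul_sq_le μ (f := fun y => ‖K x y‖ₑ ^ (1 / 2 : ℝ))
      (g := fun y => ‖K x y‖ₑ ^ (1 / 2 : ℝ) * F y)
      ((hmx x).pow_const _).aemeasurable (((hmx x).pow_const _).mul hF).aemeasurable
    have e1 : ∀ a : ℝ≥0∞, a ^ (1 / 2 : ℝ) * a ^ (1 / 2 : ℝ) = a := fun a => by
      rw [← ENNReal.rpow_add_of_nonneg _ _ (by norm_num) (by norm_num)]; norm_num
    have e2 : ∀ a : ℝ≥0∞, (a ^ (1 / 2 : ℝ)) ^ 2 = a := fun a => by rw [sq, e1]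
    simp only [← mul_assoc, e1, mul_pow, e2] at this
    exact this.trans (by gcongr; exact hK.row x)
  calc ∫⁻ x, (∫⁻ y, ‖K x y‖ₑ * F y ∂μ) ^ 2 ∂μ
      ≤ ∫⁻ x, C * ∫⁻ y, ‖K x y‖ₑ * F y ^ 2 ∂μ ∂μ := lintegral_mono h1
    _ = C * ∫⁻ y, ∫⁻ x, ‖K x y‖ₑ * F y ^ 2 ∂μ ∂μ := by
        rw [lintegral_const_mul' _ _ ENNReal.coe_ne_top, lintegral_lintegral_swap]
        exact (hm.mul ((hF.comp measurable_snd).pow_const 2)).aemeasurable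
    _ ≤ C * ∫⁻ y, C * F y ^ 2 ∂μ := by
        gcongr with y
        rw [lintegral_mul_const _ (hK.measurable_col y).enorm]
        gcongr; exact hK.col y
    _ = C ^ 2 * ∫⁻ y, F y ^ 2 ∂μ := by
        rw [lintegral_const_mul' _ _ ENNReal.coe_ne_top, ← mul_assoc, sq]

lemma SchurBound.mono {C C' : ℝ≥0} {K : M → M → ℂ} (hK : SchurBound μ C K) (h : C ≤ C') :
    SchurBound μ C' K :=
  ⟨hK.meas, fun x => (hK.row x).trans (by exact_mod_cast h),
    fun x => (hK.col x).trans (by exact_mod_cast h)⟩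

lemma SchurBound.zero : SchurBound μ 0 (fun _ _ => 0) :=
  ⟨measurable_const, fun x => by simp, fun x => by simp⟩

lemma SchurBound.add {C C' : ℝ≥0} {K K' : M → M → ℂ} (hK : SchurBound μ C K)
    (hK' : SchurBound μ C' K') : SchurBound μ (C + C') (fun x y => K x y + K' x y) := by
  refine ⟨hK.meas.add hK'.meas, fun x => ?_, fun y => ?_⟩
  · calc ∫⁻ y, ‖K x y + K' x y‖ₑ ∂μ ≤ ∫⁻ y, (‖K x y‖ₑ + ‖K' x y‖ₑ) ∂μ :=
          lintegral_mono fun y => enorm_add_le _ _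
      _ = _ := lintegral_add_left ((hK.meas.comp measurable_prodMk_left).enorm) _
      _ ≤ _ := by push_cast; exact add_le_add (hK.row x) (hK'.row x)
  · calc ∫⁻ x, ‖K x y + K' x y‖ₑ ∂μ ≤ ∫⁻ x, (‖K x y‖ₑ + ‖K' x y‖ₑ) ∂μ :=
          lintegral_mono fun y => enorm_add_le _ _
      _ = _ := lintegral_add_left ((hK.meas.comp measurable_prodMk_right).enorm) _
      _ ≤ _ := by push_cast; exact add_le_add (hK.col y) (hK'.col y)

lemma SchurBound.const_mul {C : ℝ≥0} {K : M → M → ℂ} (hK : SchurBound μ C K) (a : ℂ) :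
    SchurBound μ (‖a‖₊ * C) (fun x y => a * K x y) := by
  refine ⟨hK.meas.const_mul a, fun x => ?_, fun y => ?_⟩
  · simp only [enorm_mul]
    rw [lintegral_const_mul _ (hK.measurable_row x).enorm]
    push_cast
    exact mul_le_mul_right (hK.row x) _
  · simp only [enorm_mul]
    rw [lintegral_const_mul _ (hK.measurable_col y).enorm]
    push_cast
    exact mul_le_mul_right (hK.col y) _

lemma SchurBound.sum {ι : Type*} (s : Finset ι) {C : ι → ℝ≥0} {K : ι → M → M → ℂ}
    (hK : ∀ i ∈ s, SchurBound μ (C i) (K i)) :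
    SchurBound μ (∑ i ∈ s, C i) (fun x y => ∑ i ∈ s, K i x y) := by
  classical
  induction s using Finset.induction_on with
  | empty => simpa using SchurBound.zero
  | insert i s hi ih =>
    simp only [Finset.sum_insert hi]
    exact (hK i (by simp)).add (ih fun j hj => hK j (by simp [hj]))

lemma SchurBound.ae_lintegral_lt_top {C : ℝ≥0} {K : M → M → ℂ} (hK : SchurBound μ C K)
    {F : M → ℝ≥0∞} (hF : Measurable F) (h : ∫⁻ y, F y ^ 2 ∂μ ≠ ⊤) :
    ∀ᵐ x ∂μ, ∫⁻ y, ‖K x y‖ₑ * F y ∂μ < ⊤ := by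
  have hm : Measurable fun p : M × M => ‖K p.1 p.2‖ₑ * F p.2 :=
    hK.meas.enorm.mul (hF.comp measurable_snd)
  have h1 : ∫⁻ x, (∫⁻ y, ‖K x y‖ₑ * F y ∂μ) ^ 2 ∂μ ≠ ⊤ :=
    ((hK.lintegral_sq_le hF).trans_lt (ENNReal.mul_lt_top (by simp) h.lt_top)).ne
  filter_upwards [ae_lt_top' ((Measurable.lintegral_prod_right' hm).pow_const 2).aemeasurable h1]
    with x hx
  by_contra h
  rw [not_lt, top_le_iff] at h
  simp [h] at hx

lemma SchurBound.ae_integrable {C : ℝ≥0} {K : M → M → ℂ} (hK : SchurBound μ C K) (u : L2 M μ) :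
    ∀ᵐ x ∂μ, Integrable (fun y => K x y * u y) μ := by
  have hu := (Lp.stronglyMeasurable u).measurable
  filter_upwards [hK.ae_lintegral_lt_top hu.enorm (by rw [L2.lintegral_sq]; simp)] with x hx
  refine ⟨((hK.measurable_row x).mul hu).aestronglyMeasurable, ?_⟩
  rw [HasFiniteIntegral]
  simpa only [enorm_mul] using hx

lemma SchurBound.memLp {C : ℝ≥0} {K : M → M → ℂ} (hK : SchurBound μ C K) (u : L2 M μ) :
    MemLp (fun x => ∫ y, K x y * u y ∂μ) 2 μ ∧
      eLpNorm (fun x => ∫ y, K x y * u y ∂μ) 2 μ ≤ C * ‖u‖ₑ := by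
  have hu : Measurable fun y => ‖u y‖ₑ := (Lp.stronglyMeasurable u).measurable.enorm
  have hm : StronglyMeasurable fun x => ∫ y, K x y * u y ∂μ := by
    have : Measurable fun p : M × M => K p.1 p.2 * u p.2 :=
      hK.meas.mul ((Lp.stronglyMeasurable u).measurable.comp measurable_snd)
    exact StronglyMeasurable.integral_prod_right' (f := fun p : M × M => K p.1 p.2 * u p.2)
      this.stronglyMeasurable
  have h1 : eLpNorm (fun x => ∫ y, K x y * u y ∂μ) 2 μ ≤ C * ‖u‖ₑ := by
    rw [eLpNorm_eq_lintegral_rpow_enorm_toReal (by norm_num) (by norm_num)]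
    simp only [ENNReal.toReal_ofNat, ENNReal.rpow_ofNat, one_div]
    have : ∫⁻ x, ‖∫ y, K x y * u y ∂μ‖ₑ ^ 2 ∂μ ≤ (C * ‖u‖ₑ) ^ 2 := by
      calc ∫⁻ x, ‖∫ y, K x y * u y ∂μ‖ₑ ^ 2 ∂μ
          ≤ ∫⁻ x, (∫⁻ y, ‖K x y‖ₑ * ‖u y‖ₑ ∂μ) ^ 2 ∂μ := by
            gcongr with x
            exact (enorm_integral_le_lintegral_enorm _).trans (by simp only [enorm_mul]; exact le_rfl)
        _ ≤ _ := hK.lintegral_sq_le hu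
        _ = _ := by rw [L2.lintegral_sq, mul_pow]
    calc (∫⁻ x, ‖∫ y, K x y * u y ∂μ‖ₑ ^ 2 ∂μ) ^ ((2 : ℝ)⁻¹) ≤ ((C * ‖u‖ₑ) ^ 2) ^ ((2 : ℝ)⁻¹) := by
          gcongr
      _ = _ := by rw [← ENNReal.rpow_natCast, ← ENNReal.rpow_mul]; norm_num
  exact ⟨⟨hm.aestronglyMeasurable, h1.trans_lt (ENNReal.mul_lt_top (by simp) (by simp))⟩, h1⟩

/-- **Schur test.** -/
lemma SchurBound.exists_hasKernel {C : ℝ≥0} {K : M → M → ℂ} (hK : SchurBound μ C K) :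
    ∃ T : L2 M μ →L[ℂ] L2 M μ, HasKernel T K := by
  let T₀ : L2 M μ →ₗ[ℂ] L2 M μ :=
    { toFun := fun u => (hK.memLp u).1.toLp _
      map_add' := fun u v => by
        apply Lp.ext
        filter_upwards [(hK.memLp u).1.coeFn_toLp, (hK.memLp v).1.coeFn_toLp,
          (hK.memLp (u + v)).1.coeFn_toLp, Lp.coeFn_add ((hK.memLp u).1.toLp _)
            ((hK.memLp v).1.toLp _), hK.ae_integrable u, hK.ae_integrable v] with x h1 h2 h3 h4 h5 h6
        rw [h3, h4, Pi.add_apply, h1, h2, ← integral_add h5 h6]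
        apply integral_congr_ae
        filter_upwards [Lp.coeFn_add u v] with y hy
        rw [hy, Pi.add_apply, mul_add]
      map_smul' := fun a u => by
        apply Lp.ext
        filter_upwards [(hK.memLp u).1.coeFn_toLp, (hK.memLp (a • u)).1.coeFn_toLp,
          Lp.coeFn_smul a ((hK.memLp u).1.toLp _)] with x h1 h2 h3
        rw [h2, RingHom.id_apply, h3, Pi.smul_apply, h1, smul_eq_mul, ← integral_const_mul]
        apply integral_congr_ae
        filter_upwards [Lp.coeFn_smul a u] with y hy
        rw [hy, Pi.smul_apply, smul_eq_mul]; ring }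
  refine ⟨T₀.mkContinuous C fun u => ?_, fun u => ⟨hK.ae_integrable u, ?_⟩⟩
  · change ‖(hK.memLp u).1.toLp _‖ ≤ _
    rw [Lp.norm_toLp]
    refine ENNReal.toReal_le_of_le_ofReal (by positivity) ((hK.memLp u).2.trans ?_)
    rw [ENNReal.ofReal_mul (by positivity), ofReal_norm]
    simp
  · exact (hK.memLp u).1.coeFn_toLp

lemma SchurBound.lintegral_form_le {C : ℝ≥0} {K : M → M → ℂ} (hK : SchurBound μ C K)
    (v u : L2 M μ) :
    ∫⁻ p : M × M, ‖conj (v p.1) * (K p.1 p.2 * u p.2)‖ₑ ∂(μ.prod μ) ≤ C * ‖v‖ₑ * ‖u‖ₑ := by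
  have hu : Measurable fun y => ‖u y‖ₑ := (Lp.stronglyMeasurable u).measurable.enorm
  have hv : Measurable fun y => ‖v y‖ₑ := (Lp.stronglyMeasurable v).measurable.enorm
  have hm : Measurable fun p : M × M => ‖K p.1 p.2‖ₑ * ‖u p.2‖ₑ :=
    hK.meas.enorm.mul (hu.comp measurable_snd)
  have e : ∀ z : ℂ, ‖conj z‖ₑ = ‖z‖ₑ := fun z => by
    rw [← ofReal_norm, ← ofReal_norm, RCLike.norm_conj]
  simp only [enorm_mul, e]
  have hm' : Measurable fun p : M × M => ‖v p.1‖ₑ * (‖K p.1 p.2‖ₑ * ‖u p.2‖ₑ) :=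
    (hv.comp measurable_fst).mul hm
  rw [lintegral_prod _ hm'.aemeasurable]
  simp only
  have h1 : ∀ x, ∫⁻ y, ‖v x‖ₑ * (‖K x y‖ₑ * ‖u y‖ₑ) ∂μ = ‖v x‖ₑ * ∫⁻ y, ‖K x y‖ₑ * ‖u y‖ₑ ∂μ :=
    fun x => lintegral_const_mul _ (hm.comp measurable_prodMk_left)
  simp only [h1]
  have h2 := lintegral_mul_sq_le μ hv.aemeasurable
    (Measurable.lintegral_prod_right' (ν := μ) hm).aemeasurable
  have h3 : (∫⁻ x, ‖v x‖ₑ * ∫⁻ y, ‖K x y‖ₑ * ‖u y‖ₑ ∂μ ∂μ) ^ 2 ≤ (C * ‖v‖ₑ * ‖u‖ₑ) ^ 2 := by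
    refine h2.trans ?_
    rw [L2.lintegral_sq]
    calc _ ≤ ‖v‖ₑ ^ 2 * (C ^ 2 * ∫⁻ y, ‖u y‖ₑ ^ 2 ∂μ) := by
          gcongr; exact hK.lintegral_sq_le hu
      _ = _ := by rw [L2.lintegral_sq]; ring
  exact (ENNReal.pow_le_pow_left_iff two_ne_zero).1 h3

lemma SchurBound.integrable_form {C : ℝ≥0} {K : M → M → ℂ} (hK : SchurBound μ C K)
    (v u : L2 M μ) :
    Integrable (fun p : M × M => conj (v p.1) * (K p.1 p.2 * u p.2)) (μ.prod μ) := by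
  refine ⟨?_, (hK.lintegral_form_le v u).trans_lt
    (ENNReal.mul_lt_top (ENNReal.mul_lt_top (by simp) (by simp)) (by simp))⟩
  refine Measurable.aestronglyMeasurable ?_
  exact (Complex.continuous_conj.measurable.comp
    ((Lp.stronglyMeasurable v).measurable.comp measurable_fst)).mul
    (hK.meas.mul ((Lp.stronglyMeasurable u).measurable.comp measurable_snd))

lemma SchurBound.inner_eq_kform {C : ℝ≥0} {K : M → M → ℂ} (hK : SchurBound μ C K)
    {u w : L2 M μ} (h : KernelMaps K u w) (v : L2 M μ) : inner ℂ v w = kform K v u := by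
  rw [kform, integral_prod _ (hK.integrable_form v u), L2.inner_def]
  apply integral_congr_ae
  filter_upwards [h.2] with x hx
  rw [integral_const_mul, ← hx, RCLike.inner_apply, mul_comm]

lemma HasKernel.inner_eq {C : ℝ≥0} {K : M → M → ℂ} {T : L2 M μ →L[ℂ] L2 M μ} (h : HasKernel T K)
    (hK : SchurBound μ C K) (v u : L2 M μ) : inner ℂ v (T u) = kform K v u :=
  hK.inner_eq_kform (h u) v

/-- To identify the kernel of an operator it suffices to compare sesquilinear forms. -/
lemma SchurBound.hasKernel_of_form {C : ℝ≥0} {K : M → M → ℂ} (hK : SchurBound μ C K)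
    {T : L2 M μ →L[ℂ] L2 M μ} (h : ∀ v u, inner ℂ v (T u) = kform K v u) : HasKernel T K := by
  obtain ⟨T', hT'⟩ := hK.exists_hasKernel
  have : T = T' := by
    ext1 u
    refine ext_inner_left ℂ fun v => ?_
    rw [h, hT'.inner_eq hK]
  rw [this]; exact hT'

/-- A kernel is determined almost everywhere by its sesquilinear form. -/
lemma SchurBound.ae_eq_zero {C : ℝ≥0} {D : M → M → ℂ} (hD : SchurBound μ C D)
    (h : ∀ v u : L2 M μ, kform D v u = 0) : ∀ᵐ p ∂(μ.prod μ), D p.1 p.2 = 0 := by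
  classical
  have hrect : ∀ A B : Set M, MeasurableSet A → MeasurableSet B → μ A ≠ ⊤ → μ B ≠ ⊤ →
      ∫ p in A ×ˢ B, D p.1 p.2 ∂(μ.prod μ) = 0 := by
    intro A B hA hB hA' hB'
    rw [← h (indicatorConstLp 2 hA hA' 1) (indicatorConstLp 2 hB hB' 1), kform,
      ← integral_indicator (hA.prod hB)]
    apply integral_congr_ae
    have h1 := indicatorConstLp_coeFn (p := 2) (hs := hA) (hμs := hA') (c := (1 : ℂ))
    have h2 := indicatorConstLp_coeFn (p := 2) (hs := hB) (hμs := hB') (c := (1 : ℂ))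
    filter_upwards [Measure.quasiMeasurePreserving_fst.ae h1,
      Measure.quasiMeasurePreserving_snd.ae h2] with p hp1 hp2
    rw [hp1, hp2]
    by_cases hx : p.1 ∈ A <;> by_cases hy : p.2 ∈ B <;> simp [hx, hy, indicator, mem_prod]
  have hint : ∀ A B : Set M, MeasurableSet A → MeasurableSet B → μ A ≠ ⊤ →
      IntegrableOn (fun p : M × M => D p.1 p.2) (A ×ˢ B) (μ.prod μ) := by
    intro A B hA hB hA'
    refine ⟨hD.meas.aestronglyMeasurable, ?_⟩
    rw [HasFiniteIntegral, ← Measure.prod_restrict,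
      lintegral_prod _ hD.meas.enorm.aemeasurable]
    calc _ ≤ ∫⁻ x in A, C ∂μ := by
          refine lintegral_mono fun x => ?_
          exact (lintegral_mono' Measure.restrict_le_self le_rfl).trans (hD.row x)
      _ < ⊤ := by
          rw [lintegral_const]
          exact ENNReal.mul_lt_top (by simp) (by simpa using hA'.lt_top)
  -- exhaust the product by boxes of finite measure
  let S := spanningSets μ
  have hbox : ∀ n, ∀ E : Set (M × M), MeasurableSet E →
      ∫ p in E, D p.1 p.2 ∂((μ.prod μ).restrict (S n ×ˢ S n)) = 0 := by
    intro n
    have hS : MeasurableSet (S n) := measurableSet_spanningSets μ n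
    have hSf : μ (S n) ≠ ⊤ := (measure_spanningSets_lt_top μ n).ne
    have hI : Integrable (fun p : M × M => D p.1 p.2) ((μ.prod μ).restrict (S n ×ˢ S n)) :=
      hint _ _ hS hS hSf
    have huniv : ∫ p, D p.1 p.2 ∂((μ.prod μ).restrict (S n ×ˢ S n)) = 0 :=
      hrect _ _ hS hS hSf hSf
    refine MeasurableSpace.induction_on_inter generateFrom_prod.symm isPiSystem_prod
      (by simp) ?_ ?_ ?_
    · rintro _ ⟨A, hA, B, hB, rfl⟩
      rw [Measure.restrict_restrict (hA.prod hB), prod_inter_prod]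
      exact hrect _ _ (hA.inter hS) (hB.inter hS)
        (measure_ne_top_of_subset inter_subset_right hSf)
        (measure_ne_top_of_subset inter_subset_right hSf)
    · intro E hE ih
      rw [setIntegral_compl hE hI, ih, huniv, sub_zero]
    · intro f hd hf ih
      rw [integral_iUnion hf hd hI.integrableOn]
      simp [ih]
  have hz : ∀ n, ∀ᵐ p ∂((μ.prod μ).restrict (S n ×ˢ S n)), D p.1 p.2 = 0 := by
    intro n
    have hS : MeasurableSet (S n) := measurableSet_spanningSets μ n
    have hSf : μ (S n) ≠ ⊤ := (measure_spanningSets_lt_top μ n).ne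
    have hI : Integrable (fun p : M × M => D p.1 p.2) ((μ.prod μ).restrict (S n ×ˢ S n)) :=
      hint _ _ hS hS hSf
    exact hI.ae_eq_zero_of_forall_setIntegral_eq_zero fun s hs _ => hbox n s hs
  have hU : (⋃ n, S n ×ˢ S n) = univ := by
    rw [eq_univ_iff_forall]
    rintro ⟨x, y⟩
    have hx : x ∈ ⋃ n, S n := by simp [S, iUnion_spanningSets]
    have hy : y ∈ ⋃ n, S n := by simp [S, iUnion_spanningSets]
    obtain ⟨a, ha⟩ := mem_iUnion.1 hx
    obtain ⟨b, hb⟩ := mem_iUnion.1 hy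
    have hmono : Monotone S := monotone_spanningSets μ
    exact mem_iUnion.2 ⟨max a b, hmono (le_max_left _ _) ha, hmono (le_max_right _ _) hb⟩
  rw [← Measure.restrict_univ (μ := μ.prod μ), ← hU]
  exact (ae_restrict_iUnion_iff _ _).2 hz

lemma kform_sub {C C' : ℝ≥0} {K K' : M → M → ℂ} (hK : SchurBound μ C K)
    (hK' : SchurBound μ C' K') (v u : L2 M μ) :
    kform (fun x y => K x y + -1 * K' x y) v u = kform K v u - kform K' v u := by
  rw [kform, kform, kform, ← integral_sub (hK.integrable_form v u) (hK'.integrable_form v u)]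
  congr 1; ext p; ring

/-- Identities between kernels may be checked on sesquilinear forms. -/
lemma SchurBound.ae_eq_of_form {C C' : ℝ≥0} {K K' : M → M → ℂ} (hK : SchurBound μ C K)
    (hK' : SchurBound μ C' K') (h : ∀ v u : L2 M μ, kform K v u = kform K' v u) :
    ∀ᵐ p ∂(μ.prod μ), K p.1 p.2 = K' p.1 p.2 := by
  have := (hK.add (hK'.const_mul (-1))).ae_eq_zero fun v u => by
    rw [kform_sub hK hK', h, sub_self]
  filter_upwards [this] with p hp
  linear_combination hp

/-- The composition of two kernels. -/
def kcomp (μ : Measure M) (K K' : M → M → ℂ) (x y : M) : ℂ := ∫ z, K x z * K' z y ∂μ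

lemma measurable_kcomp {α : Type*} [MeasurableSpace α] {K K' : α → M → M → ℂ}
    (hK : Measurable fun p : α × M × M => K p.1 p.2.1 p.2.2)
    (hK' : Measurable fun p : α × M × M => K' p.1 p.2.1 p.2.2) :
    Measurable fun p : α × M × M => kcomp μ (K p.1) (K' p.1) p.2.1 p.2.2 := by
  have : Measurable fun q : (α × M × M) × M => K q.1.1 q.1.2.1 q.2 * K' q.1.1 q.2 q.1.2.2 :=
    (hK.comp (by fun_prop : Measurable fun q : (α × M × M) × M => (q.1.1, q.1.2.1, q.2))).mul
      (hK'.comp (by fun_prop : Measurable fun q : (α × M × M) × M => (q.1.1, q.2, q.1.2.2)))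
  exact (StronglyMeasurable.integral_prod_right' this.stronglyMeasurable).measurable

lemma SchurBound.lintegral_comp_row {C C' : ℝ≥0} {K K' : M → M → ℂ} (hK : SchurBound μ C K)
    (hK' : SchurBound μ C' K') (x : M) :
    ∫⁻ y, ∫⁻ z, ‖K x z * K' z y‖ₑ ∂μ ∂μ ≤ (C * C' : ℝ≥0) := by
  have hm : Measurable fun p : M × M => ‖K x p.2‖ₑ * ‖K' p.2 p.1‖ₑ :=
    ((hK.meas.comp (by fun_prop : Measurable fun p : M × M => (x, p.2))).enorm).mul
      ((hK'.meas.comp (by fun_prop : Measurable fun p : M × M => (p.2, p.1))).enorm)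
  simp only [enorm_mul]
  rw [lintegral_lintegral_swap hm.aemeasurable]
  calc ∫⁻ z, ∫⁻ y, ‖K x z‖ₑ * ‖K' z y‖ₑ ∂μ ∂μ ≤ ∫⁻ z, ‖K x z‖ₑ * C' ∂μ := by
        refine lintegral_mono fun z => ?_
        simp only
        rw [lintegral_const_mul _ (hK'.measurable_row z).enorm]
        gcongr; exact hK'.row z
    _ = (∫⁻ z, ‖K x z‖ₑ ∂μ) * C' := lintegral_mul_const _
        ((hK.meas.comp measurable_prodMk_left).enorm)
    _ ≤ _ := by push_cast; gcongr; exact hK.row x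

lemma SchurBound.lintegral_comp_col {C C' : ℝ≥0} {K K' : M → M → ℂ} (hK : SchurBound μ C K)
    (hK' : SchurBound μ C' K') (y : M) :
    ∫⁻ x, ∫⁻ z, ‖K x z * K' z y‖ₑ ∂μ ∂μ ≤ (C * C' : ℝ≥0) := by
  have hm : Measurable fun p : M × M => ‖K p.1 p.2‖ₑ * ‖K' p.2 y‖ₑ :=
    (hK.meas.enorm).mul
      ((hK'.meas.comp (by fun_prop : Measurable fun p : M × M => (p.2, y))).enorm)
  simp only [enorm_mul]
  rw [lintegral_lintegral_swap hm.aemeasurable]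
  calc ∫⁻ z, ∫⁻ x, ‖K x z‖ₑ * ‖K' z y‖ₑ ∂μ ∂μ ≤ ∫⁻ z, C * ‖K' z y‖ₑ ∂μ := by
        refine lintegral_mono fun z => ?_
        simp only
        rw [lintegral_mul_const _ (hK.measurable_col z).enorm]
        gcongr; exact hK.col z
    _ = C * (∫⁻ z, ‖K' z y‖ₑ ∂μ) := lintegral_const_mul _
        ((hK'.meas.comp measurable_prodMk_right).enorm)
    _ ≤ _ := by push_cast; gcongr; exact hK'.col y

lemma SchurBound.kcomp {C C' : ℝ≥0} {K K' : M → M → ℂ} (hK : SchurBound μ C K)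
    (hK' : SchurBound μ C' K') : SchurBound μ (C * C') (kcomp μ K K') := by
  refine ⟨?_, fun x => ?_, fun y => ?_⟩
  · have := measurable_kcomp (μ := μ) (α := Unit) (K := fun _ => K) (K' := fun _ => K')
      (hK.meas.comp measurable_snd) (hK'.meas.comp measurable_snd)
    exact this.comp (measurable_prodMk_left (x := ()))
  · exact (lintegral_mono fun y => enorm_integral_le_lintegral_enorm _).trans
      (hK.lintegral_comp_row hK' x)
  · exact (lintegral_mono fun y => enorm_integral_le_lintegral_enorm _).trans
      (hK.lintegral_comp_col hK' y)

lemma HasKernel.comp {C C' : ℝ≥0} {K K' : M → M → ℂ} (hK : SchurBound μ C K)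
    (hK' : SchurBound μ C' K') {T T' : L2 M μ →L[ℂ] L2 M μ} (h : HasKernel T K)
    (h' : HasKernel T' K') : HasKernel (T.comp T') (kcomp μ K K') := by
  intro u
  refine ⟨(hK.kcomp hK').ae_integrable u, ?_⟩
  have hu := (Lp.stronglyMeasurable u).measurable
  have hm' : Measurable fun p : M × M => ‖K' p.1 p.2‖ₑ * ‖u p.2‖ₑ :=
    hK'.meas.enorm.mul (hu.comp measurable_snd).enorm
  have hfin : ∫⁻ z, (∫⁻ y, ‖K' z y‖ₑ * ‖u y‖ₑ ∂μ) ^ 2 ∂μ ≠ ⊤ :=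
    ((hK'.lintegral_sq_le hu.enorm).trans_lt (by
      rw [L2.lintegral_sq]; exact ENNReal.mul_lt_top (by simp) (by simp))).ne
  filter_upwards [(h (T' u)).2,
    hK.ae_lintegral_lt_top (Measurable.lintegral_prod_right' hm') hfin] with x hx1 hx2
  have hmeas : Measurable fun p : M × M => K x p.2 * K' p.2 p.1 * u p.1 :=
    ((hK.meas.comp (by fun_prop : Measurable fun p : M × M => (x, p.2))).mul
      (hK'.meas.comp (by fun_prop : Measurable fun p : M × M => (p.2, p.1)))).mul
      (hu.comp measurable_fst)
  have htop : Integrable (fun p : M × M => K x p.2 * K' p.2 p.1 * u p.1) (μ.prod μ) := by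
    refine ⟨hmeas.aestronglyMeasurable, ?_⟩
    rw [HasFiniteIntegral, lintegral_prod_symm _ hmeas.enorm.aemeasurable]
    refine lt_of_le_of_lt (lintegral_mono fun z => ?_) hx2
    simp only [enorm_mul, mul_assoc]
    exact (lintegral_const_mul _ ((hK'.measurable_row z).enorm.mul hu.enorm)).le
  rw [ContinuousLinearMap.comp_apply, hx1]
  have h2 : (fun y => kcomp μ K K' x y * u y)
      = fun y => ∫ z, K x z * K' z y * u y ∂μ := by
    ext y; rw [integral_mul_const]; rfl
  rw [h2, integral_integral_swap htop]
  apply integral_congr_ae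
  filter_upwards [(h' u).2] with z hz
  rw [hz, ← integral_const_mul]
  congr 1; ext y; ring

lemma HasKernel.add {T T' : L2 M μ →L[ℂ] L2 M μ} {K K' : M → M → ℂ} (h : HasKernel T K)
    (h' : HasKernel T' K') : HasKernel (T + T') (fun x y => K x y + K' x y) := by
  intro u
  refine ⟨?_, ?_⟩
  · filter_upwards [(h u).1, (h' u).1] with x h1 h2
    simp only [add_mul]
    exact h1.add h2
  · filter_upwards [(h u).1, (h' u).1, (h u).2, (h' u).2, Lp.coeFn_add (T u) (T' u)]
      with x h1 h2 h3 h4 h5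
    rw [add_apply, h5, Pi.add_apply, h3, h4, ← integral_add h1 h2]
    simp only [add_mul]

lemma HasKernel.smul {T : L2 M μ →L[ℂ] L2 M μ} {K : M → M → ℂ} (h : HasKernel T K) (a : ℂ) :
    HasKernel (a • T) (fun x y => a * K x y) := by
  intro u
  refine ⟨?_, ?_⟩
  · filter_upwards [(h u).1] with x h1
    simpa only [mul_assoc] using h1.const_mul a
  · filter_upwards [(h u).2, Lp.coeFn_smul a (T u)] with x h3 h5
    rw [smul_apply, h5, Pi.smul_apply, h3, smul_eq_mul, ← integral_const_mul]
    simp only [mul_assoc]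

lemma HasKernel.zero : HasKernel (0 : L2 M μ →L[ℂ] L2 M μ) (fun _ _ => 0) := by
  intro u
  refine ⟨by simp, ?_⟩
  filter_upwards [Lp.coeFn_zero ℂ 2 μ] with x hx
  simpa using hx

lemma HasKernel.sum {ι : Type*} (s : Finset ι) {T : ι → L2 M μ →L[ℂ] L2 M μ}
    {K : ι → M → M → ℂ} (h : ∀ i ∈ s, HasKernel (T i) (K i)) :
    HasKernel (∑ i ∈ s, T i) (fun x y => ∑ i ∈ s, K i x y) := by
  classical
  induction s using Finset.induction_on with
  | empty => simpa using HasKernel.zero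
  | insert i s hi ih =>
    simp only [Finset.sum_insert hi]
    exact (h i (by simp)).add (ih fun j hj => h j (by simp [hj]))

end Schur

/-! ### Gaussians on doubling spaces -/

/-- Volume doubling in the form used below: `μ(B(x, l r)) ≤ A l^D μ(B(x,r))` for `l ≥ 1`. -/
structure VolGrowth {M : Type*} [MetricSpace M] [MeasurableSpace M] (μ : Measure M) (A : ℝ)
    (D : ℕ) : Prop where
  pos : ∀ (x : M) (r : ℝ), 0 < r → 0 < μ.real (Metric.ball x r)
  finite : ∀ (x : M) (r : ℝ), μ (Metric.ball x r) < ⊤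
  growth : ∀ (x : M) (r l : ℝ), 0 < r → 1 ≤ l →
    μ.real (Metric.ball x (l * r)) ≤ A * l ^ D * μ.real (Metric.ball x r)

lemma VolumeDoubling.exists_volGrowth {M : Type*} [MetricSpace M] [MeasurableSpace M]
    {μ : Measure M} (hμ : VolumeDoubling μ) : ∃ A D, VolGrowth μ A D := by
  obtain ⟨h1, C, hC⟩ := hμ
  obtain ⟨D, hD⟩ := pow_unbounded_of_one_lt (max C 1) (one_lt_two (α := ℝ))
  have hfin : ∀ (x : M) (r : ℝ), μ (Metric.ball x r) < ⊤ := fun x r =>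
    (measure_mono (Metric.ball_subset_ball (le_max_left r 1))).trans_lt
      (h1 x (max r 1) (by positivity)).2
  have hpow : ∀ (n : ℕ) (x : M) (r : ℝ), 0 < r →
      μ.real (Metric.ball x (2 ^ n * r)) ≤ ((2 : ℝ) ^ D) ^ n * μ.real (Metric.ball x r) := by
    intro n
    induction n with
    | zero => intro x r _; simp
    | succ n ih =>
      intro x r hr
      have h := hC x (2 ^ n * r) (by positivity)
      calc μ.real (Metric.ball x (2 ^ (n + 1) * r)) = μ.real (Metric.ball x (2 * (2 ^ n * r))) := by
            congr 2; ring
        _ ≤ C * μ.real (Metric.ball x (2 ^ n * r)) := h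
        _ ≤ 2 ^ D * (((2 : ℝ) ^ D) ^ n * μ.real (Metric.ball x r)) := by
            gcongr
            · exact (le_max_left _ _).trans hD.le
            · exact ih x r hr
        _ = _ := by ring
  refine ⟨2 ^ D, D, fun x r hr => ENNReal.toReal_pos (h1 x r hr).1.ne' (h1 x r hr).2.ne, hfin,
    fun x r l hr hl => ?_⟩
  obtain ⟨n, hn1, hn2⟩ := exists_nat_pow_near hl (one_lt_two (α := ℝ))
  calc μ.real (Metric.ball x (l * r)) ≤ μ.real (Metric.ball x (2 ^ (n + 1) * r)) :=
        measureReal_mono (Metric.ball_subset_ball (by gcongr)) (hfin _ _).ne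
    _ ≤ ((2 : ℝ) ^ D) ^ (n + 1) * μ.real (Metric.ball x r) := hpow _ _ _ hr
    _ = (2 * 2 ^ n) ^ D * μ.real (Metric.ball x r) := by
        rw [← pow_mul, mul_comm D, pow_mul, pow_succ']
    _ ≤ (2 * l) ^ D * μ.real (Metric.ball x r) := by gcongr
    _ = _ := by rw [mul_pow]

/-- The Gaussian at scale `√u`, `μ(B(x,√u))⁻¹ exp(-c d(x,y)²/u)`. -/
def gau {M : Type*} [MetricSpace M] [MeasurableSpace M] (μ : Measure M) (c u : ℝ) (x y : M) : ℝ :=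
  (μ.real (Metric.ball x √u))⁻¹ * Real.exp (-c * (dist x y ^ 2 / u))

lemma one_add_sq_pow_mul_exp_le (k : ℕ) {c : ℝ} (hc : 0 < c) :
    ∃ C : ℝ, 0 < C ∧ ∀ z : ℝ, 0 ≤ z → (1 + z) ^ k * Real.exp (-c * z) ≤ C := by
  refine ⟨k.factorial * (c ^ k)⁻¹ * Real.exp c, by positivity, fun z hz => ?_⟩
  have h := Real.pow_div_factorial_le_exp (c * (1 + z)) (by positivity) k
  rw [div_le_iff₀ (by positivity), mul_pow] at h
  have e : Real.exp (c * (1 + z)) = Real.exp c * Real.exp (c * z) := by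
    rw [← Real.exp_add]; ring_nf
  rw [neg_mul, Real.exp_neg, ← div_eq_mul_inv, div_le_iff₀ (Real.exp_pos _)]
  calc (1 + z) ^ k = (c ^ k)⁻¹ * (c ^ k * (1 + z) ^ k) := by field_simp
    _ ≤ (c ^ k)⁻¹ * (Real.exp (c * (1 + z)) * k.factorial) := by gcongr
    _ = _ := by rw [e]; ring

section

variable {M : Type*} [MetricSpace M] [MeasurableSpace M] {μ : Measure M} {A : ℝ} {D : ℕ}

lemma gau_nonneg (c u : ℝ) (x y : M) : 0 ≤ gau μ c u x y := by
  unfold gau; positivity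

lemma gau_anti {c c' : ℝ} (h : c ≤ c') {u : ℝ} (hu : 0 < u) (x y : M) :
    gau μ c' u x y ≤ gau μ c u x y := by
  unfold gau
  gcongr

lemma VolGrowth.one_le [Nonempty M] (hV : VolGrowth μ A D) : 1 ≤ A := by
  have x : M := Classical.arbitrary M
  have h := hV.growth x 1 1 one_pos le_rfl
  have hp := hV.pos x 1 one_pos
  simp only [mul_one, one_pow] at h
  by_contra hA
  push Not at hA
  nlinarith

lemma VolGrowth.mono (hV : VolGrowth μ A D) (x : M) {r r' : ℝ} (h : r ≤ r') :
    μ.real (Metric.ball x r) ≤ μ.real (Metric.ball x r') :=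
  measureReal_mono (Metric.ball_subset_ball h) (hV.finite _ _).ne

/-- Comparison of the volumes of balls with different centres. -/
lemma VolGrowth.swap (hV : VolGrowth μ A D) (x y : M) {r : ℝ} (hr : 0 < r) :
    μ.real (Metric.ball y r) ≤ A * (1 + dist x y / r) ^ D * μ.real (Metric.ball x r) := by
  refine le_trans ?_ (hV.growth x r (1 + dist x y / r) hr (by
    have : 0 ≤ dist x y / r := by positivity
    linarith))
  refine measureReal_mono (Metric.ball_subset_ball' ?_) (hV.finite _ _).ne
  rw [add_mul, one_mul, div_mul_cancel₀ _ hr.ne', dist_comm]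

lemma VolGrowth.gau_le_swap [Nonempty M] (hV : VolGrowth μ A D) {c : ℝ} (hc : 0 < c) :
    ∃ C : ℝ, 0 < C ∧ ∀ u : ℝ, 0 < u → ∀ x y : M, gau μ c u x y ≤ C * gau μ (c / 2) u y x := by
  obtain ⟨C, hC, h⟩ := one_add_sq_pow_mul_exp_le D (half_pos hc)
  have hA : 0 < A := lt_of_lt_of_le one_pos hV.one_le
  refine ⟨A * 2 ^ D * C, by positivity, fun u hu x y => ?_⟩
  have hs := Real.sqrt_pos.2 hu
  have hx := hV.pos x _ hs
  have hy := hV.pos y _ hs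
  set z := dist x y ^ 2 / u with hz
  have hz0 : 0 ≤ z := by positivity
  have h1 : 1 + dist x y / √u ≤ 2 * (1 + z) := by
    have e : (dist x y / √u) ^ 2 = z := by rw [div_pow, Real.sq_sqrt hu.le]
    nlinarith [sq_nonneg (dist x y / √u - 1)]
  have h2 : (μ.real (Metric.ball x √u))⁻¹
      ≤ A * 2 ^ D * (1 + z) ^ D * (μ.real (Metric.ball y √u))⁻¹ := by
    rw [← div_eq_mul_inv, inv_eq_one_div, div_le_div_iff₀ hx hy, one_mul]
    calc _ ≤ _ := hV.swap x y hs
      _ ≤ A * (2 * (1 + z)) ^ D * _ := by gcongr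
      _ = _ := by rw [mul_pow]; ring
  unfold gau
  rw [dist_comm y x, ← hz]
  have e : Real.exp (-c * z) = Real.exp (-(c / 2) * z) * Real.exp (-(c / 2) * z) := by
    rw [← Real.exp_add]; ring_nf
  rw [e]
  calc _ ≤ (A * 2 ^ D * (1 + z) ^ D * (μ.real (Metric.ball y √u))⁻¹)
        * (Real.exp (-(c / 2) * z) * Real.exp (-(c / 2) * z)) := by gcongr
    _ = A * 2 ^ D * ((1 + z) ^ D * Real.exp (-(c / 2) * z)) * (μ.real (Metric.ball y √u))⁻¹
        * Real.exp (-(c / 2) * z) := by ring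
    _ ≤ A * 2 ^ D * C * (μ.real (Metric.ball y √u))⁻¹ * Real.exp (-(c / 2) * z) := by
        gcongr; exact h z hz0
    _ = _ := by ring

/-- Comparison of the Gaussians at comparable scales. -/
lemma VolGrowth.gau_le_of_scale [Nonempty M] (hV : VolGrowth μ A D) {c l : ℝ} (hc : 0 < c)
    (hl : 1 ≤ l) :
    ∀ u w : ℝ, 0 < u → u ≤ w → w ≤ l * u → ∀ x y : M,
      gau μ c u x y ≤ A * l ^ D * gau μ c w x y := by
  intro u w hu huw hwl x y
  have hw : 0 < w := hu.trans_le huw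
  have hA : 0 < A := lt_of_lt_of_le one_pos hV.one_le
  unfold gau
  have h1 : (μ.real (Metric.ball x √u))⁻¹ ≤ A * l ^ D * (μ.real (Metric.ball x √w))⁻¹ := by
    rw [← div_eq_mul_inv, inv_eq_one_div, div_le_div_iff₀ (hV.pos x _ (Real.sqrt_pos.2 hu))
      (hV.pos x _ (Real.sqrt_pos.2 hw)), one_mul]
    refine le_trans (hV.mono x ?_) (hV.growth x _ l (Real.sqrt_pos.2 hu) hl)
    calc √w ≤ √(l ^ 2 * u) := Real.sqrt_le_sqrt (by nlinarith)
      _ = l * √u := by rw [Real.sqrt_mul (by positivity), Real.sqrt_sq (by linarith)]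
  calc _ ≤ (A * l ^ D * (μ.real (Metric.ball x √w))⁻¹) * Real.exp (-c * (dist x y ^ 2 / w)) := by
        refine mul_le_mul h1 ?_ (by positivity) (by positivity)
        refine Real.exp_le_exp.2 ?_
        rw [neg_mul, neg_mul, neg_le_neg_iff]
        gcongr
    _ = _ := by ring

end

section

variable {M : Type*} [MetricSpace M] [ProperSpace M] [MeasurableSpace M] [BorelSpace M]
  {μ : Measure M} {A : ℝ} {D : ℕ}

lemma VolGrowth.sigmaFinite (hV : VolGrowth μ A D) : SigmaFinite μ := by
  have : IsLocallyFiniteMeasure μ :=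
    ⟨fun x => ⟨Metric.ball x 1, Metric.ball_mem_nhds x one_pos, hV.finite x 1⟩⟩
  infer_instance

lemma measurable_vol (μ : Measure M) [SFinite μ] :
    Measurable fun p : M × ℝ => μ.real (Metric.ball p.1 p.2) := by
  have hs : MeasurableSet {q : (M × ℝ) × M | dist q.2 q.1.1 < q.1.2} :=
    measurableSet_lt (by fun_prop) (by fun_prop)
  exact (measurable_measure_prodMk_left hs).ennreal_toReal

lemma measurable_gau (μ : Measure M) [SFinite μ] (c : ℝ) :
    Measurable fun p : ℝ × M × M => gau μ c p.1 p.2.1 p.2.2 := by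
  unfold gau
  have h1 : Measurable fun p : ℝ × M × M => μ.real (Metric.ball p.2.1 √p.1) :=
    (measurable_vol μ).comp (by fun_prop : Measurable fun p : ℝ × M × M => (p.2.1, √p.1))
  refine h1.inv.mul (Real.measurable_exp.comp (measurable_const.mul ?_))
  exact ((by fun_prop : Measurable fun p : ℝ × M × M => dist p.2.1 p.2.2 ^ 2)).div measurable_fst

/-- Gaussians have bounded integrals: sum over the annuli `n√u ≤ d(x,y) < (n+1)√u`. -/
lemma VolGrowth.lintegral_gau_le [Nonempty M] (hV : VolGrowth μ A D) {c : ℝ} (hc : 0 < c) :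
    ∃ C : ℝ≥0, ∀ u : ℝ, 0 < u → ∀ x : M, ∫⁻ y, ENNReal.ofReal (gau μ c u x y) ∂μ ≤ C := by
  have hA : 0 < A := lt_of_lt_of_le one_pos hV.one_le
  have hsum : Summable fun n : ℕ => A * ((n : ℝ) + 1) ^ D * Real.exp (-c * n) := by
    have h := (Real.summable_pow_mul_exp_neg_nat_mul D hc).comp_injective
      (add_left_injective 1)
    refine (h.mul_left (A * Real.exp c)).congr fun n => ?_
    simp only [Function.comp]
    have : Real.exp (-c * n) = Real.exp c * Real.exp (-c * (n + 1 : ℕ)) := by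
      rw [← Real.exp_add]; push_cast; ring_nf
    rw [this]; push_cast; ring
  refine ⟨(∑' n : ℕ, A * ((n : ℝ) + 1) ^ D * Real.exp (-c * n)).toNNReal, fun u hu x => ?_⟩
  have hs := Real.sqrt_pos.2 hu
  have hx := hV.pos x _ hs
  set v := μ.real (Metric.ball x √u) with hv
  -- the Gaussian is dominated by its values on the annuli of integer radii
  have hpt : ∀ y, ENNReal.ofReal (gau μ c u x y) ≤ ∑' n : ℕ,
      (Metric.ball x (((n : ℝ) + 1) * √u)).indicator
        (fun _ => ENNReal.ofReal (v⁻¹ * Real.exp (-c * n))) y := by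
    intro y
    refine le_trans ?_ (ENNReal.le_tsum ⌊dist x y / √u⌋₊)
    have h1 : y ∈ Metric.ball x (((⌊dist x y / √u⌋₊ : ℝ) + 1) * √u) := by
      rw [Metric.mem_ball, dist_comm, ← div_lt_iff₀ hs]
      exact Nat.lt_floor_add_one _
    rw [indicator_of_mem h1]
    refine ENNReal.ofReal_le_ofReal ?_
    unfold gau
    refine mul_le_mul_of_nonneg_left (Real.exp_le_exp.2 ?_) (by positivity)
    rw [neg_mul, neg_mul, neg_le_neg_iff]
    refine mul_le_mul_of_nonneg_left ?_ hc.le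
    set n := ⌊dist x y / √u⌋₊
    have h2 : (n : ℝ) ≤ dist x y / √u := Nat.floor_le (by positivity)
    have h3 : (n : ℝ) ≤ (n : ℝ) ^ 2 := by exact_mod_cast Nat.le_self_pow two_ne_zero n
    calc (n : ℝ) ≤ (n : ℝ) ^ 2 := h3
      _ ≤ (dist x y / √u) ^ 2 := by gcongr
      _ = _ := by rw [div_pow, Real.sq_sqrt hu.le]
  calc ∫⁻ y, ENNReal.ofReal (gau μ c u x y) ∂μ
      ≤ ∫⁻ y, ∑' n : ℕ, (Metric.ball x (((n : ℝ) + 1) * √u)).indicator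
        (fun _ => ENNReal.ofReal (v⁻¹ * Real.exp (-c * n))) y ∂μ := lintegral_mono hpt
    _ = ∑' n : ℕ, ENNReal.ofReal (v⁻¹ * Real.exp (-c * n))
          * μ (Metric.ball x (((n : ℝ) + 1) * √u)) := by
        rw [lintegral_tsum fun n => (measurable_const.indicator measurableSet_ball).aemeasurable]
        simp only [lintegral_indicator measurableSet_ball, setLIntegral_const]
    _ ≤ ∑' n : ℕ, ENNReal.ofReal (A * ((n : ℝ) + 1) ^ D * Real.exp (-c * n)) := by
        refine ENNReal.tsum_le_tsum fun n => ?_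
        rw [← ENNReal.ofReal_toReal (hV.finite x _).ne, ← ENNReal.ofReal_mul (by positivity)]
        refine ENNReal.ofReal_le_ofReal ?_
        have := hV.growth x √u ((n : ℝ) + 1) hs (by linarith [n.cast_nonneg (α := ℝ)])
        calc _ ≤ v⁻¹ * Real.exp (-c * n) * (A * ((n : ℝ) + 1) ^ D * v) := by gcongr; exact this
          _ = _ := by field_simp
    _ = _ := by
        rw [← ENNReal.ofReal_tsum_of_nonneg (fun n => by positivity) hsum]; rfl

lemma VolGrowth.lintegral_gau_le_col [Nonempty M] (hV : VolGrowth μ A D) {c : ℝ} (hc : 0 < c) :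
    ∃ C : ℝ≥0, ∀ u : ℝ, 0 < u → ∀ y : M, ∫⁻ x, ENNReal.ofReal (gau μ c u x y) ∂μ ≤ C := by
  obtain ⟨C, hC, h⟩ := hV.gau_le_swap hc
  obtain ⟨C', h'⟩ := hV.lintegral_gau_le (half_pos hc)
  refine ⟨C.toNNReal * C', fun u hu y => ?_⟩
  calc ∫⁻ x, ENNReal.ofReal (gau μ c u x y) ∂μ
      ≤ ∫⁻ x, ENNReal.ofReal C * ENNReal.ofReal (gau μ (c / 2) u y x) ∂μ := by
        refine lintegral_mono fun x => ?_
        rw [← ENNReal.ofReal_mul hC.le]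
        exact ENNReal.ofReal_le_ofReal (h u hu x y)
    _ = ENNReal.ofReal C * ∫⁻ x, ENNReal.ofReal (gau μ (c / 2) u y x) ∂μ :=
        lintegral_const_mul' _ _ ENNReal.ofReal_ne_top
    _ ≤ _ := by push_cast; gcongr; exact le_rfl; exact h' u hu y

/-- Gaussians of a given shape satisfy Schur's condition uniformly in the scale. -/
lemma VolGrowth.exists_schurBound [Nonempty M] (hV : VolGrowth μ A D) {c : ℝ} (hc : 0 < c) :
    ∃ C : ℝ≥0, ∀ (K : M → M → ℂ) (u a : ℝ), 0 < u → 0 ≤ a →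
      Measurable (fun p : M × M => K p.1 p.2) → (∀ x y, ‖K x y‖ ≤ a * gau μ c u x y) →
      SchurBound μ (a.toNNReal * C) K := by
  obtain ⟨C₁, h₁⟩ := hV.lintegral_gau_le hc
  obtain ⟨C₂, h₂⟩ := hV.lintegral_gau_le_col hc
  have key : ∀ (K : M → M → ℂ) (u a : ℝ), 0 < u → 0 ≤ a → (∀ x y, ‖K x y‖ ≤ a * gau μ c u x y) →
      ∀ x y, ‖K x y‖ₑ ≤ (a.toNNReal : ℝ≥0∞) * ENNReal.ofReal (gau μ c u x y) := by
    intro K u a _ ha hK x y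
    rw [← ENNReal.ofReal, ← ENNReal.ofReal_mul ha, ← ofReal_norm]
    exact ENNReal.ofReal_le_ofReal (hK x y)
  refine ⟨max C₁ C₂, fun K u a hu ha hm hK => ⟨hm, fun x => ?_, fun y => ?_⟩⟩
  · refine (lintegral_mono (key K u a hu ha hK x)).trans ?_
    rw [lintegral_const_mul' _ _ ENNReal.coe_ne_top]
    push_cast
    gcongr
    exact (h₁ u hu x).trans (le_max_left _ _)
  · refine (lintegral_mono fun x => key K u a hu ha hK x y).trans ?_
    rw [lintegral_const_mul' _ _ ENNReal.coe_ne_top]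
    push_cast
    gcongr
    exact (h₂ u hu y).trans (le_max_right _ _)

/-- The composition of two kernels with Gaussian bounds at the same scale. -/
lemma VolGrowth.exists_kcomp_le [Nonempty M] (hV : VolGrowth μ A D) {c : ℝ} (hc : 0 < c) :
    ∃ C : ℝ, 0 < C ∧ ∀ (K K' : M → M → ℂ) (u a a' : ℝ), 0 < u → 0 ≤ a → 0 ≤ a' →
      (∀ x y, ‖K x y‖ ≤ a * gau μ c u x y) → (∀ x y, ‖K' x y‖ ≤ a' * gau μ c u x y) →
      ∀ x y, ‖kcomp μ K K' x y‖ ≤ C * a * a' * gau μ (c / 4) u x y := by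
  obtain ⟨C, h⟩ := hV.lintegral_gau_le_col (half_pos hc)
  refine ⟨C + 1, by positivity, fun K K' u a a' hu ha ha' hK hK' x y => ?_⟩
  have hpt : ∀ z, ‖K x z * K' z y‖ₑ
      ≤ ENNReal.ofReal (a * a' * gau μ (c / 4) u x y) * ENNReal.ofReal (gau μ (c / 2) u z y) := by
    intro z
    rw [← ofReal_norm, ← ENNReal.ofReal_mul (by have := gau_nonneg (μ := μ) (c / 4) u x y; positivity)]
    refine ENNReal.ofReal_le_ofReal ?_
    rw [norm_mul]
    calc ‖K x z‖ * ‖K' z y‖ ≤ (a * gau μ c u x z) * (a' * gau μ c u z y) := by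
          gcongr
          · exact mul_nonneg ha (gau_nonneg _ _ _ _)
          · exact hK x z
          · exact hK' z y
      _ = a * a' * (gau μ c u x z * gau μ c u z y) := by ring
      _ ≤ a * a' * (gau μ (c / 4) u x y * gau μ (c / 2) u z y) := by
          refine mul_le_mul_of_nonneg_left ?_ (mul_nonneg ha ha')
          unfold gau
          have hexp : Real.exp (-c * (dist x z ^ 2 / u)) * Real.exp (-c * (dist z y ^ 2 / u))
              ≤ Real.exp (-(c / 4) * (dist x y ^ 2 / u))
                * Real.exp (-(c / 2) * (dist z y ^ 2 / u)) := by
            rw [← Real.exp_add, ← Real.exp_add]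
            refine Real.exp_le_exp.2 ?_
            have ht : dist x y ≤ dist x z + dist z y := dist_triangle _ _ _
            have h2 : dist x y ^ 2 ≤ 2 * (dist x z ^ 2 + dist z y ^ 2) := by
              have h0 : 0 ≤ dist x y := dist_nonneg
              nlinarith [sq_nonneg (dist x z - dist z y)]
            have h3 : dist x y ^ 2 / u ≤ 2 * (dist x z ^ 2 / u + dist z y ^ 2 / u) := by
              rw [← add_div, ← mul_div_assoc]; gcongr
            have h4 : 0 ≤ dist x z ^ 2 / u := by positivity
            nlinarith
          calc _ = (μ.real (Metric.ball x √u))⁻¹ * (μ.real (Metric.ball z √u))⁻¹ *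
                (Real.exp (-c * (dist x z ^ 2 / u)) * Real.exp (-c * (dist z y ^ 2 / u))) := by ring
            _ ≤ _ := mul_le_mul_of_nonneg_left hexp (by positivity)
            _ = _ := by ring
      _ = _ := by ring
  have hE : ‖kcomp μ K K' x y‖ₑ ≤ ENNReal.ofReal (a * a' * gau μ (c / 4) u x y) * C := by
    calc _ ≤ ∫⁻ z, ‖K x z * K' z y‖ₑ ∂μ := enorm_integral_le_lintegral_enorm _
      _ ≤ _ := lintegral_mono hpt
      _ = _ := lintegral_const_mul' _ _ ENNReal.ofReal_ne_top
      _ ≤ _ := by gcongr; exact h u hu y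
  have h0 : 0 ≤ a * a' * gau μ (c / 4) u x y := by
    have := gau_nonneg (μ := μ) (c / 4) u x y; positivity
  rw [← ofReal_norm, ← ENNReal.ofReal_coe_nnreal, ← ENNReal.ofReal_mul h0] at hE
  have := (ENNReal.ofReal_le_ofReal_iff (by positivity)).1 hE
  nlinarith

end

/-! ### The semigroup and its derivatives -/

namespace HeatSystem

section Abstract

variable {M : Type*} [MeasurableSpace M] {μ : Measure M} {d : ℕ} {H : HeatSystem M μ d}

lemma VRel.unique : ∀ {I : List (Fin d)} {u w w' : L2 M μ}, H.VRel I u w → H.VRel I u w' → w = w'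
  | [], _, _, _, h, h' => by rw [VRel] at h h'; rw [h, h']
  | _ :: _, _, _, _, ⟨_, h1, h2⟩, ⟨_, h1', h2'⟩ =>
    LinearPMap.mem_graph_snd_inj _ h2 h2' (VRel.unique h1 h1')

lemma VRel.add : ∀ {I : List (Fin d)} {u u' w w' : L2 M μ}, H.VRel I u w → H.VRel I u' w' →
    H.VRel I (u + u') (w + w')
  | [], _, _, _, _, h, h' => by rw [VRel] at *; rw [h, h']
  | _ :: _, _, _, _, _, ⟨v, h1, h2⟩, ⟨v', h1', h2'⟩ =>
    ⟨v + v', VRel.add h1 h1', by simpa using Submodule.add_mem _ h2 h2'⟩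

lemma VRel.smul (a : ℂ) : ∀ {I : List (Fin d)} {u w : L2 M μ}, H.VRel I u w →
    H.VRel I (a • u) (a • w)
  | [], _, _, h => by rw [VRel] at *; rw [h]
  | _ :: _, _, _, ⟨v, h1, h2⟩ =>
    ⟨a • v, VRel.smul a h1, by simpa using Submodule.smul_mem _ a h2⟩

lemma VRel.zero (I : List (Fin d)) : H.VRel I 0 0 := by
  induction I with
  | nil => rfl
  | cons i I ih => exact ⟨0, ih, (H.V i).graph.zero_mem⟩

lemma VRel.sum (I : List (Fin d)) {ι : Type*} (s : Finset ι) {u w : ι → L2 M μ}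
    (h : ∀ i ∈ s, H.VRel I (u i) (w i)) : H.VRel I (∑ i ∈ s, u i) (∑ i ∈ s, w i) := by
  classical
  induction s using Finset.induction_on with
  | empty => simpa using VRel.zero I
  | insert i s hi ih =>
    rw [Finset.sum_insert hi, Finset.sum_insert hi]
    exact (h i (by simp)).add (ih fun j hj => h j (by simp [hj]))

lemma VRel.of_append : ∀ {I J : List (Fin d)} {u w : L2 M μ}, H.VRel (I ++ J) u w →
    ∃ v, H.VRel J u v ∧ H.VRel I v w
  | [], _, _, _, h => ⟨_, h, rfl⟩
  | _ :: _, _, _, _, ⟨_, h1, h2⟩ =>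
    let ⟨v, h3, h4⟩ := VRel.of_append h1
    ⟨v, h3, _, h4, h2⟩

variable (H) in
/-- The operators `L^N e^{-tL} = (-d/dt)^N e^{-tL}`. -/
def powHeat (N : ℕ) (t : ℝ) : L2 M μ →L[ℂ] L2 M μ := (-1 : ℂ) ^ N • deriv^[N] H.heat t

variable (H) in
/-- The closed linear span of the `e^{-uL}`, `u > 0`. -/
def functionsOfL : Submodule ℂ (L2 M μ →L[ℂ] L2 M μ) :=
  (Submodule.span ℂ (H.heat '' Ioi 0)).topologicalClosure

lemma powHeat_zero (t : ℝ) : H.powHeat 0 t = H.heat t := by simp [powHeat]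

/-- Integrals are limits of averages, which stay in a closed convex set. -/
lemma integral_mem_functionsOfL {f : ℝ → L2 M μ →L[ℂ] L2 M μ} {a b : ℝ} (hab : a < b)
    (hf : IntegrableOn f (Ioo a b)) (h : ∀ x ∈ Ioo a b, f x ∈ H.functionsOfL) :
    ∫ x in Ioo a b, f x ∈ H.functionsOfL := by
  have hc : Convex ℝ (H.functionsOfL : Set (L2 M μ →L[ℂ] L2 M μ)) :=
    (H.functionsOfL.restrictScalars ℝ).convex
  have h1 := hc.set_average_mem (Submodule.isClosed_topologicalClosure _)
    (μ := volume) (t := Ioo a b) (f := f) (by simpa using hab) (by simp)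
    ((ae_restrict_iff' measurableSet_Ioo).2 (ae_of_all _ h)) hf
  rw [setAverage_eq] at h1
  have h2 := Submodule.smul_of_tower_mem (S := ℝ) H.functionsOfL (volume.real (Ioo a b)) h1
  have h3 : volume.real (Ioo a b) ≠ 0 := by
    rw [Real.volume_real_Ioo_of_le hab.le]; linarith
  rwa [smul_inv_smul₀ h3] at h2

end Abstract

section Semigroup

variable {M : Type*} [MetricSpace M] [MeasurableSpace M] {μ : Measure M} {d : ℕ}
  {H : HeatSystem M μ d}

lemma AssumptionA.analyticAt_heat (hH : H.AssumptionA) {t : ℝ} (ht : 0 < t) :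
    AnalyticAt ℝ H.heat t := by
  obtain ⟨θ, hθ, F, hF, hFt⟩ := hH.holomorphic
  have hmem : {z : ℂ | z ≠ 0 ∧ |z.arg| < θ} ∈ 𝓝 (t : ℂ) := by
    have hs : (t : ℂ) ∈ Complex.slitPlane := by simp [Complex.slitPlane, ht]
    have h1 : ∀ᶠ z : ℂ in 𝓝 (t : ℂ), |z.arg| < θ := by
      have : ContinuousAt (fun z : ℂ => |z.arg|) t := (Complex.continuousAt_arg hs).abs
      refine this.eventually_lt continuousAt_const ?_
      simpa [Complex.arg_ofReal_of_nonneg ht.le] using hθ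
    have h2 : ∀ᶠ z : ℂ in 𝓝 (t : ℂ), z ≠ 0 :=
      isOpen_ne.mem_nhds (by simpa using ht.ne')
    filter_upwards [h1, h2] with z h1 h2 using ⟨h2, h1⟩
  have hA : AnalyticAt ℝ F (t : ℂ) := (hF.analyticAt hmem).restrictScalars
  have hB : AnalyticAt ℝ (fun s : ℝ => F (s : ℂ)) t :=
    AnalyticAt.fun_comp hA (Complex.ofRealCLM.analyticAt t)
  refine hB.congr ?_
  filter_upwards [isOpen_Ioi.mem_nhds ht] with s hs using hFt s hs

lemma AssumptionA.hasDerivAt_powHeat (hH : H.AssumptionA) (N : ℕ) {t : ℝ} (ht : 0 < t) :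
    HasDerivAt (H.powHeat N) (-H.powHeat (N + 1) t) t := by
  have h := ((hH.analyticAt_heat ht).iterated_deriv N).differentiableAt.hasDerivAt
  have h2 := h.const_smul ((-1 : ℂ) ^ N)
  refine h2.congr_deriv ?_
  rw [powHeat, Function.iterate_succ_apply', pow_succ]
  module

lemma AssumptionA.continuousOn_powHeat (hH : H.AssumptionA) (N : ℕ) :
    ContinuousOn (H.powHeat N) (Ioi 0) :=
  fun _ ht => (hH.hasDerivAt_powHeat N ht).continuousAt.continuousWithinAt

lemma AssumptionA.heat_mul (hH : H.AssumptionA) {s t : ℝ} (hs : 0 ≤ s) (ht : 0 ≤ t) :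
    H.heat s * H.heat t = H.heat (s + t) := (hH.heat_add s t hs ht).symm

lemma AssumptionA.heat_mul_powHeat (hH : H.AssumptionA) (N : ℕ) {s t : ℝ} (hs : 0 ≤ s)
    (ht : 0 < t) : H.heat s * H.powHeat N t = H.powHeat N (s + t) := by
  induction N generalizing t with
  | zero => simpa only [powHeat_zero] using hH.heat_mul hs ht.le
  | succ N ih =>
    have h1 : HasDerivAt (fun x => H.heat s * H.powHeat N x) (H.heat s * -H.powHeat (N + 1) t) t :=
      (hH.hasDerivAt_powHeat N ht).const_mul _
    have h2 : HasDerivAt (fun x => H.powHeat N (s + x)) (-H.powHeat (N + 1) (s + t)) t :=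
      (hH.hasDerivAt_powHeat N (by positivity)).comp_const_add s t
    have h3 := h1.unique (h2.congr_of_eventuallyEq (by
      filter_upwards [isOpen_Ioi.mem_nhds ht] with x hx using ih hx))
    rw [mul_neg] at h3
    exact neg_injective h3

lemma AssumptionA.powHeat_mul_powHeat (hH : H.AssumptionA) (N K : ℕ) {s t : ℝ} (hs : 0 < s)
    (ht : 0 < t) : H.powHeat K s * H.powHeat N t = H.powHeat (K + N) (s + t) := by
  induction K generalizing s with
  | zero => simpa only [powHeat_zero, zero_add] using hH.heat_mul_powHeat N hs.le ht
  | succ K ih =>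
    have h1 : HasDerivAt (fun x => H.powHeat K x * H.powHeat N t)
        (-H.powHeat (K + 1) s * H.powHeat N t) s :=
      (hH.hasDerivAt_powHeat K hs).mul_const _
    have h2 : HasDerivAt (fun x => H.powHeat (K + N) (x + t)) (-H.powHeat (K + N + 1) (s + t)) s :=
      (hH.hasDerivAt_powHeat (K + N) (by positivity)).comp_add_const s t
    have h3 := h1.unique (h2.congr_of_eventuallyEq (by
      filter_upwards [isOpen_Ioi.mem_nhds hs] with x hx using ih hx))
    rw [neg_mul] at h3
    rw [neg_injective h3]
    congr 1; ring

lemma AssumptionA.powHeat_mul_heat (hH : H.AssumptionA) (N : ℕ) {s t : ℝ} (hs : 0 ≤ s)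
    (ht : 0 < t) : H.powHeat N t * H.heat s = H.powHeat N (t + s) := by
  rcases hs.eq_or_lt with rfl | hs
  · rw [hH.heat_zero, mul_one, add_zero]
  · simpa only [powHeat_zero, add_zero] using hH.powHeat_mul_powHeat 0 N ht hs

lemma AssumptionA.powHeat_mem (hH : H.AssumptionA) (N : ℕ) {t : ℝ} (ht : 0 < t) :
    H.powHeat N t ∈ H.functionsOfL := by
  induction N generalizing t with
  | zero =>
    rw [powHeat_zero]
    exact Submodule.le_topologicalClosure _ (Submodule.subset_span ⟨t, ht, rfl⟩)
  | succ N ih =>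
    have h := hasDerivAt_iff_tendsto_slope.1 (hH.hasDerivAt_powHeat N ht)
    rw [← neg_neg (H.powHeat (N + 1) t)]
    refine Submodule.neg_mem _ ?_
    refine (Submodule.isClosed_topologicalClosure _).mem_of_tendsto h ?_
    filter_upwards [mem_nhdsWithin_of_mem_nhds (isOpen_Ioi.mem_nhds ht)] with x hx
    exact Submodule.smul_of_tower_mem H.functionsOfL _ (Submodule.sub_mem _ (ih hx) (ih ht))

/-- The range of `L^N e^{-tL}` is in the domain of `L`, and `powHeat` does represent
`L^N e^{-tL}`. -/
lemma AssumptionA.powHeat_succ_mem_graph (hH : H.AssumptionA) (N : ℕ) {t : ℝ} (ht : 0 < t)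
    (u : L2 M μ) : (H.powHeat N t u, H.powHeat (N + 1) t u) ∈ H.L.graph := by
  rw [hH.generator]
  have h := hasDerivAt_iff_tendsto_slope_zero.1 (hH.hasDerivAt_powHeat N ht)
  have h1 : Tendsto (fun x : ℝ => x⁻¹ • (H.powHeat N (t + x) - H.powHeat N t)) (𝓝[>] 0)
      (𝓝 (-H.powHeat (N + 1) t)) := h.mono_left (nhdsWithin_mono _ fun x hx => ne_of_gt hx)
  have h2 := ((ContinuousLinearMap.apply ℂ (L2 M μ) u).continuous.tendsto _).comp h1.neg
  rw [neg_neg] at h2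
  refine h2.congr' ?_
  filter_upwards [self_mem_nhdsWithin] with x hx
  have hx' : (0 : ℝ) ≤ x := le_of_lt hx
  simp only [Function.comp, ContinuousLinearMap.apply_apply]
  have e : H.heat x (H.powHeat N t u) = H.powHeat N (t + x) u := by
    rw [add_comm t x, ← hH.heat_mul_powHeat N hx' ht]; rfl
  rw [e, ← smul_neg, neg_sub]
  rw [smul_apply, sub_apply, Complex.coe_smul]
  rfl

end Semigroup

/-! ### The kernels of `V_I L^N e^{-uL} V_J` -/

/-- The standing assumptions, with volume doubling in quantitative form. -/
structure Setting {M : Type*} [MetricSpace M] [MeasurableSpace M] {μ : Measure M} {d : ℕ}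
    (H : HeatSystem M μ d) (A : ℝ) (D : ℕ) : Prop extends H.AssumptionA where
  growth : VolGrowth μ A D

section Ops

variable {M : Type*} [MetricSpace M] [ProperSpace M] [MeasurableSpace M] [BorelSpace M]
  {μ : Measure M} [SigmaFinite μ] [Nonempty M] {d : ℕ} {H : HeatSystem M μ d} {A : ℝ} {D : ℕ}

lemma Setting.left_measurable_pair (hS : H.Setting A D) (I : List (Fin d)) (t : ℝ) :
    Measurable fun p : M × M => H.left I t p.1 p.2 :=
  (hS.left_measurable I).comp (by fun_prop : Measurable fun p : M × M => (t, p.1, p.2))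

lemma Setting.right_measurable_pair (hS : H.Setting A D) (I : List (Fin d)) (t : ℝ) :
    Measurable fun p : M × M => H.right I t p.1 p.2 :=
  (hS.right_measurable I).comp (by fun_prop : Measurable fun p : M × M => (t, p.1, p.2))

lemma Setting.schur_of_gaussianRegular (hS : H.Setting A D) {K : ℝ → M → M → ℂ} {j : ℕ}
    (hK : GaussianRegular μ j K) {t : ℝ} (ht : 0 < t)
    (hm : Measurable fun p : M × M => K t p.1 p.2) : ∃ C, SchurBound μ C (K t) := by
  obtain ⟨C, c, hc, h⟩ := hK
  obtain ⟨C', hC'⟩ := hS.growth.exists_schurBound hc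
  refine ⟨_, hC' (K t) t ((√t ^ j)⁻¹ * max C 0) ht (by positivity) hm fun x y => ?_⟩
  have h1 := (h t ht x y).1
  have hs : 0 < √t ^ j := pow_pos (Real.sqrt_pos.2 ht) j
  rw [mul_assoc, ← div_eq_inv_mul, le_div_iff₀ hs, mul_comm]
  refine h1.trans ?_
  rw [mul_assoc]
  exact mul_le_mul_of_nonneg_right (le_max_left _ _) (gau_nonneg c t x y)

lemma Setting.schur_left (hS : H.Setting A D) (I : List (Fin d)) {t : ℝ} (ht : 0 < t) :
    ∃ C, SchurBound μ C (H.left I t) :=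
  hS.schur_of_gaussianRegular (hS.left_gaussian I) ht (hS.left_measurable_pair I t)

lemma Setting.schur_right (hS : H.Setting A D) (I : List (Fin d)) {t : ℝ} (ht : 0 < t) :
    ∃ C, SchurBound μ C (H.right I t) :=
  hS.schur_of_gaussianRegular (hS.right_gaussian I) ht (hS.right_measurable_pair I t)

open Classical in
/-- The operator with kernel `K`, if there is one. -/
def opOf (K : M → M → ℂ) : L2 M μ →L[ℂ] L2 M μ :=
  if h : ∃ T : L2 M μ →L[ℂ] L2 M μ, HasKernel T K then h.choose else 0

lemma hasKernel_opOf {C : ℝ≥0} {K : M → M → ℂ} (hK : SchurBound μ C K) :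
    HasKernel (opOf K : L2 M μ →L[ℂ] L2 M μ) K := by
  have h := hK.exists_hasKernel
  rw [opOf, dif_pos h]
  exact h.choose_spec

lemma opOf_apply_eq {C : ℝ≥0} {K : M → M → ℂ} (hK : SchurBound μ C K) {u w : L2 M μ}
    (h : KernelMaps K u w) : (opOf K : L2 M μ →L[ℂ] L2 M μ) u = w := by
  apply Lp.ext
  filter_upwards [(hasKernel_opOf hK u).2, h.2] with x h1 h2
  rw [h1, h2]

variable (H) in
/-- The bounded operator `V_I e^{-tL}`. -/
def leftOp (I : List (Fin d)) (t : ℝ) : L2 M μ →L[ℂ] L2 M μ := opOf (H.left I t)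

variable (H) in
/-- The bounded extension of `e^{-tL} V_I`. -/
def rightOp (I : List (Fin d)) (t : ℝ) : L2 M μ →L[ℂ] L2 M μ := opOf (H.right I t)

lemma Setting.vRel_leftOp (hS : H.Setting A D) (I : List (Fin d)) {t : ℝ} (ht : 0 < t)
    (u : L2 M μ) : H.VRel I (H.heat t u) (H.leftOp I t u) := by
  obtain ⟨C, hC⟩ := hS.schur_left I ht
  obtain ⟨w, h1, h2⟩ := hS.left_kernel I t ht u
  rwa [leftOp, opOf_apply_eq hC h2]

lemma Setting.rightOp_apply (hS : H.Setting A D) {I : List (Fin d)} {t : ℝ} (ht : 0 < t)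
    {u v : L2 M μ} (h : H.VRel I u v) : H.rightOp I t u = H.heat t v := by
  obtain ⟨C, hC⟩ := hS.schur_right I ht
  rw [rightOp, opOf_apply_eq hC (hS.right_kernel I t ht u v h)]

lemma Setting.leftOp_nil (hS : H.Setting A D) {t : ℝ} (ht : 0 < t) :
    H.leftOp [] t = H.heat t := by
  ext1 u
  exact hS.vRel_leftOp [] ht u

lemma Setting.rightOp_nil (hS : H.Setting A D) {t : ℝ} (ht : 0 < t) :
    H.rightOp [] t = H.heat t := by
  ext1 u
  exact hS.rightOp_apply ht (I := []) rfl

/-- The identity is plain on the domain of `V_I`, and this domain is dense: it contains the range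
of the semigroup. -/
lemma Setting.heat_mul_rightOp (hS : H.Setting A D) (I : List (Fin d)) {s t : ℝ} (hs : 0 ≤ s)
    (ht : 0 < t) : H.heat s * H.rightOp I t = H.rightOp I (s + t) := by
  ext1 u
  have h1 := ((H.heat s * H.rightOp I t).continuous.tendsto u).comp (hS.heat_continuous u)
  have h2 := ((H.rightOp I (s + t)).continuous.tendsto u).comp (hS.heat_continuous u)
  refine tendsto_nhds_unique (h1.congr' ?_) h2
  filter_upwards [self_mem_nhdsWithin] with ε hε
  have h3 := hS.vRel_leftOp I hε u
  simp only [Function.comp]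
  rw [mul_apply_eq_comp, hS.rightOp_apply ht h3, hS.rightOp_apply (by positivity) h3,
    ← hS.heat_mul hs ht.le]
  rfl

variable (H) in
/-- The operator `V_I L^N e^{-tL}`, written as `(-1)^N ∑ V_I V_{i₁}² ⋯ V_{i_N}² e^{-tL}`. -/
def leftPowOp (I : List (Fin d)) (N : ℕ) (t : ℝ) : L2 M μ →L[ℂ] L2 M μ :=
  (-1 : ℂ) ^ N • ∑ w : Fin N → Fin d, H.leftOp (I ++ doubled w) t

lemma doubled_cons {N : ℕ} (i : Fin d) (w : Fin N → Fin d) :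
    doubled (Fin.cons i w : Fin (N + 1) → Fin d) = [i, i] ++ doubled w := by
  simp [doubled, List.ofFn_succ]

lemma leftPowOp_succ (I : List (Fin d)) (N : ℕ) (t : ℝ) :
    H.leftPowOp I (N + 1) t = -∑ i : Fin d, H.leftPowOp (I ++ [i, i]) N t := by
  unfold leftPowOp
  rw [← (Fin.consEquiv fun _ : Fin (N + 1) => Fin d).sum_comp, Fintype.sum_prod_type,
    ← Finset.smul_sum, pow_succ, mul_neg_one, neg_smul]
  congr 3
  ext1 i
  congr 1
  ext1 w
  rw [List.append_assoc, ← doubled_cons]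
  rfl

/-- `leftPowOp` is indeed `V_I L^N e^{-tL}`: writing `L = -∑ V_i²` repeatedly, `V_I L^N e^{-tL}` is
defined everywhere and has the expected expression. -/
lemma Setting.vRel_leftPowOp (hS : H.Setting A D) (I : List (Fin d)) (N : ℕ) {t : ℝ} (ht : 0 < t)
    (u : L2 M μ) : H.VRel I (H.powHeat N t u) (H.leftPowOp I N t u) := by
  induction N generalizing I with
  | zero =>
    rw [powHeat_zero]
    have : H.leftPowOp I 0 t = H.leftOp I t := by simp [leftPowOp, doubled]
    rw [this]
    exact hS.vRel_leftOp I ht u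
  | succ N ih =>
    obtain ⟨v, hv1, hv2⟩ := hS.sum_squares _ _ (hS.powHeat_succ_mem_graph N ht u)
    rw [hv2, leftPowOp_succ, neg_apply]
    have h1 : ∀ i, H.VRel I (v i) (H.leftPowOp (I ++ [i, i]) N t u) := by
      intro i
      obtain ⟨v', h2, h3⟩ := VRel.of_append (ih (I ++ [i, i]))
      rwa [(hv1 i).unique h2]
    have h2 := VRel.smul (-1) (VRel.sum I Finset.univ fun i _ => h1 i)
    rw [neg_one_smul, neg_one_smul] at h2
    convert h2
    simp

lemma Setting.leftPowOp_eq (hS : H.Setting A D) (I : List (Fin d)) (N : ℕ) {ε t : ℝ} (hε : 0 < ε)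
    (ht : 0 < t) : H.leftPowOp I N (ε + t) = H.leftOp I ε * H.powHeat N t := by
  ext1 u
  have h1 := hS.vRel_leftPowOp I N (by positivity : 0 < ε + t) u
  rw [← hS.heat_mul_powHeat N hε.le ht] at h1
  exact h1.unique (hS.vRel_leftOp I hε _)

lemma Setting.schur_leftPow (hS : H.Setting A D) (I : List (Fin d)) (N : ℕ) {t : ℝ} (ht : 0 < t) :
    ∃ C, SchurBound μ C (H.leftPow I N t) := by
  choose C hC using fun w : Fin N → Fin d => hS.schur_left (I ++ doubled w) ht
  exact ⟨_, (SchurBound.sum Finset.univ fun w _ => hC w).const_mul _⟩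

lemma Setting.hasKernel_leftPow (hS : H.Setting A D) (I : List (Fin d)) (N : ℕ) {t : ℝ}
    (ht : 0 < t) : HasKernel (H.leftPowOp I N t) (H.leftPow I N t) := by
  refine HasKernel.smul (HasKernel.sum Finset.univ fun w _ => ?_) _
  obtain ⟨C, hC⟩ := hS.schur_left (I ++ doubled w) ht
  exact hasKernel_opOf hC

variable (H) in
/-- The kernel of `V_I L^N e^{-uL} V_J`. -/
def sandwich (I : List (Fin d)) (N : ℕ) (J : List (Fin d)) (u : ℝ) : M → M → ℂ :=
  kcomp μ (H.leftPow I N (u / 2)) (H.right J (u / 2))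

variable (H) in
/-- The bounded extension of `V_I L^N e^{-uL} V_J`. -/
def sandwichOp (I : List (Fin d)) (N : ℕ) (J : List (Fin d)) (u : ℝ) : L2 M μ →L[ℂ] L2 M μ :=
  H.leftPowOp I N (u / 2) * H.rightOp J (u / 2)

lemma Setting.hasKernel_sandwich (hS : H.Setting A D) (I : List (Fin d)) (N : ℕ)
    (J : List (Fin d)) {u : ℝ} (hu : 0 < u) :
    HasKernel (H.sandwichOp I N J u) (H.sandwich I N J u) := by
  obtain ⟨C, hC⟩ := hS.schur_leftPow I N (half_pos hu)
  obtain ⟨C', hC'⟩ := hS.schur_right J (half_pos hu)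
  exact HasKernel.comp hC hC' (hS.hasKernel_leftPow I N (half_pos hu)) (hasKernel_opOf hC')

/-- The semigroup property of `V_I L^N e^{-uL} V_J`: short pieces of the semigroup suffice to absorb
`V_I` and `V_J`, and what remains is differentiable in the time. -/
lemma Setting.sandwichOp_eq (hS : H.Setting A D) (I : List (Fin d)) (N : ℕ) (J : List (Fin d))
    {ε u : ℝ} (hε : 0 < ε) (hu : 2 * ε < u) :
    H.sandwichOp I N J u = H.leftOp I ε * H.powHeat N (u - 2 * ε) * H.rightOp J ε := by
  have h1 : 0 < u / 2 - ε := by linarith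
  have e1 : u / 2 = ε + (u / 2 - ε) := by ring
  have e2 : H.leftPowOp I N (u / 2) = H.leftOp I ε * H.powHeat N (u / 2 - ε) := by
    conv_lhs => rw [e1]
    exact hS.leftPowOp_eq I N hε h1
  have e3 : H.rightOp J (u / 2) = H.heat (u / 2 - ε) * H.rightOp J ε := by
    rw [hS.heat_mul_rightOp J h1.le hε]; congr 1; ring
  rw [sandwichOp, e2, e3, mul_assoc, ← mul_assoc (H.powHeat N _), hS.powHeat_mul_heat N h1.le h1,
    mul_assoc]
  congr 3; ring

lemma Setting.sandwichOp_mul (hS : H.Setting A D) (I : List (Fin d)) (N K : ℕ) (J : List (Fin d))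
    {u v : ℝ} (hu : 0 < u) (hv : 0 < v) :
    H.sandwichOp I N [] u * H.sandwichOp [] K J v = H.sandwichOp I (N + K) J (u + v) := by
  obtain ⟨ε, hε, h1⟩ : ∃ ε > 0, 4 * ε < min u v := ⟨min u v / 5, by positivity, by
    have : 0 < min u v := by positivity
    linarith⟩
  rw [lt_min_iff] at h1
  rw [hS.sandwichOp_eq I N [] hε (by linarith), hS.sandwichOp_eq [] K J hε (by linarith),
    hS.sandwichOp_eq I (N + K) J hε (by linarith), hS.leftOp_nil hε, hS.rightOp_nil hε,
    mul_assoc, mul_assoc, mul_assoc, mul_assoc, ← mul_assoc (H.heat ε) _ (H.rightOp J ε),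
    hS.heat_mul_powHeat K hε.le (by linarith), ← mul_assoc (H.heat ε),
    hS.heat_mul_powHeat K hε.le (by linarith), ← mul_assoc (H.powHeat N _),
    hS.powHeat_mul_powHeat K N (by linarith) (by linarith)]
  congr 3; ring

lemma Setting.heat_mul_sandwichOp (hS : H.Setting A D) (N : ℕ) (J : List (Fin d)) {s u : ℝ}
    (hs : 0 ≤ s) (hu : 0 < u) :
    H.heat s * H.sandwichOp [] N J u = H.sandwichOp [] N J (s + u) := by
  have h4 : 0 < u / 4 := by positivity
  rw [hS.sandwichOp_eq [] N J h4 (by linarith), hS.sandwichOp_eq [] N J h4 (by linarith),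
    hS.leftOp_nil h4, ← mul_assoc, ← mul_assoc, hS.heat_mul hs h4.le, add_comm s,
    ← hS.heat_mul h4.le hs, mul_assoc (H.heat (u / 4)), hS.heat_mul_powHeat N hs (by linarith)]
  congr 3; ring

lemma Setting.leftPowOp_mul_heat (hS : H.Setting A D) (I : List (Fin d)) (N : ℕ) {s t : ℝ}
    (hs : 0 ≤ s) (ht : 0 < t) :
    H.leftPowOp I N t * H.heat s = H.leftPowOp I N (t + s) := by
  have h2 := half_pos ht
  have e1 : t = t / 2 + t / 2 := by ring
  have e2 : t + s = t / 2 + (t / 2 + s) := by ring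
  rw [e2, hS.leftPowOp_eq I N h2 (by positivity)]
  conv_lhs => rw [e1]
  rw [hS.leftPowOp_eq I N h2 h2, mul_assoc, hS.powHeat_mul_heat N hs h2]

lemma Setting.sandwichOp_nil (hS : H.Setting A D) (I : List (Fin d)) (N : ℕ) {u : ℝ}
    (hu : 0 < u) : H.sandwichOp I N [] u = H.leftPowOp I N u := by
  rw [sandwichOp, hS.rightOp_nil (half_pos hu), hS.leftPowOp_mul_heat I N (half_pos hu).le
    (half_pos hu), add_halves]

end Ops

end HeatSystem

/-! ### Uniform Gaussian bounds -/

/-- `K_u` is `u^{-q/2}` times a Gaussian at scale `√u`. -/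
def GaussDecay {M : Type*} [MetricSpace M] [MeasurableSpace M] (μ : Measure M) (q : ℕ) (C c : ℝ)
    (K : ℝ → M → M → ℂ) : Prop :=
  ∀ u : ℝ, 0 < u → ∀ x y, √u ^ q * ‖K u x y‖ ≤ C * gau μ c u x y

/-- Finitely many estimates hold with common constants. -/
lemma exists_uniform {ι : Type*} {s : Set ι} (hs : s.Finite) {P : ι → ℝ → ℝ → Prop}
    (mono : ∀ i C C' c c', C ≤ C' → c' ≤ c → P i C c → P i C' c')
    (h : ∀ i ∈ s, ∃ C c, 0 < c ∧ P i C c) : ∃ C c, 0 < C ∧ 0 < c ∧ ∀ i ∈ s, P i C c := by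
  induction s, hs using Set.Finite.induction_on with
  | empty => exact ⟨1, 1, one_pos, one_pos, by simp⟩
  | insert _ _ ih =>
    obtain ⟨C, c, hC, hc, h1⟩ := ih fun i hi => h i (mem_insert_of_mem _ hi)
    obtain ⟨C', c', hc', h2⟩ := h _ (mem_insert _ _)
    refine ⟨max C C', min c c', lt_max_of_lt_left hC, lt_min hc hc', ?_⟩
    rintro i (rfl | hi)
    · exact mono _ _ _ _ _ (le_max_right _ _) (min_le_right _ _) h2
    · exact mono _ _ _ _ _ (le_max_left _ _) (min_le_left _ _) (h1 i hi)

section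

variable {M : Type*} [MetricSpace M] [MeasurableSpace M] {μ : Measure M}

lemma GaussDecay.mono {q : ℕ} {C C' c c' : ℝ} {K : ℝ → M → M → ℂ} (h : GaussDecay μ q C c K)
    (hC : C ≤ C') (hC' : 0 ≤ C') (hc : c' ≤ c) : GaussDecay μ q C' c' K := fun u hu x y =>
  (h u hu x y).trans (by
    calc C * gau μ c u x y ≤ C' * gau μ c u x y :=
          mul_le_mul_of_nonneg_right hC (gau_nonneg _ _ _ _)
      _ ≤ _ := mul_le_mul_of_nonneg_left (gau_anti hc hu x y) hC')

lemma GaussDecay.norm_le {q : ℕ} {C c : ℝ} {K : ℝ → M → M → ℂ} (h : GaussDecay μ q C c K) {u : ℝ}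
    (hu : 0 < u) (x y : M) : ‖K u x y‖ ≤ C * (√u ^ q)⁻¹ * gau μ c u x y := by
  have hs : 0 < √u ^ q := pow_pos (Real.sqrt_pos.2 hu) q
  rw [mul_right_comm, ← div_eq_mul_inv, le_div_iff₀ hs, mul_comm]
  exact h u hu x y

lemma exists_uniform_gaussDecay {ι : Type*} {s : Set ι} (hs : s.Finite) {q : ι → ℕ}
    {K : ι → ℝ → M → M → ℂ} (h : ∀ i ∈ s, ∃ C c, 0 < c ∧ GaussDecay μ (q i) C c (K i)) :
    ∃ C c, 0 < C ∧ 0 < c ∧ ∀ i ∈ s, GaussDecay μ (q i) C c (K i) := by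
  obtain ⟨C, c, hC, hc, h1⟩ := exists_uniform hs
    (P := fun i C c => GaussDecay μ (q i) (max C 0) c (K i))
    (fun i C C' c c' hC hc h => h.mono (max_le_max_right _ hC) (le_max_right _ _) hc)
    (fun i hi => by
      obtain ⟨C, c, hc, h2⟩ := h i hi
      exact ⟨C, c, hc, h2.mono (le_max_left _ _) (le_max_right _ _) le_rfl⟩)
  refine ⟨C, c, hC, hc, fun i hi => ?_⟩
  have := h1 i hi
  rwa [max_eq_left hC.le] at this

end

namespace HeatSystem

section Ops

variable {M : Type*} [MetricSpace M] [ProperSpace M] [MeasurableSpace M] [BorelSpace M]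
  {μ : Measure M} [SigmaFinite μ] [Nonempty M] {d : ℕ} {H : HeatSystem M μ d} {A : ℝ} {D : ℕ}

lemma Setting.measurable_leftPow (hS : H.Setting A D) (I : List (Fin d)) (N : ℕ) :
    Measurable fun p : ℝ × M × M => H.leftPow I N p.1 p.2.1 p.2.2 := by
  unfold leftPow
  refine Measurable.const_mul ?_ _
  exact Finset.measurable_sum _ fun w _ => hS.left_measurable (I ++ doubled w)

lemma Setting.measurable_sandwich (hS : H.Setting A D) (I : List (Fin d)) (N : ℕ)
    (J : List (Fin d)) : Measurable fun p : ℝ × M × M => H.sandwich I N J p.1 p.2.1 p.2.2 := by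
  have h0 : Measurable fun p : ℝ × M × M => (p.1 / 2, p.2) := by fun_prop
  have h1 : Measurable fun p : ℝ × M × M => H.leftPow I N (p.1 / 2) p.2.1 p.2.2 := by
    have := (hS.measurable_leftPow I N).comp h0
    exact this
  have h2 : Measurable fun p : ℝ × M × M => H.right J (p.1 / 2) p.2.1 p.2.2 :=
    (hS.right_measurable J).comp h0
  exact measurable_kcomp (μ := μ) (K := fun u => H.leftPow I N (u / 2))
    (K' := fun u => H.right J (u / 2)) h1 h2

lemma Setting.measurable_sandwich_pair (hS : H.Setting A D) (I : List (Fin d)) (N : ℕ)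
    (J : List (Fin d)) (u : ℝ) : Measurable fun p : M × M => H.sandwich I N J u p.1 p.2 := by
  have h0 : Measurable fun p : M × M => (u, p) := by fun_prop
  have := (hS.measurable_sandwich I N J).comp h0
  exact this

lemma gaussDecay_of_gaussianRegular {j : ℕ} {K : ℝ → M → M → ℂ} (h : GaussianRegular μ j K) :
    ∃ C c, 0 < c ∧ GaussDecay μ j C c K := by
  obtain ⟨C, c, hc, h⟩ := h
  refine ⟨C, c, hc, fun u hu x y => ?_⟩
  rw [gau, ← mul_assoc]
  exact (h u hu x y).1

lemma length_doubled {N : ℕ} (w : Fin N → Fin d) : (doubled w).length = 2 * N := by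
  simp [doubled, List.length_flatMap, Function.comp_def, mul_comm]

lemma Setting.gaussDecay_leftPow (hS : H.Setting A D) (I : List (Fin d)) (N : ℕ) :
    ∃ C c, 0 < C ∧ 0 < c ∧ GaussDecay μ (I.length + 2 * N) C c (H.leftPow I N) := by
  obtain ⟨C, c, hC, hc, h⟩ := exists_uniform_gaussDecay (s := (univ : Set (Fin N → Fin d)))
    finite_univ (q := fun w => (I ++ doubled w).length) (K := fun w => H.left (I ++ doubled w))
    fun w _ => gaussDecay_of_gaussianRegular (hS.left_gaussian (I ++ doubled w))
  refine ⟨((Fintype.card (Fin N → Fin d) : ℝ) + 1) * C, c, by positivity, hc, fun u hu x y => ?_⟩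
  have h0 : 0 ≤ C * gau μ c u x y := mul_nonneg hC.le (gau_nonneg _ _ _ _)
  rw [leftPow, norm_mul, norm_pow, norm_neg, norm_one, one_pow, one_mul]
  calc _ ≤ √u ^ (I.length + 2 * N) * ∑ w : Fin N → Fin d, ‖H.left (I ++ doubled w) u x y‖ := by
        gcongr; exact norm_sum_le _ _
    _ = ∑ w : Fin N → Fin d, √u ^ (I.length + 2 * N) * ‖H.left (I ++ doubled w) u x y‖ :=
        Finset.mul_sum _ _ _
    _ ≤ ∑ w : Fin N → Fin d, C * gau μ c u x y := by
        refine Finset.sum_le_sum fun w _ => ?_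
        have := h w (mem_univ _) u hu x y
        rwa [List.length_append, length_doubled] at this
    _ ≤ _ := by
        rw [Finset.sum_const, Finset.card_univ, nsmul_eq_mul]
        nlinarith

lemma Setting.gaussDecay_sandwich (hS : H.Setting A D) (I : List (Fin d)) (N : ℕ)
    (J : List (Fin d)) :
    ∃ C c, 0 < c ∧ GaussDecay μ (I.length + 2 * N + J.length) C c (H.sandwich I N J) := by
  have h1 := hS.gaussDecay_leftPow I N
  have h2 := gaussDecay_of_gaussianRegular (hS.right_gaussian J)
  obtain ⟨C₁, c₁, hC₁, hc₁, h1⟩ := h1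
  obtain ⟨C₂, c₂, hc₂, h2⟩ := h2
  have h1 := h1.mono (le_max_left C₁ 0) (le_max_right _ _) (min_le_left c₁ c₂)
  have h2 := h2.mono (le_max_left C₂ 0) (le_max_right _ _) (min_le_right c₁ c₂)
  set c := min c₁ c₂
  have hc : 0 < c := lt_min hc₁ hc₂
  obtain ⟨C, hC, h3⟩ := hS.growth.exists_kcomp_le hc
  have hA : 0 < A := lt_of_lt_of_le one_pos hS.growth.one_le
  refine ⟨√2 ^ (I.length + 2 * N + J.length) * C * max C₁ 0 * max C₂ 0 * (A * 2 ^ D), c / 4,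
    by positivity, fun u hu x y => ?_⟩
  have hu2 := half_pos hu
  have hs := Real.sqrt_pos.2 hu2
  have h4 := h3 (H.leftPow I N (u / 2)) (H.right J (u / 2)) (u / 2)
    (max C₁ 0 * (√(u / 2) ^ (I.length + 2 * N))⁻¹) (max C₂ 0 * (√(u / 2) ^ J.length)⁻¹) hu2
    (by positivity) (by positivity) (fun x y => h1.norm_le hu2 x y)
    (fun x y => h2.norm_le hu2 x y) x y
  have h5 := hS.growth.gau_le_of_scale (c := c / 4) (l := 2) (by positivity) one_le_two (u / 2) u
    hu2 (by linarith) (by linarith) x y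
  have e : √u = √2 * √(u / 2) := by rw [← Real.sqrt_mul zero_le_two]; congr 1; ring
  have hs2 : √(u / 2) ≠ 0 := hs.ne'
  calc √u ^ (I.length + 2 * N + J.length) * ‖H.sandwich I N J u x y‖
      ≤ √u ^ (I.length + 2 * N + J.length) *
        (C * (max C₁ 0 * (√(u / 2) ^ (I.length + 2 * N))⁻¹) *
          (max C₂ 0 * (√(u / 2) ^ J.length)⁻¹) * gau μ (c / 4) (u / 2) x y) := by
        gcongr; exact h4
    _ = √2 ^ (I.length + 2 * N + J.length) * C * max C₁ 0 * max C₂ 0 *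
        gau μ (c / 4) (u / 2) x y := by
        rw [e, mul_pow, pow_add (√(u / 2))]; field_simp
    _ ≤ √2 ^ (I.length + 2 * N + J.length) * C * max C₁ 0 * max C₂ 0 *
        (A * 2 ^ D * gau μ (c / 4) u x y) := by gcongr
    _ = _ := by ring

/-- The kernels of `V_I L^N e^{-uL} V_J` have Gaussian bounds, with constants uniform over tuples
and powers of bounded length. -/
lemma Setting.exists_gaussDecay (hS : H.Setting A D) (n : ℕ) :
    ∃ C c, 0 < C ∧ 0 < c ∧ ∀ I J : List (Fin d), ∀ N : ℕ, I.length ≤ n → J.length ≤ n → N ≤ n →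
      GaussDecay μ (I.length + 2 * N + J.length) C c (H.sandwich I N J) := by
  have hfin : ({l : List (Fin d) | l.length ≤ n} ×ˢ ({l : List (Fin d) | l.length ≤ n} ×ˢ
      Iic n)).Finite :=
    (List.finite_length_le (Fin d) n).prod ((List.finite_length_le (Fin d) n).prod (finite_Iic n))
  obtain ⟨C, c, hC, hc, h⟩ := exists_uniform_gaussDecay (μ := μ) hfin
    (q := fun p => p.1.length + 2 * p.2.2 + p.2.1.length)
    (K := fun p => H.sandwich p.1 p.2.2 p.2.1)
    fun p _ => hS.gaussDecay_sandwich p.1 p.2.2 p.2.1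
  exact ⟨C, c, hC, hc, fun I J N hI hJ hN => h (I, J, N) ⟨hI, hJ, hN⟩⟩

/-- Schur's condition, uniformly for times bounded from below. -/
lemma Setting.schur_sandwich (hS : H.Setting A D) (I : List (Fin d)) (N : ℕ) (J : List (Fin d))
    {θ : ℝ} (hθ : 0 < θ) : ∃ C, ∀ u, θ ≤ u → SchurBound μ C (H.sandwich I N J u) := by
  obtain ⟨C, c, hc, h⟩ := hS.gaussDecay_sandwich I N J
  obtain ⟨C', h'⟩ := hS.growth.exists_schurBound hc
  refine ⟨(max C 0 * (√θ ^ (I.length + 2 * N + J.length))⁻¹).toNNReal * C', fun u hu => ?_⟩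
  have hu0 : 0 < u := hθ.trans_le hu
  have hs := Real.sqrt_pos.2 hθ
  refine h' _ u _ hu0 (by positivity) (hS.measurable_sandwich_pair I N J u) fun x y => ?_
  refine (h.norm_le hu0 x y).trans ?_
  refine mul_le_mul_of_nonneg_right ?_ (gau_nonneg _ _ _ _)
  gcongr
  exact le_max_left _ _

lemma Setting.schur_heat (hS : H.Setting A D) :
    ∃ C, ∀ u, 0 < u → SchurBound μ C (H.left [] u) := by
  obtain ⟨C, c, hc, h⟩ := gaussDecay_of_gaussianRegular (hS.left_gaussian [])
  obtain ⟨C', h'⟩ := hS.growth.exists_schurBound hc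
  refine ⟨(max C 0).toNNReal * C', fun u hu => ?_⟩
  refine h' _ u _ hu (by positivity) (hS.left_measurable_pair [] u) fun x y => ?_
  have := h u hu x y
  simp only [List.length_nil, pow_zero, one_mul] at this
  exact this.trans (mul_le_mul_of_nonneg_right (le_max_left _ _) (gau_nonneg _ _ _ _))

end Ops

end HeatSystem

/-! ### Integrals of kernels in time -/

section Time

variable {M : Type*} [MeasurableSpace M] {μ : Measure M} [SigmaFinite μ]

lemma measurable_kint {α β : Type*} [MeasurableSpace α] [MeasurableSpace β]
    {K : β → α → ℂ} (hK : Measurable fun p : β × α => K p.1 p.2) (ν : Measure β) [SFinite ν] :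
    Measurable fun a => ∫ b, K b a ∂ν :=
  (StronglyMeasurable.integral_prod_left' (f := fun p : β × α => K p.1 p.2)
    hK.stronglyMeasurable).measurable

/-- Kernels may be integrated over bounded sets of times, and the form of the integral is the integral
of the forms. -/
lemma SchurBound.time_integral {C : ℝ≥0} {K : ℝ → M → M → ℂ} {s : Set ℝ} {V : ℝ≥0}
    (hV : volume s ≤ V)
    (hm : Measurable fun p : ℝ × M × M => K p.1 p.2.1 p.2.2)
    (hK : ∀ ρ ∈ s, SchurBound μ C (K ρ)) :
    SchurBound μ (C * V) (fun x y => ∫ ρ in s, K ρ x y) ∧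
      ∀ v u : L2 M μ, kform (fun x y => ∫ ρ in s, K ρ x y) v u = ∫ ρ in s, kform (K ρ) v u := by
  have hVt : volume s < ⊤ := hV.trans_lt ENNReal.coe_lt_top
  refine ⟨⟨measurable_kint (K := fun ρ (p : M × M) => K ρ p.1 p.2) hm _, fun x => ?_,
    fun y => ?_⟩, fun v u => ?_⟩
  · calc ∫⁻ y, ‖∫ ρ in s, K ρ x y‖ₑ ∂μ ≤ ∫⁻ y, (∫⁻ ρ in s, ‖K ρ x y‖ₑ) ∂μ :=
          lintegral_mono fun y => enorm_integral_le_lintegral_enorm _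
      _ = ∫⁻ ρ in s, ∫⁻ y, ‖K ρ x y‖ₑ ∂μ := by
          rw [lintegral_lintegral_swap]
          exact (hm.comp (by fun_prop : Measurable fun p : M × ℝ => (p.2, x, p.1))).enorm.aemeasurable
      _ ≤ ∫⁻ ρ in s, C := setLIntegral_mono measurable_const fun ρ hρ => (hK ρ hρ).row x
      _ ≤ _ := by rw [setLIntegral_const]; push_cast; gcongr
  · calc ∫⁻ x, ‖∫ ρ in s, K ρ x y‖ₑ ∂μ ≤ ∫⁻ x, (∫⁻ ρ in s, ‖K ρ x y‖ₑ) ∂μ :=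
          lintegral_mono fun y => enorm_integral_le_lintegral_enorm _
      _ = ∫⁻ ρ in s, ∫⁻ x, ‖K ρ x y‖ₑ ∂μ := by
          rw [lintegral_lintegral_swap]
          exact (hm.comp (by fun_prop : Measurable fun p : M × ℝ => (p.2, p.1, y))).enorm.aemeasurable
      _ ≤ ∫⁻ ρ in s, C := setLIntegral_mono measurable_const fun ρ hρ => (hK ρ hρ).col y
      _ ≤ _ := by rw [setLIntegral_const]; push_cast; gcongr
  · have hmeas : Measurable fun q : (M × M) × ℝ => conj (v q.1.1) * (K q.2 q.1.1 q.1.2 * u q.1.2) := by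
      refine ((Complex.continuous_conj.measurable.comp
        ((Lp.stronglyMeasurable v).measurable.comp measurable_fst)).comp measurable_fst).mul
        ((hm.comp (by fun_prop : Measurable fun q : (M × M) × ℝ => (q.2, q.1.1, q.1.2))).mul
        ((Lp.stronglyMeasurable u).measurable.comp (measurable_snd.comp measurable_fst)))
    have hint : Integrable (fun q : (M × M) × ℝ => conj (v q.1.1) * (K q.2 q.1.1 q.1.2 * u q.1.2))
        ((μ.prod μ).prod (volume.restrict s)) := by
      refine ⟨hmeas.aestronglyMeasurable, ?_⟩
      rw [HasFiniteIntegral, lintegral_prod_symm _ hmeas.enorm.aemeasurable]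
      calc _ ≤ ∫⁻ ρ in s, C * ‖v‖ₑ * ‖u‖ₑ :=
            setLIntegral_mono measurable_const fun ρ hρ => (hK ρ hρ).lintegral_form_le v u
        _ < ⊤ := by
            rw [setLIntegral_const]
            exact ENNReal.mul_lt_top (ENNReal.mul_lt_top (ENNReal.mul_lt_top (by simp) (by simp))
              (by simp)) hVt
    simp only [kform]
    rw [← integral_integral_swap hint]
    congr 1
    ext p
    rw [integral_const_mul, integral_mul_const]

/-- The space-time kernel of a Volterra operator in time, `k r` being its kernel for the elapsed
time `r > 0`. -/
def volterra (k : ℝ → M → M → ℂ) (e e' : M × ℝ) : ℂ :=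
  if e'.2 < e.2 then k (e.2 - e'.2) e.1 e'.1 else 0

/-- The kernels, depending on the elapsed time, of a composition of Volterra operators. -/
def timeConv (μ : Measure M) (k k' : ℝ → M → M → ℂ) (r : ℝ) (x y : M) : ℂ :=
  ∫ ρ in Ioo 0 r, kcomp μ (k (r - ρ)) (k' ρ) x y

lemma measurable_volterra {k : ℝ → M → M → ℂ}
    (hk : Measurable fun p : ℝ × M × M => k p.1 p.2.1 p.2.2) :
    Measurable fun p : (M × ℝ) × (M × ℝ) => volterra k p.1 p.2 :=
  Measurable.ite (measurableSet_lt (by fun_prop) (by fun_prop))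
    (hk.comp (by fun_prop : Measurable fun p : (M × ℝ) × (M × ℝ) =>
      (p.1.2 - p.2.2, p.1.1, p.2.1))) measurable_const

variable {k k' : ℝ → M → M → ℂ} {C C' : ℝ≥0} {r : ℝ}

/-- The form of a composition of Volterra operators. -/
lemma timeConv_spec (hk : Measurable fun p : ℝ × M × M => k p.1 p.2.1 p.2.2)
    (hk' : Measurable fun p : ℝ × M × M => k' p.1 p.2.1 p.2.2)
    (hC : ∀ ρ ∈ Ioo 0 r, SchurBound μ C (k ρ)) (hC' : ∀ ρ ∈ Ioo 0 r, SchurBound μ C' (k' ρ)) :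
    SchurBound μ (C * C' * r.toNNReal) (timeConv μ k k' r) ∧
      ∀ v u : L2 M μ, kform (timeConv μ k k' r) v u
        = ∫ ρ in Ioo 0 r, kform (kcomp μ (k (r - ρ)) (k' ρ)) v u := by
  refine SchurBound.time_integral (by simp [ENNReal.ofReal]) ?_ fun ρ hρ => ?_
  · exact measurable_kcomp (K := fun ρ => k (r - ρ)) (K' := k')
      (hk.comp (by fun_prop : Measurable fun p : ℝ × M × M => (r - p.1, p.2))) hk'
  · exact (hC _ ⟨by linarith [hρ.2], by linarith [hρ.1]⟩).kcomp (hC' _ hρ)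

/-- Composing Volterra operators amounts to composing their kernels and convolving in time. -/
lemma compKernel_volterra (hk : Measurable fun p : ℝ × M × M => k p.1 p.2.1 p.2.2)
    (hk' : Measurable fun p : ℝ × M × M => k' p.1 p.2.1 p.2.2) {τ σ : ℝ} (hσ : 0 ≤ σ)
    (hC : ∀ ρ ∈ Ioo 0 (τ - σ), SchurBound μ C (k ρ))
    (hC' : ∀ ρ ∈ Ioo 0 (τ - σ), SchurBound μ C' (k' ρ)) (x : M) :
    ∀ᵐ y ∂μ, compKernel μ (volterra k) (volterra k') (x, τ) (y, σ)
      = timeConv μ k k' (τ - σ) x y := by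
  set r := τ - σ with hr
  have hm : Measurable fun q : M × ℝ × M => k (τ - q.2.1) x q.2.2 * k' (q.2.1 - σ) q.2.2 q.1 :=
    (hk.comp (by fun_prop : Measurable fun q : M × ℝ × M => (τ - q.2.1, x, q.2.2))).mul
      (hk'.comp (by fun_prop : Measurable fun q : M × ℝ × M => (q.2.1 - σ, q.2.2, q.1)))
  have hfin : ∫⁻ y, (∫⁻ ζ in Ioo σ τ, ∫⁻ z, ‖k (τ - ζ) x z * k' (ζ - σ) z y‖ₑ ∂μ) ∂μ ≠ ⊤ := by
    rw [lintegral_lintegral_swap]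
    · refine ne_of_lt (lt_of_le_of_lt (setLIntegral_mono (g := fun _ => ((C * C' : ℝ≥0) : ℝ≥0∞))
        measurable_const fun ζ hζ => ?_) ?_)
      · exact (hC (τ - ζ) ⟨by linarith [hζ.2], by linarith [hζ.1]⟩).lintegral_comp_row
          (hC' (ζ - σ) ⟨by linarith [hζ.1], by linarith [hζ.2]⟩) x
      · rw [setLIntegral_const]
        exact ENNReal.mul_lt_top ENNReal.coe_lt_top (by simp)
    · have hm2 : Measurable fun q : (M × ℝ) × M =>
          ‖k (τ - q.1.2) x q.2 * k' (q.1.2 - σ) q.2 q.1.1‖ₑ :=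
        (hm.comp (by fun_prop : Measurable fun q : (M × ℝ) × M => (q.1.1, q.1.2, q.2))).enorm
      exact hm2.lintegral_prod_right'.aemeasurable
  have hm3 : Measurable fun y => ∫⁻ ζ in Ioo σ τ, ∫⁻ z, ‖k (τ - ζ) x z * k' (ζ - σ) z y‖ₑ ∂μ := by
    have hm2 : Measurable fun q : (M × ℝ) × M =>
        ‖k (τ - q.1.2) x q.2 * k' (q.1.2 - σ) q.2 q.1.1‖ₑ :=
      (hm.comp (by fun_prop : Measurable fun q : (M × ℝ) × M => (q.1.1, q.1.2, q.2))).enorm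
    exact hm2.lintegral_prod_right'.lintegral_prod_right'
  filter_upwards [ae_lt_top hm3 hfin] with y hy
  have hmy : Measurable fun q : M × ℝ => k (τ - q.2) x q.1 * k' (q.2 - σ) q.1 y :=
    hm.comp (by fun_prop : Measurable fun q : M × ℝ => (y, q.2, q.1))
  have hint : Integrable (fun q : M × ℝ => k (τ - q.2) x q.1 * k' (q.2 - σ) q.1 y)
      (μ.prod (volume.restrict (Ioo σ τ))) := by
    refine ⟨hmy.aestronglyMeasurable, ?_⟩
    rwa [HasFiniteIntegral, lintegral_prod_symm _ hmy.enorm.aemeasurable]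
  have e1 : compKernel μ (volterra k) (volterra k') (x, τ) (y, σ)
      = ∫ q, k (τ - q.2) x q.1 * k' (q.2 - σ) q.1 y ∂(μ.prod (volume.restrict (Ioo σ τ))) := by
    have hp : ∀ s : Set ℝ, μ.prod (volume.restrict s) = (μ.prod volume).restrict (univ ×ˢ s) :=
      fun s => by rw [← Measure.prod_restrict, Measure.restrict_univ]
    rw [compKernel, posMeasure, hp, hp, ← integral_indicator (by measurability),
      ← integral_indicator (by measurability)]
    congr 1
    ext ⟨z, ζ⟩
    simp only [indicator, volterra, mem_prod, mem_univ, true_and, mem_Ici, mem_Ioo]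
    by_cases h1 : ζ < τ <;> by_cases h2 : σ < ζ
    · simp [h1, h2, hσ.trans h2.le]
    all_goals simp [h1, h2]
  rw [e1, integral_prod_symm _ hint, timeConv]
  have e2 : ∀ F : ℝ → ℂ, ∫ ζ in Ioo σ τ, F ζ = ∫ ρ in Ioo 0 r, F (ρ + σ) := by
    intro F
    rw [← integral_indicator measurableSet_Ioo, ← integral_indicator measurableSet_Ioo,
      ← integral_add_right_eq_self _ σ]
    congr 1
    ext ρ
    have : ρ + σ ∈ Ioo σ τ ↔ ρ ∈ Ioo 0 r := by
      simp only [mem_Ioo, hr]; constructor <;> rintro ⟨h1, h2⟩ <;> constructor <;> linarith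
    simp only [indicator, this]
  rw [e2]
  refine setIntegral_congr_fun measurableSet_Ioo fun ρ _ => ?_
  simp only [kcomp]
  congr 1
  ext z
  rw [show τ - (ρ + σ) = r - ρ by rw [hr]; ring, add_sub_cancel_right]

end Time

/-! ### Smearing the semigroup in time -/

section Form

variable {M : Type*} [MeasurableSpace M] {μ : Measure M} [SigmaFinite μ]

lemma kform_const_mul (K : M → M → ℂ) (a : ℂ) (v u : L2 M μ) :
    kform (fun x y => a * K x y) v u = a * kform K v u := by
  rw [kform, kform, ← integral_const_mul]
  congr 1; ext p; ring

lemma kform_sum {ι : Type*} (s : Finset ι) {C : ι → ℝ≥0} {K : ι → M → M → ℂ}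
    (hK : ∀ i ∈ s, SchurBound μ (C i) (K i)) (v u : L2 M μ) :
    kform (fun x y => ∑ i ∈ s, K i x y) v u = ∑ i ∈ s, kform (K i) v u := by
  simp only [kform]
  rw [← integral_finsetSum s fun i hi => (hK i hi).integrable_form v u]
  congr 1; ext p
  rw [Finset.sum_mul, Finset.mul_sum]

lemma kform_add {C C' : ℝ≥0} {K K' : M → M → ℂ} (hK : SchurBound μ C K)
    (hK' : SchurBound μ C' K') (v u : L2 M μ) :
    kform (fun x y => K x y + K' x y) v u = kform K v u + kform K' v u := by
  rw [kform, kform, kform, ← integral_add (hK.integrable_form v u) (hK'.integrable_form v u)]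
  congr 1; ext p; ring

end Form

/-- Reversing time in an integral over `(0,r)`. -/
lemma setIntegral_Ioo_reflect (F : ℝ → ℂ) (r : ℝ) :
    ∫ ρ in Ioo 0 r, F (r - ρ) = ∫ ρ in Ioo 0 r, F ρ := by
  rw [← integral_indicator measurableSet_Ioo, ← integral_indicator measurableSet_Ioo,
    ← integral_sub_left_eq_self _ _ r]
  congr 1
  ext ρ
  have : r - ρ ∈ Ioo 0 r ↔ ρ ∈ Ioo 0 r := by
    simp only [mem_Ioo]; constructor <;> rintro ⟨h1, h2⟩ <;> constructor <;> linarith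
  by_cases h : ρ ∈ Ioo 0 r
  · rw [indicator_of_mem h, indicator_of_mem (this.2 h), sub_sub_cancel]
  · rw [indicator_of_notMem h, indicator_of_notMem (mt this.1 h)]

/-- Fubini's theorem for a double Volterra integral. -/
lemma volterra_fubini {m₁ m₂ : ℝ → ℝ} (h₁ : Continuous m₁) (h₂ : Continuous m₂) {B₁ B₂ : ℝ}
    (hB₁ : ∀ ρ, |m₁ ρ| ≤ B₁) (hB₂ : ∀ ρ, |m₂ ρ| ≤ B₂) (hz₁ : ∀ ρ ≤ 0, m₁ ρ = 0)
    (hz₂ : ∀ ρ ≤ 0, m₂ ρ = 0) {r : ℝ} {g : ℝ → ℂ} (hg : ContinuousOn g (Icc 0 r)) :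
    IntegrableOn (fun ρ' => (m₂ ρ' : ℂ) * ∫ ρ in Ioo 0 (r - ρ'), (m₁ ρ : ℂ) * g (ρ + ρ')) (Ioo 0 r) ∧
    ∫ ρ' in Ioo 0 r, (m₂ ρ' : ℂ) * ∫ ρ in Ioo 0 (r - ρ'), (m₁ ρ : ℂ) * g (ρ + ρ')
      = ∫ v in Ioo 0 r, ((∫ ρ', m₂ ρ' * m₁ (v - ρ') : ℝ) : ℂ) * g v := by
  have hinner : ∀ ρ' ∈ Ioo 0 r, (m₂ ρ' : ℂ) * ∫ ρ in Ioo 0 (r - ρ'), (m₁ ρ : ℂ) * g (ρ + ρ')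
      = ∫ v in Ioo 0 r, (m₂ ρ' : ℂ) * ((m₁ (v - ρ') : ℂ) * g v) := by
    intro ρ' hρ'
    rw [integral_const_mul]
    congr 1
    rw [← integral_indicator measurableSet_Ioo, ← integral_indicator measurableSet_Ioo,
      ← integral_add_right_eq_self (fun v => (Ioo 0 r).indicator _ v) ρ']
    congr 1
    ext ρ
    by_cases h0 : 0 < ρ
    · have : ρ ∈ Ioo 0 (r - ρ') ↔ ρ + ρ' ∈ Ioo 0 r := by
        simp only [mem_Ioo]
        have := hρ'.1
        constructor <;> rintro ⟨h1, h2⟩ <;> constructor <;> linarith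
      simp only [indicator, this, add_sub_cancel_right]
    · have h1 : ρ ∉ Ioo 0 (r - ρ') := fun h => h0 h.1
      simp [indicator, h1, hz₁ ρ (not_lt.1 h0)]
  obtain ⟨G, hG⟩ := isCompact_Icc.exists_bound_of_continuousOn hg
  have hgm : AEStronglyMeasurable g (volume.restrict (Ioo 0 r)) :=
    (hg.mono Ioo_subset_Icc_self).aestronglyMeasurable measurableSet_Ioo
  have hmeas : AEStronglyMeasurable
      (fun q : ℝ × ℝ => (m₂ q.1 : ℂ) * ((m₁ (q.2 - q.1) : ℂ) * g q.2))
      ((volume.restrict (Ioo 0 r)).prod (volume.restrict (Ioo 0 r))) := by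
    refine AEStronglyMeasurable.mul (Continuous.aestronglyMeasurable (by fun_prop))
      (AEStronglyMeasurable.mul (Continuous.aestronglyMeasurable (by fun_prop)) hgm.comp_snd)
  have hint : Integrable (fun q : ℝ × ℝ => (m₂ q.1 : ℂ) * ((m₁ (q.2 - q.1) : ℂ) * g q.2))
      ((volume.restrict (Ioo 0 r)).prod (volume.restrict (Ioo 0 r))) := by
    refine Integrable.of_bound hmeas (B₂ * (B₁ * G)) ?_
    rw [Measure.prod_restrict]
    refine (ae_restrict_iff' (measurableSet_Ioo.prod measurableSet_Ioo)).2 (ae_of_all _ ?_)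
    rintro ⟨ρ', v⟩ ⟨_, hv⟩
    have hB₁0 : 0 ≤ B₁ := (abs_nonneg _).trans (hB₁ 0)
    have hB₂0 : 0 ≤ B₂ := (abs_nonneg _).trans (hB₂ 0)
    rw [norm_mul, norm_mul, Complex.norm_real, Complex.norm_real]
    have := hG v (Ioo_subset_Icc_self hv)
    gcongr
    · exact hB₂ _
    · exact hB₁ _
  constructor
  · refine (hint.integral_prod_left).congr ?_
    exact (ae_restrict_iff' measurableSet_Ioo).2 (ae_of_all _ fun ρ' hρ' => (hinner ρ' hρ').symm)
  · rw [setIntegral_congr_fun measurableSet_Ioo hinner, integral_integral_swap hint]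
    refine setIntegral_congr_fun measurableSet_Ioo fun v hv => ?_
    simp only [← mul_assoc]
    rw [integral_mul_const]
    congr 1
    rw [← integral_complex_ofReal, ← integral_indicator measurableSet_Ioo]
    congr 1
    ext ρ'
    by_cases h : ρ' ∈ Ioo 0 r
    · rw [indicator_of_mem h]; push_cast; rfl
    · rw [indicator_of_notMem h]
      rcases not_and_or.1 h with h | h
      · rw [hz₂ ρ' (not_lt.1 h)]; simp
      · rw [hz₁ (v - ρ') (by linarith [hv.2, not_lt.1 h])]; simp

namespace HeatSystem

section Ops

variable {M : Type*} [MetricSpace M] [ProperSpace M] [MeasurableSpace M] [BorelSpace M]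
  {μ : Measure M} [SigmaFinite μ] [Nonempty M] {d : ℕ} {H : HeatSystem M μ d} {A : ℝ} {D : ℕ}

variable (H) in
/-- The matrix coefficient `⟪v, V_I L^N e^{-τL} V_J u⟫`. -/
def matCoef (I : List (Fin d)) (N : ℕ) (J : List (Fin d)) (v u : L2 M μ) (τ : ℝ) : ℂ :=
  inner ℂ v (H.sandwichOp I N J τ u)

lemma Setting.hasDerivAt_matCoef (hS : H.Setting A D) (I : List (Fin d)) (N : ℕ)
    (J : List (Fin d)) (v u : L2 M μ) {τ : ℝ} (hτ : 0 < τ) :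
    HasDerivAt (H.matCoef I N J v u) (-H.matCoef I (N + 1) J v u τ) τ := by
  have hε : 0 < τ / 4 := by positivity
  have h1 : HasDerivAt (fun x => H.powHeat N (x - 2 * (τ / 4)))
      (-H.powHeat (N + 1) (τ - 2 * (τ / 4))) τ :=
    (hS.hasDerivAt_powHeat N (by linarith : 0 < τ - 2 * (τ / 4))).comp_sub_const τ _
  have h2 := (h1.const_mul (H.leftOp I (τ / 4))).mul_const (H.rightOp J (τ / 4))
  let Λ : (L2 M μ →L[ℂ] L2 M μ) →L[ℂ] ℂ :=
    (innerSL ℂ v).comp (ContinuousLinearMap.apply ℂ (L2 M μ) u)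
  have h3 := (Λ.restrictScalars ℝ).hasFDerivAt.comp_hasDerivAt τ h2
  refine (h3.congr_deriv ?_).congr_of_eventuallyEq ?_
  · rw [matCoef, hS.sandwichOp_eq I (N + 1) J hε (by linarith)]
    simp [Λ, inner_neg_right]
  · filter_upwards [isOpen_Ioi.mem_nhds (show τ / 2 < τ by linarith)] with x hx
    rw [matCoef, hS.sandwichOp_eq I N J hε (by have := mem_Ioi.1 hx; linarith)]
    rfl

lemma Setting.continuousOn_matCoef (hS : H.Setting A D) (I : List (Fin d)) (N : ℕ)
    (J : List (Fin d)) (v u : L2 M μ) {θ r : ℝ} (hθ : 0 < θ) :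
    ContinuousOn (fun ρ => H.matCoef I N J v u (θ + r - ρ)) (Icc 0 r) := by
  intro ρ hρ
  have h : ContinuousAt (H.matCoef I N J v u) (θ + r - ρ) :=
    (hS.hasDerivAt_matCoef I N J v u (by linarith [hρ.2])).continuousAt
  exact (ContinuousAt.comp (f := fun ρ => θ + r - ρ) h (by fun_prop)).continuousWithinAt

/-- Integration by parts against the semigroup, which trades a derivative in time for a factor
`L`. -/
lemma Setting.integral_deriv_mul_matCoef (hS : H.Setting A D) (I : List (Fin d)) (N : ℕ)
    (J : List (Fin d)) (v u : L2 M μ) {θ r : ℝ} (hθ : 0 < θ) (hr : 0 < r) {η : ℝ → ℝ}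
    (hη : ContDiff ℝ ∞ η) (h0 : η 0 = 0) :
    ∫ ρ in Ioo 0 r, ((deriv η ρ : ℝ) : ℂ) * H.matCoef I N J v u (θ + r - ρ)
      = η r * H.matCoef I N J v u θ
        - ∫ ρ in Ioo 0 r, (η ρ : ℂ) * H.matCoef I (N + 1) J v u (θ + r - ρ) := by
  have hd : ∀ ρ, HasDerivAt η (deriv η ρ) ρ := fun ρ =>
    (hη.differentiable (by simp)).differentiableAt.hasDerivAt
  have hdc : Continuous (deriv η) := hη.continuous_deriv (by simp)
  have hderiv : ∀ ρ ∈ uIcc 0 r, HasDerivAt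
      (fun ρ => (η ρ : ℂ) * H.matCoef I N J v u (θ + r - ρ))
      (((deriv η ρ : ℝ) : ℂ) * H.matCoef I N J v u (θ + r - ρ)
        + (η ρ : ℂ) * H.matCoef I (N + 1) J v u (θ + r - ρ)) ρ := by
    intro ρ hρ
    rw [uIcc_of_le hr.le] at hρ
    have h1 := (hS.hasDerivAt_matCoef I N J v u (by linarith [hρ.2] : 0 < θ + r - ρ))
    have h2 : HasDerivAt (fun ρ => H.matCoef I N J v u (θ + r - ρ))
        (H.matCoef I (N + 1) J v u (θ + r - ρ)) ρ := by
      have := h1.comp_const_sub (θ + r) ρ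
      simpa using this
    exact ((hd ρ).ofReal_comp).mul h2
  have hi1 : IntervalIntegrable (fun ρ => ((deriv η ρ : ℝ) : ℂ) * H.matCoef I N J v u (θ + r - ρ))
      volume 0 r := by
    refine ContinuousOn.intervalIntegrable ?_
    rw [uIcc_of_le hr.le]
    exact (by fun_prop : Continuous fun ρ => ((deriv η ρ : ℝ) : ℂ)).continuousOn.mul
      (hS.continuousOn_matCoef I N J v u hθ)
  have hi2 : IntervalIntegrable (fun ρ => (η ρ : ℂ) * H.matCoef I (N + 1) J v u (θ + r - ρ))
      volume 0 r := by
    refine ContinuousOn.intervalIntegrable ?_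
    rw [uIcc_of_le hr.le]
    have := hη.continuous
    exact (by fun_prop : Continuous fun ρ => (η ρ : ℂ)).continuousOn.mul
      (hS.continuousOn_matCoef I (N + 1) J v u hθ)
  have h := intervalIntegral.integral_eq_sub_of_hasDerivAt hderiv (hi1.add hi2)
  rw [intervalIntegral.integral_add hi1 hi2, h0, intervalIntegral.integral_of_le hr.le,
    intervalIntegral.integral_of_le hr.le, integral_Ioc_eq_integral_Ioo,
    integral_Ioc_eq_integral_Ioo] at h
  simp only [add_sub_cancel_right, Complex.ofReal_zero, zero_mul, sub_zero] at h
  exact eq_sub_of_add_eq h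

variable (H) in
/-- The kernel of `∫_0^r f(ρ) V_I L^N e^{-(θ+r-ρ)L} V_J dρ`. -/
def smear (f : ℝ → ℝ) (I : List (Fin d)) (N : ℕ) (J : List (Fin d)) (θ r : ℝ) (x y : M) : ℂ :=
  ∫ ρ in Ioo 0 r, (f ρ : ℂ) * H.sandwich I N J (θ + r - ρ) x y

lemma Setting.schur_smear (hS : H.Setting A D) {f : ℝ → ℝ} (hf : Measurable f) {B : ℝ}
    (hB : ∀ ρ, |f ρ| ≤ B) (I : List (Fin d)) (N : ℕ) (J : List (Fin d)) {θ : ℝ} (hθ : 0 < θ)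
    (R : ℝ) : ∃ C, ∀ r ≤ R, SchurBound μ C (H.smear f I N J θ r) ∧
      ∀ v u : L2 M μ, kform (H.smear f I N J θ r) v u
        = ∫ ρ in Ioo 0 r, (f ρ : ℂ) * H.matCoef I N J v u (θ + r - ρ) := by
  obtain ⟨C, hC⟩ := hS.schur_sandwich I N J hθ
  have hK : ∀ r, ∀ ρ ∈ Ioo 0 r, SchurBound μ (B.toNNReal * C)
      (fun x y => (f ρ : ℂ) * H.sandwich I N J (θ + r - ρ) x y) := by
    intro r ρ hρ
    refine ((hC (θ + r - ρ) (by linarith [hρ.2])).const_mul (f ρ : ℂ)).mono ?_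
    gcongr
    rw [← NNReal.coe_le_coe, coe_nnnorm, Complex.norm_real]
    exact (hB ρ).trans (Real.le_coe_toNNReal B)
  refine ⟨B.toNNReal * C * R.toNNReal, fun r hr => ?_⟩
  have h0 : Measurable fun p : ℝ × M × M => (θ + r - p.1, p.2) := by fun_prop
  have hm : Measurable fun p : ℝ × M × M => (f p.1 : ℂ) *
      H.sandwich I N J (θ + r - p.1) p.2.1 p.2.2 := by
    have h1 := (hS.measurable_sandwich I N J).comp h0
    exact (Complex.measurable_ofReal.comp (hf.comp measurable_fst)).mul h1
  obtain ⟨h1, h2⟩ := SchurBound.time_integral (V := R.toNNReal) (s := Ioo 0 r)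
    (by simpa [ENNReal.ofReal] using Real.toNNReal_le_toNNReal hr) hm (hK r)
  refine ⟨h1, fun v u => ?_⟩
  have h3 := h2 v u
  unfold smear
  rw [h3]
  refine setIntegral_congr_fun measurableSet_Ioo fun ρ hρ => ?_
  have hu : θ ≤ θ + r - ρ := by linarith [hρ.2]
  rw [kform_const_mul, matCoef,
    (hS.hasKernel_sandwich I N J (hθ.trans_le hu)).inner_eq (hC _ hu)]

/-- If `Ω` is compactly supported inside `(0,r)`, derivatives of `Ω` turn into powers of `L`. -/
lemma Setting.smear_iteratedDeriv (hS : H.Setting A D) (I : List (Fin d)) (J : List (Fin d))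
    {θ r a b : ℝ} (hθ : 0 < θ) (ha : 0 < a) (hr : 0 < r) (hb : b < r) (κ : ℕ) :
    ∀ (N : ℕ) {Ω : ℝ → ℝ}, ContDiff ℝ ∞ Ω → Function.support Ω ⊆ Icc a b →
    ∀ᵐ p ∂(μ.prod μ), H.smear (iteratedDeriv κ Ω) I N J θ r p.1 p.2
      = (-1) ^ κ * H.smear Ω I (N + κ) J θ r p.1 p.2 := by
  have hbd : ∀ {f : ℝ → ℝ}, ContDiff ℝ ∞ f → Function.support f ⊆ Icc a b →
      ∃ B, ∀ ρ, |f ρ| ≤ B := by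
    intro f hf hs
    have hcs : HasCompactSupport f := HasCompactSupport.of_support_subset_isCompact isCompact_Icc hs
    exact hcs.exists_bound_of_continuous hf.continuous
  have hsd : ∀ {f : ℝ → ℝ}, Function.support f ⊆ Icc a b → Function.support (deriv f) ⊆ Icc a b :=
    fun hs => support_deriv_subset.trans (closure_minimal hs isClosed_Icc)
  induction κ with
  | zero => intro N Ω _ _; simp
  | succ κ ih =>
    intro N Ω hΩ hs
    have hΩ' : ContDiff ℝ ∞ (deriv Ω) := hΩ.deriv'
    have h1 := ih N hΩ' (hsd hs)
    obtain ⟨B, hB⟩ := hbd hΩ hs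
    obtain ⟨B', hB'⟩ := hbd hΩ' (hsd hs)
    obtain ⟨C, hC⟩ := hS.schur_smear hΩ.continuous.measurable hB I (N + (κ + 1)) J hθ r
    obtain ⟨C', hC'⟩ := hS.schur_smear hΩ'.continuous.measurable hB' I (N + κ) J hθ r
    have h2 : ∀ᵐ p ∂(μ.prod μ), H.smear (deriv Ω) I (N + κ) J θ r p.1 p.2
        = -1 * H.smear Ω I (N + (κ + 1)) J θ r p.1 p.2 := by
      refine (hC' r le_rfl).1.ae_eq_of_form ((hC r le_rfl).1.const_mul (-1)) fun v u => ?_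
      have hz : ∀ ρ, ρ ∉ Icc a b → Ω ρ = 0 := fun ρ hρ => by
        by_contra h; exact hρ (hs h)
      rw [kform_const_mul, (hC' r le_rfl).2, (hC r le_rfl).2,
        hS.integral_deriv_mul_matCoef I (N + κ) J v u hθ hr hΩ
          (hz 0 fun h => absurd h.1 (by linarith)), hz r fun h => absurd h.2 (by linarith)]
      simp [add_assoc]
    filter_upwards [h1, h2] with p h1 h2
    rw [iteratedDeriv_succ', h1, h2]
    ring

/-! ### The operators `ℒ⁻¹` composed with standard families -/

variable (H) in
/-- The kernels, for the elapsed time `r`, of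
`t⁻¹ (t^{|I|/2} V_I) (tL)^n P_t^{(c)} (t^{|J|/2} V_J) ⊗ m_t^⋆` composed with `ℒ⁻¹`, which commutes
with functions of `L`: for `J = []` they are those of `t⁻¹ 𝒬_t ℒ⁻¹`, for `I = []` those of
`t⁻¹ ℒ⁻¹ 𝒬_t^•`, for a standard family `𝒬`. -/
def duhamel (I J : List (Fin d)) (n c : ℕ) (m : ℝ → ℝ) (t r : ℝ) (x y : M) : ℂ :=
  ((√t ^ (I.length + J.length) * t⁻¹ : ℝ) : ℂ) *
    ∑ i ∈ Finset.range c, ((t ^ (n + i) / i.factorial : ℝ) : ℂ) *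
      H.smear (rescale m t) I (n + i) J t r x y

variable (H) in
/-- The kernels of a standard family, for the elapsed time `r`. -/
def stdTime (J : List (Fin d)) (n c : ℕ) (m : ℝ → ℝ) (t r : ℝ) (x y : M) : ℂ :=
  ((√t ^ J.length * rescale m t r : ℝ) : ℂ) *
    ∑ i ∈ Finset.range c, ((t ^ (n + i) / i.factorial : ℝ) : ℂ) * H.leftPow J (n + i) t x y

variable (H) in
/-- The kernels of the dual of a standard family, for the elapsed time `r`. -/
def dualTime (J : List (Fin d)) (n c : ℕ) (m : ℝ → ℝ) (t r : ℝ) (x y : M) : ℂ :=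
  ((√t ^ J.length * rescale m t r : ℝ) : ℂ) *
    ∑ i ∈ Finset.range c, ((t ^ (n + i) / i.factorial : ℝ) : ℂ) * H.rightPow J (n + i) t x y

end Ops

end HeatSystem

/-! ### Profiles in time -/

/-- The functions of time used in standard families. -/
structure IsProfile (m : ℝ → ℝ) : Prop where
  smooth : ContDiff ℝ ∞ m
  supp : Function.support m ⊆ Icc (1 / 2) 2

namespace IsProfile

variable {m : ℝ → ℝ} (hm : IsProfile m)

include hm

lemma hasCompactSupport : HasCompactSupport m :=
  HasCompactSupport.of_support_subset_isCompact isCompact_Icc hm.supp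

lemma deriv : IsProfile (deriv m) :=
  ⟨hm.smooth.deriv', support_deriv_subset.trans (closure_minimal hm.supp isClosed_Icc)⟩

lemma iteratedDeriv (k : ℕ) : IsProfile (iteratedDeriv k m) := by
  induction k with
  | zero => simpa using hm
  | succ k ih => rw [iteratedDeriv_succ]; exact ih.deriv

lemma const_mul (a : ℝ) : IsProfile fun r => a * m r :=
  ⟨contDiff_const.mul hm.smooth, fun r hr => hm.supp fun h => hr (by simp [h])⟩

lemma exists_bound : ∃ B, 0 ≤ B ∧ ∀ r, |m r| ≤ B := by
  obtain ⟨B, hB⟩ := hm.hasCompactSupport.exists_bound_of_continuous hm.smooth.continuous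
  exact ⟨B, (norm_nonneg _).trans (hB 0), hB⟩

lemma eq_zero {r : ℝ} (hr : r ≤ 0) : m r = 0 := by
  by_contra h
  have := (hm.supp h).1
  linarith

lemma contDiff_rescale (t : ℝ) : ContDiff ℝ ∞ (rescale m t) := by
  unfold rescale
  exact contDiff_const.mul (hm.smooth.comp (contDiff_id.div_const t))

lemma support_rescale {t : ℝ} (ht : 0 < t) :
    Function.support (rescale m t) ⊆ Icc (t / 2) (2 * t) := by
  intro r hr
  have h : m (r / t) ≠ 0 := fun h => hr (by simp [rescale, h])
  obtain ⟨h1, h2⟩ := hm.supp h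
  rw [le_div_iff₀ ht] at h1
  rw [div_le_iff₀ ht] at h2
  exact ⟨by linarith, h2⟩

lemma rescale_eq_zero {t : ℝ} (ht : 0 < t) {r : ℝ} (hr : r ≤ 0) : rescale m t r = 0 := by
  rw [rescale, hm.eq_zero (div_nonpos_of_nonpos_of_nonneg hr ht.le), mul_zero]

lemma exists_bound_rescale (t : ℝ) : ∃ B, 0 ≤ B ∧ ∀ r, |rescale m t r| ≤ B := by
  obtain ⟨B, hB0, hB⟩ := hm.exists_bound
  refine ⟨|t⁻¹| * B, by positivity, fun r => ?_⟩
  rw [rescale, abs_mul]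
  gcongr
  exact hB _

lemma rescale_deriv {t : ℝ} (ht : t ≠ 0) (r : ℝ) :
    rescale (_root_.deriv m) t r = t * _root_.deriv (rescale m t) r := by
  have h : HasDerivAt m (_root_.deriv m (r / t)) (r / t) :=
    (hm.smooth.differentiable (by simp)).differentiableAt.hasDerivAt
  have h2 : HasDerivAt (rescale m t) (t⁻¹ * (_root_.deriv m (r / t) * (1 / t))) r :=
    (h.comp r ((hasDerivAt_id r).div_const t)).const_mul t⁻¹
  rw [h2.deriv, rescale]
  field_simp

end IsProfile

lemma measurable_rescale {m : ℝ → ℝ} (hm : Measurable m) :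
    Measurable fun p : ℝ × ℝ => rescale m p.1 p.2 := by
  unfold rescale
  exact measurable_fst.inv.mul (hm.comp (measurable_snd.div measurable_fst))

/-! ### Composition with the resolution operator -/

namespace HeatSystem

section Ops

variable {M : Type*} [MetricSpace M] [ProperSpace M] [MeasurableSpace M] [BorelSpace M]
  {μ : Measure M} [SigmaFinite μ] [Nonempty M] {d : ℕ} {H : HeatSystem M μ d} {A : ℝ} {D : ℕ}
  {m : ℝ → ℝ}

lemma family_eq_volterra (hm : IsProfile m) (J : List (Fin d)) (n c : ℕ) {t : ℝ} (ht : 0 < t) :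
    H.family J n c m t = volterra (H.stdTime J n c m t) := by
  ext e e'
  simp only [family, volterra, stdTime]
  split_ifs with h
  · rfl
  · rw [hm.rescale_eq_zero ht (by linarith)]; simp

lemma dualFamily_eq_volterra (hm : IsProfile m) (J : List (Fin d)) (n c : ℕ) {t : ℝ}
    (ht : 0 < t) : H.dualFamily J n c m t = volterra (H.dualTime J n c m t) := by
  ext e e'
  simp only [dualFamily, volterra, dualTime]
  split_ifs with h
  · rfl
  · rw [hm.rescale_eq_zero ht (by linarith)]; simp

lemma Setting.measurable_stdTime (hS : H.Setting A D) (hm : Measurable m) (J : List (Fin d))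
    (n c : ℕ) :
    Measurable fun p : ℝ × ℝ × M × M => H.stdTime J n c m p.1 p.2.1 p.2.2.1 p.2.2.2 := by
  unfold stdTime
  refine Measurable.mul ?_ (Finset.measurable_sum _ fun i _ => Measurable.mul ?_ ?_)
  · exact Complex.measurable_ofReal.comp ((by fun_prop : Measurable
      fun p : ℝ × ℝ × M × M => √p.1 ^ J.length).mul ((measurable_rescale hm).comp
        (by fun_prop : Measurable fun p : ℝ × ℝ × M × M => (p.1, p.2.1))))
  · exact Complex.measurable_ofReal.comp (by fun_prop)
  · have h0 : Measurable fun p : ℝ × ℝ × M × M => (p.1, p.2.2) := by fun_prop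
    have := (hS.measurable_leftPow J (n + i)).comp h0
    exact this

lemma Setting.measurable_dualTime (hS : H.Setting A D) (hm : Measurable m) (J : List (Fin d))
    (n c : ℕ) :
    Measurable fun p : ℝ × ℝ × M × M => H.dualTime J n c m p.1 p.2.1 p.2.2.1 p.2.2.2 := by
  unfold dualTime
  refine Measurable.mul ?_ (Finset.measurable_sum _ fun i _ => Measurable.mul ?_ ?_)
  · exact Complex.measurable_ofReal.comp ((by fun_prop : Measurable
      fun p : ℝ × ℝ × M × M => √p.1 ^ J.length).mul ((measurable_rescale hm).comp
        (by fun_prop : Measurable fun p : ℝ × ℝ × M × M => (p.1, p.2.1))))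
  · exact Complex.measurable_ofReal.comp (by fun_prop)
  · have h0 : Measurable fun p : ℝ × ℝ × M × M => (p.1, p.2.2) := by fun_prop
    have := (hS.measurable_sandwich [] (n + i) J).comp h0
    exact this

lemma Setting.measurable_smear_rescale (hS : H.Setting A D) (hm : Measurable m)
    (I : List (Fin d)) (N : ℕ) (J : List (Fin d)) :
    Measurable fun p : ℝ × ℝ × M × M =>
      H.smear (rescale m p.1) I N J p.1 p.2.1 p.2.2.1 p.2.2.2 := by
  have h1 : Measurable fun q : ℝ × (ℝ × ℝ × M × M) =>
      if 0 < q.1 ∧ q.1 < q.2.2.1 then (rescale m q.2.1 q.1 : ℂ) *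
        H.sandwich I N J (q.2.1 + q.2.2.1 - q.1) q.2.2.2.1 q.2.2.2.2 else 0 := by
    refine Measurable.ite ?_ (Measurable.mul ?_ ?_) measurable_const
    · exact (measurableSet_lt measurable_const measurable_fst).inter
        (measurableSet_lt measurable_fst
          (measurable_fst.comp (measurable_snd.comp measurable_snd)))
    · exact Complex.measurable_ofReal.comp ((measurable_rescale hm).comp
        (by fun_prop : Measurable fun q : ℝ × (ℝ × ℝ × M × M) => (q.2.1, q.1)))
    · have h0 : Measurable fun q : ℝ × (ℝ × ℝ × M × M) =>
          (q.2.1 + q.2.2.1 - q.1, q.2.2.2) := by fun_prop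
      have := (hS.measurable_sandwich I N J).comp h0
      exact this
  have h2 := measurable_kint (K := fun (ρ : ℝ) (p : ℝ × ℝ × M × M) =>
    if 0 < ρ ∧ ρ < p.2.1 then (rescale m p.1 ρ : ℂ) *
        H.sandwich I N J (p.1 + p.2.1 - ρ) p.2.2.1 p.2.2.2 else 0) h1 volume
  have e : (fun p : ℝ × ℝ × M × M =>
      H.smear (rescale m p.1) I N J p.1 p.2.1 p.2.2.1 p.2.2.2) = fun p => ∫ ρ,
      (if 0 < ρ ∧ ρ < p.2.1 then (rescale m p.1 ρ : ℂ) *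
        H.sandwich I N J (p.1 + p.2.1 - ρ) p.2.2.1 p.2.2.2 else 0) := by
    ext p
    rw [smear, ← integral_indicator measurableSet_Ioo]
    congr 1; ext ρ
    simp only [indicator, mem_Ioo]
  rw [e]
  exact h2

lemma Setting.measurable_duhamel (hS : H.Setting A D) (hm : Measurable m) (I J : List (Fin d))
    (n c : ℕ) :
    Measurable fun p : ℝ × ℝ × M × M => H.duhamel I J n c m p.1 p.2.1 p.2.2.1 p.2.2.2 := by
  unfold duhamel
  refine Measurable.mul ?_ (Finset.measurable_sum _ fun i _ => Measurable.mul ?_ ?_)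
  · exact Complex.measurable_ofReal.comp (by fun_prop)
  · exact Complex.measurable_ofReal.comp (by fun_prop)
  · exact hS.measurable_smear_rescale hm I (n + i) J

lemma Setting.schur_duhamel (hS : H.Setting A D) (hm : IsProfile m) (I J : List (Fin d))
    (n c : ℕ) {t : ℝ} (ht : 0 < t) (R : ℝ) :
    ∃ C, ∀ r ≤ R, SchurBound μ C (H.duhamel I J n c m t r) ∧
      ∀ v u : L2 M μ, kform (H.duhamel I J n c m t r) v u =
        ((√t ^ (I.length + J.length) * t⁻¹ : ℝ) : ℂ) *
          ∑ i ∈ Finset.range c, ((t ^ (n + i) / i.factorial : ℝ) : ℂ) *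
            ∫ ρ in Ioo 0 r, (rescale m t ρ : ℂ) * H.matCoef I (n + i) J v u (t + r - ρ) := by
  obtain ⟨B, _, hB⟩ := hm.exists_bound_rescale t
  choose C hC using fun i =>
    hS.schur_smear (hm.contDiff_rescale t).continuous.measurable hB I (n + i) J ht R
  have hb : ∀ r ≤ R, ∀ i ∈ Finset.range c, SchurBound μ
      (‖((t ^ (n + i) / i.factorial : ℝ) : ℂ)‖₊ * C i) (fun x y =>
        ((t ^ (n + i) / i.factorial : ℝ) : ℂ) * H.smear (rescale m t) I (n + i) J t r x y) :=
    fun r hr i _ => (hC i r hr).1.const_mul _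
  refine ⟨_, fun r hr => ⟨(SchurBound.sum _ (hb r hr)).const_mul _, fun v u => ?_⟩⟩
  unfold duhamel
  rw [kform_const_mul, kform_sum _ (hb r hr)]
  congr 1
  refine Finset.sum_congr rfl fun i _ => ?_
  rw [kform_const_mul, (hC i r hr).2]

lemma Setting.stdTime_spec (hS : H.Setting A D) (hm : IsProfile m) (J : List (Fin d)) (n c : ℕ)
    {t : ℝ} (ht : 0 < t) :
    (∃ C, ∀ r, SchurBound μ C (H.stdTime J n c m t r)) ∧
    ∀ r, HasKernel (((√t ^ J.length * rescale m t r : ℝ) : ℂ) •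
      ∑ i ∈ Finset.range c, ((t ^ (n + i) / i.factorial : ℝ) : ℂ) • H.sandwichOp J (n + i) [] t)
      (H.stdTime J n c m t r) := by
  obtain ⟨B, hB0, hB⟩ := hm.exists_bound_rescale t
  choose C hC using fun i => hS.schur_leftPow J (n + i) ht
  have hb := SchurBound.sum (Finset.range c) fun i _ =>
    (hC i).const_mul ((t ^ (n + i) / i.factorial : ℝ) : ℂ)
  refine ⟨⟨(√t ^ J.length * B).toNNReal *
    ∑ i ∈ Finset.range c, ‖((t ^ (n + i) / i.factorial : ℝ) : ℂ)‖₊ * C i, fun r => (hb.const_mul _).mono ?_⟩, fun r => ?_⟩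
  · gcongr
    rw [← NNReal.coe_le_coe, coe_nnnorm, Complex.norm_real, Real.coe_toNNReal _ (by positivity),
      Real.norm_eq_abs, abs_mul, abs_of_nonneg (by positivity : 0 ≤ √t ^ J.length)]
    gcongr
    exact hB r
  · refine HasKernel.smul (HasKernel.sum _ fun i _ => HasKernel.smul ?_ _) _
    rw [hS.sandwichOp_nil J (n + i) ht]
    exact hS.hasKernel_leftPow J (n + i) ht

lemma Setting.dualTime_spec (hS : H.Setting A D) (hm : IsProfile m) (J : List (Fin d)) (n c : ℕ)
    {t : ℝ} (ht : 0 < t) :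
    (∃ C, ∀ r, SchurBound μ C (H.dualTime J n c m t r)) ∧
    ∀ r, HasKernel (((√t ^ J.length * rescale m t r : ℝ) : ℂ) •
      ∑ i ∈ Finset.range c, ((t ^ (n + i) / i.factorial : ℝ) : ℂ) • H.sandwichOp [] (n + i) J t)
      (H.dualTime J n c m t r) := by
  obtain ⟨B, hB0, hB⟩ := hm.exists_bound_rescale t
  choose C hC using fun i => hS.schur_sandwich [] (n + i) J ht
  have hb := SchurBound.sum (Finset.range c) fun i _ =>
    (hC i t le_rfl).const_mul ((t ^ (n + i) / i.factorial : ℝ) : ℂ)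
  refine ⟨⟨(√t ^ J.length * B).toNNReal *
    ∑ i ∈ Finset.range c, ‖((t ^ (n + i) / i.factorial : ℝ) : ℂ)‖₊ * C i, fun r => (hb.const_mul _).mono ?_⟩, fun r => ?_⟩
  · gcongr
    rw [← NNReal.coe_le_coe, coe_nnnorm, Complex.norm_real, Real.coe_toNNReal _ (by positivity),
      Real.norm_eq_abs, abs_mul, abs_of_nonneg (by positivity : 0 ≤ √t ^ J.length)]
    gcongr
    exact hB r
  · exact HasKernel.smul (HasKernel.sum _ fun i _ =>
      HasKernel.smul (hS.hasKernel_sandwich [] (n + i) J ht) _) _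

lemma Setting.hasKernel_heat (hS : H.Setting A D) {t : ℝ} (ht : 0 < t) :
    HasKernel (H.heat t) (H.left [] t) := by
  rw [← hS.leftOp_nil ht]
  exact hasKernel_opOf (hS.schur_left [] ht).choose_spec

/-- The identity `ℒ⁻¹ 𝒬_t^• = t (t⁻¹ ℒ⁻¹ 𝒬_t^•)` at the level of kernels. -/
lemma Setting.timeConv_heat_dualTime (hS : H.Setting A D) (hm : IsProfile m) (J : List (Fin d))
    (n c : ℕ) {t r : ℝ} (ht : 0 < t) :
    ∀ᵐ p ∂(μ.prod μ), timeConv μ (H.left []) (H.dualTime J n c m t) r p.1 p.2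
      = t * H.duhamel [] J n c m t r p.1 p.2 := by
  obtain ⟨C, hC⟩ := hS.schur_heat
  obtain ⟨⟨C', hC'⟩, hop⟩ := hS.dualTime_spec hm J n c ht
  obtain ⟨C'', hC''⟩ := hS.schur_duhamel hm [] J n c ht r
  have hmd : Measurable fun p : ℝ × M × M => H.dualTime J n c m t p.1 p.2.1 p.2.2 := by
    have h0 : Measurable fun p : ℝ × M × M => (t, p) := by fun_prop
    have := (hS.measurable_dualTime hm.smooth.continuous.measurable J n c).comp h0
    exact this
  obtain ⟨h1, h2⟩ := timeConv_spec (r := r) (hS.left_measurable []) hmd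
    (fun ρ hρ => hC ρ hρ.1) (fun ρ _ => hC' ρ)
  refine h1.ae_eq_of_form ((hC'' r le_rfl).1.const_mul t) fun v u => ?_
  rw [h2, kform_const_mul, (hC'' r le_rfl).2]
  have hi : ∀ i, IntegrableOn (fun ρ => (rescale m t ρ : ℂ) *
      H.matCoef [] (n + i) J v u (t + r - ρ)) (Ioo 0 r) := fun i =>
    (((Complex.continuous_ofReal.comp (hm.contDiff_rescale t).continuous).continuousOn.mul
      (hS.continuousOn_matCoef [] (n + i) J v u ht)).integrableOn_Icc).mono_set Ioo_subset_Icc_self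
  have e : ∀ ρ ∈ Ioo 0 r, kform (kcomp μ (H.left [] (r - ρ)) (H.dualTime J n c m t ρ)) v u
      = (√t ^ J.length : ℝ) * ∑ i ∈ Finset.range c, ((t ^ (n + i) / i.factorial : ℝ) : ℂ) *
        ((rescale m t ρ : ℂ) * H.matCoef [] (n + i) J v u (t + r - ρ)) := by
    intro ρ hρ
    have hr : 0 < r - ρ := by linarith [hρ.2]
    have h3 := (HasKernel.comp (hC _ hr) (hC' ρ) (hS.hasKernel_heat hr) (hop ρ)).inner_eq
      ((hC _ hr).kcomp (hC' ρ)) v u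
    rw [← h3]
    have h4 : (H.heat (r - ρ)).comp (((√t ^ J.length * rescale m t ρ : ℝ) : ℂ) •
        ∑ i ∈ Finset.range c, ((t ^ (n + i) / i.factorial : ℝ) : ℂ) • H.sandwichOp [] (n + i) J t)
        = ((√t ^ J.length * rescale m t ρ : ℝ) : ℂ) • ∑ i ∈ Finset.range c,
          ((t ^ (n + i) / i.factorial : ℝ) : ℂ) • H.sandwichOp [] (n + i) J (t + r - ρ) := by
      rw [← ContinuousLinearMap.mul_def, mul_smul_comm, Finset.mul_sum]
      congr 1
      refine Finset.sum_congr rfl fun i _ => ?_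
      rw [mul_smul_comm, hS.heat_mul_sandwichOp _ _ hr.le ht]
      congr 2; ring
    rw [h4, smul_apply, inner_smul_right, sum_apply, inner_sum, Complex.ofReal_mul, mul_assoc,
      Finset.mul_sum]
    congr 1
    refine Finset.sum_congr rfl fun i _ => ?_
    rw [smul_apply, inner_smul_right, matCoef]
    ring
  rw [setIntegral_congr_fun measurableSet_Ioo e, integral_const_mul,
    integral_finsetSum _ fun i _ => (hi i).const_mul _]
  simp only [integral_const_mul]
  have ht' : (t : ℂ) ≠ 0 := by exact_mod_cast ht.ne'
  simp only [List.length_nil, zero_add]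
  push_cast
  field_simp

/-- `𝒬_t ℒ⁻¹ = t (t⁻¹ 𝒬_t ℒ⁻¹)` at the level of kernels. -/
lemma Setting.timeConv_stdTime_heat (hS : H.Setting A D) (hm : IsProfile m) (J : List (Fin d))
    (n c : ℕ) {t r : ℝ} (ht : 0 < t) :
    ∀ᵐ p ∂(μ.prod μ), timeConv μ (H.stdTime J n c m t) (H.left []) r p.1 p.2
      = t * H.duhamel J [] n c m t r p.1 p.2 := by
  obtain ⟨C, hC⟩ := hS.schur_heat
  obtain ⟨⟨C', hC'⟩, hop⟩ := hS.stdTime_spec hm J n c ht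
  obtain ⟨C'', hC''⟩ := hS.schur_duhamel hm J [] n c ht r
  have hmd : Measurable fun p : ℝ × M × M => H.stdTime J n c m t p.1 p.2.1 p.2.2 := by
    have h0 : Measurable fun p : ℝ × M × M => (t, p) := by fun_prop
    have := (hS.measurable_stdTime hm.smooth.continuous.measurable J n c).comp h0
    exact this
  obtain ⟨h1, h2⟩ := timeConv_spec (r := r) hmd (hS.left_measurable [])
    (fun ρ _ => hC' ρ) (fun ρ hρ => hC ρ hρ.1)
  refine h1.ae_eq_of_form ((hC'' r le_rfl).1.const_mul t) fun v u => ?_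
  rw [h2, kform_const_mul, (hC'' r le_rfl).2]
  have hi : ∀ i, IntegrableOn (fun ρ => (rescale m t ρ : ℂ) *
      H.matCoef J (n + i) [] v u (t + r - ρ)) (Ioo 0 r) := fun i =>
    (((Complex.continuous_ofReal.comp (hm.contDiff_rescale t).continuous).continuousOn.mul
      (hS.continuousOn_matCoef J (n + i) [] v u ht)).integrableOn_Icc).mono_set Ioo_subset_Icc_self
  have e : ∀ ρ ∈ Ioo 0 r, kform (kcomp μ (H.stdTime J n c m t (r - (r - ρ)))
      (H.left [] (r - ρ))) v u
      = (√t ^ J.length : ℝ) * ∑ i ∈ Finset.range c, ((t ^ (n + i) / i.factorial : ℝ) : ℂ) *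
        ((rescale m t ρ : ℂ) * H.matCoef J (n + i) [] v u (t + r - ρ)) := by
    intro ρ hρ
    have hr : 0 < r - ρ := by linarith [hρ.2]
    rw [sub_sub_cancel]
    have h3 := (HasKernel.comp (hC' ρ) (hC _ hr) (hop ρ) (hS.hasKernel_heat hr)).inner_eq
      ((hC' ρ).kcomp (hC _ hr)) v u
    rw [← h3]
    have h4 : (((√t ^ J.length * rescale m t ρ : ℝ) : ℂ) •
        ∑ i ∈ Finset.range c, ((t ^ (n + i) / i.factorial : ℝ) : ℂ) •
          H.sandwichOp J (n + i) [] t).comp (H.heat (r - ρ))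
        = ((√t ^ J.length * rescale m t ρ : ℝ) : ℂ) • ∑ i ∈ Finset.range c,
          ((t ^ (n + i) / i.factorial : ℝ) : ℂ) • H.sandwichOp J (n + i) [] (t + r - ρ) := by
      rw [← ContinuousLinearMap.mul_def, smul_mul_assoc, Finset.sum_mul]
      congr 1
      refine Finset.sum_congr rfl fun i _ => ?_
      rw [smul_mul_assoc, hS.sandwichOp_nil _ _ ht, hS.leftPowOp_mul_heat _ _ hr.le ht,
        hS.sandwichOp_nil _ _ (by linarith)]
      congr 2; ring
    rw [h4, smul_apply, inner_smul_right, sum_apply, inner_sum, Complex.ofReal_mul, mul_assoc,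
      Finset.mul_sum]
    congr 1
    refine Finset.sum_congr rfl fun i _ => ?_
    rw [smul_apply, inner_smul_right, matCoef]
    ring
  rw [← setIntegral_Ioo_reflect, setIntegral_congr_fun measurableSet_Ioo e, integral_const_mul,
    integral_finsetSum _ fun i _ => (hi i).const_mul _]
  simp only [integral_const_mul]
  have ht' : (t : ℂ) ≠ 0 := by exact_mod_cast ht.ne'
  simp only [List.length_nil, add_zero]
  push_cast
  field_simp

/-- The identity `𝒬_t = (t⁻¹ 𝒬_t ℒ⁻¹)(t∂_τ) + (t⁻¹ 𝒬_t ℒ⁻¹)(tL)`, that is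
`𝒬_t = 𝒬_t ℒ ℒ⁻¹`, at the level of kernels. -/
lemma Setting.duhamel_add_duhamel (hS : H.Setting A D) (hm : IsProfile m) (J : List (Fin d))
    (n c : ℕ) {t r : ℝ} (ht : 0 < t) (hr : 0 < r) :
    ∀ᵐ p ∂(μ.prod μ), H.duhamel J [] n c (deriv m) t r p.1 p.2
      + H.duhamel J [] (n + 1) c m t r p.1 p.2 = H.stdTime J n c m t r p.1 p.2 := by
  obtain ⟨⟨C', hC'⟩, hop⟩ := hS.stdTime_spec hm J n c ht
  obtain ⟨C₁, hC₁⟩ := hS.schur_duhamel hm.deriv J [] n c ht r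
  obtain ⟨C₂, hC₂⟩ := hS.schur_duhamel hm J [] (n + 1) c ht r
  refine ((hC₁ r le_rfl).1.add (hC₂ r le_rfl).1).ae_eq_of_form (hC' r) fun v u => ?_
  rw [kform_add (hC₁ r le_rfl).1 (hC₂ r le_rfl).1, (hC₁ r le_rfl).2, (hC₂ r le_rfl).2,
    ← (hop r).inner_eq (hC' r), smul_apply, inner_smul_right, sum_apply, inner_sum, ← mul_add,
    ← Finset.sum_add_distrib]
  have ht' : (t : ℂ) ≠ 0 := by exact_mod_cast ht.ne'
  have e : ∀ i ∈ Finset.range c, ((t ^ (n + i) / i.factorial : ℝ) : ℂ) *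
        (∫ ρ in Ioo 0 r, (rescale (deriv m) t ρ : ℂ) * H.matCoef J (n + i) [] v u (t + r - ρ))
      + ((t ^ (n + 1 + i) / i.factorial : ℝ) : ℂ) *
        ∫ ρ in Ioo 0 r, (rescale m t ρ : ℂ) * H.matCoef J (n + 1 + i) [] v u (t + r - ρ)
      = ((t * rescale m t r : ℝ) : ℂ) *
        inner ℂ v ((((t ^ (n + i) / i.factorial : ℝ) : ℂ) • H.sandwichOp J (n + i) [] t) u) := by
    intro i _
    have h1 := hS.integral_deriv_mul_matCoef J (n + i) [] v u ht hr (hm.contDiff_rescale t)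
      (hm.rescale_eq_zero ht le_rfl)
    have h2 : ∫ ρ in Ioo 0 r, (rescale (deriv m) t ρ : ℂ) * H.matCoef J (n + i) [] v u (t + r - ρ)
        = t * ∫ ρ in Ioo 0 r,
          ((deriv (rescale m t) ρ : ℝ) : ℂ) * H.matCoef J (n + i) [] v u (t + r - ρ) := by
      rw [← integral_const_mul]
      congr 1; ext ρ
      rw [hm.rescale_deriv ht.ne']; push_cast; ring
    rw [h2, h1, show n + 1 + i = n + i + 1 by ring, smul_apply, inner_smul_right,
      show inner ℂ v (H.sandwichOp J (n + i) [] t u) = H.matCoef J (n + i) [] v u t from rfl]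
    push_cast
    rw [pow_succ]
    ring
  rw [Finset.sum_congr rfl e, ← Finset.mul_sum]
  simp only [List.length_nil, add_zero]
  push_cast
  field_simp

end Ops

end HeatSystem

/-! ### Composition with dual standard families, and formal duals -/

namespace HeatSystem

section Ops

variable {M : Type*} [MetricSpace M] [ProperSpace M] [MeasurableSpace M] [BorelSpace M]
  {μ : Measure M} [SigmaFinite μ] [Nonempty M] {d : ℕ} {H : HeatSystem M μ d} {A : ℝ} {D : ℕ}
  {m m' : ℝ → ℝ}

lemma Setting.matCoef_sandwichOp (hS : H.Setting A D) (I J : List (Fin d)) (N K : ℕ)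
    (v u : L2 M μ) {τ s : ℝ} (hτ : 0 < τ) (hs : 0 < s) :
    H.matCoef I N [] v (H.sandwichOp [] K J s u) τ = H.matCoef I (N + K) J v u (τ + s) := by
  rw [matCoef, matCoef, ← hS.sandwichOp_mul I N K J hτ hs]
  rfl

lemma matCoef_smul (I J : List (Fin d)) (N : ℕ) (v u : L2 M μ) (τ : ℝ) (a : ℂ) :
    H.matCoef I N J v (a • u) τ = a * H.matCoef I N J v u τ := by
  rw [matCoef, map_smul, inner_smul_right, matCoef]

lemma matCoef_sum {ι : Type*} (s : Finset ι) (I J : List (Fin d)) (N : ℕ) (v : L2 M μ)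
    (u : ι → L2 M μ) (τ : ℝ) :
    H.matCoef I N J v (∑ i ∈ s, u i) τ = ∑ i ∈ s, H.matCoef I N J v (u i) τ := by
  simp only [matCoef, map_sum, inner_sum]

/-- The convolution `m_t ⋆ m'_s` of two rescaled profiles. -/
def _root_.Paracontrolled.convProfile (m m' : ℝ → ℝ) (t s v : ℝ) : ℝ :=
  ∫ ρ, rescale m' s ρ * rescale m t (v - ρ)

lemma _root_.Paracontrolled.measurable_convProfile (hm : IsProfile m) (hm' : IsProfile m')
    (t s : ℝ) : Measurable (convProfile m m' t s) := by
  have h : StronglyMeasurable (fun p : ℝ × ℝ => rescale m' s p.2 * rescale m t (p.1 - p.2)) := by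
    have h1 := (hm.contDiff_rescale t).continuous
    have h2 := (hm'.contDiff_rescale s).continuous
    exact (Continuous.mul (h2.comp continuous_snd)
      (h1.comp (continuous_fst.sub continuous_snd))).stronglyMeasurable
  exact (h.integral_prod_right').measurable

lemma _root_.Paracontrolled.exists_bound_convProfile (hm : IsProfile m) (hm' : IsProfile m')
    (t s : ℝ) : ∃ B, ∀ v, |convProfile m m' t s v| ≤ B := by
  obtain ⟨B, hB0, hB⟩ := hm.exists_bound_rescale t
  refine ⟨∫ ρ, |rescale m' s ρ| * B, fun v => ?_⟩
  rw [convProfile, ← Real.norm_eq_abs]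
  have hc : HasCompactSupport (rescale m' s) := by
    by_cases hs : s = 0
    · subst hs
      have : rescale m' 0 = 0 := by ext; simp [rescale]
      rw [this]; exact HasCompactSupport.zero
    · have := hm'.hasCompactSupport.comp_homeomorph (Homeomorph.mulRight₀ s⁻¹ (inv_ne_zero hs))
      exact (this.mul_left (f := fun _ => s⁻¹))
  have hi : Integrable (rescale m' s) :=
    (hm'.contDiff_rescale s).continuous.integrable_of_hasCompactSupport hc
  refine norm_integral_le_of_norm_le (hi.abs.mul_const B) (ae_of_all _ fun ρ => ?_)
  rw [Real.norm_eq_abs, abs_mul]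
  gcongr
  exact hB _

/-- The composition of `t⁻¹ 𝒬_t ℒ⁻¹` with the dual of a standard family is a combination of
integrals of the semigroup against the convolution of the two profiles. -/
lemma Setting.timeConv_duhamel_dualTime (hS : H.Setting A D) (hm : IsProfile m)
    (hm' : IsProfile m') (I J : List (Fin d)) (n c n' c' : ℕ) {t s r : ℝ} (ht : 0 < t)
    (hs : 0 < s) :
    ∀ᵐ p ∂(μ.prod μ), timeConv μ (H.duhamel I [] n c m t) (H.dualTime J n' c' m' s) r p.1 p.2
      = ((√t ^ I.length * t⁻¹ * √s ^ J.length : ℝ) : ℂ) *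
        ∑ i ∈ Finset.range c, ∑ j ∈ Finset.range c',
          ((t ^ (n + i) / i.factorial * (s ^ (n' + j) / j.factorial) : ℝ) : ℂ) *
          H.smear (convProfile m m' t s) I (n + i + (n' + j)) J (t + s) r p.1 p.2 := by
  obtain ⟨C, hC⟩ := hS.schur_duhamel hm I [] n c ht r
  obtain ⟨⟨C', hC'⟩, hop⟩ := hS.dualTime_spec hm' J n' c' hs
  obtain ⟨B, hB⟩ := exists_bound_convProfile hm hm' t s
  choose C'' hC'' using fun i j => hS.schur_smear (measurable_convProfile hm hm' t s) hB I
    (n + i + (n' + j)) J (add_pos ht hs) r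
  have hmd : Measurable fun p : ℝ × M × M => H.duhamel I [] n c m t p.1 p.2.1 p.2.2 := by
    have h0 : Measurable fun p : ℝ × M × M => (t, p) := by fun_prop
    have := (hS.measurable_duhamel hm.smooth.continuous.measurable I [] n c).comp h0
    exact this
  have hmd' : Measurable fun p : ℝ × M × M => H.dualTime J n' c' m' s p.1 p.2.1 p.2.2 := by
    have h0 : Measurable fun p : ℝ × M × M => (s, p) := by fun_prop
    have := (hS.measurable_dualTime hm'.smooth.continuous.measurable J n' c').comp h0
    exact this
  obtain ⟨h1, h2⟩ := timeConv_spec (r := r) hmd hmd' (fun ρ hρ => (hC ρ hρ.2.le).1)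
    (fun ρ _ => hC' ρ)
  have hb1 : ∀ i j, SchurBound μ _ (fun x y =>
      ((t ^ (n + i) / i.factorial * (s ^ (n' + j) / j.factorial) : ℝ) : ℂ) *
        H.smear (convProfile m m' t s) I (n + i + (n' + j)) J (t + s) r x y) := fun i j =>
    (hC'' i j r le_rfl).1.const_mul _
  have hb2 : ∀ i, SchurBound μ _ (fun x y => ∑ j ∈ Finset.range c',
      ((t ^ (n + i) / i.factorial * (s ^ (n' + j) / j.factorial) : ℝ) : ℂ) *
        H.smear (convProfile m m' t s) I (n + i + (n' + j)) J (t + s) r x y) := fun i =>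
    SchurBound.sum _ fun j _ => hb1 i j
  refine h1.ae_eq_of_form ((SchurBound.sum (Finset.range c) fun i _ => hb2 i).const_mul _)
    fun v u => ?_
  rw [h2, kform_const_mul, kform_sum _ fun i _ => hb2 i]
  have hF : ∀ i j, IntegrableOn (fun ρ => (rescale m' s ρ : ℂ) * ∫ ρ' in Ioo 0 (r - ρ),
        (rescale m t ρ' : ℂ) * H.matCoef I (n + i + (n' + j)) J v u (t + s + r - (ρ' + ρ)))
        (Ioo 0 r) ∧ ∫ ρ in Ioo 0 r, (rescale m' s ρ : ℂ) * ∫ ρ' in Ioo 0 (r - ρ),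
        (rescale m t ρ' : ℂ) * H.matCoef I (n + i + (n' + j)) J v u (t + s + r - (ρ' + ρ))
        = ∫ w in Ioo 0 r, (convProfile m m' t s w : ℂ) *
          H.matCoef I (n + i + (n' + j)) J v u (t + s + r - w) := by
    intro i j
    obtain ⟨B₁, _, hB₁⟩ := hm.exists_bound_rescale t
    obtain ⟨B₂, _, hB₂⟩ := hm'.exists_bound_rescale s
    have := volterra_fubini (r := r)
      (g := fun w => H.matCoef I (n + i + (n' + j)) J v u (t + s + r - w)) (hm.contDiff_rescale t).continuous (hm'.contDiff_rescale s).continuous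
      hB₁ hB₂ (fun ρ => hm.rescale_eq_zero ht) (fun ρ => hm'.rescale_eq_zero hs)
      (hS.continuousOn_matCoef I (n + i + (n' + j)) J v u (add_pos ht hs))
    exact this
  have e : ∀ ρ ∈ Ioo 0 r,
      kform (kcomp μ (H.duhamel I [] n c m t (r - ρ)) (H.dualTime J n' c' m' s ρ)) v u
      = ((√t ^ I.length * t⁻¹ * √s ^ J.length : ℝ) : ℂ) *
        ∑ i ∈ Finset.range c, ∑ j ∈ Finset.range c',
          ((t ^ (n + i) / i.factorial * (s ^ (n' + j) / j.factorial) : ℝ) : ℂ) *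
          ((rescale m' s ρ : ℂ) * ∫ ρ' in Ioo 0 (r - ρ), (rescale m t ρ' : ℂ) *
            H.matCoef I (n + i + (n' + j)) J v u (t + s + r - (ρ' + ρ))) := by
    intro ρ hρ
    have hD := hC (r - ρ) (by linarith [hρ.1])
    have hk := hasKernel_opOf hD.1
    rw [← (HasKernel.comp hD.1 (hC' ρ) hk (hop ρ)).inner_eq (hD.1.kcomp (hC' ρ)) v u,
      ContinuousLinearMap.comp_apply, hk.inner_eq hD.1, hD.2, Complex.ofReal_mul _ (√s ^ _),
      mul_assoc]
    simp only [List.length_nil, add_zero]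
    congr 1
    rw [Finset.mul_sum]
    refine Finset.sum_congr rfl fun i _ => ?_
    have hi : ∀ j, IntegrableOn (fun ρ' => (rescale m t ρ' : ℂ) *
        H.matCoef I (n + i + (n' + j)) J v u (t + s + (r - ρ) - ρ')) (Ioo 0 (r - ρ)) := fun j =>
      (((Complex.continuous_ofReal.comp (hm.contDiff_rescale t).continuous).continuousOn.mul
        (hS.continuousOn_matCoef I (n + i + (n' + j)) J v u
          (add_pos ht hs))).integrableOn_Icc).mono_set Ioo_subset_Icc_self
    have e2 : ∀ ρ' ∈ Ioo 0 (r - ρ), (rescale m t ρ' : ℂ) * H.matCoef I (n + i) [] v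
        ((((√s ^ J.length * rescale m' s ρ : ℝ) : ℂ) • ∑ j ∈ Finset.range c',
          ((s ^ (n' + j) / j.factorial : ℝ) : ℂ) • H.sandwichOp [] (n' + j) J s) u)
          (t + (r - ρ) - ρ')
        = ((√s ^ J.length * rescale m' s ρ : ℝ) : ℂ) * ∑ j ∈ Finset.range c',
          ((s ^ (n' + j) / j.factorial : ℝ) : ℂ) * ((rescale m t ρ' : ℂ) *
            H.matCoef I (n + i + (n' + j)) J v u (t + s + (r - ρ) - ρ')) := by
      intro ρ' hρ'
      rw [smul_apply, sum_apply, matCoef_smul, matCoef_sum, mul_left_comm, Finset.mul_sum]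
      congr 1
      refine Finset.sum_congr rfl fun j _ => ?_
      rw [smul_apply, matCoef_smul, hS.matCoef_sandwichOp _ _ _ _ _ _ (by linarith [hρ'.2]) hs,
        mul_left_comm]
      congr 3; ring
    rw [setIntegral_congr_fun measurableSet_Ioo e2, integral_const_mul,
      integral_finsetSum _ fun j _ => (hi j).const_mul _, Finset.mul_sum, Finset.mul_sum,
      Finset.mul_sum]
    refine Finset.sum_congr rfl fun j _ => ?_
    rw [integral_const_mul, show (fun ρ' => (rescale m t ρ' : ℂ) *
      H.matCoef I (n + i + (n' + j)) J v u (t + s + (r - ρ) - ρ')) = fun ρ' =>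
      (rescale m t ρ' : ℂ) * H.matCoef I (n + i + (n' + j)) J v u (t + s + r - (ρ' + ρ)) by
        ext ρ'; congr 2; ring]
    push_cast
    ring
  rw [setIntegral_congr_fun measurableSet_Ioo e, integral_const_mul,
    integral_finsetSum _ fun i _ => integrable_finsetSum _ fun j _ => (hF i j).1.const_mul _]
  congr 1
  refine Finset.sum_congr rfl fun i _ => ?_
  rw [integral_finsetSum _ fun j _ => (hF i j).1.const_mul _,
    kform_sum _ fun j _ => hb1 i j]
  refine Finset.sum_congr rfl fun j _ => ?_
  rw [integral_const_mul, (hF i j).2, kform_const_mul, (hC'' i j r le_rfl).2]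

variable (H) in
/-- The operator `∑_{i<c} (t^{n+i}/i!) ∫_0^r m_t(ρ) L^{n+i} e^{-(δ+r-ρ)L} dρ`, multiplied by
`t^{j/2-1}`. -/
def duhamelOp (j n c : ℕ) (m : ℝ → ℝ) (t δ r : ℝ) : L2 M μ →L[ℂ] L2 M μ :=
  ((√t ^ j * t⁻¹ : ℝ) : ℂ) • ∑ i ∈ Finset.range c, ((t ^ (n + i) / i.factorial : ℝ) : ℂ) •
    ∫ ρ in Ioo 0 r, (rescale m t ρ : ℂ) • H.powHeat (n + i) (δ + r - ρ)

lemma Setting.integrableOn_powHeat (hS : H.Setting A D) (hm : IsProfile m) (N : ℕ) {t δ r : ℝ}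
    (hδ : 0 < δ) :
    IntegrableOn (fun ρ => (rescale m t ρ : ℂ) • H.powHeat N (δ + r - ρ)) (Ioo 0 r) := by
  refine IntegrableOn.mono_set (ContinuousOn.integrableOn_Icc ?_) Ioo_subset_Icc_self
  refine (Complex.continuous_ofReal.comp (hm.contDiff_rescale t).continuous).continuousOn.smul ?_
  refine (hS.toAssumptionA.continuousOn_powHeat N).comp (by fun_prop) fun ρ hρ => ?_
  simp only [mem_Ioi]; linarith [hρ.2]

/-- `duhamelOp` is a function of `L`, as an integral of derivatives of the semigroup. -/
lemma Setting.duhamelOp_mem (hS : H.Setting A D) (hm : IsProfile m) (j n c : ℕ) {t δ r : ℝ}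
    (hδ : 0 < δ) (hr : 0 < r) : H.duhamelOp j n c m t δ r ∈ H.functionsOfL := by
  refine Submodule.smul_mem _ _ (Submodule.sum_mem _ fun i _ => Submodule.smul_mem _ _ ?_)
  refine integral_mem_functionsOfL hr (hS.integrableOn_powHeat hm _ hδ) fun ρ hρ => ?_
  exact Submodule.smul_mem _ _ (hS.toAssumptionA.powHeat_mem _ (by linarith [hρ.2]))

lemma Setting.inner_duhamelOp (hS : H.Setting A D) (hm : IsProfile m) (j n c : ℕ) {t δ r : ℝ}
    (hδ : 0 < δ) (S T : L2 M μ →L[ℂ] L2 M μ) (v u : L2 M μ) :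
    inner ℂ v ((S * H.duhamelOp j n c m t δ r * T) u) = ((√t ^ j * t⁻¹ : ℝ) : ℂ) *
      ∑ i ∈ Finset.range c, ((t ^ (n + i) / i.factorial : ℝ) : ℂ) *
        ∫ ρ in Ioo 0 r, (rescale m t ρ : ℂ) *
          inner ℂ v ((S * H.powHeat (n + i) (δ + r - ρ) * T) u) := by
  rw [duhamelOp, mul_smul_comm, smul_mul_assoc, smul_apply, inner_smul_right, Finset.mul_sum,
    Finset.sum_mul, sum_apply, inner_sum]
  congr 1
  refine Finset.sum_congr rfl fun i _ => ?_
  rw [mul_smul_comm, smul_mul_assoc, smul_apply, inner_smul_right]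
  congr 1
  have := ContinuousLinearMap.integral_comp_comm
    ((innerSL ℂ v).comp (S.comp (ContinuousLinearMap.apply ℂ (L2 M μ) (T u))))
    (hS.integrableOn_powHeat (r := r) hm (n + i) (t := t) hδ)
  refine (Eq.trans ?_ this).symm
  refine integral_congr_ae (ae_of_all _ fun ρ => ?_)
  simp

lemma Setting.heat_mul_duhamelOp (hS : H.Setting A D) (hm : IsProfile m) (j n c : ℕ)
    {t δ r : ℝ} (hδ : 0 < δ) {s : ℝ} (hs : 0 ≤ s) :
    H.heat s * H.duhamelOp j n c m t δ r = H.duhamelOp j n c m t (s + δ) r := by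
  refine ContinuousLinearMap.ext fun u => ext_inner_left ℂ fun v => ?_
  have h1 := hS.inner_duhamelOp hm j n c (t := t) (r := r) hδ (H.heat s) 1 v u
  have h2 := hS.inner_duhamelOp hm j n c (t := t) (r := r) (add_pos_of_nonneg_of_pos hs hδ) 1 1 v u
  simp only [mul_one, one_mul] at h1 h2
  rw [h1, h2]
  congr 1
  refine Finset.sum_congr rfl fun i _ => ?_
  congr 1
  refine setIntegral_congr_fun measurableSet_Ioo fun ρ hρ => ?_
  rw [hS.toAssumptionA.heat_mul_powHeat _ hs (by linarith [hρ.2])]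
  congr 4; ring

lemma Setting.duhamelOp_mul_heat (hS : H.Setting A D) (hm : IsProfile m) (j n c : ℕ)
    {t δ r : ℝ} (hδ : 0 < δ) {s : ℝ} (hs : 0 ≤ s) :
    H.duhamelOp j n c m t δ r * H.heat s = H.duhamelOp j n c m t (δ + s) r := by
  refine ContinuousLinearMap.ext fun u => ext_inner_left ℂ fun v => ?_
  have h1 := hS.inner_duhamelOp hm j n c (t := t) (r := r) hδ 1 (H.heat s) v u
  have h2 := hS.inner_duhamelOp hm j n c (t := t) (r := r) (add_pos_of_pos_of_nonneg hδ hs) 1 1 v u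
  simp only [mul_one, one_mul] at h1 h2
  rw [h1, h2]
  congr 1
  refine Finset.sum_congr rfl fun i _ => ?_
  congr 1
  refine setIntegral_congr_fun measurableSet_Ioo fun ρ hρ => ?_
  rw [hS.toAssumptionA.powHeat_mul_heat _ hs (by linarith [hρ.2])]
  congr 4; ring

/-- `t⁻¹ ℒ⁻¹ 𝒬_t^•` is the formal dual of `t⁻¹ 𝒬_t ℒ⁻¹`. -/
lemma Setting.isFormalDual_duhamel (hS : H.Setting A D) (hm : IsProfile m) (J : List (Fin d))
    (n c : ℕ) : H.IsFormalDual (fun t => volterra (H.duhamel J [] n c m t))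
      (fun t => volterra (H.duhamel [] J n c m t)) := by
  refine ⟨J, fun t r => H.duhamelOp J.length n c m t t r, H.duhamel J [] n c m,
    H.duhamel [] J n c m, fun t ht r hr => ⟨hS.duhamelOp_mem hm _ _ _ ht.1 hr, fun u => ?_,
      fun u v huv => ?_⟩, fun _ _ _ => rfl, fun _ _ _ => rfl⟩
  -- The integrand involves the semigroup at times larger than `t` only, and half of `t` is set aside
  -- to make sense of `V_J`.
  · have ht2 : 0 < t / 2 := half_pos ht.1
    have e : H.duhamelOp J.length n c m t t r
        = H.heat (t / 2) * H.duhamelOp J.length n c m t (t / 2) r := by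
      rw [hS.heat_mul_duhamelOp hm _ _ _ ht2 ht2.le, add_halves]
    refine ⟨(H.leftOp J (t / 2) * H.duhamelOp J.length n c m t (t / 2) r) u, ?_, ?_⟩
    · show H.VRel J (H.duhamelOp J.length n c m t t r u) _
      rw [e]
      exact hS.vRel_leftOp J ht2 _
    · obtain ⟨C, hC⟩ := hS.schur_duhamel hm J [] n c ht.1 r
      refine (hC r le_rfl).1.hasKernel_of_form (fun v u => ?_) u
      have h := hS.inner_duhamelOp hm J.length n c (t := t) (r := r) ht2 (H.leftOp J (t / 2)) 1 v u
      rw [mul_one] at h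
      rw [h, (hC r le_rfl).2, List.length_nil, add_zero]
      congr 1
      refine Finset.sum_congr rfl fun i _ => ?_
      congr 1
      refine setIntegral_congr_fun measurableSet_Ioo fun ρ hρ => ?_
      simp only [mul_one]
      rw [matCoef, hS.sandwichOp_nil _ _ (by linarith [hρ.2, ht.1]),
        ← hS.leftPowOp_eq _ _ ht2 (by linarith [hρ.2])]
      congr 4; ring
  · have ht2 : 0 < t / 2 := half_pos ht.1
    have e : H.duhamelOp J.length n c m t t r v
        = (H.duhamelOp J.length n c m t (t / 2) r * H.rightOp J (t / 2)) u := by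
      rw [mul_apply_eq_comp, hS.rightOp_apply ht2 huv, ← mul_apply_eq_comp,
        hS.duhamelOp_mul_heat hm _ _ _ ht2 ht2.le, add_halves]
    show KernelMaps (H.duhamel [] J n c m t r) u (H.duhamelOp J.length n c m t t r v)
    rw [e]
    obtain ⟨C, hC⟩ := hS.schur_duhamel hm [] J n c ht.1 r
    refine (hC r le_rfl).1.hasKernel_of_form (fun v u => ?_) u
    have h := hS.inner_duhamelOp hm J.length n c (t := t) (r := r) ht2 1 (H.rightOp J (t / 2)) v u
    rw [one_mul] at h
    rw [h, (hC r le_rfl).2, List.length_nil, zero_add]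
    congr 1
    refine Finset.sum_congr rfl fun i _ => ?_
    congr 1
    refine setIntegral_congr_fun measurableSet_Ioo fun ρ hρ => ?_
    simp only [one_mul]
    rw [matCoef, hS.sandwichOp_eq [] _ J ht2 (by linarith [hρ.2]), hS.leftOp_nil ht2,
      hS.toAssumptionA.heat_mul_powHeat _ ht2.le (by linarith [hρ.2])]
    congr 5; ring

end Ops

end HeatSystem

/-! ### Primitives and convolutions of profiles -/

namespace IsProfile

variable {m m' : ℝ → ℝ}

lemma integrable_pow_mul (hm : IsProfile m) (i : ℕ) : Integrable fun r => r ^ i * m r :=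
  ((continuous_pow i).mul hm.smooth.continuous).integrable_of_hasCompactSupport
    (hm.hasCompactSupport.mul_left (f := fun r => r ^ i))

/-- The primitive of a profile of mean zero is a profile, with one vanishing moment less. -/
lemma exists_primitive_aux (hm : IsProfile m) {B : ℝ} (hB : ∀ r, |m r| ≤ B) {k : ℕ}
    (h : ∀ i < k + 1, ∫ r, r ^ i * m r = 0) :
    ∃ M, IsProfile M ∧ _root_.deriv M = m ∧ (∀ r, |M r| ≤ 2 * B) ∧
      ∀ i < k, ∫ r, r ^ i * M r = 0 := by
  have hB0 : 0 ≤ B := (abs_nonneg _).trans (hB 0)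
  set M : ℝ → ℝ := fun r => ∫ x in (0 : ℝ)..r, m x with hM
  have hd : ∀ r, HasDerivAt M (m r) r := fun r =>
    intervalIntegral.integral_hasDerivAt_right (hm.smooth.continuous.intervalIntegrable _ _)
      hm.smooth.continuous.stronglyMeasurable.stronglyMeasurableAtFilter
      hm.smooth.continuous.continuousAt
  have hde : _root_.deriv M = m := funext fun r => (hd r).deriv
  have hsupp : Function.support M ⊆ Icc (1 / 2) 2 := by
    intro r hr
    by_contra hc
    refine hr ?_
    rw [mem_Icc, not_and_or, not_le, not_le] at hc
    rcases hc with hc | hc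
    · refine intervalIntegral.integral_zero_ae (ae_of_all _ fun x hx => ?_)
      by_contra hne
      have h1 := (hm.supp hne).1
      have h2 : x ≤ max 0 r := (mem_uIoc.1 hx).elim (fun h => h.2.trans (le_max_right _ _))
        fun h => h.2.trans (le_max_left _ _)
      rcases max_cases 0 r with h3 | h3 <;> linarith
    · have h0 := h 0 (by omega)
      simp only [pow_zero, one_mul] at h0
      rw [hM, ← h0]
      refine intervalIntegral.integral_eq_integral_of_support_subset fun x hx => ?_
      have := hm.supp hx
      exact ⟨by linarith [this.1], by linarith [this.2]⟩
  have hM' : IsProfile M := by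
    refine ⟨?_, hsupp⟩
    rw [contDiff_infty_iff_deriv, hde]
    exact ⟨fun r => (hd r).differentiableAt, hm.smooth⟩
  refine ⟨M, hM', hde, fun r => ?_, fun i hi => ?_⟩
  · by_cases hr : r ∈ Icc (1 / 2) (2 : ℝ)
    · have h1 : ‖∫ x in (0 : ℝ)..r, m x‖ ≤ B * |r - 0| :=
        intervalIntegral.norm_integral_le_of_norm_le_const fun x _ => hB x
      rw [sub_zero, abs_of_nonneg (by linarith [hr.1])] at h1
      refine h1.trans ?_
      nlinarith [hr.2]
    · have : M r = 0 := by
        by_contra h0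
        exact hr (hsupp h0)
      rw [this, abs_zero]; positivity
  · have h1 : ∀ r, HasDerivAt (fun r => r ^ (i + 1) * M r)
        (((i + 1 : ℕ) : ℝ) * r ^ i * M r + r ^ (i + 1) * m r) r := fun r =>
      (hasDerivAt_pow (i + 1) r).mul (hd r)
    have hi1 : Integrable fun r => ((i + 1 : ℕ) : ℝ) * r ^ i * M r := by
      simpa only [mul_assoc] using (hM'.integrable_pow_mul i).const_mul ((i + 1 : ℕ) : ℝ)
    have h2 := integral_eq_zero_of_hasDerivAt_of_integrable h1
      (hi1.add (hm.integrable_pow_mul (i + 1))) (hM'.integrable_pow_mul (i + 1))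
    rw [integral_add hi1 (hm.integrable_pow_mul _), h _ (by omega), add_zero] at h2
    simp only [mul_assoc] at h2
    rw [integral_const_mul] at h2
    exact (mul_eq_zero.1 h2).resolve_left (by positivity)

/-- A profile with `k` vanishing moments is the `k`-th derivative of a profile. -/
lemma exists_primitive : ∀ (k : ℕ) {m : ℝ → ℝ} {B : ℝ}, IsProfile m → (∀ r, |m r| ≤ B) →
    (∀ i < k, ∫ r, r ^ i * m r = 0) →
    ∃ M, IsProfile M ∧ _root_.iteratedDeriv k M = m ∧ ∀ r, |M r| ≤ 2 ^ k * B
  | 0, m, B, hm, hB, _ => ⟨m, hm, by simp, by simpa using hB⟩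
  | k + 1, m, B, hm, hB, h => by
    obtain ⟨M₁, h1, h2, h3, h4⟩ := hm.exists_primitive_aux hB h
    obtain ⟨M, h5, h6, h7⟩ := exists_primitive k h1 h3 h4
    refine ⟨M, h5, by rw [iteratedDeriv_succ, h6, h2], fun r => (h7 r).trans_eq ?_⟩
    ring

lemma abs_le_of_abs_deriv_le (hm : IsProfile m) (h : ∀ r, |_root_.deriv m r| ≤ 1) (r : ℝ) :
    |m r| ≤ 2 := by
  by_cases hr : r ∈ Icc (1 / 2) (2 : ℝ)
  · have h1 := (convex_univ).norm_image_sub_le_of_norm_deriv_le (f := m) (C := 1) (x := 0) (y := r)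
      (fun x _ => (hm.smooth.differentiable (by simp)).differentiableAt) (fun x _ => h x)
      (mem_univ _) (mem_univ _)
    rw [hm.eq_zero le_rfl, sub_zero, sub_zero, one_mul, Real.norm_eq_abs, Real.norm_eq_abs,
      abs_of_nonneg (by linarith [hr.1] : 0 ≤ r)] at h1
    exact h1.trans hr.2
  · have : m r = 0 := by
      by_contra h0
      exact hr (hm.supp h0)
    rw [this, abs_zero]; norm_num

lemma hasCompactSupport_rescale (hm : IsProfile m) {t : ℝ} (ht : 0 < t) :
    HasCompactSupport (rescale m t) :=
  HasCompactSupport.of_support_subset_isCompact isCompact_Icc (hm.support_rescale ht)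

lemma integrable_rescale (hm : IsProfile m) {t : ℝ} (ht : 0 < t) : Integrable (rescale m t) :=
  (hm.contDiff_rescale t).continuous.integrable_of_hasCompactSupport
    (hm.hasCompactSupport_rescale ht)

lemma iteratedDeriv_rescale (hm : IsProfile m) {t : ℝ} (ht : t ≠ 0) :
    ∀ k : ℕ, _root_.iteratedDeriv k (rescale m t)
      = fun r => (t ^ k)⁻¹ * rescale (_root_.iteratedDeriv k m) t r
  | 0 => by simp
  | k + 1 => by
    ext r
    rw [iteratedDeriv_succ, hm.iteratedDeriv_rescale ht k, deriv_const_mul_field,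
      iteratedDeriv_succ, (hm.iteratedDeriv k).rescale_deriv ht, pow_succ]
    field_simp

lemma abs_rescale_le {B : ℝ} (hB : ∀ r, |m r| ≤ B) {t : ℝ} (ht : 0 < t) (r : ℝ) :
    |rescale m t r| ≤ t⁻¹ * B := by
  rw [rescale, abs_mul, abs_of_pos (inv_pos.2 ht)]
  gcongr
  exact hB _

lemma integral_abs_rescale_le (hm : IsProfile m) {B : ℝ} (hB : ∀ r, |m r| ≤ B) {t : ℝ}
    (ht : 0 < t) : ∫ r, |rescale m t r| ≤ 2 * B := by
  have hB0 : 0 ≤ B := (abs_nonneg _).trans (hB 0)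
  have h1 : ∫ r, |rescale m t r| = ∫ r in Icc (t / 2) (2 * t), |rescale m t r| := by
    rw [setIntegral_eq_integral_of_forall_compl_eq_zero]
    intro r hr
    by_contra h
    exact hr (hm.support_rescale ht fun h0 => h (by rw [h0, abs_zero]))
  rw [h1]
  calc ∫ r in Icc (t / 2) (2 * t), |rescale m t r|
      ≤ ∫ r in Icc (t / 2) (2 * t), t⁻¹ * B :=
        integral_mono_of_nonneg (ae_of_all _ fun _ => abs_nonneg _)
          (integrableOn_const (by simp)) (ae_of_all _ fun r => abs_rescale_le hB ht r)
    _ = (2 * t - t / 2) * (t⁻¹ * B) := by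
        rw [setIntegral_const, Real.volume_real_Icc_of_le (by linarith), smul_eq_mul]
    _ ≤ 2 * B := by
        have : (2 * t - t / 2) * (t⁻¹ * B) = 3 / 2 * B := by field_simp; ring
        rw [this]; linarith

end IsProfile

section Convolution

variable {m m' : ℝ → ℝ}

lemma convProfile_eq_convolution (m m' : ℝ → ℝ) (t s : ℝ) :
    convProfile m m' t s
      = convolution (rescale m' s) (rescale m t) (ContinuousLinearMap.mul ℝ ℝ) volume := rfl

lemma convProfile_comm (m m' : ℝ → ℝ) (t s : ℝ) : convProfile m m' t s = convProfile m' m s t := by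
  ext v
  rw [convProfile, convProfile,
    ← integral_sub_left_eq_self (fun ρ => rescale m t ρ * rescale m' s (v - ρ)) volume v]
  congr 1; ext ρ
  rw [sub_sub_cancel, mul_comm]

lemma contDiff_convProfile (hm : IsProfile m) (hm' : IsProfile m') {t s : ℝ} (ht : 0 < t)
    (hs : 0 < s) : ContDiff ℝ ∞ (convProfile m m' t s) := by
  rw [convProfile_eq_convolution]
  exact (hm.hasCompactSupport_rescale ht).contDiff_convolution_right _
    (hm'.integrable_rescale hs).locallyIntegrable (hm.contDiff_rescale t)

lemma deriv_convProfile (hm : IsProfile m) (hm' : IsProfile m') {t s : ℝ} (ht : 0 < t)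
    (hs : 0 < s) (v : ℝ) :
    deriv (convProfile m m' t s) v = t⁻¹ * convProfile (deriv m) m' t s v := by
  have h := (hm.hasCompactSupport_rescale ht).hasDerivAt_convolution_right
    (ContinuousLinearMap.mul ℝ ℝ) (hm'.integrable_rescale hs).locallyIntegrable
    ((hm.contDiff_rescale t).of_le (by simp)) v
  rw [convProfile_eq_convolution, h.deriv, convolution, convProfile, ← integral_const_mul]
  congr 1; ext ρ
  rw [hm.rescale_deriv ht.ne', ContinuousLinearMap.mul_apply']
  field_simp

lemma iteratedDeriv_convProfile (hm : IsProfile m) (hm' : IsProfile m') {t s : ℝ} (ht : 0 < t)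
    (hs : 0 < s) : ∀ j : ℕ, iteratedDeriv j (convProfile m m' t s)
      = fun v => (t ^ j)⁻¹ * convProfile (iteratedDeriv j m) m' t s v
  | 0 => by simp
  | j + 1 => by
    ext v
    rw [iteratedDeriv_succ, iteratedDeriv_convProfile hm hm' ht hs j, deriv_const_mul_field,
      deriv_convProfile (hm.iteratedDeriv j) hm' ht hs, iteratedDeriv_succ, pow_succ, mul_inv,
      mul_assoc]

lemma convProfile_iteratedDeriv_left (hm : IsProfile m) (hm' : IsProfile m') {t s : ℝ} (ht : 0 < t)
    (hs : 0 < s) (j : ℕ) (v : ℝ) : convProfile (iteratedDeriv j m) m' t s v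
      = t ^ j * iteratedDeriv j (convProfile m m' t s) v := by
  rw [iteratedDeriv_convProfile hm hm' ht hs j, mul_inv_cancel_left₀ (by positivity)]

lemma convProfile_iteratedDeriv_right (hm : IsProfile m) (hm' : IsProfile m') {t s : ℝ}
    (ht : 0 < t) (hs : 0 < s) (j : ℕ) (v : ℝ) : convProfile m (iteratedDeriv j m') t s v
      = s ^ j * iteratedDeriv j (convProfile m m' t s) v := by
  rw [convProfile_comm, convProfile_iteratedDeriv_left hm' hm hs ht, convProfile_comm]

lemma abs_convProfile_le (hm' : IsProfile m') {B B' : ℝ} (hB : ∀ r, |m r| ≤ B)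
    (hB' : ∀ r, |m' r| ≤ B') {t s : ℝ} (ht : 0 < t) (hs : 0 < s) (v : ℝ) :
    |convProfile m m' t s v| ≤ 2 * B * B' * t⁻¹ := by
  have hB0 : 0 ≤ B := (abs_nonneg _).trans (hB 0)
  rw [convProfile, ← Real.norm_eq_abs]
  calc ‖∫ ρ, rescale m' s ρ * rescale m t (v - ρ)‖
      ≤ ∫ ρ, |rescale m' s ρ| * (t⁻¹ * B) := by
        refine norm_integral_le_of_norm_le ((hm'.integrable_rescale hs).abs.mul_const _)
          (ae_of_all _ fun ρ => ?_)
        rw [Real.norm_eq_abs, abs_mul]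
        gcongr
        exact IsProfile.abs_rescale_le hB ht _
    _ = (∫ ρ, |rescale m' s ρ|) * (t⁻¹ * B) := integral_mul_const _ _
    _ ≤ 2 * B' * (t⁻¹ * B) := by
        gcongr
        exact hm'.integral_abs_rescale_le hB' hs
    _ = _ := by ring

lemma support_convProfile (hm : IsProfile m) (hm' : IsProfile m') {t s : ℝ} (ht : 0 < t)
    (hs : 0 < s) :
    Function.support (convProfile m m' t s) ⊆ Icc ((t + s) / 2) (2 * (t + s)) := by
  intro v hv
  by_contra hc
  refine hv ?_
  rw [convProfile]
  refine integral_eq_zero_of_ae (ae_of_all _ fun ρ => ?_)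
  by_contra h
  obtain ⟨h1, h2⟩ := mul_ne_zero_iff.1 h
  have h3 := hm'.support_rescale hs h1
  have h4 := hm.support_rescale ht h2
  exact hc ⟨by linarith [h3.1, h4.1], by linarith [h3.2, h4.2]⟩

/-- The convolution of two profiles with `k` and `k'` vanishing moments is, at every scale, a
derivative of order `k + k'` of a function of size `t^k s^{k'} / (t + s)`, and it is itself of the
size that this suggests. -/
lemma exists_convProfile_primitive (hm : IsProfile m) {k : ℕ}
    (hk : ∀ i < k, ∫ r, r ^ i * m r = 0) (K : ℕ) :
    ∃ C : ℝ, 0 < C ∧ ∀ k' ≤ K, ∀ m' : ℝ → ℝ, IsProfile m' →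
      (∀ i < k', ∫ r, r ^ i * m' r = 0) → (∀ r, |m' r| ≤ 2) →
      (∀ r, |iteratedDeriv k m' r| ≤ 2) → ∀ t s : ℝ, 0 < t → 0 < s →
      ∃ Ω : ℝ → ℝ, ContDiff ℝ ∞ Ω ∧ Function.support Ω ⊆ Icc ((t + s) / 2) (2 * (t + s)) ∧
        iteratedDeriv (k + k') Ω = convProfile m m' t s ∧
        (∀ v, |Ω v| ≤ C * (t + s)⁻¹ * t ^ k * s ^ k') ∧
        ∀ v, |convProfile m m' t s v| ≤ C * (t + s)⁻¹ * t ^ k * s ^ k' * ((t + s) ^ (k + k'))⁻¹ := by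
  obtain ⟨B₀, hB₀, hB⟩ : ∃ B₀, 0 ≤ B₀ ∧ ∀ i ≤ K, ∀ r, |iteratedDeriv i m r| ≤ B₀ := by
    choose B hB0 hB using fun i => (hm.iteratedDeriv i).exists_bound
    refine ⟨∑ i ∈ Finset.range (K + 1), B i, Finset.sum_nonneg fun i _ => hB0 i,
      fun i hi r => (hB i r).trans ?_⟩
    exact Finset.single_le_sum (fun i _ => hB0 i) (Finset.mem_range.2 (by omega))
  obtain ⟨M, hM, hMm, hMB⟩ := IsProfile.exists_primitive k hm (fun r => by
    simpa using hB 0 (by omega) r) hk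
  refine ⟨(2 ^ k * B₀ + 1) * 2 ^ K * 2 ^ (k + K + 4), by positivity, ?_⟩
  intro k' hk' m' hm' hmom hb2 hbk t s ht hs
  obtain ⟨M', hM', hMm', hMB'⟩ := IsProfile.exists_primitive k' hm' hb2 hmom
  have hts : 0 < t + s := by positivity
  have hpk : (2 : ℝ) ^ k' ≤ 2 ^ K := pow_le_pow_right₀ (by norm_num) hk'
  have hone : (1 : ℝ) ≤ 2 ^ k := one_le_pow₀ (by norm_num)
  have hone' : (1 : ℝ) ≤ 2 ^ K := one_le_pow₀ (by norm_num)
  have hone'' : (1 : ℝ) ≤ 2 ^ (k + K) := one_le_pow₀ (by norm_num)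
  have hp4 : (2 : ℝ) ^ (k + K + 4) = 16 * 2 ^ (k + K) := by rw [pow_add]; ring
  have hsc := contDiff_convProfile hM hM' ht hs
  -- `(t ∨ s)⁻¹ ≤ 2 (t + s)⁻¹`
  have hmax : ∀ x : ℝ, 0 < x → t + s ≤ 2 * x → x⁻¹ ≤ 2 * (t + s)⁻¹ := by
    intro x hx hxx
    rw [← div_eq_mul_inv, le_div_iff₀ hts, inv_mul_le_iff₀ hx]
    linarith
  -- `M` and `M'` being primitives of `m` and `m'`, of orders `k` and `k'`, the function is `M_t ⋆ M'_s`
  -- up to the powers of `t` and `s` that come from rescaling.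
  refine ⟨fun v => t ^ k * s ^ k' * convProfile M M' t s v, contDiff_const.mul hsc, ?_, ?_, ?_, ?_⟩
  · exact fun v hv => support_convProfile hM hM' ht hs fun h => hv (by simp [h])
  · ext v
    rw [iteratedDeriv_const_mul_field, add_comm k k']
    have h1 : iteratedDeriv (k' + k) (convProfile M M' t s)
        = iteratedDeriv k' (iteratedDeriv k (convProfile M M' t s)) := by
      simp only [iteratedDeriv_eq_iterate, Function.iterate_add_apply]
    have h2 : iteratedDeriv k (convProfile M M' t s) = fun v => (t ^ k)⁻¹ * convProfile m M' t s v := by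
      rw [iteratedDeriv_convProfile hM hM' ht hs, hMm]
    rw [h1, h2, iteratedDeriv_const_mul_field]
    have h3 := convProfile_iteratedDeriv_right hm hM' ht hs k' v
    rw [hMm'] at h3
    rw [h3]
    field_simp
  · intro v
    rw [abs_mul, abs_of_nonneg (by positivity : 0 ≤ t ^ k * s ^ k')]
    have h1 : |convProfile M M' t s v| ≤ (2 ^ k * B₀ + 1) * 2 ^ K * 2 ^ (k + K + 4) * (t + s)⁻¹ := by
      rcases le_total s t with hst | hst
      · have h := abs_convProfile_le hM' hMB hMB' ht hs v
        calc |convProfile M M' t s v| ≤ 2 * (2 ^ k * B₀) * (2 ^ k' * 2) * t⁻¹ := h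
          _ ≤ 2 * (2 ^ k * B₀ + 1) * (2 ^ K * 2) * (2 * (t + s)⁻¹) := by
            gcongr
            · linarith
            · exact hmax t ht (by linarith)
          _ = (2 ^ k * B₀ + 1) * 2 ^ K * 8 * (t + s)⁻¹ := by ring
          _ ≤ _ := by gcongr; linarith
      · rw [convProfile_comm]
        have h := abs_convProfile_le hM hMB' hMB hs ht v
        calc |convProfile M' M s t v| ≤ 2 * (2 ^ k' * 2) * (2 ^ k * B₀) * s⁻¹ := h
          _ ≤ 2 * (2 ^ K * 2) * (2 ^ k * B₀ + 1) * (2 * (t + s)⁻¹) := by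
            gcongr
            · linarith
            · exact hmax s hs (by linarith)
          _ = (2 ^ k * B₀ + 1) * 2 ^ K * 8 * (t + s)⁻¹ := by ring
          _ ≤ _ := by gcongr; linarith
    calc t ^ k * s ^ k' * |convProfile M M' t s v|
        ≤ t ^ k * s ^ k' * ((2 ^ k * B₀ + 1) * 2 ^ K * 2 ^ (k + K + 4) * (t + s)⁻¹) := by gcongr
      _ = _ := by ring
  · intro v
    -- the derivatives fall on the profile with the larger scale
    rcases le_total s t with hst | hst
    · have h3 : convProfile m m' t s v
          = s ^ k' * ((t ^ k')⁻¹ * convProfile (iteratedDeriv k' m) M' t s v) := by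
        have := convProfile_iteratedDeriv_right hm hM' ht hs k' v
        rw [hMm', iteratedDeriv_convProfile hm hM' ht hs] at this
        exact this
      have h4 := abs_convProfile_le hM' (hB k' hk') hMB' ht hs v
      have h5 : (t + s) ^ (k + k') ≤ 2 ^ (k + K) * t ^ k * t ^ k' := by
        calc (t + s) ^ (k + k') ≤ (2 * t) ^ (k + k') := by gcongr; linarith
          _ = 2 ^ (k + k') * t ^ k * t ^ k' := by rw [mul_pow]; ring
          _ ≤ _ := by gcongr; norm_num
      have h6 : (t ^ k')⁻¹ ≤ 2 ^ (k + K) * t ^ k * ((t + s) ^ (k + k'))⁻¹ := by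
        rw [← div_eq_mul_inv, le_div_iff₀ (by positivity), inv_mul_le_iff₀ (by positivity)]
        linarith
      rw [h3, abs_mul, abs_mul, abs_of_nonneg (by positivity : 0 ≤ s ^ k'),
        abs_of_nonneg (by positivity : 0 ≤ (t ^ k')⁻¹)]
      calc s ^ k' * ((t ^ k')⁻¹ * |convProfile (iteratedDeriv k' m) M' t s v|)
          ≤ s ^ k' * ((2 ^ (k + K) * t ^ k * ((t + s) ^ (k + k'))⁻¹) *
            (2 * (2 ^ k * B₀ + 1) * (2 ^ K * 2) * (2 * (t + s)⁻¹))) := by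
            gcongr
            refine h4.trans ?_
            gcongr
            · nlinarith
            · exact hmax t ht (by linarith)
        _ = (2 ^ k * B₀ + 1) * 2 ^ K * (8 * 2 ^ (k + K)) * (t + s)⁻¹ * t ^ k * s ^ k'
            * ((t + s) ^ (k + k'))⁻¹ := by ring
        _ ≤ _ := by
            gcongr
            rw [hp4]; nlinarith
    · have h3 : convProfile m m' t s v
          = t ^ k * ((s ^ k)⁻¹ * convProfile (iteratedDeriv k m') M s t v) := by
        have := convProfile_iteratedDeriv_left hM hm' ht hs k v
        rw [hMm, convProfile_comm M, iteratedDeriv_convProfile hm' hM hs ht] at this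
        exact this
      have h4 := abs_convProfile_le hM hbk hMB hs ht v
      have h5 : (t + s) ^ (k + k') ≤ 2 ^ (k + K) * s ^ k * s ^ k' := by
        calc (t + s) ^ (k + k') ≤ (2 * s) ^ (k + k') := by gcongr; linarith
          _ = 2 ^ (k + k') * s ^ k * s ^ k' := by rw [mul_pow]; ring
          _ ≤ _ := by gcongr; norm_num
      have h6 : (s ^ k)⁻¹ ≤ 2 ^ (k + K) * s ^ k' * ((t + s) ^ (k + k'))⁻¹ := by
        rw [← div_eq_mul_inv, le_div_iff₀ (by positivity), inv_mul_le_iff₀ (by positivity)]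
        linarith
      rw [h3, abs_mul, abs_mul, abs_of_nonneg (by positivity : 0 ≤ t ^ k),
        abs_of_nonneg (by positivity : 0 ≤ (s ^ k)⁻¹)]
      calc t ^ k * ((s ^ k)⁻¹ * |convProfile (iteratedDeriv k m') M s t v|)
          ≤ t ^ k * ((2 ^ (k + K) * s ^ k' * ((t + s) ^ (k + k'))⁻¹) *
            (2 * (2 ^ K * 2) * (2 ^ k * B₀ + 1) * (2 * (t + s)⁻¹))) := by
            gcongr
            refine h4.trans ?_
            gcongr
            · nlinarith
            · linarith
            · exact hmax s hs (by linarith)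
        _ = (2 ^ k * B₀ + 1) * 2 ^ K * (8 * 2 ^ (k + K)) * (t + s)⁻¹ * t ^ k * s ^ k'
            * ((t + s) ^ (k + k'))⁻¹ := by ring
        _ ≤ _ := by
            gcongr
            rw [hp4]; nlinarith

end Convolution

/-! ### Size of the kernels -/

lemma sqrt_mul_inv_pow {a w : ℝ} (ha : 0 ≤ a) (p : ℕ) :
    √a ^ p * (√w ^ p)⁻¹ = √(a / w) ^ p := by
  rw [Real.sqrt_div ha, div_pow, div_eq_mul_inv]

lemma sqrt_pow_two_mul {a : ℝ} (ha : 0 ≤ a) (p : ℕ) : √a ^ (2 * p) = a ^ p := by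
  rw [pow_mul, Real.sq_sqrt ha]

namespace HeatSystem

section Ops

variable {M : Type*} [MetricSpace M] [ProperSpace M] [MeasurableSpace M] [BorelSpace M]
  {μ : Measure M} [SigmaFinite μ] [Nonempty M] {d : ℕ} {H : HeatSystem M μ d} {A : ℝ} {D : ℕ}
  {m : ℝ → ℝ}

/-- When `f` lives at times at most `2θ`, the times `θ + r - ρ` at which the semigroup is
evaluated in `smear` are comparable to `θ + r`. -/
lemma Setting.exists_smear_le (hS : H.Setting A D) (n : ℕ) :
    ∃ C c, 0 < C ∧ 0 < c ∧ ∀ I J : List (Fin d), ∀ N : ℕ, I.length ≤ n → J.length ≤ n → N ≤ n →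
      ∀ (f : ℝ → ℝ) (F θ r : ℝ), 0 < θ → 0 < r → (∀ ρ, |f ρ| ≤ F) →
      Function.support f ⊆ Iic (2 * θ) → ∀ x y : M,
      ‖H.smear f I N J θ r x y‖ ≤ C * (θ * F) * (√(θ + r) ^ (I.length + 2 * N + J.length))⁻¹
        * gau μ c (θ + r) x y := by
  obtain ⟨C, c, hC, hc, hG⟩ := hS.exists_gaussDecay n
  have hA : 1 ≤ A := hS.growth.one_le
  have hA0 : 0 < A := by linarith
  refine ⟨2 * (C * 5 ^ (4 * n) * (A * 5 ^ D)), c, by positivity, hc, ?_⟩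
  intro I J N hI hJ hN f F θ r hθ hr hF hsupp x y
  have hF0 : 0 ≤ F := (abs_nonneg _).trans (hF 0)
  set w := θ + r with hw
  have hw0 : 0 < w := by positivity
  set p := I.length + 2 * N + J.length with hp
  set E := C * 5 ^ (4 * n) * (A * 5 ^ D) * (√w ^ p)⁻¹ * gau μ c w x y with hE
  have hg0 := gau_nonneg (μ := μ) c w x y
  have hE0 : 0 ≤ E := by positivity
  have key : ∀ u, 0 < u → u ≤ w → w ≤ 5 * u → ‖H.sandwich I N J u x y‖ ≤ E := by
    intro u hu huw hwu
    have h1 := (hG I J N hI hJ hN).norm_le hu x y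
    have h2 := hS.growth.gau_le_of_scale hc (by norm_num : (1 : ℝ) ≤ 5) u w hu huw hwu x y
    have h3 : √w ≤ 5 * √u := by
      rw [Real.sqrt_le_left (by positivity), mul_pow, Real.sq_sqrt hu.le]
      linarith
    have h4 : (√u ^ p)⁻¹ ≤ 5 ^ (4 * n) * (√w ^ p)⁻¹ := by
      have hsu : 0 < √u := Real.sqrt_pos.2 hu
      have hsw : 0 < √w := Real.sqrt_pos.2 hw0
      rw [← div_eq_mul_inv, le_div_iff₀ (by positivity), inv_mul_le_iff₀ (by positivity)]
      calc √w ^ p ≤ (5 * √u) ^ p := by gcongr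
        _ = √u ^ p * 5 ^ p := by rw [mul_pow, mul_comm]
        _ ≤ √u ^ p * 5 ^ (4 * n) := by
          gcongr
          · norm_num
          · omega
    calc ‖H.sandwich I N J u x y‖ ≤ C * (√u ^ p)⁻¹ * gau μ c u x y := h1
      _ ≤ C * (5 ^ (4 * n) * (√w ^ p)⁻¹) * (A * 5 ^ D * gau μ c w x y) := by
        gcongr
        exact gau_nonneg _ _ _ _
      _ = E := by rw [hE]; ring
  rw [smear, ← integral_indicator measurableSet_Ioo]
  calc ‖∫ ρ, (Ioo 0 r).indicator (fun ρ => (f ρ : ℂ) * H.sandwich I N J (w - ρ) x y) ρ‖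
      ≤ ∫ ρ, (Ioc 0 (2 * θ)).indicator (fun _ => F * E) ρ := by
        refine norm_integral_le_of_norm_le ((integrable_indicator_iff measurableSet_Ioc).2
          (integrableOn_const measure_Ioc_lt_top.ne)) (ae_of_all _ fun ρ => ?_)
        by_cases hρ : ρ ∈ Ioo 0 r
        · rw [indicator_of_mem hρ, norm_mul, Complex.norm_real, Real.norm_eq_abs]
          by_cases h0 : f ρ = 0
          · rw [h0, abs_zero, zero_mul]
            exact indicator_nonneg (fun _ _ => by positivity) _
          · have hρ2 : ρ ≤ 2 * θ := hsupp h0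
            rw [indicator_of_mem (show ρ ∈ Ioc 0 (2 * θ) from ⟨hρ.1, hρ2⟩)]
            gcongr
            · exact hF ρ
            · refine key _ (by linarith [hρ.2]) (by linarith [hρ.1]) ?_
              rcases le_total r (4 * θ) with h | h
              · linarith [hρ.2]
              · linarith
        · rw [indicator_of_notMem hρ, norm_zero]
          exact indicator_nonneg (fun _ _ => by positivity) _
    _ = 2 * θ * (F * E) := by
        rw [integral_indicator measurableSet_Ioc, setIntegral_const,
          Real.volume_real_Ioc_of_le (by linarith), smul_eq_mul, sub_zero]
    _ = _ := by rw [hE]; ring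

/-- Integration by parts in time trades the cancellation of the time profile for powers of `L`.
For elapsed times `r ≤ 4θ` there is nothing to gain, and the bound is the plain one. -/
lemma Setting.exists_smear_iteratedDeriv_le (hS : H.Setting A D) (n : ℕ) :
    ∃ C c, 0 < C ∧ 0 < c ∧ ∀ I J : List (Fin d), ∀ N κ : ℕ, I.length ≤ n → J.length ≤ n →
      N + κ ≤ n → ∀ (Ω : ℝ → ℝ) (F θ r : ℝ), 0 < θ → 0 < r → ContDiff ℝ ∞ Ω →
      Function.support Ω ⊆ Icc (θ / 2) (2 * θ) → (∀ ρ, |Ω ρ| ≤ F) →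
      (∀ ρ, |iteratedDeriv κ Ω ρ| ≤ F * (θ ^ κ)⁻¹) → ∀ᵐ p ∂(μ.prod μ),
      ‖H.smear (iteratedDeriv κ Ω) I N J θ r p.1 p.2‖ ≤
        C * (θ * F) * (√(θ + r) ^ (I.length + 2 * (N + κ) + J.length))⁻¹
          * gau μ c (θ + r) p.1 p.2 := by
  obtain ⟨C, c, hC, hc, hb⟩ := hS.exists_smear_le n
  refine ⟨C * 5 ^ n, c, by positivity, hc, ?_⟩
  intro I J N κ hI hJ hN Ω F θ r hθ hr hΩ hsupp hF hF'
  have hF0 : 0 ≤ F := (abs_nonneg _).trans (hF 0)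
  have h5 : (1 : ℝ) ≤ 5 ^ n := one_le_pow₀ (by norm_num)
  -- For `r > 4θ` the support of `Ω` is inside `(0, r)` and there are no boundary terms.
  rcases le_or_gt r (4 * θ) with h | h
  · refine ae_of_all _ fun p => ?_
    have hs : Function.support (iteratedDeriv κ Ω) ⊆ Iic (2 * θ) := by
      have h1 : ∀ κ : ℕ, Function.support (iteratedDeriv κ Ω) ⊆ Icc (θ / 2) (2 * θ) := by
        intro κ
        induction κ with
        | zero => simpa using hsupp
        | succ κ ih =>
          rw [iteratedDeriv_succ]
          exact support_deriv_subset.trans (closure_minimal ih isClosed_Icc)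
      exact (h1 κ).trans Icc_subset_Iic_self
    refine (hb I J N hI hJ (by omega) _ _ θ r hθ hr hF' hs p.1 p.2).trans ?_
    have hg0 := gau_nonneg (μ := μ) c (θ + r) p.1 p.2
    have hsw : 0 < √(θ + r) := Real.sqrt_pos.2 (by positivity)
    have h1 : (θ ^ κ)⁻¹ ≤ 5 ^ n * ((θ + r) ^ κ)⁻¹ := by
      rw [← div_eq_mul_inv, le_div_iff₀ (by positivity), inv_mul_le_iff₀ (by positivity)]
      calc (θ + r) ^ κ ≤ (5 * θ) ^ κ := by gcongr; linarith
        _ = θ ^ κ * 5 ^ κ := by rw [mul_pow, mul_comm]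
        _ ≤ θ ^ κ * 5 ^ n := by
          gcongr
          · norm_num
          · omega
    calc C * (θ * (F * (θ ^ κ)⁻¹)) * (√(θ + r) ^ (I.length + 2 * N + J.length))⁻¹
          * gau μ c (θ + r) p.1 p.2
        ≤ C * (θ * (F * (5 ^ n * ((θ + r) ^ κ)⁻¹)))
          * (√(θ + r) ^ (I.length + 2 * N + J.length))⁻¹ * gau μ c (θ + r) p.1 p.2 := by
          gcongr
      _ = _ := by
          rw [show I.length + 2 * (N + κ) + J.length = (I.length + 2 * N + J.length) + 2 * κ by
            ring, pow_add _ (I.length + 2 * N + J.length), sqrt_pow_two_mul (by positivity), mul_inv]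
          ring
  · have hg := hS.smear_iteratedDeriv I J (a := θ / 2) hθ (half_pos hθ) hr
      (by linarith : 2 * θ < r) κ N hΩ hsupp
    filter_upwards [hg] with p hp
    rw [hp, norm_mul, norm_pow, norm_neg, norm_one, one_pow, one_mul]
    refine (hb I J (N + κ) hI hJ hN Ω F θ r hθ hr hF (hsupp.trans Icc_subset_Iic_self)
      p.1 p.2).trans ?_
    have hg0 := gau_nonneg (μ := μ) c (θ + r) p.1 p.2
    gcongr
    nlinarith

/-- Off-diagonal decay in time of `t⁻¹ 𝒬_t ℒ⁻¹`: it improves with the total cancellation. -/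
lemma Setting.exists_duhamel_le (hS : H.Setting A D) (hm : IsProfile m) {k : ℕ}
    (hk : ∀ i < k, ∫ r, r ^ i * m r = 0) (I J : List (Fin d)) (n c : ℕ) :
    ∃ C c', 0 < C ∧ 0 < c' ∧ ∀ t r : ℝ, 0 < t → 0 < r → ∀ᵐ p ∂(μ.prod μ),
      ‖H.duhamel I J n c m t r p.1 p.2‖ ≤
        C * t⁻¹ * √(t / (t + r)) ^ (I.length + J.length + 2 * n + 2 * k)
          * gau μ c' (t + r) p.1 p.2 := by
  obtain ⟨B, hB0, hB⟩ := hm.exists_bound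
  obtain ⟨P, hP, hPm, hPB⟩ := IsProfile.exists_primitive k hm hB hk
  obtain ⟨C, c', hC, hc', hb⟩ :=
    hS.exists_smear_iteratedDeriv_le (I.length + J.length + n + c + k)
  have hone : (1 : ℝ) ≤ 2 ^ k := one_le_pow₀ (by norm_num)
  refine ⟨(c + 1) * (C * (2 ^ k * (B + 1))), c', by positivity, hc', ?_⟩
  intro t r ht hr
  have e : iteratedDeriv k (fun ρ => t ^ k * rescale P t ρ) = rescale m t := by
    ext ρ
    rw [iteratedDeriv_const_mul_field, hP.iteratedDeriv_rescale ht.ne', hPm]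
    field_simp
  have hall : ∀ i ∈ Finset.range c, ∀ᵐ p ∂(μ.prod μ),
      ‖H.smear (rescale m t) I (n + i) J t r p.1 p.2‖ ≤
        C * (t * (t ^ k * (t⁻¹ * (2 ^ k * (B + 1)))))
          * (√(t + r) ^ (I.length + 2 * (n + i + k) + J.length))⁻¹ * gau μ c' (t + r) p.1 p.2 := by
    intro i hi
    rw [← e]
    refine hb I J (n + i) k (by omega) (by omega)
      (by have := Finset.mem_range.1 hi; omega) _ _ t r ht hr
      (contDiff_const.mul (hP.contDiff_rescale t)) ?_ ?_ ?_
    · exact fun v hv => hP.support_rescale ht fun h => hv (by simp [h])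
    · intro ρ
      rw [abs_mul, abs_of_nonneg (by positivity : 0 ≤ t ^ k)]
      gcongr
      exact IsProfile.abs_rescale_le (fun r => (hPB r).trans (by gcongr; linarith)) ht ρ
    · intro ρ
      rw [e]
      refine (IsProfile.abs_rescale_le hB ht ρ).trans ?_
      rw [mul_comm (t ^ k), mul_assoc, mul_inv_cancel₀ (by positivity), mul_one]
      gcongr
      nlinarith
  filter_upwards [(ae_ball_iff (Finset.range c).countable_toSet).2 hall] with p hp
  have hg0 := gau_nonneg (μ := μ) c' (t + r) p.1 p.2
  set q := I.length + J.length + 2 * n + 2 * k with hq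
  set G := gau μ c' (t + r) p.1 p.2 with hG
  have hterm : ∀ i ∈ Finset.range c,
      ‖((t ^ (n + i) / i.factorial : ℝ) : ℂ) * H.smear (rescale m t) I (n + i) J t r p.1 p.2‖ ≤
        C * (2 ^ k * (B + 1)) * (t ^ (n + k) * (√(t + r) ^ q)⁻¹) * G := by
    intro i hi
    have h1 := hp i (by simpa using hi)
    have h2 : t ^ (n + i) / i.factorial ≤ t ^ (n + i) :=
      div_le_self (by positivity) (by exact_mod_cast Nat.one_le_iff_ne_zero.2 i.factorial_ne_zero)
    have h3 : t ^ i * ((t + r) ^ i)⁻¹ ≤ 1 := by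
      rw [← div_eq_mul_inv, ← div_pow]
      exact pow_le_one₀ (by positivity) ((div_le_one (by positivity)).2 (by linarith))
    rw [norm_mul, Complex.norm_real, Real.norm_of_nonneg (by positivity)]
    calc t ^ (n + i) / i.factorial * ‖H.smear (rescale m t) I (n + i) J t r p.1 p.2‖
        ≤ t ^ (n + i) * (C * (t * (t ^ k * (t⁻¹ * (2 ^ k * (B + 1)))))
          * (√(t + r) ^ (I.length + 2 * (n + i + k) + J.length))⁻¹ * G) := by gcongr
      _ = (t ^ i * ((t + r) ^ i)⁻¹) * (C * (2 ^ k * (B + 1)) * (t ^ (n + k) * (√(t + r) ^ q)⁻¹) * G)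
          := by
          rw [show I.length + 2 * (n + i + k) + J.length = q + 2 * i by rw [hq]; ring,
            pow_add _ q, sqrt_pow_two_mul (by positivity), mul_inv, pow_add _ n i, pow_add _ n k]
          field_simp
      _ ≤ 1 * (C * (2 ^ k * (B + 1)) * (t ^ (n + k) * (√(t + r) ^ q)⁻¹) * G) := by
          gcongr
      _ = _ := one_mul _
  rw [duhamel, norm_mul, Complex.norm_real, Real.norm_of_nonneg (by positivity)]
  calc √t ^ (I.length + J.length) * t⁻¹ * ‖∑ i ∈ Finset.range c,
        ((t ^ (n + i) / i.factorial : ℝ) : ℂ) * H.smear (rescale m t) I (n + i) J t r p.1 p.2‖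
      ≤ √t ^ (I.length + J.length) * t⁻¹ * ∑ i ∈ Finset.range c,
        C * (2 ^ k * (B + 1)) * (t ^ (n + k) * (√(t + r) ^ q)⁻¹) * G := by
        gcongr
        exact (norm_sum_le _ _).trans (Finset.sum_le_sum hterm)
    _ = c * (C * (2 ^ k * (B + 1))) * t⁻¹ * (√t ^ q * (√(t + r) ^ q)⁻¹) * G := by
        rw [Finset.sum_const, Finset.card_range, nsmul_eq_mul, hq,
          show I.length + J.length + 2 * n + 2 * k = (I.length + J.length) + 2 * (n + k) by ring,
          pow_add (√t) (I.length + J.length) (2 * _), sqrt_pow_two_mul ht.le]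
        ring
    _ ≤ (c + 1) * (C * (2 ^ k * (B + 1))) * t⁻¹ * (√t ^ q * (√(t + r) ^ q)⁻¹) * G := by
        have : 0 < √(t + r) := Real.sqrt_pos.2 (by positivity)
        gcongr
        linarith
    _ = _ := by rw [sqrt_mul_inv_pow ht.le]

/-- The compositions with duals of standard families inherit the cancellations of both factors. -/
lemma Setting.exists_timeConv_le (hS : H.Setting A D) (hm : IsProfile m) {k b : ℕ} (hkb : k ≤ b)
    (hb1 : 1 ≤ b) (hk : ∀ i < k, ∫ r, r ^ i * m r = 0) (I : List (Fin d)) (n c : ℕ) :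
    ∃ C c', 0 < C ∧ 0 < c' ∧ ∀ S : StdFamily d, S.Normalized b → S.order ≤ 2 * b →
      ∀ t s r : ℝ, 0 < t → 0 < s → 0 < r → ∀ᵐ p ∂(μ.prod μ),
      ‖timeConv μ (H.duhamel I [] n c m t) (H.dualTime S.J S.n S.c S.m s) r p.1 p.2‖ ≤
        C * t⁻¹ * √(t / (t + s + r)) ^ (I.length + 2 * n + 2 * k)
          * √(s / (t + s + r)) ^ S.order * gau μ c' (t + s + r) p.1 p.2 := by
  obtain ⟨B, hB0, hB⟩ := exists_convProfile_primitive hm hk b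
  obtain ⟨C, c', hC, hc', hb⟩ :=
    hS.exists_smear_iteratedDeriv_le (I.length + n + c + k + 5 * b)
  refine ⟨(c + 1) * (b + 1) * (C * B), c', by positivity, hc', ?_⟩
  intro S hSN hSo t s r ht hs hr
  have hS' : IsProfile S.m := ⟨S.smooth, S.supp⟩
  have hord : S.order = S.J.length + 2 * S.n + 2 * S.k := rfl
  have hSk : S.k ≤ b := by omega
  have hd1 : ∀ r, |deriv S.m r| ≤ 1 := fun r => by
    simpa using hSN.2.2 1 le_rfl hb1 r
  have hb2 : ∀ r, |S.m r| ≤ 2 := hS'.abs_le_of_abs_deriv_le hd1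
  have hbk : ∀ r, |iteratedDeriv k S.m r| ≤ 2 := fun r => by
    rcases Nat.eq_zero_or_pos k with h0 | h0
    · subst h0; simpa using hb2 r
    · exact (hSN.2.2 k h0 hkb r).trans (by norm_num)
  obtain ⟨Ω, hΩ1, hΩ2, hΩ3, hΩ4, hΩ5⟩ := hB S.k hSk S.m hS' S.moments hb2 hbk t s ht hs
  have hts : 0 < t + s := by positivity
  set w := t + s + r with hw
  have hw0 : 0 < w := by positivity
  have hsw : 0 < √w := Real.sqrt_pos.2 hw0
  have hall : ∀ i ∈ Finset.range c, ∀ j ∈ Finset.range S.c, ∀ᵐ p ∂(μ.prod μ),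
      ‖H.smear (convProfile m S.m t s) I (n + i + (S.n + j)) S.J (t + s) r p.1 p.2‖ ≤
        C * ((t + s) * (B * (t + s)⁻¹ * t ^ k * s ^ S.k))
          * (√w ^ (I.length + 2 * (n + i + (S.n + j) + (k + S.k)) + S.J.length))⁻¹
          * gau μ c' w p.1 p.2 := by
    intro i hi j hj
    have hi' := Finset.mem_range.1 hi
    have hj' := Finset.mem_range.1 hj
    have := hSN.2.1
    rw [← hΩ3]
    refine hb I S.J _ (k + S.k) (by omega) (by omega) (by omega) Ω _ (t + s) r hts hr hΩ1 hΩ2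
      hΩ4 ?_
    rw [hΩ3]
    exact hΩ5
  have hall' := (ae_ball_iff (Finset.range c).countable_toSet).2 fun i hi =>
    (ae_ball_iff (Finset.range S.c).countable_toSet).2 (hall i (by simpa using hi))
  filter_upwards [hall', hS.timeConv_duhamel_dualTime hm hS' I S.J n c S.n S.c ht hs (r := r)]
    with p hp he
  have hg0 := gau_nonneg (μ := μ) c' w p.1 p.2
  set G := gau μ c' w p.1 p.2 with hG
  set q := I.length + 2 * n + 2 * k with hq
  set K := C * B * (t ^ (n + k) * s ^ (S.n + S.k) * ((√w ^ q)⁻¹ * (√w ^ S.order)⁻¹)) * G with hK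
  have hK0 : 0 ≤ K := by positivity
  have hterm : ∀ i ∈ Finset.range c, ∀ j ∈ Finset.range S.c,
      ‖((t ^ (n + i) / i.factorial * (s ^ (S.n + j) / j.factorial) : ℝ) : ℂ) *
        H.smear (convProfile m S.m t s) I (n + i + (S.n + j)) S.J (t + s) r p.1 p.2‖ ≤ K := by
    intro i hi j hj
    have h1 := hp i (by simpa using hi) j (by simpa using hj)
    have h2 : t ^ (n + i) / i.factorial ≤ t ^ (n + i) :=
      div_le_self (by positivity) (by exact_mod_cast Nat.one_le_iff_ne_zero.2 i.factorial_ne_zero)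
    have h2' : s ^ (S.n + j) / j.factorial ≤ s ^ (S.n + j) :=
      div_le_self (by positivity) (by exact_mod_cast Nat.one_le_iff_ne_zero.2 j.factorial_ne_zero)
    have h3 : t ^ i * (w ^ i)⁻¹ ≤ 1 := by
      rw [← div_eq_mul_inv, ← div_pow]
      exact pow_le_one₀ (by positivity) ((div_le_one (by positivity)).2 (by linarith))
    have h3' : s ^ j * (w ^ j)⁻¹ ≤ 1 := by
      rw [← div_eq_mul_inv, ← div_pow]
      exact pow_le_one₀ (by positivity) ((div_le_one (by positivity)).2 (by linarith))
    rw [norm_mul, Complex.norm_real, Real.norm_of_nonneg (by positivity)]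
    calc t ^ (n + i) / i.factorial * (s ^ (S.n + j) / j.factorial) *
          ‖H.smear (convProfile m S.m t s) I (n + i + (S.n + j)) S.J (t + s) r p.1 p.2‖
        ≤ t ^ (n + i) * s ^ (S.n + j) * (C * ((t + s) * (B * (t + s)⁻¹ * t ^ k * s ^ S.k))
          * (√w ^ (I.length + 2 * (n + i + (S.n + j) + (k + S.k)) + S.J.length))⁻¹ * G) := by
          gcongr
      _ = (t ^ i * (w ^ i)⁻¹) * (s ^ j * (w ^ j)⁻¹) * K := by
          rw [show I.length + 2 * (n + i + (S.n + j) + (k + S.k)) + S.J.length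
            = q + S.order + 2 * i + 2 * j by rw [hq, hord]; ring,
            pow_add _ (q + S.order + 2 * i), pow_add _ (q + S.order), pow_add _ q,
            sqrt_pow_two_mul hw0.le, sqrt_pow_two_mul hw0.le, hK, mul_inv, mul_inv, mul_inv,
            pow_add _ n i, pow_add _ S.n j, pow_add _ n k, pow_add _ S.n S.k]
          field_simp
      _ ≤ 1 * 1 * K := by gcongr
      _ = K := by ring
  rw [he, norm_mul, Complex.norm_real, Real.norm_of_nonneg (by positivity)]
  calc √t ^ I.length * t⁻¹ * √s ^ S.J.length * ‖∑ i ∈ Finset.range c, ∑ j ∈ Finset.range S.c,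
        ((t ^ (n + i) / i.factorial * (s ^ (S.n + j) / j.factorial) : ℝ) : ℂ) *
        H.smear (convProfile m S.m t s) I (n + i + (S.n + j)) S.J (t + s) r p.1 p.2‖
      ≤ √t ^ I.length * t⁻¹ * √s ^ S.J.length *
        ∑ i ∈ Finset.range c, ∑ j ∈ Finset.range S.c, K := by
        gcongr
        refine (norm_sum_le _ _).trans (Finset.sum_le_sum fun i hi => ?_)
        exact (norm_sum_le _ _).trans (Finset.sum_le_sum fun j hj => hterm i hi j hj)
    _ = c * S.c * (√t ^ I.length * t⁻¹ * √s ^ S.J.length * K) := by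
        simp only [Finset.sum_const, Finset.card_range, nsmul_eq_mul]
        ring
    _ ≤ (c + 1) * (b + 1) * (√t ^ I.length * t⁻¹ * √s ^ S.J.length * K) := by
        have : (S.c : ℝ) ≤ b := by exact_mod_cast hSN.2.1
        gcongr <;> linarith
    _ = (c + 1) * (b + 1) * (C * B) * t⁻¹ * (√t ^ q * (√w ^ q)⁻¹)
          * (√s ^ S.order * (√w ^ S.order)⁻¹) * G := by
        rw [hK, hq, hord,
          show I.length + 2 * n + 2 * k = I.length + 2 * (n + k) by ring,
          show S.J.length + 2 * S.n + 2 * S.k = S.J.length + 2 * (S.n + S.k) by ring,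
          pow_add (√t), pow_add (√s), sqrt_pow_two_mul ht.le, sqrt_pow_two_mul hs.le]
        ring
    _ = _ := by rw [sqrt_mul_inv_pow ht.le, sqrt_mul_inv_pow hs.le]

end Ops

end HeatSystem

/-! ### Comparison with the reference kernels -/

section RefKernel

variable {M : Type*} [MetricSpace M] [ProperSpace M] [MeasurableSpace M] [BorelSpace M]
  {μ : Measure M} [SigmaFinite μ] {A : ℝ} {D : ℕ}

lemma VolGrowth.pvol_le (hV : VolGrowth μ A D) (e : M × ℝ) {r : ℝ} (hr : 0 < r) :
    0 < pvol μ e r ∧ pvol μ e r ≤ 2 * r ^ 2 * μ.real (Metric.ball e.1 r) := by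
  have hbox : ∀ s : ℝ, 0 < s → (μ.prod volume).real (Metric.ball e.1 s ×ˢ Metric.ball e.2 (s ^ 2))
      = μ.real (Metric.ball e.1 s) * (2 * s ^ 2) := fun s hs => by
    rw [measureReal_prod_prod, Real.volume_real_ball (by positivity)]
  have hfin : ∀ s : ℝ, 0 < s →
      (μ.prod volume) (Metric.ball e.1 s ×ˢ Metric.ball e.2 (s ^ 2)) ≠ ⊤ := fun s hs => by
    rw [Measure.prod_prod]
    exact ENNReal.mul_ne_top (hV.finite _ _).ne measure_ball_lt_top.ne
  have hsub : {e' | pdist e e' < r} ⊆ Metric.ball e.1 r ×ˢ Metric.ball e.2 (r ^ 2) := by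
    intro e' he
    have he : dist e.1 e'.1 + √|e.2 - e'.2| < r := he
    refine ⟨?_, ?_⟩
    · rw [Metric.mem_ball, dist_comm]
      linarith [Real.sqrt_nonneg |e.2 - e'.2|]
    · rw [Metric.mem_ball, dist_comm, Real.dist_eq, ← Real.sqrt_lt' hr]
      linarith [dist_nonneg (x := e.1) (y := e'.1)]
  refine ⟨?_, ?_⟩
  · refine lt_of_lt_of_le ?_ (measureReal_mono (s₁ := Metric.ball e.1 (r / 2) ×ˢ
      Metric.ball e.2 ((r / 2) ^ 2)) ?_ ((measure_mono hsub).trans_lt (hfin r hr).lt_top).ne)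
    · rw [hbox _ (half_pos hr)]
      have := hV.pos e.1 _ (half_pos hr)
      positivity
    · rintro e' ⟨h1, h2⟩
      rw [Metric.mem_ball, dist_comm] at h1 h2
      rw [Real.dist_eq, ← Real.sqrt_lt' (half_pos hr)] at h2
      show dist e.1 e'.1 + √|e.2 - e'.2| < r
      linarith
  · rw [pvol]
    refine (measureReal_mono hsub (hfin r hr)).trans_eq ?_
    rw [hbox r hr]; ring

set_option maxHeartbeats 1000000 in
/-- A Gaussian at scale `θ + r`, where `r` is the elapsed time, which has a sufficient extra decay
in `r / θ`, is dominated by the reference kernel at scale `θ`, as long as times or distances are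
bounded. -/
lemma VolGrowth.exists_le_refKernel [Nonempty M] (hV : VolGrowth μ A D) (ℓ : ℕ) {c R : ℝ}
    (hc : 0 < c) (hR : 0 < R) :
    ∃ C c', 0 < C ∧ 0 < c' ∧ ∀ (θ : ℝ) (e e' : M × ℝ), 0 < θ → θ ≤ 2 → e'.2 < e.2 →
      (e.2 - e'.2 ≤ R ∨ dist e.1 e'.1 ≤ R) →
      θ⁻¹ * (θ / (θ + (e.2 - e'.2))) ^ (2 * ℓ + 1) * gau μ c (θ + (e.2 - e'.2)) e.1 e'.1
        ≤ C * refKernel μ ℓ c' θ e e' := by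
  have hA : 1 ≤ A := hV.one_le
  have hA0 : 0 < A := by linarith
  obtain ⟨C₁, hC₁, hb₁⟩ := one_add_sq_pow_mul_exp_le ℓ hc
  obtain ⟨C₂, hC₂, hb₂⟩ := one_add_sq_pow_mul_exp_le (ℓ + 1 + D) (half_pos hc)
  set c' := c / (2 * (R + 2)) with hc'
  have hc'0 : 0 < c' := by positivity
  have hexp1 : 1 ≤ Real.exp (c' * R ^ 2) := Real.one_le_exp (by positivity)
  refine ⟨2 * 2 ^ ℓ * C₁ + 2 * (A * 2 ^ D) * C₂ * Real.exp (c' * R ^ 2), c', by positivity, hc'0, ?_⟩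
  intro θ e e' hθ hθ2 hlt hor
  set r := e.2 - e'.2 with hr
  set x := dist e.1 e'.1 with hx
  have hr0 : 0 < r := by rw [hr]; linarith
  have hx0 : 0 ≤ x := dist_nonneg
  set w := θ + r with hw
  have hw0 : 0 < w := by positivity
  set z := x ^ 2 / w with hz
  have hz0 : 0 ≤ z := by positivity
  have hzw : z * w = x ^ 2 := by rw [hz]; field_simp
  have habs : |e.2 - e'.2| = r := abs_of_pos hr0
  have hθw : θ / w ≤ 1 := (div_le_one hw0).2 (by linarith)
  have hθw0 : 0 < θ / w := by positivity
  have hsw : 0 < √w := Real.sqrt_pos.2 hw0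
  have hVw := hV.pos e.1 _ hsw
  rw [gau, ← hx, ← hz, refKernel, if_neg (not_le.2 hlt)]
  by_cases hx1 : x ≤ 1
  · rw [if_pos hx1]
    have hsθ : 0 < √θ := Real.sqrt_pos.2 hθ
    obtain ⟨hp0, hp⟩ := hV.pvol_le e hsθ
    rw [Real.sq_sqrt hθ.le] at hp
    have hVm := hV.mono e.1 (Real.sqrt_le_sqrt (by linarith : θ ≤ w))
    have hVθ := hV.pos e.1 _ hsθ
    -- `θ + ρ² ≤ 2 (w + d²)`
    have h1 : 1 + pdist e e' ^ 2 / θ ≤ 2 * (w / θ) * (1 + z) := by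
      have e1 : 2 * (w / θ) * (1 + z) = (2 * (w + x ^ 2)) / θ := by rw [← hzw]; field_simp
      rw [e1, ← div_self hθ.ne', ← add_div]
      gcongr
      rw [pdist, habs, ← hx]
      nlinarith [Real.sq_sqrt hr0.le, sq_nonneg (x - √r)]
    have h0 : 0 < 1 + pdist e e' ^ 2 / θ := by positivity
    have h2 : (θ / w) ^ (2 * ℓ + 1) * (1 + pdist e e' ^ 2 / θ) ^ ℓ * Real.exp (-c * z)
        ≤ 2 ^ ℓ * C₁ := by
      calc (θ / w) ^ (2 * ℓ + 1) * (1 + pdist e e' ^ 2 / θ) ^ ℓ * Real.exp (-c * z)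
          ≤ (θ / w) ^ ℓ * (2 * (w / θ) * (1 + z)) ^ ℓ * Real.exp (-c * z) := by
            gcongr ?_ * ?_ ^ ℓ * _
            · exact pow_le_pow_of_le_one hθw0.le hθw (by omega)
        _ = 2 ^ ℓ * ((1 + z) ^ ℓ * Real.exp (-c * z)) := by
            rw [mul_pow, mul_pow, div_pow, div_pow]; field_simp
        _ ≤ 2 ^ ℓ * C₁ := by gcongr; exact hb₁ z hz0
    have h3 : (θ / w) ^ (2 * ℓ + 1) * Real.exp (-c * z)
        ≤ 2 ^ ℓ * C₁ * ((1 + pdist e e' ^ 2 / θ) ^ ℓ)⁻¹ := by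
      rw [← div_eq_mul_inv, le_div_iff₀ (by positivity)]
      linarith
    have h4 : θ⁻¹ * (μ.real (Metric.ball e.1 √w))⁻¹ ≤ 2 * (pvol μ e √θ)⁻¹ := by
      rw [← mul_inv, ← div_eq_mul_inv, le_div_iff₀ hp0, inv_mul_le_iff₀ (by positivity)]
      nlinarith
    calc θ⁻¹ * (θ / w) ^ (2 * ℓ + 1) * ((μ.real (Metric.ball e.1 √w))⁻¹ * Real.exp (-c * z))
        = (θ⁻¹ * (μ.real (Metric.ball e.1 √w))⁻¹) * ((θ / w) ^ (2 * ℓ + 1) * Real.exp (-c * z)) := by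
          ring
      _ ≤ (2 * (pvol μ e √θ)⁻¹) * (2 ^ ℓ * C₁ * ((1 + pdist e e' ^ 2 / θ) ^ ℓ)⁻¹) := by
          gcongr
      _ = (2 * 2 ^ ℓ * C₁) * ((pvol μ e √θ)⁻¹ * ((1 + pdist e e' ^ 2 / θ) ^ ℓ)⁻¹) := by ring
      _ ≤ _ := by
          gcongr
          have : 0 ≤ 2 * (A * 2 ^ D) * C₂ * Real.exp (c' * R ^ 2) := by positivity
          linarith
  · rw [if_neg hx1, habs]
    rw [not_le] at hx1
    obtain ⟨hp0, hp⟩ := hV.pvol_le e one_pos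
    have hx2 : 1 ≤ x ^ 2 := by nlinarith
    -- `V(x,1) ≤ C (1 + d²/w)^D V(x,√w)`
    have hV1 : μ.real (Metric.ball e.1 1) ≤ A * (2 * (1 + z)) ^ D * μ.real (Metric.ball e.1 √w) := by
      have h1 := hV.growth e.1 √w (1 + (√w)⁻¹) hsw (by simp)
      have h2 := hV.mono e.1 (show (1 : ℝ) ≤ (1 + (√w)⁻¹) * √w by
        rw [add_mul, inv_mul_cancel₀ hsw.ne']; linarith)
      refine (h2.trans h1).trans ?_
      have h3 : 1 + (√w)⁻¹ ≤ 2 * (1 + z) := by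
        have h5 : (√w)⁻¹ ^ 2 ≤ z := by
          rw [inv_pow, Real.sq_sqrt hw0.le, hz, inv_eq_one_div]
          gcongr
        nlinarith [sq_nonneg ((√w)⁻¹ - 1)]
      gcongr
    have hwz : w⁻¹ ≤ 1 + z := by
      have : w⁻¹ ≤ z := by
        rw [hz, inv_eq_one_div]
        gcongr
      linarith
    have h2 : θ⁻¹ * (θ / w) ^ (2 * ℓ + 1) = w⁻¹ * (θ / w) ^ ℓ * (θ / w) ^ ℓ := by
      rw [pow_succ, two_mul, pow_add]; field_simp
    have h3 : (θ / w) ^ ℓ * (1 + x ^ 2 / θ) ^ ℓ ≤ (1 + z) ^ ℓ := by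
      rw [← mul_pow]
      gcongr
      rw [mul_add, mul_one, hz]
      have : θ / w * (x ^ 2 / θ) = x ^ 2 / w := by field_simp
      rw [this]; linarith
    have h3' : (θ / w) ^ ℓ ≤ (1 + z) ^ ℓ * ((1 + x ^ 2 / θ) ^ ℓ)⁻¹ := by
      rw [← div_eq_mul_inv, le_div_iff₀ (by positivity)]
      exact h3
    have h4 : ((1 + r / θ) ^ ℓ)⁻¹ = (θ / w) ^ ℓ := by
      rw [← inv_pow]
      congr 1
      rw [hw]; field_simp
    have h5 : (μ.real (Metric.ball e.1 √w))⁻¹ ≤ 2 * (A * 2 ^ D) * (1 + z) ^ D * (pvol μ e 1)⁻¹ := by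
      rw [← div_eq_mul_inv, le_div_iff₀ hp0, inv_mul_le_iff₀ hVw]
      rw [mul_pow] at hV1
      linarith
    -- If times are bounded then so is `w`, and the Gaussian at scale `√w` gives `exp(-c' d²)`;
    -- if distances are bounded then `exp(-c' d²)` is bounded below.
    have h6 : Real.exp (-(c / 2) * z) ≤ Real.exp (c' * R ^ 2) * Real.exp (-c' * x ^ 2) := by
      rw [← Real.exp_add, Real.exp_le_exp]
      rcases hor with h | h
      · have h7 : c' * x ^ 2 ≤ c / 2 * z := by
          rw [← hzw, hc', div_mul_eq_mul_div, div_le_iff₀ (by positivity)]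
          have : w ≤ R + 2 := by rw [hw]; linarith
          nlinarith [mul_nonneg (mul_nonneg hc.le hz0) (sub_nonneg.2 this)]
        have : 0 ≤ c' * R ^ 2 := by positivity
        linarith
      · have h7 : c' * x ^ 2 ≤ c' * R ^ 2 := by gcongr
        have : 0 ≤ c / 2 * z := by positivity
        linarith
    have h8 : Real.exp (-c * z) = Real.exp (-(c / 2) * z) * Real.exp (-(c / 2) * z) := by
      rw [← Real.exp_add]; congr 1; ring
    calc θ⁻¹ * (θ / w) ^ (2 * ℓ + 1) * ((μ.real (Metric.ball e.1 √w))⁻¹ * Real.exp (-c * z))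
        = w⁻¹ * (θ / w) ^ ℓ * (θ / w) ^ ℓ * ((μ.real (Metric.ball e.1 √w))⁻¹ *
          (Real.exp (-(c / 2) * z) * Real.exp (-(c / 2) * z))) := by rw [h2, h8]
      _ ≤ (1 + z) * (θ / w) ^ ℓ * ((1 + z) ^ ℓ * ((1 + x ^ 2 / θ) ^ ℓ)⁻¹) *
          ((2 * (A * 2 ^ D) * (1 + z) ^ D * (pvol μ e 1)⁻¹) *
          (Real.exp (-(c / 2) * z) * (Real.exp (c' * R ^ 2) * Real.exp (-c' * x ^ 2)))) := by
          gcongr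
      _ = 2 * (A * 2 ^ D) * Real.exp (c' * R ^ 2) *
          ((1 + z) ^ (ℓ + 1 + D) * Real.exp (-(c / 2) * z)) *
          ((pvol μ e 1)⁻¹ * (θ / w) ^ ℓ * ((1 + x ^ 2 / θ) ^ ℓ)⁻¹ * Real.exp (-c' * x ^ 2)) := by
          rw [pow_add, pow_succ]; ring
      _ ≤ 2 * (A * 2 ^ D) * Real.exp (c' * R ^ 2) * C₂ *
          ((pvol μ e 1)⁻¹ * (θ / w) ^ ℓ * ((1 + x ^ 2 / θ) ^ ℓ)⁻¹ * Real.exp (-c' * x ^ 2)) := by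
          gcongr
          exact hb₂ z hz0
      _ ≤ (2 * 2 ^ ℓ * C₁ + 2 * (A * 2 ^ D) * C₂ * Real.exp (c' * R ^ 2)) *
          ((pvol μ e 1)⁻¹ * (θ / w) ^ ℓ * ((1 + x ^ 2 / θ) ^ ℓ)⁻¹ * Real.exp (-c' * x ^ 2)) := by
          gcongr
          have : 0 ≤ 2 * 2 ^ ℓ * C₁ := by positivity
          linarith
      _ = _ := by rw [h4]

end RefKernel

/-! ### Almost everywhere statements in space-time -/

lemma measurableSet_ae {α β : Type*} [MeasurableSpace α] [MeasurableSpace β] (ν : Measure β)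
    [SFinite ν] {P : α → β → Prop} (h : MeasurableSet {p : α × β | P p.1 p.2}) :
    MeasurableSet {a | ∀ᵐ b ∂ν, P a b} :=
  measurable_measure_prodMk_left (ν := ν) h.compl (measurableSet_singleton 0)

section SpaceTime

variable {M : Type*} [MeasurableSpace M] {μ : Measure M} [SigmaFinite μ]

/-- A property that holds for all times, almost everywhere in space, holds almost everywhere in
space-time. -/
lemma ae_of_forall_times {P : (M × ℝ) × (M × ℝ) → Prop} (hP : MeasurableSet {q | P q})
    (h : ∀ τ σ : ℝ, ∀ᵐ p ∂(μ.prod μ), P ((p.1, τ), (p.2, σ))) :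
    ∀ᵐ q ∂((μ.prod volume).prod (μ.prod (volume : Measure ℝ))), P q := by
  have m1 : MeasurableSet {p : (M × ℝ × ℝ) × M | P ((p.1.1, p.1.2.1), (p.2, p.1.2.2))} :=
    (by fun_prop : Measurable fun p : (M × ℝ × ℝ) × M =>
      ((p.1.1, p.1.2.1), (p.2, p.1.2.2))) hP
  have m2 : MeasurableSet {p : M × ℝ × ℝ | ∀ᵐ y ∂μ, P ((p.1, p.2.1), (y, p.2.2))} :=
    measurableSet_ae μ m1
  have m3 : MeasurableSet {p : M × ℝ | ∀ᵐ σ : ℝ, ∀ᵐ y ∂μ, P (p, (y, σ))} :=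
    measurableSet_ae (P := fun (p : M × ℝ) (σ : ℝ) => ∀ᵐ y ∂μ, P (p, (y, σ))) volume
      ((by fun_prop : Measurable fun p : (M × ℝ) × ℝ => (p.1.1, p.1.2, p.2)) m2)
  have h1 : ∀ᵐ x ∂μ, ∀ᵐ τ : ℝ, ∀ᵐ σ : ℝ, ∀ᵐ y ∂μ, P ((x, τ), (y, σ)) := by
    rw [Measure.ae_ae_comm m3]
    refine ae_of_all _ fun τ => ?_
    have m4 : MeasurableSet {p : M × ℝ | ∀ᵐ y ∂μ, P ((p.1, τ), (y, p.2))} :=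
      (by fun_prop : Measurable fun p : M × ℝ => (p.1, τ, p.2)) m2
    rw [Measure.ae_ae_comm m4]
    exact ae_of_all _ fun σ => Measure.ae_ae_of_ae_prod (h τ σ)
  rw [Measure.ae_prod_iff_ae_ae hP]
  have h2 := (Measure.ae_prod_iff_ae_ae (μ := μ) (ν := (volume : Measure ℝ)) m3).2 h1
  filter_upwards [h2] with e he
  have m5 : MeasurableSet {p : M × ℝ | P (e, p)} := measurable_prodMk_left hP
  rw [Measure.ae_prod_iff_ae_ae m5, Measure.ae_ae_comm m5]
  exact he

lemma posMeasure_absolutelyContinuous (μ : Measure M) [SigmaFinite μ] :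
    posMeasure μ ≪ μ.prod volume :=
  Measure.AbsolutelyContinuous.prod Measure.AbsolutelyContinuous.rfl
    Measure.absolutelyContinuous_restrict

lemma ae_posMeasure_nonneg (μ : Measure M) [SigmaFinite μ] :
    ∀ᵐ z ∂(posMeasure μ), (0 : ℝ) ≤ z.2 := by
  have : ∀ᵐ z ∂(μ.prod (volume.restrict (Ici (0 : ℝ)))), z.2 ∈ Ici (0 : ℝ) :=
    Measure.quasiMeasurePreserving_snd.ae (ae_restrict_mem measurableSet_Ici)
  exact this

instance : SigmaFinite (posMeasure μ) := by unfold posMeasure; infer_instance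

lemma measurable_compKernel {α : Type*} [MeasurableSpace α] {K K' : α → M × ℝ → M × ℝ → ℂ}
    (hK : Measurable fun p : α × (M × ℝ) × (M × ℝ) => K p.1 p.2.1 p.2.2)
    (hK' : Measurable fun p : α × (M × ℝ) × (M × ℝ) => K' p.1 p.2.1 p.2.2) :
    Measurable fun p : α × (M × ℝ) × (M × ℝ) => compKernel μ (K p.1) (K' p.1) p.2.1 p.2.2 := by
  refine measurable_kint (K := fun z (p : α × (M × ℝ) × (M × ℝ)) =>
    K p.1 p.2.1 z * K' p.1 z p.2.2) ?_ (posMeasure μ)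
  have h1 : Measurable fun q : (M × ℝ) × α × (M × ℝ) × (M × ℝ) => (q.2.1, q.2.2.1, q.1) := by
    fun_prop
  have h2 : Measurable fun q : (M × ℝ) × α × (M × ℝ) × (M × ℝ) => (q.2.1, q.1, q.2.2.2) := by
    fun_prop
  exact (hK.comp h1).mul (hK'.comp h2)

lemma measurable_act {α : Type*} [MeasurableSpace α] {K : α → M × ℝ → M × ℝ → ℂ}
    (hK : Measurable fun p : α × (M × ℝ) × (M × ℝ) => K p.1 p.2.1 p.2.2)
    {F : α → M × ℝ → ℂ} (hF : Measurable fun p : α × (M × ℝ) => F p.1 p.2) :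
    Measurable fun p : α × (M × ℝ) => act μ (K p.1) (F p.1) p.2 := by
  refine measurable_kint (K := fun z (p : α × (M × ℝ)) => K p.1 p.2 z * F p.1 z) ?_
    (posMeasure μ)
  have h1 : Measurable fun q : (M × ℝ) × α × (M × ℝ) => (q.2.1, q.2.2, q.1) := by fun_prop
  have h2 : Measurable fun q : (M × ℝ) × α × (M × ℝ) => (q.2.1, q.1) := by fun_prop
  exact (hK.comp h1).mul (hF.comp h2)

lemma measurable_volterra_param {α : Type*} [MeasurableSpace α] {k : α → ℝ → M → M → ℂ}
    (hk : Measurable fun p : α × ℝ × M × M => k p.1 p.2.1 p.2.2.1 p.2.2.2) :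
    Measurable fun p : α × (M × ℝ) × (M × ℝ) => volterra (k p.1) p.2.1 p.2.2 := by
  refine Measurable.ite (measurableSet_lt (by fun_prop) (by fun_prop)) ?_ measurable_const
  have h1 : Measurable fun p : α × (M × ℝ) × (M × ℝ) =>
    (p.1, p.2.1.2 - p.2.2.2, p.2.1.1, p.2.2.1) := by fun_prop
  have := hk.comp h1
  exact this

lemma volterra_eq_zero {k : ℝ → M → M → ℂ} {e e' : M × ℝ} (h : e.2 ≤ e'.2) :
    volterra k e e' = 0 := if_neg (not_lt.2 h)

lemma compKernel_volterra_eq_zero {k k' : ℝ → M → M → ℂ} {e e' : M × ℝ} (h : e.2 ≤ e'.2) :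
    compKernel μ (volterra k) (volterra k') e e' = 0 := by
  refine integral_eq_zero_of_ae (ae_of_all _ fun z => ?_)
  show volterra k e z * volterra k' z e' = 0
  rcases le_or_gt e.2 z.2 with h1 | h1
  · rw [volterra_eq_zero h1, zero_mul]
  · rw [volterra_eq_zero (k := k') (by linarith), mul_zero]

lemma compKernel_volterra_ae {k k' : ℝ → M → M → ℂ} {C C' : ℝ≥0}
    (hk : Measurable fun p : ℝ × M × M => k p.1 p.2.1 p.2.2)
    (hk' : Measurable fun p : ℝ × M × M => k' p.1 p.2.1 p.2.2) {τ σ : ℝ} (hσ : 0 ≤ σ)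
    (hC : ∀ ρ ∈ Ioo 0 (τ - σ), SchurBound μ C (k ρ))
    (hC' : ∀ ρ ∈ Ioo 0 (τ - σ), SchurBound μ C' (k' ρ)) :
    ∀ᵐ p ∂(μ.prod μ), compKernel μ (volterra k) (volterra k') (p.1, τ) (p.2, σ)
      = timeConv μ k k' (τ - σ) p.1 p.2 := by
  have h1 : Measurable fun p : M × M =>
      compKernel μ (volterra k) (volterra k') (p.1, τ) (p.2, σ) := by
    have h0 := measurable_compKernel (μ := μ) (α := Unit) (K := fun _ => volterra k)
      (K' := fun _ => volterra k') ((measurable_volterra hk).comp measurable_snd)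
      ((measurable_volterra hk').comp measurable_snd)
    have h2 : Measurable fun p : M × M => ((), (p.1, τ), (p.2, σ)) := by fun_prop
    have := h0.comp h2
    exact this
  rw [Measure.ae_prod_iff_ae_ae (measurableSet_eq_fun h1 (timeConv_spec hk hk' hC hC').1.meas)]
  exact ae_of_all _ fun x => compKernel_volterra hk hk' hσ hC hC' x

end SpaceTime

/-! ### Membership in the classes `G` and `GC^a` -/

/-- A surplus of cancellation, `q` instead of `a`, is converted into decay in `(t + s) / w` and into
the change of the normalization `t⁻¹` into `(t + s)⁻¹`. -/
lemma scale_factors_le {t s w : ℝ} (ht : 0 < t) (hs : 0 < s) (hw : t + s ≤ w) {a a' q N : ℕ}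
    (hq : a + 2 * N + 2 ≤ q) (ha : a ≤ a') :
    t⁻¹ * √(t / w) ^ q * √(s / w) ^ a'
      ≤ (s * t / (s + t) ^ 2) ^ ((a : ℝ) / 2) * ((t + s)⁻¹ * ((t + s) / w) ^ N) := by
  have hw0 : 0 < w := by linarith
  have h1 : √(t / w) ^ q ≤ √(t / w) ^ a * (t / w) ^ N * (t / w) := by
    have e : √(t / w) ^ a * (t / w) ^ N * (t / w) = √(t / w) ^ (a + 2 * N + 2) := by
      rw [pow_add, pow_add, sqrt_pow_two_mul (by positivity), Real.sq_sqrt (by positivity)]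
    rw [e]
    exact pow_le_pow_of_le_one (Real.sqrt_nonneg _)
      (Real.sqrt_le_one.2 ((div_le_one hw0).2 (by linarith))) hq
  have h2 : √(s / w) ^ a' ≤ √(s / w) ^ a :=
    pow_le_pow_of_le_one (Real.sqrt_nonneg _)
      (Real.sqrt_le_one.2 ((div_le_one hw0).2 (by linarith))) ha
  have h3 : √(t / w) ^ a * √(s / w) ^ a ≤ (s * t / (s + t) ^ 2) ^ ((a : ℝ) / 2) := by
    have e : (s * t / (s + t) ^ 2) ^ ((a : ℝ) / 2) = √(s * t / (s + t) ^ 2) ^ a := by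
      rw [Real.sqrt_eq_rpow, ← Real.rpow_natCast (_ ^ (1 / 2 : ℝ)) a,
        ← Real.rpow_mul (by positivity)]
      congr 1; ring
    rw [e, ← mul_pow, ← Real.sqrt_mul (by positivity)]
    gcongr
    rw [div_mul_div_comm, mul_comm t s, sq]
    gcongr <;> linarith
  have h4 : t⁻¹ * (t / w) ≤ (t + s)⁻¹ := by
    rw [inv_mul_eq_div, div_div_cancel_left' ht.ne']
    gcongr
  calc t⁻¹ * √(t / w) ^ q * √(s / w) ^ a'
      ≤ t⁻¹ * (√(t / w) ^ a * (t / w) ^ N * (t / w)) * √(s / w) ^ a := by gcongr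
    _ = (√(t / w) ^ a * √(s / w) ^ a) * ((t⁻¹ * (t / w)) * (t / w) ^ N) := by ring
    _ ≤ _ := by
      gcongr
      linarith

namespace HeatSystem

section Ops

variable {M : Type*} [MetricSpace M] [ProperSpace M] [MeasurableSpace M] [BorelSpace M]
  {μ : Measure M} [SigmaFinite μ] [Nonempty M] {d : ℕ} {H : HeatSystem M μ d} {A : ℝ} {D : ℕ}
  {m : ℝ → ℝ}

lemma measurable_volterra_gau (μ : Measure M) [SigmaFinite μ] (c θ : ℝ) :
    Measurable fun q : (M × ℝ) × (M × ℝ) => gau μ c (θ + (q.1.2 - q.2.2)) q.1.1 q.2.1 := by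
  have h0 : Measurable fun q : (M × ℝ) × (M × ℝ) => (θ + (q.1.2 - q.2.2), q.1.1, q.2.1) := by
    fun_prop
  have := (measurable_gau μ c).comp h0
  exact this

lemma Setting.measurable_duhamel_family (hS : H.Setting A D) (hm : Measurable m)
    (I J : List (Fin d)) (n c : ℕ) :
    Family.IsMeasurable fun t => volterra (H.duhamel I J n c m t) :=
  measurable_volterra_param (hS.measurable_duhamel hm I J n c)

lemma Setting.measurable_duhamel_time (hS : H.Setting A D) (hm : Measurable m)
    (I J : List (Fin d)) (n c : ℕ) (t : ℝ) :
    Measurable fun p : ℝ × M × M => H.duhamel I J n c m t p.1 p.2.1 p.2.2 := by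
  have h0 : Measurable fun p : ℝ × M × M => (t, p) := by fun_prop
  have := (hS.measurable_duhamel hm I J n c).comp h0
  exact this

lemma Setting.measurable_dualTime_time (hS : H.Setting A D) (hm : Measurable m)
    (J : List (Fin d)) (n c : ℕ) (t : ℝ) :
    Measurable fun p : ℝ × M × M => H.dualTime J n c m t p.1 p.2.1 p.2.2 := by
  have h0 : Measurable fun p : ℝ × M × M => (t, p) := by fun_prop
  have := (hS.measurable_dualTime hm J n c).comp h0
  exact this

/-- The pointwise form, almost everywhere in space-time, of `exists_duhamel_le`. -/
lemma Setting.exists_volterra_duhamel_le (hS : H.Setting A D) (hm : IsProfile m) {k : ℕ}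
    (hk : ∀ i < k, ∫ r, r ^ i * m r = 0) (I J : List (Fin d)) (n c : ℕ) :
    ∃ C c', 0 < C ∧ 0 < c' ∧ ∀ t : ℝ, 0 < t →
      ∀ᵐ q ∂((μ.prod volume).prod (μ.prod (volume : Measure ℝ))),
      ‖volterra (H.duhamel I J n c m t) q.1 q.2‖ ≤
        C * t⁻¹ * √(t / (t + (q.1.2 - q.2.2))) ^ (I.length + J.length + 2 * n + 2 * k)
          * gau μ c' (t + (q.1.2 - q.2.2)) q.1.1 q.2.1 := by
  obtain ⟨C, c', hC, hc', h⟩ := hS.exists_duhamel_le hm hk I J n c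
  refine ⟨C, c', hC, hc', fun t ht => ae_of_forall_times (measurableSet_le ?_ ?_) fun τ σ => ?_⟩
  · exact (measurable_volterra
      (hS.measurable_duhamel_time hm.smooth.continuous.measurable I J n c t)).norm
  · exact (by fun_prop : Measurable fun q : (M × ℝ) × (M × ℝ) => C * t⁻¹ *
      √(t / (t + (q.1.2 - q.2.2))) ^ (I.length + J.length + 2 * n + 2 * k)).mul
        (measurable_volterra_gau μ c' t)
  · rcases le_or_gt τ σ with hle | hlt
    · refine ae_of_all _ fun p => ?_
      rw [volterra_eq_zero hle, norm_zero]
      have := gau_nonneg (μ := μ) c' (t + (τ - σ)) p.1 p.2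
      positivity
    · filter_upwards [h t (τ - σ) ht (by linarith)] with p hp
      simpa only [volterra, if_pos hlt] using hp

/-- Over time sets `J ⊆ [0,∞)` for which elapsed times or distances are bounded, the families
`t⁻¹ 𝒬_t ℒ⁻¹` are in `GC^a` when `𝒬` has enough cancellation. -/
lemma Setting.inGC_duhamel (hS : H.Setting A D) (hm : IsProfile m) {k b ℓ a : ℕ} (hkb : k ≤ b)
    (hb1 : 1 ≤ b) (hk : ∀ i < k, ∫ r, r ^ i * m r = 0) (I : List (Fin d)) (n c : ℕ)
    (hq : a + 2 * (2 * ℓ + 1) + 2 ≤ I.length + 2 * n + 2 * k) {J : Set ℝ} (hJ0 : J ⊆ Ici 0)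
    {R : ℝ} (hR : 0 < R) (hJ : ∀ e e' : M × ℝ, e.2 ∈ J → e'.2 ∈ J →
      e.2 - e'.2 ≤ R ∨ dist e.1 e'.1 ≤ R) :
    H.InGC ℓ b a J (fun t => volterra (H.duhamel I [] n c m t)) := by
  have hmm := hm.smooth.continuous.measurable
  have href : ∀ (c' θ : ℝ) (e e' : M × ℝ), e.2 ≤ e'.2 → refKernel μ ℓ c' θ e e' = 0 :=
    fun c' θ e e' h => if_pos h
  refine ⟨?_, ?_⟩
  · obtain ⟨C, c', hC, hc', h⟩ := hS.exists_volterra_duhamel_le hm hk I [] n c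
    obtain ⟨C₂, c₂, hC₂, hc₂, h₂⟩ := hS.growth.exists_le_refKernel ℓ hc' hR
    refine ⟨C * C₂, c₂, hc₂, fun t ht => ?_⟩
    filter_upwards [h t ht.1] with q hq' h1 h2
    rcases le_or_gt q.1.2 q.2.2 with hle | hlt
    · rw [volterra_eq_zero hle, href _ _ _ _ hle]; simp
    · have hg0 := gau_nonneg (μ := μ) c' (t + (q.1.2 - q.2.2)) q.1.1 q.2.1
      have ht0 := ht.1
      have hr0 : 0 < q.1.2 - q.2.2 := by linarith
      refine hq'.trans ?_
      calc C * t⁻¹ * √(t / (t + (q.1.2 - q.2.2))) ^ (I.length + ([] : List (Fin d)).length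
            + 2 * n + 2 * k) * gau μ c' (t + (q.1.2 - q.2.2)) q.1.1 q.2.1
          ≤ C * t⁻¹ * √(t / (t + (q.1.2 - q.2.2))) ^ (2 * (2 * ℓ + 1))
            * gau μ c' (t + (q.1.2 - q.2.2)) q.1.1 q.2.1 := by
            gcongr ?_ * ?_ * _
            refine pow_le_pow_of_le_one (Real.sqrt_nonneg _) (Real.sqrt_le_one.2
              ((div_le_one (by positivity)).2 (by linarith))) ?_
            simp only [List.length_nil]
            omega
        _ = C * (t⁻¹ * (t / (t + (q.1.2 - q.2.2))) ^ (2 * ℓ + 1)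
            * gau μ c' (t + (q.1.2 - q.2.2)) q.1.1 q.2.1) := by
            rw [sqrt_pow_two_mul (by positivity)]; ring
        _ ≤ C * (C₂ * refKernel μ ℓ c₂ t q.1 q.2) := by
            refine mul_le_mul_of_nonneg_left ?_ hC.le
            exact h₂ t q.1 q.2 ht.1 (by linarith [ht.2]) hlt (hJ _ _ h1 h2)
        _ = _ := by ring
  · obtain ⟨C, c', hC, hc', h⟩ := hS.exists_timeConv_le hm hkb hb1 hk I n c
    obtain ⟨C₂, c₂, hC₂, hc₂, h₂⟩ := hS.growth.exists_le_refKernel ℓ hc' hR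
    refine ⟨C * C₂, c₂, hc₂, fun t ht s hs a' ha' ha'b S hSt => ?_⟩
    have ht0 := ht.1
    have hs0 := hs.1
    have hS' : IsProfile S.m := ⟨S.smooth, S.supp⟩
    have hdual : H.stdDual S s = volterra (H.dualTime S.J S.n S.c S.m s) :=
      dualFamily_eq_volterra hS' S.J S.n S.c hs0
    have hk1 := hS.measurable_duhamel_time hmm I [] n c t
    have hk2 := hS.measurable_dualTime_time hS'.smooth.continuous.measurable S.J S.n S.c s
    have hmeas : Measurable fun q : (M × ℝ) × (M × ℝ) => compKernel μ
        (volterra (H.duhamel I [] n c m t)) (volterra (H.dualTime S.J S.n S.c S.m s)) q.1 q.2 := by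
      have h0 := measurable_compKernel (μ := μ) (α := Unit)
        (K := fun _ => volterra (H.duhamel I [] n c m t))
        (K' := fun _ => volterra (H.dualTime S.J S.n S.c S.m s))
        ((measurable_volterra hk1).comp measurable_snd)
        ((measurable_volterra hk2).comp measurable_snd)
      have h2 : Measurable fun p : (M × ℝ) × (M × ℝ) => ((), p) := by fun_prop
      have := h0.comp h2
      exact this
    have hae : ∀ᵐ q ∂((μ.prod volume).prod (μ.prod (volume : Measure ℝ))), q.2.2 < 0 ∨
        ‖compKernel μ (volterra (H.duhamel I [] n c m t))
          (volterra (H.dualTime S.J S.n S.c S.m s)) q.1 q.2‖ ≤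
        C * t⁻¹ * √(t / (t + s + (q.1.2 - q.2.2))) ^ (I.length + 2 * n + 2 * k)
          * √(s / (t + s + (q.1.2 - q.2.2))) ^ S.order
          * gau μ c' (t + s + (q.1.2 - q.2.2)) q.1.1 q.2.1 := by
      refine ae_of_forall_times (MeasurableSet.union
        (measurableSet_lt (measurable_snd.comp measurable_snd) measurable_const)
        (measurableSet_le hmeas.norm ?_)) fun τ σ => ?_
      · exact (by fun_prop : Measurable fun q : (M × ℝ) × (M × ℝ) => C * t⁻¹ *
          √(t / (t + s + (q.1.2 - q.2.2))) ^ (I.length + 2 * n + 2 * k)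
            * √(s / (t + s + (q.1.2 - q.2.2))) ^ S.order).mul (measurable_volterra_gau μ c' (t + s))
      · rcases lt_or_ge σ 0 with hσ | hσ
        · exact ae_of_all _ fun p => Or.inl hσ
        rcases le_or_gt τ σ with hle | hlt
        · refine ae_of_all _ fun p => Or.inr ?_
          rw [compKernel_volterra_eq_zero hle, norm_zero]
          have := gau_nonneg (μ := μ) c' (t + s + (τ - σ)) p.1 p.2
          positivity
        · obtain ⟨C₃, hC₃⟩ := hS.schur_duhamel hm I [] n c ht0 (τ - σ)
          obtain ⟨⟨C₄, hC₄⟩, -⟩ := hS.dualTime_spec hS' S.J S.n S.c hs0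
          filter_upwards [h S hSt.1 (hSt.2.le.trans ha'b) t s (τ - σ) ht0 hs0 (by linarith),
            compKernel_volterra_ae hk1 hk2 hσ (fun ρ hρ => (hC₃ ρ hρ.2.le).1)
              (fun ρ _ => hC₄ ρ)] with p hp he
          right
          simpa only [he] using hp
    unfold KernelBound
    filter_upwards [hae] with q hq' h1 h2
    rw [hdual]
    rcases le_or_gt q.1.2 q.2.2 with hle | hlt
    · rw [compKernel_volterra_eq_zero hle, href _ _ _ _ hle]; simp
    · have hq2 := hq'.resolve_left (not_lt.2 (hJ0 h2))
      have hg0 := gau_nonneg (μ := μ) c' (t + s + (q.1.2 - q.2.2)) q.1.1 q.2.1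
      have hr0 : 0 < q.1.2 - q.2.2 := by linarith
      have hsc := scale_factors_le ht0 hs0 (w := t + s + (q.1.2 - q.2.2)) (by linarith) hq
        (ha'.trans hSt.2.ge)
      have hX : 0 ≤ (s * t / (s + t) ^ 2) ^ ((a : ℝ) / 2) := by positivity
      calc _ ≤ C * t⁻¹ * √(t / (t + s + (q.1.2 - q.2.2))) ^ (I.length + 2 * n + 2 * k)
            * √(s / (t + s + (q.1.2 - q.2.2))) ^ S.order
            * gau μ c' (t + s + (q.1.2 - q.2.2)) q.1.1 q.2.1 := hq2
        _ = C * (t⁻¹ * √(t / (t + s + (q.1.2 - q.2.2))) ^ (I.length + 2 * n + 2 * k)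
            * √(s / (t + s + (q.1.2 - q.2.2))) ^ S.order)
            * gau μ c' (t + s + (q.1.2 - q.2.2)) q.1.1 q.2.1 := by ring
        _ ≤ C * ((s * t / (s + t) ^ 2) ^ ((a : ℝ) / 2) *
            ((t + s)⁻¹ * ((t + s) / (t + s + (q.1.2 - q.2.2))) ^ (2 * ℓ + 1)))
            * gau μ c' (t + s + (q.1.2 - q.2.2)) q.1.1 q.2.1 := by gcongr
        _ = C * (s * t / (s + t) ^ 2) ^ ((a : ℝ) / 2) *
            ((t + s)⁻¹ * ((t + s) / (t + s + (q.1.2 - q.2.2))) ^ (2 * ℓ + 1)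
            * gau μ c' (t + s + (q.1.2 - q.2.2)) q.1.1 q.2.1) := by ring
        _ ≤ C * (s * t / (s + t) ^ 2) ^ ((a : ℝ) / 2) * (C₂ * refKernel μ ℓ c₂ (t + s) q.1 q.2) := by
            refine mul_le_mul_of_nonneg_left ?_ (by positivity)
            exact h₂ (t + s) q.1 q.2 (by linarith) (by linarith [ht.2, hs.2]) hlt (hJ _ _ h1 h2)
        _ = _ := by ring

end Ops

end HeatSystem

/-! ### Operators in space-time acting on bounded functions -/

section Act

variable {M : Type*} [MeasurableSpace M] {μ : Measure M} [SigmaFinite μ]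

lemma integrable_mul_of_bounded {K F : M × ℝ → ℂ} {ν : Measure (M × ℝ)} (hK : Measurable K)
    (hF : Measurable F) (hfin : ∫⁻ z, ‖K z‖ₑ ∂ν ≠ ⊤) {B : ℝ}
    (hB : ∀ᵐ z ∂ν, K z = 0 ∨ ‖F z‖ ≤ B) : Integrable (fun z => K z * F z) ν := by
  have hi : Integrable (fun z => ‖K z‖ * B) ν :=
    (Integrable.norm ⟨hK.aestronglyMeasurable, lt_top_iff_ne_top.2 hfin⟩).mul_const B
  refine hi.mono' (hK.mul hF).aestronglyMeasurable ?_
  filter_upwards [hB] with z hz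
  rw [norm_mul]
  rcases hz with h | h
  · simp [h]
  · gcongr

lemma norm_integral_mul_le {K F : M × ℝ → ℂ} {ν : Measure (M × ℝ)} (hK : Measurable K)
    {C : ℝ≥0} (hC : ∫⁻ z, ‖K z‖ₑ ∂ν ≤ C) {B : ℝ} (hB0 : 0 ≤ B)
    (hB : ∀ᵐ z ∂ν, K z = 0 ∨ ‖F z‖ ≤ B) : ‖∫ z, K z * F z ∂ν‖ ≤ C * B := by
  have hKi : Integrable K ν :=
    ⟨hK.aestronglyMeasurable, hC.trans_lt ENNReal.coe_lt_top⟩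
  calc ‖∫ z, K z * F z ∂ν‖ ≤ ∫ z, ‖K z‖ * B ∂ν := by
        refine norm_integral_le_of_norm_le (hKi.norm.mul_const B) ?_
        filter_upwards [hB] with z hz
        rw [norm_mul]
        rcases hz with h | h
        · simp [h]
        · gcongr
    _ = (∫ z, ‖K z‖ ∂ν) * B := integral_mul_const _ _
    _ ≤ C * B := by
        gcongr
        rw [integral_norm_eq_lintegral_enorm hK.aestronglyMeasurable]
        exact ENNReal.toReal_le_coe_of_le_coe hC

/-- Associativity of the action of kernels on bounded functions. -/
lemma act_act {K K' : M × ℝ → M × ℝ → ℂ}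
    (hK : Measurable fun p : (M × ℝ) × (M × ℝ) => K p.1 p.2)
    (hK' : Measurable fun p : (M × ℝ) × (M × ℝ) => K' p.1 p.2) {h : M × ℝ → ℂ}
    (hh : Measurable h) {B : ℝ} (hB : ∀ e, ‖h e‖ ≤ B) {e : M × ℝ}
    (hfin : ∫⁻ z, ‖K e z‖ₑ ∂(posMeasure μ) ≠ ⊤) {C : ℝ≥0}
    (hC : ∀ z, K e z = 0 ∨ ∫⁻ e', ‖K' z e'‖ₑ ∂(posMeasure μ) ≤ C) :
    act μ K (act μ K' h) e = act μ (compKernel μ K K') h e := by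
  have hmeas : Measurable fun p : (M × ℝ) × (M × ℝ) => K e p.1 * K' p.1 p.2 * h p.2 := by
    have h1 : Measurable fun p : (M × ℝ) × (M × ℝ) => K e p.1 :=
      hK.comp (by fun_prop : Measurable fun p : (M × ℝ) × (M × ℝ) => (e, p.1))
    exact (h1.mul hK').mul (hh.comp measurable_snd)
  have hint : Integrable (fun p : (M × ℝ) × (M × ℝ) => K e p.1 * K' p.1 p.2 * h p.2)
      ((posMeasure μ).prod (posMeasure μ)) := by
    refine ⟨hmeas.aestronglyMeasurable, ?_⟩
    rw [HasFiniteIntegral, lintegral_prod _ hmeas.enorm.aemeasurable]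
    calc ∫⁻ z, ∫⁻ e', ‖K e z * K' z e' * h e'‖ₑ ∂(posMeasure μ) ∂(posMeasure μ)
        ≤ ∫⁻ z, ‖K e z‖ₑ * (C * B.toNNReal : ℝ≥0) ∂(posMeasure μ) := by
          refine lintegral_mono fun z => ?_
          have h2 : ∀ e', ‖h e'‖ₑ ≤ (B.toNNReal : ℝ≥0∞) := fun e' => by
            rw [enorm_le_coe, ← NNReal.coe_le_coe, coe_nnnorm]
            exact (hB e').trans (Real.le_coe_toNNReal B)
          calc ∫⁻ e', ‖K e z * K' z e' * h e'‖ₑ ∂(posMeasure μ)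
              ≤ ∫⁻ e', ‖K e z‖ₑ * B.toNNReal * ‖K' z e'‖ₑ ∂(posMeasure μ) := by
                refine lintegral_mono fun e' => ?_
                rw [enorm_mul, enorm_mul, mul_assoc, mul_assoc, mul_comm (B.toNNReal : ℝ≥0∞)]
                gcongr
                exact h2 e'
            _ = ‖K e z‖ₑ * B.toNNReal * ∫⁻ e', ‖K' z e'‖ₑ ∂(posMeasure μ) :=
                lintegral_const_mul _ (hK'.comp measurable_prodMk_left).enorm
            _ ≤ ‖K e z‖ₑ * (C * B.toNNReal : ℝ≥0) := by
                rcases hC z with h3 | h3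
                · simp [h3]
                · rw [ENNReal.coe_mul, mul_comm (C : ℝ≥0∞), mul_assoc]
                  gcongr
      _ = (∫⁻ z, ‖K e z‖ₑ ∂(posMeasure μ)) * (C * B.toNNReal : ℝ≥0) :=
          lintegral_mul_const _ (hK.comp measurable_prodMk_left).enorm
      _ < ⊤ := ENNReal.mul_lt_top (lt_top_iff_ne_top.2 hfin) ENNReal.coe_lt_top
  calc act μ K (act μ K' h) e
      = ∫ z, ∫ e', K e z * K' z e' * h e' ∂(posMeasure μ) ∂(posMeasure μ) := by
        refine integral_congr_ae (ae_of_all _ fun z => ?_)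
        simp only [act, mul_assoc]
        rw [integral_const_mul]
    _ = ∫ e', ∫ z, K e z * K' z e' * h e' ∂(posMeasure μ) ∂(posMeasure μ) :=
        integral_integral_swap hint
    _ = _ := by
        refine integral_congr_ae (ae_of_all _ fun e' => ?_)
        simp only [compKernel]
        rw [integral_mul_const]

/-- Volterra operators only see the past. -/
lemma act_volterra_congr {k : ℝ → M → M → ℂ} {J : Set ℝ}
    (hJ : ∀ τ ∈ J, ∀ σ, 0 ≤ σ → σ ≤ τ → σ ∈ J) {F F' : M × ℝ → ℂ}
    (h : ∀ᵐ e ∂(μ.prod volume), e.2 ∈ J → F e = F' e) {e : M × ℝ} (he : e.2 ∈ J) :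
    act μ (volterra k) F e = act μ (volterra k) F' e := by
  have h0 := ae_posMeasure_nonneg μ
  refine integral_congr_ae ?_
  filter_upwards [(posMeasure_absolutelyContinuous μ).ae_le h, h0] with z hz hz0
  rcases lt_or_ge z.2 e.2 with h1 | h1
  · rw [hz (hJ _ he _ hz0 h1.le)]
  · rw [volterra_eq_zero h1, zero_mul, zero_mul]

/-- A property that holds at every scale, almost everywhere, holds almost everywhere at almost
every scale. -/
lemma ae_ae_scale {P : ℝ → M × ℝ → Prop} (hP : MeasurableSet {p : ℝ × (M × ℝ) | P p.1 p.2})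
    {ν : Measure (M × ℝ)} [SFinite ν] (h : ∀ t ∈ Ioc (0 : ℝ) 1, ∀ᵐ e ∂ν, P t e) :
    (∀ᵐ e ∂ν, ∀ᵐ t ∂(volume.restrict (Ioc (0 : ℝ) 1)), P t e) ∧
      ∀ᵐ p ∂((volume.restrict (Ioc (0 : ℝ) 1)).prod ν), P p.1 p.2 := by
  have h1 : ∀ᵐ t ∂(volume.restrict (Ioc (0 : ℝ) 1)), ∀ᵐ e ∂ν, P t e :=
    (ae_restrict_mem measurableSet_Ioc).mono fun t ht => h t ht
  exact ⟨(Measure.ae_ae_comm hP).1 h1, (Measure.ae_prod_iff_ae_ae hP).2 h1⟩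

end Act

section Rows

variable {M : Type*} [MetricSpace M] [ProperSpace M] [MeasurableSpace M] [BorelSpace M]
  {μ : Measure M} [SigmaFinite μ] [Nonempty M] {A : ℝ} {D : ℕ}

/-- Integrating a Gaussian bound in space leaves its profile in the elapsed time. -/
lemma VolGrowth.exists_lintegral_volterra_le (hV : VolGrowth μ A D) {c : ℝ} (hc : 0 < c) :
    ∃ C : ℝ≥0, ∀ (K : M × ℝ → ℂ) (e : M × ℝ) (a u : ℝ → ℝ), Measurable a → Measurable u →
      (∀ r, 0 < r → 0 < u r) →
      (∀ᵐ e' ∂(posMeasure μ), e'.2 < e.2 →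
        ‖K e'‖ ≤ a (e.2 - e'.2) * gau μ c (u (e.2 - e'.2)) e.1 e'.1) →
      (∀ e', e.2 ≤ e'.2 → K e' = 0) →
      ∫⁻ e', ‖K e'‖ₑ ∂(posMeasure μ) ≤ C * ∫⁻ r in Ioi 0, ENNReal.ofReal (a r) := by
  obtain ⟨C, hC⟩ := hV.lintegral_gau_le hc
  refine ⟨C, fun K e a u ha hu hu0 hK hK0 => ?_⟩
  set b : ℝ → ℝ≥0∞ := (Ioi 0).indicator fun r => ENNReal.ofReal (a r) with hb
  have hbm : Measurable b := ha.ennreal_ofReal.indicator measurableSet_Ioi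
  have hgm : Measurable fun e' : M × ℝ =>
      ENNReal.ofReal (gau μ c (u (e.2 - e'.2)) e.1 e'.1) := by
    have h0 : Measurable fun e' : M × ℝ => (u (e.2 - e'.2), e.1, e'.1) :=
      (hu.comp (measurable_const.sub measurable_snd)).prodMk
        (measurable_const.prodMk measurable_fst)
    have := (measurable_gau μ c).comp h0
    exact this.ennreal_ofReal
  have hbm2 : Measurable fun e' : M × ℝ => b (e.2 - e'.2) :=
    hbm.comp (measurable_const.sub measurable_snd)
  calc ∫⁻ e', ‖K e'‖ₑ ∂(posMeasure μ)
      ≤ ∫⁻ e', b (e.2 - e'.2) * ENNReal.ofReal (gau μ c (u (e.2 - e'.2)) e.1 e'.1)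
          ∂(posMeasure μ) := by
        refine lintegral_mono_ae ?_
        filter_upwards [hK] with e' he
        rcases lt_or_ge e'.2 e.2 with h | h
        · have h1 : e.2 - e'.2 ∈ Ioi (0 : ℝ) := by simp only [mem_Ioi]; linarith
          rw [hb, indicator_of_mem h1, ← ENNReal.ofReal_mul' (gau_nonneg _ _ _ _),
            ← ofReal_norm]
          exact ENNReal.ofReal_le_ofReal (he h)
        · rw [hK0 e' h]; simp
    _ = ∫⁻ σ in Ici (0 : ℝ), ∫⁻ y, b (e.2 - σ) * ENNReal.ofReal (gau μ c (u (e.2 - σ)) e.1 y) ∂μ := by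
        exact lintegral_prod_symm' _ (hbm2.mul hgm)
    _ ≤ ∫⁻ σ in Ici (0 : ℝ), b (e.2 - σ) * C := by
        refine lintegral_mono fun σ => ?_
        have h1 : Measurable fun y : M => ENNReal.ofReal (gau μ c (u (e.2 - σ)) e.1 y) :=
          by have := hgm.comp (measurable_prodMk_right (y := σ)); exact this
        rw [lintegral_const_mul _ h1]
        by_cases h : e.2 - σ ∈ Ioi (0 : ℝ)
        · gcongr
          exact hC _ (hu0 _ h) _
        · rw [hb, indicator_of_notMem h, zero_mul, zero_mul]
    _ ≤ ∫⁻ σ, b (e.2 - σ) * C := setLIntegral_le_lintegral _ _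
    _ = ∫⁻ r, b r * C := lintegral_sub_left_eq_self (fun r => b r * C) e.2
    _ = _ := by
        rw [lintegral_mul_const _ hbm, hb, lintegral_indicator measurableSet_Ioi, mul_comm]

end Rows

lemma lintegral_div_sq_le {t : ℝ} (ht : 0 < t) :
    ∫⁻ r in Ioi 0, ENNReal.ofReal (t⁻¹ * (t / (t + r)) ^ 2) ≤ 1 := by
  have hd : ∀ r ∈ Ici (0 : ℝ), HasDerivAt (fun r => -(t / (t + r))) (t⁻¹ * (t / (t + r)) ^ 2) r := by
    intro r hr
    have h0 : t + r ≠ 0 := by have : (0 : ℝ) ≤ r := hr; positivity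
    have h1 := ((hasDerivAt_const r t).div ((hasDerivAt_id r).const_add t) h0).neg
    have h2 : HasDerivAt (fun r => -(t / (t + r))) (-((0 * (t + r) - t * 1) / (t + r) ^ 2)) r := h1
    have e : t⁻¹ * (t / (t + r)) ^ 2 = -((0 * (t + r) - t * 1) / (t + r) ^ 2) := by
      field_simp
      ring
    rwa [e]
  have hl : Tendsto (fun r : ℝ => -(t / (t + r))) atTop (𝓝 (-0)) :=
    ((tendsto_atTop_add_const_left _ _ tendsto_id).const_div_atTop t).neg
  have hnn : ∀ r ∈ Ioi (0 : ℝ), 0 ≤ t⁻¹ * (t / (t + r)) ^ 2 := fun r hr => by positivity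
  rw [← ofReal_integral_eq_lintegral_ofReal (integrableOn_Ioi_deriv_of_nonneg' hd hnn hl)
    ((ae_restrict_mem measurableSet_Ioi).mono hnn), integral_Ioi_of_hasDerivAt_of_nonneg' hd hnn hl]
  simp [ht.ne']

namespace HeatSystem

section Ops

variable {M : Type*} [MetricSpace M] [ProperSpace M] [MeasurableSpace M] [BorelSpace M]
  {μ : Measure M} [SigmaFinite μ] [Nonempty M] {d : ℕ} {H : HeatSystem M μ d} {A : ℝ} {D : ℕ}
  {m : ℝ → ℝ}

lemma Setting.exists_row_heat (hS : H.Setting A D) :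
    ∃ C : ℝ≥0, ∀ e : M × ℝ,
      ∫⁻ e', ‖volterra (H.left []) e e'‖ₑ ∂(posMeasure μ) ≤ C * ENNReal.ofReal e.2 := by
  obtain ⟨C, c, hc, h⟩ := gaussDecay_of_gaussianRegular (hS.left_gaussian [])
  obtain ⟨C', hC'⟩ := hS.growth.exists_lintegral_volterra_le hc
  refine ⟨C' * C.toNNReal, fun e => ?_⟩
  have h1 := hC' (volterra (H.left []) e) e ((Iic e.2).indicator fun _ => C) id
    (measurable_const.indicator measurableSet_Iic) measurable_id (fun r hr => hr) ?_
    (fun e' he => volterra_eq_zero he)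
  · refine h1.trans ?_
    rw [ENNReal.coe_mul, mul_assoc]
    gcongr
    calc ∫⁻ r in Ioi 0, ENNReal.ofReal ((Iic e.2).indicator (fun _ => C) r)
        = ∫⁻ r in Ioi 0, (Iic e.2).indicator (fun _ => ENNReal.ofReal C) r := by
          congr 1; ext r; simp only [indicator]; split_ifs <;> simp
      _ = ∫⁻ r in Iic e.2 ∩ Ioi 0, ENNReal.ofReal C := by
          rw [lintegral_indicator measurableSet_Iic, Measure.restrict_restrict measurableSet_Iic]
      _ ≤ C.toNNReal * ENNReal.ofReal e.2 := by
          rw [setLIntegral_const, inter_comm, Ioi_inter_Iic, Real.volume_Ioc, sub_zero]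
          rfl
  · have h0 := ae_posMeasure_nonneg μ
    filter_upwards [h0] with e' he0 he
    have hr : 0 < e.2 - e'.2 := by linarith
    have h2 := h _ hr e.1 e'.1
    rw [List.length_nil, pow_zero, one_mul] at h2
    rw [volterra, if_pos he, indicator_of_mem (by simp only [mem_Iic]; linarith)]
    exact h2

/-- The Gaussian bound of the kernels of standard families and of their duals. -/
lemma norm_profile_sum_le {K : ℕ → ℝ → M → M → ℂ} {C c' : ℝ} (j n c : ℕ)
    (hK : ∀ i ∈ Finset.range c, GaussDecay μ (j + 2 * (n + i)) C c' (K (n + i))) {t r : ℝ}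
    (ht : 0 < t) (x y : M) :
    ‖((√t ^ j * rescale m t r : ℝ) : ℂ) *
      ∑ i ∈ Finset.range c, ((t ^ (n + i) / i.factorial : ℝ) : ℂ) * K (n + i) t x y‖
      ≤ (c * C * |rescale m t r|) * gau μ c' t x y := by
  have hg := gau_nonneg (μ := μ) c' t x y
  rw [norm_mul, Complex.norm_real, norm_mul, Real.norm_eq_abs, Real.norm_eq_abs,
    abs_of_nonneg (by positivity : 0 ≤ √t ^ j)]
  have h1 : √t ^ j * ‖∑ i ∈ Finset.range c, ((t ^ (n + i) / i.factorial : ℝ) : ℂ) *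
      K (n + i) t x y‖ ≤ ∑ i ∈ Finset.range c, C * gau μ c' t x y := by
    calc _ ≤ √t ^ j * ∑ i ∈ Finset.range c, ‖((t ^ (n + i) / i.factorial : ℝ) : ℂ) *
          K (n + i) t x y‖ := by
          gcongr
          exact norm_sum_le _ _
      _ = ∑ i ∈ Finset.range c, √t ^ j * ‖((t ^ (n + i) / i.factorial : ℝ) : ℂ) *
          K (n + i) t x y‖ := Finset.mul_sum _ _ _
      _ ≤ _ := by
          refine Finset.sum_le_sum fun i hi => ?_
          have h2 : t ^ (n + i) / i.factorial ≤ t ^ (n + i) := div_le_self (by positivity)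
            (by exact_mod_cast Nat.one_le_iff_ne_zero.2 i.factorial_ne_zero)
          rw [norm_mul, Complex.norm_real, Real.norm_of_nonneg (by positivity)]
          calc √t ^ j * (t ^ (n + i) / i.factorial * ‖K (n + i) t x y‖)
              ≤ √t ^ j * (t ^ (n + i) * ‖K (n + i) t x y‖) := by gcongr
            _ = √t ^ (j + 2 * (n + i)) * ‖K (n + i) t x y‖ := by
                rw [pow_add _ j, sqrt_pow_two_mul ht.le]; ring
            _ ≤ _ := hK i hi t ht x y
  rw [Finset.sum_const, Finset.card_range, nsmul_eq_mul] at h1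
  calc √t ^ j * |rescale m t r| * ‖∑ i ∈ Finset.range c, ((t ^ (n + i) / i.factorial : ℝ) : ℂ) *
      K (n + i) t x y‖ = |rescale m t r| * (√t ^ j * ‖∑ i ∈ Finset.range c,
      ((t ^ (n + i) / i.factorial : ℝ) : ℂ) * K (n + i) t x y‖) := by ring
    _ ≤ |rescale m t r| * (c * (C * gau μ c' t x y)) := by gcongr
    _ = _ := by ring

lemma exists_lintegral_rescale_le (hm : IsProfile m) (a : ℝ) :
    ∃ C : ℝ≥0, ∀ t : ℝ, 0 < t → ∫⁻ r in Ioi 0, ENNReal.ofReal (a * |rescale m t r|) ≤ C := by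
  obtain ⟨B, hB0, hB⟩ := hm.exists_bound
  refine ⟨(|a| * (2 * B)).toNNReal, fun t ht => ?_⟩
  calc ∫⁻ r in Ioi 0, ENNReal.ofReal (a * |rescale m t r|)
      ≤ ∫⁻ r, ENNReal.ofReal (|a| * |rescale m t r|) := by
        refine (setLIntegral_le_lintegral _ _).trans (lintegral_mono fun r => ?_)
        exact ENNReal.ofReal_le_ofReal (by gcongr; exact le_abs_self a)
    _ = ENNReal.ofReal (∫ r, |a| * |rescale m t r|) :=
        (ofReal_integral_eq_lintegral_ofReal ((hm.integrable_rescale ht).abs.const_mul _)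
          (ae_of_all _ fun r => by positivity)).symm
    _ ≤ _ := by
        rw [integral_const_mul]
        refine ENNReal.ofReal_le_ofReal (mul_le_mul_of_nonneg_left ?_ (abs_nonneg _))
        exact hm.integral_abs_rescale_le hB ht

lemma Setting.exists_row_std (hS : H.Setting A D) (S : StdFamily d) :
    ∃ C : ℝ≥0, ∀ t : ℝ, 0 < t → ∀ e,
      ∫⁻ e', ‖H.std S t e e'‖ₑ ∂(posMeasure μ) ≤ C := by
  have hm : IsProfile S.m := ⟨S.smooth, S.supp⟩
  obtain ⟨C, c', hC, hc', h⟩ := exists_uniform_gaussDecay (Finset.finite_toSet (Finset.range S.c))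
    (q := fun i => S.J.length + 2 * (S.n + i)) (K := fun i => H.leftPow S.J (S.n + i))
    fun i _ => let ⟨C, c, _, h1, h2⟩ := hS.gaussDecay_leftPow S.J (S.n + i); ⟨C, c, h1, h2⟩
  obtain ⟨C₁, hC₁⟩ := hS.growth.exists_lintegral_volterra_le hc'
  obtain ⟨C₂, hC₂⟩ := exists_lintegral_rescale_le hm (S.c * C)
  refine ⟨C₁ * C₂, fun t ht e => ?_⟩
  rw [ENNReal.coe_mul]
  refine (hC₁ (H.std S t e) e (fun r => S.c * C * |rescale S.m t r|) (fun _ => t) ?_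
    measurable_const (fun _ _ => ht) (ae_of_all _ fun e' _ => ?_) fun e' he => ?_).trans ?_
  · exact measurable_const.mul (hm.contDiff_rescale t).continuous.abs.measurable
  · exact norm_profile_sum_le (K := fun N => H.leftPow S.J N) S.J.length S.n S.c
      (fun i hi => h i (by simpa using hi)) ht e.1 e'.1
  · rw [std, family_eq_volterra hm S.J S.n S.c ht, volterra_eq_zero he]
  · gcongr
    exact hC₂ t ht

lemma Setting.exists_row_stdDual (hS : H.Setting A D) (S : StdFamily d) :
    ∃ C : ℝ≥0, ∀ t : ℝ, 0 < t → ∀ e,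
      ∫⁻ e', ‖H.stdDual S t e e'‖ₑ ∂(posMeasure μ) ≤ C := by
  have hm : IsProfile S.m := ⟨S.smooth, S.supp⟩
  obtain ⟨C, c', hC, hc', h⟩ := hS.exists_gaussDecay (S.J.length + S.n + S.c)
  obtain ⟨C₁, hC₁⟩ := hS.growth.exists_lintegral_volterra_le hc'
  obtain ⟨C₂, hC₂⟩ := exists_lintegral_rescale_le hm (S.c * C)
  refine ⟨C₁ * C₂, fun t ht e => ?_⟩
  rw [ENNReal.coe_mul]
  refine (hC₁ (H.stdDual S t e) e (fun r => S.c * C * |rescale S.m t r|) (fun _ => t) ?_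
    measurable_const (fun _ _ => ht) (ae_of_all _ fun e' _ => ?_) fun e' he => ?_).trans ?_
  · exact measurable_const.mul (hm.contDiff_rescale t).continuous.abs.measurable
  · refine norm_profile_sum_le (K := fun N => H.rightPow S.J N) S.J.length S.n S.c
      (fun i hi => ?_) ht e.1 e'.1
    have h1 := h [] S.J (S.n + i) (by simp) (by omega)
      (by have := Finset.mem_range.1 hi; omega)
    rwa [List.length_nil, zero_add, add_comm] at h1
  · rw [stdDual, dualFamily_eq_volterra hm S.J S.n S.c ht, volterra_eq_zero he]
  · gcongr
    exact hC₂ t ht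

/-- The families `t⁻¹ 𝒬_t ℒ⁻¹` and `t⁻¹ ℒ⁻¹ 𝒬_t^•` are bounded on `L^∞`, uniformly in the scale, if
`𝒬` has some cancellation. -/
lemma Setting.exists_row_duhamel (hS : H.Setting A D) (hm : IsProfile m) {k : ℕ}
    (hk : ∀ i < k, ∫ r, r ^ i * m r = 0) (I J : List (Fin d)) (n c : ℕ)
    (hq : 4 ≤ I.length + J.length + 2 * n + 2 * k) :
    ∃ C : ℝ≥0, ∀ t : ℝ, 0 < t → ∀ᵐ e ∂(μ.prod volume),
      ∫⁻ e', ‖volterra (H.duhamel I J n c m t) e e'‖ₑ ∂(posMeasure μ) ≤ C := by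
  obtain ⟨C, c', hC, hc', h⟩ := hS.exists_volterra_duhamel_le hm hk I J n c
  obtain ⟨C₁, hC₁⟩ := hS.growth.exists_lintegral_volterra_le hc'
  refine ⟨C₁ * C.toNNReal, fun t ht => ?_⟩
  filter_upwards [Measure.ae_ae_of_ae_prod (h t ht)] with e he
  rw [ENNReal.coe_mul]
  refine (hC₁ _ e (fun r => C * (t⁻¹ * (t / (t + r)) ^ 2)) (fun r => t + r) (by fun_prop)
    (by fun_prop) (fun r hr => by positivity) ?_ fun e' he => volterra_eq_zero he).trans ?_
  · filter_upwards [(posMeasure_absolutelyContinuous μ).ae_le he] with e' he' hlt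
    have hg := gau_nonneg (μ := μ) c' (t + (e.2 - e'.2)) e.1 e'.1
    have hr : 0 < e.2 - e'.2 := by linarith
    refine he'.trans ?_
    rw [← mul_assoc]
    gcongr
    calc √(t / (t + (e.2 - e'.2))) ^ (I.length + J.length + 2 * n + 2 * k)
        ≤ √(t / (t + (e.2 - e'.2))) ^ (2 * 2) :=
          pow_le_pow_of_le_one (Real.sqrt_nonneg _) (Real.sqrt_le_one.2
            ((div_le_one (by positivity)).2 (by linarith))) hq
      _ = _ := sqrt_pow_two_mul (by positivity) 2
  · gcongr
    calc ∫⁻ r in Ioi 0, ENNReal.ofReal (C * (t⁻¹ * (t / (t + r)) ^ 2))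
        = ENNReal.ofReal C * ∫⁻ r in Ioi 0, ENNReal.ofReal (t⁻¹ * (t / (t + r)) ^ 2) := by
          rw [← lintegral_const_mul _ (by fun_prop)]
          congr 1; ext r
          rw [ENNReal.ofReal_mul hC.le]
      _ ≤ ENNReal.ofReal C * 1 := by
          gcongr
          exact lintegral_div_sq_le ht
      _ = _ := by rw [mul_one]; rfl

end Ops

end HeatSystem

/-! ### Operations on standard families -/

namespace StdFamily

variable {d : ℕ}

lemma isProfile (S : StdFamily d) : IsProfile S.m := ⟨S.smooth, S.supp⟩

/-- The family `t∂_τ 𝒬_t`. -/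
def timeDeriv (S : StdFamily d) : StdFamily d where
  J := S.J
  n := S.n
  k := S.k + 1
  c := S.c
  m := deriv S.m
  smooth := S.isProfile.deriv.smooth
  supp := S.isProfile.deriv.supp
  moments i hi := by
    have h1 : ∀ r, HasDerivAt (fun r => r ^ i * S.m r)
        ((i : ℝ) * r ^ (i - 1) * S.m r + r ^ i * deriv S.m r) r := fun r =>
      (hasDerivAt_pow i r).mul
        (S.smooth.differentiable (by simp)).differentiableAt.hasDerivAt
    have hi1 : Integrable fun r => (i : ℝ) * r ^ (i - 1) * S.m r := by
      simpa only [mul_assoc] using (S.isProfile.integrable_pow_mul (i - 1)).const_mul (i : ℝ)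
    have hi2 := S.isProfile.deriv.integrable_pow_mul i
    have h2 := integral_eq_zero_of_hasDerivAt_of_integrable h1 (hi1.add hi2)
      (S.isProfile.integrable_pow_mul i)
    rw [integral_add hi1 hi2] at h2
    simp only [mul_assoc] at h2
    rw [integral_const_mul] at h2
    rcases Nat.eq_zero_or_pos i with h0 | h0
    · subst h0
      simpa using h2
    · rwa [S.moments (i - 1) (by omega), mul_zero, zero_add] at h2

/-- The family `(tL) 𝒬_t`. -/
def powSucc (S : StdFamily d) : StdFamily d := { S with n := S.n + 1 }

/-- The family `a 𝒬_t`. -/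
def scale (a : ℝ) (S : StdFamily d) : StdFamily d where
  J := S.J
  n := S.n
  k := S.k
  c := S.c
  m := fun r => a * S.m r
  smooth := (S.isProfile.const_mul a).smooth
  supp := (S.isProfile.const_mul a).supp
  moments i hi := by
    simp only [mul_left_comm _ a]
    rw [integral_const_mul, S.moments i hi, mul_zero]

lemma order_timeDeriv (S : StdFamily d) : S.timeDeriv.order = S.order + 2 := by
  simp only [order, timeDeriv]; ring

lemma order_powSucc (S : StdFamily d) : S.powSucc.order = S.order + 2 := by
  simp only [order, powSucc]; ring

lemma order_scale (a : ℝ) (S : StdFamily d) : (S.scale a).order = S.order := rfl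

lemma exists_scale_normalized {b : ℕ} (S : StdFamily d) (h1 : 1 ≤ S.c) (h2 : S.c ≤ b) :
    ∃ a : ℝ, 0 < a ∧ (S.scale a).Normalized b := by
  choose B hB0 hB using fun i => (S.isProfile.iteratedDeriv i).exists_bound
  have hs : 0 ≤ ∑ i ∈ Finset.range (b + 1), B i := Finset.sum_nonneg fun i _ => hB0 i
  refine ⟨(1 + ∑ i ∈ Finset.range (b + 1), B i)⁻¹, by positivity, h1, h2, fun i _ hi r => ?_⟩
  have h3 : B i ≤ ∑ i ∈ Finset.range (b + 1), B i :=
    Finset.single_le_sum (fun i _ => hB0 i) (Finset.mem_range.2 (by omega))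
  have h4 : iteratedDeriv i (S.scale (1 + ∑ i ∈ Finset.range (b + 1), B i)⁻¹).m r
      = (1 + ∑ i ∈ Finset.range (b + 1), B i)⁻¹ * iteratedDeriv i S.m r := by
    simp only [scale]
    rw [iteratedDeriv_const_mul_field]
  rw [h4, abs_mul, abs_of_nonneg (by positivity), inv_mul_le_iff₀ (by positivity)]
  linarith [hB i r]

end StdFamily

/-! ### The modified paraproduct of a single term -/

namespace HeatSystem

section Ops

variable {M : Type*} [MetricSpace M] [ProperSpace M] [MeasurableSpace M] [BorelSpace M]
  {μ : Measure M} [SigmaFinite μ] [Nonempty M] {d : ℕ} {H : HeatSystem M μ d} {A : ℝ} {D : ℕ}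
  {m : ℝ → ℝ}

lemma std_scale (a : ℝ) (S : StdFamily d) (t : ℝ) (e e' : M × ℝ) :
    H.std (S.scale a) t e e' = a * H.std S t e e' := by
  simp only [std, family, StdFamily.scale, rescale]
  push_cast
  ring

lemma act_std_scale (a : ℝ) (S : StdFamily d) (t : ℝ) (F : M × ℝ → ℂ) (e : M × ℝ) :
    act μ (H.std (S.scale a) t) F e = a * act μ (H.std S t) F e := by
  simp only [act, std_scale, mul_assoc]
  rw [integral_const_mul]

lemma Setting.measurable_std (hS : H.Setting A D) (S : StdFamily d) :
    (Measurable fun p : ℝ × (M × ℝ) × (M × ℝ) => H.std S p.1 p.2.1 p.2.2) := by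
  have h0 : Measurable fun p : ℝ × (M × ℝ) × (M × ℝ) =>
    (p.1, p.2.1.2 - p.2.2.2, p.2.1.1, p.2.2.1) := by fun_prop
  have := (hS.measurable_stdTime S.smooth.continuous.measurable S.J S.n S.c).comp h0
  exact this

lemma Setting.measurable_stdDual (hS : H.Setting A D) (S : StdFamily d) :
    (Measurable fun p : ℝ × (M × ℝ) × (M × ℝ) => H.stdDual S p.1 p.2.1 p.2.2) := by
  have h0 : Measurable fun p : ℝ × (M × ℝ) × (M × ℝ) =>
    (p.1, p.2.1.2 - p.2.2.2, p.2.1.1, p.2.2.1) := by fun_prop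
  have := (hS.measurable_dualTime S.smooth.continuous.measurable S.J S.n S.c).comp h0
  exact this

lemma measurable_at_scale {K : ℝ → M × ℝ → M × ℝ → ℂ}
    (hK : Measurable fun p : ℝ × (M × ℝ) × (M × ℝ) => K p.1 p.2.1 p.2.2) (t : ℝ) :
    Measurable fun p : (M × ℝ) × (M × ℝ) => K t p.1 p.2 := by
  have h0 : Measurable fun p : (M × ℝ) × (M × ℝ) => (t, p) := by fun_prop
  have := hK.comp h0
  exact this

lemma Setting.measurable_resolution (hS : H.Setting A D) {h : M × ℝ → ℂ} (hh : Measurable h) :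
    Measurable (H.resolution h) := by
  have h0 := measurable_act (μ := μ) (α := Unit) (K := fun _ => volterra (H.left []))
    (F := fun _ => h) ((measurable_volterra (hS.left_measurable [])).comp measurable_snd)
    (hh.comp measurable_snd)
  have h1 : Measurable fun e : M × ℝ => ((), e) := by fun_prop
  have := h0.comp h1
  exact this

/-- An identity between kernels for fixed elapsed times gives one in space-time. -/
lemma compKernel_ae_eq {k k' l : ℝ → M → M → ℂ} {a : ℂ}
    (hk : Measurable fun p : ℝ × M × M => k p.1 p.2.1 p.2.2)
    (hk' : Measurable fun p : ℝ × M × M => k' p.1 p.2.1 p.2.2)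
    (hl : Measurable fun p : ℝ × M × M => l p.1 p.2.1 p.2.2)
    (hC : ∀ r, ∃ C, ∀ ρ ∈ Ioo 0 r, SchurBound μ C (k ρ))
    (hC' : ∀ r, ∃ C, ∀ ρ ∈ Ioo 0 r, SchurBound μ C (k' ρ))
    (h : ∀ r, 0 < r → ∀ᵐ p ∂(μ.prod μ), timeConv μ k k' r p.1 p.2 = a * l r p.1 p.2) :
    ∀ᵐ e ∂(μ.prod volume), ∀ᵐ e' ∂(posMeasure μ),
      compKernel μ (volterra k) (volterra k') e e' = a * volterra l e e' := by
  have hm : Measurable fun q : (M × ℝ) × (M × ℝ) =>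
      compKernel μ (volterra k) (volterra k') q.1 q.2 := by
    have h0 := measurable_compKernel (μ := μ) (α := Unit) (K := fun _ => volterra k)
      (K' := fun _ => volterra k') ((measurable_volterra hk).comp measurable_snd)
      ((measurable_volterra hk').comp measurable_snd)
    have h2 : Measurable fun p : (M × ℝ) × (M × ℝ) => ((), p) := by fun_prop
    have := h0.comp h2
    exact this
  have h1 : ∀ᵐ q ∂((μ.prod volume).prod (μ.prod (volume : Measure ℝ))), q.2.2 < 0 ∨
      compKernel μ (volterra k) (volterra k') q.1 q.2 = a * volterra l q.1 q.2 := by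
    refine ae_of_forall_times (MeasurableSet.union
      (measurableSet_lt (measurable_snd.comp measurable_snd) measurable_const)
      (measurableSet_eq_fun hm ((measurable_volterra hl).const_mul a))) fun τ σ => ?_
    rcases lt_or_ge σ 0 with hσ | hσ
    · exact ae_of_all _ fun p => Or.inl hσ
    rcases le_or_gt τ σ with hle | hlt
    · refine ae_of_all _ fun p => Or.inr ?_
      rw [compKernel_volterra_eq_zero hle, volterra_eq_zero hle, mul_zero]
    · obtain ⟨C, hC⟩ := hC (τ - σ)
      obtain ⟨C', hC'⟩ := hC' (τ - σ)
      filter_upwards [compKernel_volterra_ae hk hk' hσ hC hC', h (τ - σ) (by linarith)]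
        with p hp hp'
      right
      rw [hp, hp']
      simp only [volterra, if_pos hlt]
  have h0 := ae_posMeasure_nonneg μ
  filter_upwards [Measure.ae_ae_of_ae_prod h1] with e he
  filter_upwards [(posMeasure_absolutelyContinuous μ).ae_le he, h0] with e' he' h0'
  exact he'.resolve_left (not_lt.2 h0')

lemma Setting.compKernel_std_heat (hS : H.Setting A D) (S : StdFamily d) {t : ℝ} (ht : 0 < t) :
    ∀ᵐ e ∂(μ.prod volume), ∀ᵐ e' ∂(posMeasure μ),
      compKernel μ (H.std S t) (volterra (H.left [])) e e'
        = t * volterra (H.duhamel S.J [] S.n S.c S.m t) e e' := by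
  have hmm := S.smooth.continuous.measurable
  have e1 : H.std S t = volterra (H.stdTime S.J S.n S.c S.m t) :=
    family_eq_volterra S.isProfile S.J S.n S.c ht
  rw [e1]
  obtain ⟨⟨C, hC⟩, -⟩ := hS.stdTime_spec S.isProfile S.J S.n S.c ht
  obtain ⟨C', hC'⟩ := hS.schur_heat
  have hmd : Measurable fun p : ℝ × M × M => H.stdTime S.J S.n S.c S.m t p.1 p.2.1 p.2.2 := by
    have h0 : Measurable fun p : ℝ × M × M => (t, p) := by fun_prop
    have := (hS.measurable_stdTime hmm S.J S.n S.c).comp h0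
    exact this
  exact compKernel_ae_eq hmd (hS.left_measurable []) (hS.measurable_duhamel_time hmm _ _ _ _ t)
    (fun r => ⟨C, fun ρ _ => hC ρ⟩) (fun r => ⟨C', fun ρ hρ => hC' ρ hρ.1⟩)
    fun r _ => hS.timeConv_stdTime_heat S.isProfile S.J S.n S.c ht

lemma Setting.compKernel_heat_stdDual (hS : H.Setting A D) (S : StdFamily d) {t : ℝ}
    (ht : 0 < t) :
    ∀ᵐ e ∂(μ.prod volume), ∀ᵐ e' ∂(posMeasure μ),
      compKernel μ (volterra (H.left [])) (H.stdDual S t) e e'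
        = t * volterra (H.duhamel [] S.J S.n S.c S.m t) e e' := by
  have hmm := S.smooth.continuous.measurable
  have e1 : H.stdDual S t = volterra (H.dualTime S.J S.n S.c S.m t) :=
    dualFamily_eq_volterra S.isProfile S.J S.n S.c ht
  rw [e1]
  obtain ⟨⟨C, hC⟩, -⟩ := hS.dualTime_spec S.isProfile S.J S.n S.c ht
  obtain ⟨C', hC'⟩ := hS.schur_heat
  exact compKernel_ae_eq (hS.left_measurable []) (hS.measurable_dualTime_time hmm _ _ _ t)
    (hS.measurable_duhamel_time hmm _ _ _ _ t)
    (fun r => ⟨C', fun ρ hρ => hC' ρ hρ.1⟩) (fun r => ⟨C, fun ρ _ => hC ρ⟩)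
    fun r _ => hS.timeConv_heat_dualTime S.isProfile S.J S.n S.c ht

/-- A standard family with enough cancellation gains a factor `t` on `ℒ⁻¹ h`, `h` bounded. -/
lemma Setting.exists_act_std_resolution (hS : H.Setting A D) (S : StdFamily d)
    (ho : 4 ≤ S.order) {h : M × ℝ → ℂ} (hh : Measurable h) {B : ℝ} (hB : ∀ e, ‖h e‖ ≤ B) :
    ∃ C : ℝ, 0 ≤ C ∧ ∀ t : ℝ, 0 < t → ∀ᵐ z ∂(μ.prod volume),
      act μ (H.std S t) (H.resolution h) z
        = t * act μ (volterra (H.duhamel S.J [] S.n S.c S.m t)) h z ∧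
      Integrable (fun e' => volterra (H.duhamel S.J [] S.n S.c S.m t) z e' * h e')
        (posMeasure μ) ∧
      ‖act μ (H.std S t) (H.resolution h) z‖ ≤ C * t := by
  have hmm := S.smooth.continuous.measurable
  obtain ⟨C₁, hC₁⟩ := hS.exists_row_std S
  obtain ⟨C₂, hC₂⟩ := hS.exists_row_heat
  obtain ⟨C₃, hC₃⟩ := hS.exists_row_duhamel S.isProfile S.moments S.J [] S.n S.c
    (by simpa [StdFamily.order] using ho)
  have hB0 : 0 ≤ B := by
    obtain ⟨x⟩ := ‹Nonempty M›
    exact (norm_nonneg _).trans (hB (x, 0))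
  refine ⟨C₃ * B, by positivity, fun t ht => ?_⟩
  filter_upwards [hS.compKernel_std_heat S ht, hC₃ t ht] with z hz hrow
  have hKm : Measurable (volterra (H.duhamel S.J [] S.n S.c S.m t) z) :=
    (measurable_volterra (hS.measurable_duhamel_time hmm _ _ _ _ t)).comp measurable_prodMk_left
  have e1 : act μ (H.std S t) (H.resolution h) z
      = t * act μ (volterra (H.duhamel S.J [] S.n S.c S.m t)) h z := by
    have h1 : act μ (H.std S t) (act μ (volterra (H.left [])) h) z
        = act μ (compKernel μ (H.std S t) (volterra (H.left []))) h z := by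
      refine act_act (measurable_at_scale (hS.measurable_std S) t)
        (measurable_volterra (hS.left_measurable [])) hh hB
        ((hC₁ t ht z).trans_lt ENNReal.coe_lt_top).ne (C := C₂ * z.2.toNNReal) fun z' => ?_
      rcases lt_or_ge z'.2 z.2 with hlt | hle
      · right
        rw [ENNReal.coe_mul]
        refine (hC₂ z').trans ?_
        gcongr
        exact ENNReal.ofReal_le_ofReal hlt.le
      · left
        rw [std, family_eq_volterra S.isProfile S.J S.n S.c ht, volterra_eq_zero hle]
    refine Eq.trans h1 ?_
    rw [act, act, ← integral_const_mul]
    refine integral_congr_ae ?_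
    filter_upwards [hz] with e' he
    rw [he, mul_assoc]
  have hbd : ∀ᵐ e' ∂(posMeasure μ), volterra (H.duhamel S.J [] S.n S.c S.m t) z e' = 0 ∨
      ‖h e'‖ ≤ B := ae_of_all _ fun e' => Or.inr (hB e')
  refine ⟨e1, integrable_mul_of_bounded hKm hh (hrow.trans_lt ENNReal.coe_lt_top).ne hbd, ?_⟩
  rw [e1, norm_mul, Complex.norm_real, Real.norm_of_nonneg ht.le, mul_comm]
  gcongr
  exact norm_integral_mul_le hKm hrow hB0 hbd

/-- `t 𝒬_t h = (t∂_τ 𝒬_t) f + (tL 𝒬_t) f` when `f = ℒ⁻¹ h`. -/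
lemma Setting.mul_act_std_eq (hS : H.Setting A D) (S : StdFamily d) (ho : 2 ≤ S.order)
    {h : M × ℝ → ℂ} (hh : Measurable h) {B : ℝ} (hB : ∀ e, ‖h e‖ ≤ B) {t : ℝ} (ht : 0 < t) :
    ∀ᵐ z ∂(μ.prod volume), t * act μ (H.std S t) h z
      = act μ (H.std S.timeDeriv t) (H.resolution h) z
        + act μ (H.std S.powSucc t) (H.resolution h) z := by
  have hmm := S.smooth.continuous.measurable
  obtain ⟨C₁, -, h1⟩ := hS.exists_act_std_resolution S.timeDeriv
    (by rw [S.order_timeDeriv]; omega) hh hB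
  obtain ⟨C₂, -, h2⟩ := hS.exists_act_std_resolution S.powSucc
    (by rw [S.order_powSucc]; omega) hh hB
  have hmd : Measurable fun p : ℝ × M × M => H.stdTime S.J S.n S.c S.m t p.1 p.2.1 p.2.2 := by
    have h0 : Measurable fun p : ℝ × M × M => (t, p) := by fun_prop
    have := (hS.measurable_stdTime hmm S.J S.n S.c).comp h0
    exact this
  have hker : ∀ᵐ q ∂((μ.prod volume).prod (μ.prod (volume : Measure ℝ))),
      volterra (H.duhamel S.J [] S.n S.c (deriv S.m) t) q.1 q.2
        + volterra (H.duhamel S.J [] (S.n + 1) S.c S.m t) q.1 q.2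
      = volterra (H.stdTime S.J S.n S.c S.m t) q.1 q.2 := by
    refine ae_of_forall_times (measurableSet_eq_fun (Measurable.add ?_ ?_) ?_) fun τ σ => ?_
    · exact measurable_volterra (hS.measurable_duhamel_time
        S.isProfile.deriv.smooth.continuous.measurable _ _ _ _ t)
    · exact measurable_volterra (hS.measurable_duhamel_time hmm _ _ _ _ t)
    · exact measurable_volterra hmd
    · rcases le_or_gt τ σ with hle | hlt
      · refine ae_of_all _ fun p => ?_
        rw [volterra_eq_zero hle, volterra_eq_zero hle, volterra_eq_zero hle, add_zero]
      · filter_upwards [hS.duhamel_add_duhamel S.isProfile S.J S.n S.c ht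
          (by linarith : 0 < τ - σ)] with p hp
        simpa only [volterra, if_pos hlt] using hp
  filter_upwards [h1 t ht, h2 t ht, Measure.ae_ae_of_ae_prod hker] with z h1 h2 h3
  rw [h1.1, h2.1, ← mul_add]
  congr 1
  rw [act, act, act, ← integral_add h1.2.1 h2.2.1]
  refine integral_congr_ae ?_
  filter_upwards [(posMeasure_absolutelyContinuous μ).ae_le h3] with e' he
  rw [← add_mul]
  have e1 : H.std S t = volterra (H.stdTime S.J S.n S.c S.m t) :=
    family_eq_volterra S.isProfile S.J S.n S.c ht
  rw [e1, ← he]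
  rfl

end Ops

end HeatSystem

namespace HeatSystem

section Ops

variable {M : Type*} [MetricSpace M] [ProperSpace M] [MeasurableSpace M] [BorelSpace M]
  {μ : Measure M} [SigmaFinite μ] [Nonempty M] {d : ℕ} {H : HeatSystem M μ d} {A : ℝ} {D : ℕ}

lemma Setting.measurable_act_std (hS : H.Setting A D) (S : StdFamily d) {h : M × ℝ → ℂ}
    (hh : Measurable h) : Measurable fun p : ℝ × (M × ℝ) => act μ (H.std S p.1) h p.2 :=
  measurable_act (F := fun _ => h) (hS.measurable_std S) (hh.comp measurable_snd)

lemma Setting.measurable_bilinear_stdDual (hS : H.Setting A D) (X Y Z : StdFamily d)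
    {h g : M × ℝ → ℂ} (hh : Measurable h) (hg : Measurable g) :
    Measurable fun p : ℝ × (M × ℝ) => H.bilinear (H.stdDual X) Y Z h g p.1 p.2 :=
  measurable_act (K := H.stdDual X)
    (F := fun t e => act μ (H.std Y t) h e * act μ (H.std Z t) g e) (hS.measurable_stdDual X)
    ((hS.measurable_act_std Y hh).mul (hS.measurable_act_std Z hg))

lemma measurable_at_point {F : ℝ → M × ℝ → ℂ} (hF : Measurable fun p : ℝ × (M × ℝ) => F p.1 p.2)
    (e : M × ℝ) : Measurable fun t => F t e := by
  have h0 : Measurable fun t : ℝ => (t, e) := by fun_prop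
  have := hF.comp h0
  exact this

lemma measurable_slice {F : ℝ → M × ℝ → ℂ} (hF : Measurable fun p : ℝ × (M × ℝ) => F p.1 p.2)
    (t : ℝ) : Measurable (F t) := by
  have h0 : Measurable fun e : M × ℝ => (t, e) := by fun_prop
  have := hF.comp h0
  exact this

/-- Standard families are bounded on `L^∞`, uniformly in the scale. -/
lemma Setting.exists_act_std_le (hS : H.Setting A D) (S : StdFamily d) {h : M × ℝ → ℂ}
    {B : ℝ} (hB : ∀ e, ‖h e‖ ≤ B) :
    ∃ C : ℝ, 0 ≤ C ∧ ∀ t : ℝ, 0 < t → ∀ e, ‖act μ (H.std S t) h e‖ ≤ C := by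
  obtain ⟨C, hC⟩ := hS.exists_row_std S
  have hB0 : 0 ≤ B := by
    obtain ⟨x⟩ := ‹Nonempty M›
    exact (norm_nonneg _).trans (hB (x, 0))
  refine ⟨C * B, by positivity, fun t ht e => ?_⟩
  exact norm_integral_mul_le
    ((measurable_at_scale (hS.measurable_std S) t).comp measurable_prodMk_left) (hC t ht e) hB0
    (ae_of_all _ fun e' => Or.inr (hB e'))

/-- A Hölder function loses nothing in the terms of a paraproduct: they are `O(t^{s/2})`. -/
lemma Setting.exists_bilinear_stdDual_le (hS : H.Setting A D) (X Y Z : StdFamily d) {J : Set ℝ}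
    (hJ : ∀ τ ∈ J, ∀ σ, 0 ≤ σ → σ ≤ τ → σ ∈ J) {h g : M × ℝ → ℂ}
    {B : ℝ} (hB : ∀ e, ‖g e‖ ≤ B) {s C : ℝ}
    (hHol : ∀ t ∈ Ioc (0 : ℝ) 1, ∀ᵐ e ∂(μ.prod volume), e.2 ∈ J →
      ‖act μ (H.std Y t) h e‖ ≤ C * t ^ (s / 2)) :
    ∃ C' : ℝ, 0 ≤ C' ∧ ∀ t ∈ Ioc (0 : ℝ) 1, ∀ e : M × ℝ, e.2 ∈ J →
      ‖H.bilinear (H.stdDual X) Y Z h g t e‖ ≤ C' * t ^ (s / 2) := by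
  obtain ⟨C₁, hC₁⟩ := hS.exists_row_stdDual X
  obtain ⟨C₂, hC₂0, hC₂⟩ := hS.exists_act_std_le Z hB
  refine ⟨C₁ * (|C| * C₂), by positivity, fun t ht e he => ?_⟩
  have ht0 := ht.1
  rw [mul_assoc]
  refine norm_integral_mul_le
    ((measurable_at_scale (hS.measurable_stdDual X) t).comp measurable_prodMk_left)
    (hC₁ t ht.1 e) (by positivity) ?_
  filter_upwards [(posMeasure_absolutelyContinuous μ).ae_le (hHol t ht), ae_posMeasure_nonneg μ]
    with z hz hz0
  rcases lt_or_ge z.2 e.2 with hlt | hle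
  · right
    have h1 := hz (hJ _ he _ hz0 hlt.le)
    rw [norm_mul]
    calc _ ≤ (C * t ^ (s / 2)) * C₂ := by
          gcongr
          · exact (norm_nonneg _).trans h1
          · exact hC₂ t ht0 z
      _ ≤ (|C| * t ^ (s / 2)) * C₂ := by gcongr; exact le_abs_self C
      _ = _ := by ring
  · left
    change H.stdDual X t e z = 0
    rw [stdDual, dualFamily_eq_volterra X.isProfile X.J X.n X.c ht0, volterra_eq_zero hle]

lemma integrableOn_rpow_half_sub_one {s : ℝ} (hs : 0 < s) (C : ℝ) :
    IntegrableOn (fun t : ℝ => C * t ^ (s / 2 - 1)) (Ioc 0 1) := by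
  have h := intervalIntegral.intervalIntegrable_rpow' (a := 0) (b := 1)
    (by linarith : -1 < s / 2 - 1)
  exact ((intervalIntegrable_iff_integrableOn_Ioc_of_le zero_le_one).1 h).const_mul C

lemma norm_inv_mul_le {s C t : ℝ} (ht : 0 < t) {z : ℂ} (hz : ‖z‖ ≤ C * t ^ (s / 2)) :
    ‖((t⁻¹ : ℝ) : ℂ) * z‖ ≤ C * t ^ (s / 2 - 1) := by
  rw [norm_mul, Complex.norm_real, Real.norm_of_nonneg (by positivity),
    Real.rpow_sub_one ht.ne']
  calc t⁻¹ * ‖z‖ ≤ t⁻¹ * (C * t ^ (s / 2)) := by gcongr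
    _ = _ := by ring

/-- The terms of a paraproduct are given by absolutely convergent integrals over the scales. -/
lemma Setting.integrableOn_term (hS : H.Setting A D) (X Y Z : StdFamily d) {J : Set ℝ}
    (hJ : ∀ τ ∈ J, ∀ σ, 0 ≤ σ → σ ≤ τ → σ ∈ J) {h g : M × ℝ → ℂ} (hh : Measurable h)
    (hg : Measurable g) {B : ℝ} (hB : ∀ e, ‖g e‖ ≤ B) {s C : ℝ} (hs : 0 < s)
    (hHol : ∀ t ∈ Ioc (0 : ℝ) 1, ∀ᵐ e ∂(μ.prod volume), e.2 ∈ J →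
      ‖act μ (H.std Y t) h e‖ ≤ C * t ^ (s / 2)) {e : M × ℝ} (he : e.2 ∈ J) :
    IntegrableOn (fun t : ℝ => ((t⁻¹ : ℝ) : ℂ) * H.bilinear (H.stdDual X) Y Z h g t e)
      (Ioc 0 1) := by
  obtain ⟨C', hC'0, hC'⟩ := hS.exists_bilinear_stdDual_le X Y Z hJ hB hHol
  have hm : Measurable fun t : ℝ => ((t⁻¹ : ℝ) : ℂ) * H.bilinear (H.stdDual X) Y Z h g t e :=
    (Complex.measurable_ofReal.comp measurable_inv).mul
      (measurable_at_point (hS.measurable_bilinear_stdDual X Y Z hh hg) e)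
  refine (integrableOn_rpow_half_sub_one hs C').mono' hm.aestronglyMeasurable ?_
  filter_upwards [ae_restrict_mem measurableSet_Ioc] with t ht
  exact norm_inv_mul_le ht.1 (hC' t ht e he)

/-- The integrals over the scales and the integral in `ℒ⁻¹` may be interchanged. -/
lemma Setting.integrable_heat_mul_term (hS : H.Setting A D) (X Y Z : StdFamily d) {J : Set ℝ}
    (hJ : ∀ τ ∈ J, ∀ σ, 0 ≤ σ → σ ≤ τ → σ ∈ J) {h g : M × ℝ → ℂ} (hh : Measurable h)
    (hg : Measurable g) {B : ℝ} (hB : ∀ e, ‖g e‖ ≤ B) {s C : ℝ} (hs : 0 < s)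
    (hHol : ∀ t ∈ Ioc (0 : ℝ) 1, ∀ᵐ e ∂(μ.prod volume), e.2 ∈ J →
      ‖act μ (H.std Y t) h e‖ ≤ C * t ^ (s / 2)) {e : M × ℝ} (he : e.2 ∈ J) :
    Integrable (fun p : (M × ℝ) × ℝ => volterra (H.left []) e p.1 *
        (((p.2⁻¹ : ℝ) : ℂ) * H.bilinear (H.stdDual X) Y Z h g p.2 p.1))
      ((posMeasure μ).prod (volume.restrict (Ioc 0 1))) := by
  obtain ⟨C', hC'0, hC'⟩ := hS.exists_bilinear_stdDual_le X Y Z hJ hB hHol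
  obtain ⟨C₁, hC₁⟩ := hS.exists_row_heat
  have hGm : Measurable (volterra (H.left []) e) :=
    (measurable_volterra (hS.left_measurable [])).comp measurable_prodMk_left
  have hG : Integrable (volterra (H.left []) e) (posMeasure μ) :=
    ⟨hGm.aestronglyMeasurable,
      (hC₁ e).trans_lt (ENNReal.mul_lt_top ENNReal.coe_lt_top ENNReal.ofReal_lt_top)⟩
  have hT : Measurable fun p : (M × ℝ) × ℝ =>
      ((p.2⁻¹ : ℝ) : ℂ) * H.bilinear (H.stdDual X) Y Z h g p.2 p.1 := by
    have h0 := (hS.measurable_bilinear_stdDual X Y Z hh hg).comp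
      (measurable_swap (α := M × ℝ) (β := ℝ))
    have h1 : Measurable fun p : (M × ℝ) × ℝ => ((p.2⁻¹ : ℝ) : ℂ) :=
      Complex.measurable_ofReal.comp (measurable_inv.comp measurable_snd)
    exact h1.mul h0
  refine (hG.norm.mul_prod (integrableOn_rpow_half_sub_one hs C')).mono'
    ((hGm.comp measurable_fst).mul hT).aestronglyMeasurable ?_
  have h1 : ∀ᵐ p ∂((posMeasure μ).prod (volume.restrict (Ioc (0 : ℝ) 1))), (0 : ℝ) ≤ p.1.2 :=
    Measure.quasiMeasurePreserving_fst.ae (ae_posMeasure_nonneg μ)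
  have h2 : ∀ᵐ p ∂((posMeasure μ).prod (volume.restrict (Ioc (0 : ℝ) 1))), p.2 ∈ Ioc (0 : ℝ) 1 :=
    Measure.quasiMeasurePreserving_snd.ae (ae_restrict_mem measurableSet_Ioc)
  filter_upwards [h1, h2] with p hp1 hp2
  rw [norm_mul]
  rcases lt_or_ge p.1.2 e.2 with hlt | hle
  · gcongr
    exact norm_inv_mul_le hp2.1 (hC' _ hp2 _ (hJ _ he _ hp1 hlt.le))
  · rw [volterra_eq_zero hle, norm_zero, zero_mul, zero_mul]

/-- `ℒ⁻¹ 𝒬_t^•(F₁ F₂) = t (t⁻¹ ℒ⁻¹ 𝒬_t^•)(F₁ F₂)`. -/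
lemma Setting.act_heat_bilinear (hS : H.Setting A D) (X Y Z : StdFamily d)
    {h g : M × ℝ → ℂ} (hh : Measurable h) (hg : Measurable g) {B B' : ℝ}
    (hB : ∀ e, ‖h e‖ ≤ B) (hB' : ∀ e, ‖g e‖ ≤ B') {t : ℝ} (ht : 0 < t) {e : M × ℝ}
    (he : ∀ᵐ z ∂(posMeasure μ), compKernel μ (volterra (H.left [])) (H.stdDual X t) e z
      = t * volterra (H.duhamel [] X.J X.n X.c X.m t) e z) :
    act μ (volterra (H.left [])) (H.bilinear (H.stdDual X) Y Z h g t) e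
      = t * H.bilinear (fun t => volterra (H.duhamel [] X.J X.n X.c X.m t)) Y Z h g t e := by
  obtain ⟨C₁, hC₁⟩ := hS.exists_row_stdDual X
  obtain ⟨C₂, hC₂0, hC₂⟩ := hS.exists_act_std_le Y hB
  obtain ⟨C₃, hC₃0, hC₃⟩ := hS.exists_act_std_le Z hB'
  obtain ⟨C₄, hC₄⟩ := hS.exists_row_heat
  have hw : Measurable fun z => act μ (H.std Y t) h z * act μ (H.std Z t) g z :=
    (measurable_slice (F := fun t => act μ (H.std Y t) h) (hS.measurable_act_std Y hh) t).mul
      (measurable_slice (F := fun t => act μ (H.std Z t) g) (hS.measurable_act_std Z hg) t)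
  have h1 := act_act (measurable_volterra (hS.left_measurable []))
    (measurable_at_scale (hS.measurable_stdDual X) t) hw (B := C₂ * C₃) (fun z => by
      rw [norm_mul]
      gcongr
      exacts [hC₂ t ht z, hC₃ t ht z]) (e := e) (C := C₁)
    ((hC₄ e).trans_lt (ENNReal.mul_lt_top ENNReal.coe_lt_top ENNReal.ofReal_lt_top)).ne
    fun z => Or.inr (hC₁ t ht z)
  refine h1.trans ?_
  rw [bilinear, act, act, ← integral_const_mul]
  refine integral_congr_ae ?_
  filter_upwards [he] with z hz
  rw [hz, mul_assoc]

/-- Absolute convergence in the representation of the modified paraproduct. -/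
lemma Setting.integrable_representation (hS : H.Setting A D) (X Y Z : StdFamily d)
    (hX : 4 ≤ X.order) (hY : 4 ≤ Y.order) {h g : M × ℝ → ℂ} (hh : Measurable h)
    (hg : Measurable g) {B B' : ℝ} (hB : ∀ e, ‖h e‖ ≤ B) (hB' : ∀ e, ‖g e‖ ≤ B') :
    ∀ᵐ e ∂(μ.prod volume), Integrable
      (fun p : ℝ × (M × ℝ) => ((p.1⁻¹ : ℝ) : ℂ) *
        (volterra (H.duhamel [] X.J X.n X.c X.m p.1) e p.2 *
          (act μ (H.std Y p.1) (H.resolution h) p.2 * act μ (H.std Z p.1) g p.2)))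
      ((volume.restrict (Ioc 0 1)).prod (posMeasure μ)) := by
  have hmm := X.smooth.continuous.measurable
  have hQ := hS.measurable_duhamel_family hmm [] X.J X.n X.c
  obtain ⟨C₁, hC₁⟩ := hS.exists_row_duhamel X.isProfile X.moments [] X.J X.n X.c
    (by simpa [StdFamily.order] using hX)
  obtain ⟨C₂, hC₂0, hC₂⟩ := hS.exists_act_std_resolution Y hY hh hB
  obtain ⟨C₃, hC₃0, hC₃⟩ := hS.exists_act_std_le Z hB'
  have hA := hS.measurable_act_std Y (hS.measurable_resolution hh)
  have hZ := hS.measurable_act_std Z hg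
  have hrow : Measurable fun p : ℝ × (M × ℝ) =>
      ∫⁻ z, ‖volterra (H.duhamel [] X.J X.n X.c X.m p.1) p.2 z‖ₑ ∂(posMeasure μ) := by
    have h0 : Measurable fun p : (ℝ × (M × ℝ)) × (M × ℝ) => (p.1.1, p.1.2, p.2) := by fun_prop
    exact (Measurable.enorm (hQ.comp h0)).lintegral_prod_right'
  have h1 := (ae_ae_scale (ν := μ.prod volume)
    (P := fun t e => ∫⁻ z, ‖volterra (H.duhamel [] X.J X.n X.c X.m t) e z‖ₑ ∂(posMeasure μ) ≤ C₁)
    (measurableSet_le hrow measurable_const) fun t ht => hC₁ t ht.1).1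
  have h2 := (ae_ae_scale (ν := posMeasure μ)
    (P := fun t z => ‖act μ (H.std Y t) (H.resolution h) z‖ ≤ C₂ * t)
    (measurableSet_le hA.norm (measurable_const.mul measurable_fst)) fun t ht =>
      (posMeasure_absolutelyContinuous μ).ae_le ((hC₂ t ht.1).mono fun z hz => hz.2.2)).2
  have h3 : ∀ᵐ p ∂((volume.restrict (Ioc (0 : ℝ) 1)).prod (posMeasure μ)), p.1 ∈ Ioc (0 : ℝ) 1 :=
    Measure.quasiMeasurePreserving_fst.ae (ae_restrict_mem measurableSet_Ioc)
  filter_upwards [h1] with e he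
  have hQe : Measurable fun p : ℝ × (M × ℝ) =>
      volterra (H.duhamel [] X.J X.n X.c X.m p.1) e p.2 := by
    have h0 : Measurable fun p : ℝ × (M × ℝ) => (p.1, e, p.2) := by fun_prop
    exact hQ.comp h0
  have hi : Integrable (fun p : ℝ × (M × ℝ) =>
      volterra (H.duhamel [] X.J X.n X.c X.m p.1) e p.2)
      ((volume.restrict (Ioc 0 1)).prod (posMeasure μ)) := by
    refine ⟨hQe.aestronglyMeasurable, ?_⟩
    rw [HasFiniteIntegral, lintegral_prod _ hQe.enorm.aemeasurable]
    calc _ ≤ ∫⁻ t in Ioc (0 : ℝ) 1, (C₁ : ℝ≥0∞) := lintegral_mono_ae he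
      _ < ⊤ := by simp
  refine (hi.norm.mul_const (C₂ * C₃)).mono' ?_ ?_
  · exact ((Complex.measurable_ofReal.comp (measurable_inv.comp measurable_fst)).mul
      (hQe.mul (hA.mul hZ))).aestronglyMeasurable
  · filter_upwards [h2, h3] with p hp2 hp3
    have ht := hp3.1
    rw [norm_mul, norm_mul, norm_mul, Complex.norm_real, Real.norm_of_nonneg (by positivity)]
    calc _ ≤ p.1⁻¹ * (‖volterra (H.duhamel [] X.J X.n X.c X.m p.1) e p.2‖ *
          (C₂ * p.1 * C₃)) := by
          gcongr
          exact hC₃ _ ht _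
      _ = _ := by field_simp

/-- The identity behind the representation: `ℒ⁻¹` is absorbed by the outer family, and
`ℒ` by the family that acts on `h = ℒ f`. -/
lemma Setting.resolution_term (hS : H.Setting A D) (X Y Z : StdFamily d)
    (hX : 4 ≤ X.order) (hY : 2 ≤ Y.order) {J : Set ℝ}
    (hJ : ∀ τ ∈ J, ∀ σ, 0 ≤ σ → σ ≤ τ → σ ∈ J) {h g : M × ℝ → ℂ} (hh : Measurable h)
    (hg : Measurable g) {B B' : ℝ} (hB : ∀ e, ‖h e‖ ≤ B) (hB' : ∀ e, ‖g e‖ ≤ B') {s C : ℝ}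
    (hs : 0 < s) (hHol : ∀ t ∈ Ioc (0 : ℝ) 1, ∀ᵐ e ∂(μ.prod volume), e.2 ∈ J →
      ‖act μ (H.std Y t) h e‖ ≤ C * t ^ (s / 2)) :
    ∀ᵐ e ∂(μ.prod volume), e.2 ∈ J →
      ∫ e', volterra (H.left []) e e' * (∫ t in Ioc (0 : ℝ) 1, ((t⁻¹ : ℝ) : ℂ) *
          H.bilinear (H.stdDual X) Y Z h g t e') ∂(posMeasure μ)
        = (∫ t in Ioc (0 : ℝ) 1, ((t⁻¹ : ℝ) : ℂ) *
            H.bilinear (fun t => volterra (H.duhamel [] X.J X.n X.c X.m t)) Y.timeDeriv Z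
              (H.resolution h) g t e)
          + ∫ t in Ioc (0 : ℝ) 1, ((t⁻¹ : ℝ) : ℂ) *
            H.bilinear (fun t => volterra (H.duhamel [] X.J X.n X.c X.m t)) Y.powSucc Z
              (H.resolution h) g t e := by
  have hmm := X.smooth.continuous.measurable
  have hQ := hS.measurable_duhamel_family hmm [] X.J X.n X.c
  have hR := hS.measurable_resolution hh
  have hcomp : MeasurableSet {p : ℝ × (M × ℝ) | ∀ᵐ z ∂(posMeasure μ),
      compKernel μ (volterra (H.left [])) (H.stdDual X p.1) p.2 z
        = p.1 * volterra (H.duhamel [] X.J X.n X.c X.m p.1) p.2 z} := by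
    refine measurableSet_ae (P := fun (p : ℝ × (M × ℝ)) z =>
      compKernel μ (volterra (H.left [])) (H.stdDual X p.1) p.2 z
        = p.1 * volterra (H.duhamel [] X.J X.n X.c X.m p.1) p.2 z) _ ?_
    have h0 : Measurable fun p : (ℝ × (M × ℝ)) × (M × ℝ) => (p.1.1, p.1.2, p.2) := by fun_prop
    have h1 := (measurable_compKernel (μ := μ) (K := fun _ : ℝ => volterra (H.left []))
      ((measurable_volterra (hS.left_measurable [])).comp measurable_snd)
      (hS.measurable_stdDual X)).comp h0
    exact measurableSet_eq_fun h1 ((Complex.measurable_ofReal.comp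
      (measurable_fst.comp measurable_fst)).mul (hQ.comp h0))
  have hsplit : ∀ᵐ p ∂((volume.restrict (Ioc (0 : ℝ) 1)).prod (posMeasure μ)),
      p.1 * act μ (H.std Y p.1) h p.2 = act μ (H.std Y.timeDeriv p.1) (H.resolution h) p.2
        + act μ (H.std Y.powSucc p.1) (H.resolution h) p.2 := by
    refine (ae_ae_scale (ν := posMeasure μ) (P := fun t z => t * act μ (H.std Y t) h z
      = act μ (H.std Y.timeDeriv t) (H.resolution h) z
        + act μ (H.std Y.powSucc t) (H.resolution h) z) (measurableSet_eq_fun ?_ ?_)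
      fun t ht => (posMeasure_absolutelyContinuous μ).ae_le (hS.mul_act_std_eq Y hY hh hB ht.1)).2
    · exact (Complex.measurable_ofReal.comp measurable_fst).mul (hS.measurable_act_std Y hh)
    · exact (hS.measurable_act_std _ hR).add (hS.measurable_act_std _ hR)
  filter_upwards [(ae_ae_scale hcomp fun t ht => hS.compKernel_heat_stdDual X ht.1).1,
    hS.integrable_representation X Y.timeDeriv Z hX (by rw [Y.order_timeDeriv]; omega) hh hg hB hB',
    hS.integrable_representation X Y.powSucc Z hX (by rw [Y.order_powSucc]; omega) hh hg hB hB']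
    with e he hi1 hi2 heJ
  have hfub := hS.integrable_heat_mul_term X Y Z hJ hh hg hB' hs hHol heJ
  calc ∫ e', volterra (H.left []) e e' * (∫ t in Ioc (0 : ℝ) 1, ((t⁻¹ : ℝ) : ℂ) *
          H.bilinear (H.stdDual X) Y Z h g t e') ∂(posMeasure μ)
      = ∫ e', (∫ t in Ioc (0 : ℝ) 1, volterra (H.left []) e e' * (((t⁻¹ : ℝ) : ℂ) *
          H.bilinear (H.stdDual X) Y Z h g t e')) ∂(posMeasure μ) := by
        simp only [integral_const_mul]
    _ = ∫ t in Ioc (0 : ℝ) 1, (∫ e', volterra (H.left []) e e' * (((t⁻¹ : ℝ) : ℂ) *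
          H.bilinear (H.stdDual X) Y Z h g t e') ∂(posMeasure μ)) :=
        integral_integral_swap hfub
    _ = ∫ t in Ioc (0 : ℝ) 1, ((∫ z, ((t⁻¹ : ℝ) : ℂ) *
          (volterra (H.duhamel [] X.J X.n X.c X.m t) e z *
            (act μ (H.std Y.timeDeriv t) (H.resolution h) z * act μ (H.std Z t) g z))
            ∂(posMeasure μ)) + ∫ z, ((t⁻¹ : ℝ) : ℂ) *
          (volterra (H.duhamel [] X.J X.n X.c X.m t) e z *
            (act μ (H.std Y.powSucc t) (H.resolution h) z * act μ (H.std Z t) g z))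
            ∂(posMeasure μ)) := by
        refine integral_congr_ae ?_
        filter_upwards [he, ae_restrict_mem measurableSet_Ioc, Measure.ae_ae_of_ae_prod hsplit,
          hi1.prod_right_ae, hi2.prod_right_ae] with t ht1 ht2 ht3 ht4 ht5
        have ht0 : (t : ℂ) ≠ 0 := by exact_mod_cast ht2.1.ne'
        rw [← integral_add ht4 ht5]
        have h1 := hS.act_heat_bilinear X Y Z hh hg hB hB' ht2.1 ht1
        calc ∫ e', volterra (H.left []) e e' * (((t⁻¹ : ℝ) : ℂ) *
              H.bilinear (H.stdDual X) Y Z h g t e') ∂(posMeasure μ)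
            = ((t⁻¹ : ℝ) : ℂ) *
              act μ (volterra (H.left [])) (H.bilinear (H.stdDual X) Y Z h g t) e := by
              simp only [mul_left_comm _ ((t⁻¹ : ℝ) : ℂ)]
              rw [integral_const_mul]
              rfl
          _ = H.bilinear (fun t => volterra (H.duhamel [] X.J X.n X.c X.m t)) Y Z h g t e := by
              rw [h1, Complex.ofReal_inv, inv_mul_cancel_left₀ ht0]
          _ = _ := by
              refine integral_congr_ae ?_
              filter_upwards [ht3] with z hz
              have h2 : act μ (H.std Y t) h z = (t : ℂ)⁻¹ *
                  (act μ (H.std Y.timeDeriv t) (H.resolution h) z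
                    + act μ (H.std Y.powSucc t) (H.resolution h) z) := by
                rw [← hz, inv_mul_cancel_left₀ ht0]
              simp only [h2, Complex.ofReal_inv]
              ring
    _ = _ := by
        rw [integral_add hi1.integral_prod_left hi2.integral_prod_left]
        simp only [integral_const_mul]
        rfl

end Ops

end HeatSystem

/-! ### The terms of a paraproduct -/

/-- The standard family `(t^{|I|/2+k} V_I ∂_τ^k) 𝒫_t^{(b)}`, for a profile `φ`. -/
def StdFamily.mollified {d : ℕ} (b : ℕ) {φ : ℝ → ℝ} (hφ : IsProfile φ) (I : List (Fin d))
    (k : ℕ) : StdFamily d :=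
  StdFamily.timeDeriv^[k] ⟨I, 0, 0, b, φ, hφ.smooth, hφ.supp, fun _ h => absurd h (by omega)⟩

lemma StdFamily.mollified_fields {d : ℕ} (b : ℕ) {φ : ℝ → ℝ} (hφ : IsProfile φ)
    (I : List (Fin d)) (k : ℕ) :
    (mollified b hφ I k).J = I ∧ (mollified b hφ I k).n = 0 ∧ (mollified b hφ I k).k = k ∧
      (mollified b hφ I k).c = b ∧ (mollified b hφ I k).m = iteratedDeriv k φ := by
  induction k with
  | zero => simp [mollified]
  | succ k ih =>
    have h : mollified b hφ I (k + 1) = (mollified b hφ I k).timeDeriv :=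
      Function.iterate_succ_apply' _ _ _
    obtain ⟨h1, h2, h3, h4, h5⟩ := ih
    rw [h]
    refine ⟨h1, h2, ?_, h4, ?_⟩
    · simp only [timeDeriv, h3]
    · simp only [timeDeriv, h5, iteratedDeriv_succ]

lemma StdFamily.order_mollified {d : ℕ} (b : ℕ) {φ : ℝ → ℝ} (hφ : IsProfile φ)
    (I : List (Fin d)) (k : ℕ) : (mollified b hφ I k).order = I.length + 2 * k := by
  obtain ⟨h1, h2, h3, -, -⟩ := mollified_fields b hφ I k
  simp only [order, h1, h2, h3]
  ring

/-- A term `X_t^•(Y_t f · Z_t g)`, with a coefficient. Both kinds of terms of a paraproduct are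
of this form. -/
structure ParaTerm (d : ℕ) where
  coeff : ℝ
  X : StdFamily d
  Y : StdFamily d
  Z : StdFamily d

/-- The terms of type `𝒜` (left summand) and `ℬ` (right summand) of an expansion. -/
def LeibnizExpansion.term {d b : ℕ} (E : LeibnizExpansion d b) {φ : ℝ → ℝ} (hφ : IsProfile φ) :
    Fin E.nA ⊕ Fin E.nB → ParaTerm d :=
  Sum.elim
    (fun i => ⟨(E.A i).coeff, .mollified b hφ (E.A i).I (E.A i).k, (E.A i).S,
      .mollified b hφ (E.A i).J (E.A i).l⟩)
    (fun i => ⟨(E.B i).coeff, (E.B i).S, .mollified b hφ (E.B i).I (E.B i).k,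
      .mollified b hφ (E.B i).J (E.B i).l⟩)

/-- The indices of the terms that enter in the paraproduct. -/
def LeibnizExpansion.IsHigh {d b : ℕ} (E : LeibnizExpansion d b) :
    Fin E.nA ⊕ Fin E.nB → Prop :=
  Sum.elim (fun i => (E.A i).IsHigh) fun i => (E.B i).IsHigh

namespace HeatSystem

section Algebra

variable {M : Type*} [MeasurableSpace M] {μ : Measure M} {d b : ℕ} (H : HeatSystem M μ d)
  {φ : ℝ → ℝ} (hφ : IsProfile φ)

lemma VP_eq_std (I : List (Fin d)) (k : ℕ) : H.VP b φ I k = H.std (.mollified b hφ I k) := by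
  obtain ⟨h1, h2, -, h4, h5⟩ := StdFamily.mollified_fields b hφ I k
  rw [VP, std, h1, h2, h4, h5]

lemma PV_eq_stdDual (I : List (Fin d)) (k : ℕ) :
    H.PV b φ I k = H.stdDual (.mollified b hφ I k) := by
  obtain ⟨h1, h2, -, h4, h5⟩ := StdFamily.mollified_fields b hφ I k
  rw [PV, stdDual, h1, h2, h4, h5]

lemma paraproduct_eq (E : LeibnizExpansion d b) [Fintype {i // E.IsHigh i}] (g f : M × ℝ → ℂ) (e : M × ℝ) :
    H.paraproduct φ E g f e = ∫ t in Ioc (0 : ℝ) 1, ((t⁻¹ : ℝ) : ℂ) *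
      ∑ i : {i // E.IsHigh i}, ((E.term hφ i).coeff : ℂ) *
        H.bilinear (H.stdDual (E.term hφ i).X) (E.term hφ i).Y (E.term hφ i).Z f g t e := by
  classical
  rw [paraproduct]
  congr 1
  ext t
  congr 1
  rw [← Finset.sum_subtype (Finset.univ.filter E.IsHigh) (by simp) (fun i =>
    ((E.term hφ i).coeff : ℂ) *
      H.bilinear (H.stdDual (E.term hφ i).X) (E.term hφ i).Y (E.term hφ i).Z f g t e),
    Finset.sum_filter, Fintype.sum_sum_type]
  simp only [LeibnizExpansion.IsHigh, LeibnizExpansion.term, Sum.elim_inl, Sum.elim_inr, bilinear,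
    termA, termB, H.VP_eq_std hφ, H.PV_eq_stdDual hφ]
  congr!

end Algebra

section Ops

variable {M : Type*} [MetricSpace M] [ProperSpace M] [MeasurableSpace M] [BorelSpace M]
  {μ : Measure M} [SigmaFinite μ] [Nonempty M] {d : ℕ} {H : HeatSystem M μ d} {A : ℝ} {D : ℕ}

lemma bilinear_scale (Q : Family M) (a a' : ℝ) (Y Z : StdFamily d) (f g : M × ℝ → ℂ) (t : ℝ)
    (e : M × ℝ) : H.bilinear Q (Y.scale a) (Z.scale a') f g t e
      = a * a' * H.bilinear Q Y Z f g t e := by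
  simp only [bilinear, act_std_scale]
  rw [act, act, ← integral_const_mul]
  congr 1
  ext z
  ring

/-- The Hölder condition, for families that are not normalized. -/
lemma MemHolder.exists_act_std_le {b : ℕ} {J : Set ℝ} {s : ℝ} {h : M × ℝ → ℂ}
    (hh : H.MemHolder b J s h) (S : StdFamily d) (h1 : 1 ≤ S.c) (h2 : S.c ≤ b)
    (hs : s < S.order) (ho : S.order ≤ 2 * b) :
    ∃ C : ℝ, ∀ t ∈ Ioc (0 : ℝ) 1, ∀ᵐ e ∂(μ.prod volume), e.2 ∈ J →
      ‖act μ (H.std S t) h e‖ ≤ C * t ^ (s / 2) := by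
  obtain ⟨-, -, C, -, hC⟩ := hh
  obtain ⟨a, ha, hn⟩ := S.exists_scale_normalized h1 h2
  refine ⟨a⁻¹ * C, fun t ht => ?_⟩
  filter_upwards [hC S.order hs ho (S.scale a) ⟨hn, rfl⟩ t ht] with e he heJ
  have h3 := he heJ
  rw [act_std_scale, norm_mul, Complex.norm_real, Real.norm_of_nonneg ha.le] at h3
  rw [mul_assoc, le_inv_mul_iff₀ ha]
  exact h3

/-- The value of `ℒ⁻¹` on a finite sum of terms, integrated over the scales. -/
lemma Setting.resolution_sum (hS : H.Setting A D) {κ : Type*} [Fintype κ] (p : κ → ParaTerm d)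
    (hX : ∀ i, 4 ≤ (p i).X.order) (hY : ∀ i, 2 ≤ (p i).Y.order) {J : Set ℝ}
    (hJ : ∀ τ ∈ J, ∀ σ, 0 ≤ σ → σ ≤ τ → σ ∈ J) {h g : M × ℝ → ℂ} (hh : Measurable h)
    (hg : Measurable g) {B B' : ℝ} (hB : ∀ e, ‖h e‖ ≤ B) (hB' : ∀ e, ‖g e‖ ≤ B') {s : ℝ}
    (hs : 0 < s) {C : κ → ℝ} (hHol : ∀ i, ∀ t ∈ Ioc (0 : ℝ) 1, ∀ᵐ e ∂(μ.prod volume), e.2 ∈ J →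
      ‖act μ (H.std (p i).Y t) h e‖ ≤ C i * t ^ (s / 2)) :
    ∀ᵐ e ∂(μ.prod volume), e.2 ∈ J →
      H.resolution (fun e' => ∫ t in Ioc (0 : ℝ) 1, ((t⁻¹ : ℝ) : ℂ) *
        ∑ i, ((p i).coeff : ℂ) * H.bilinear (H.stdDual (p i).X) (p i).Y (p i).Z h g t e') e
      = ∑ i, ((p i).coeff : ℂ) *
        ((∫ t in Ioc (0 : ℝ) 1, ((t⁻¹ : ℝ) : ℂ) *
            H.bilinear (fun t => volterra (H.duhamel [] (p i).X.J (p i).X.n (p i).X.c (p i).X.m t))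
              (p i).Y.timeDeriv (p i).Z (H.resolution h) g t e)
          + ∫ t in Ioc (0 : ℝ) 1, ((t⁻¹ : ℝ) : ℂ) *
            H.bilinear (fun t => volterra (H.duhamel [] (p i).X.J (p i).X.n (p i).X.c (p i).X.m t))
              (p i).Y.powSucc (p i).Z (H.resolution h) g t e) := by
  have h1 : ∀ᵐ e ∂(μ.prod volume), ∀ i, e.2 ∈ J → _ := (ae_all_iff.2 fun i =>
    hS.resolution_term (p i).X (p i).Y (p i).Z (hX i) (hY i) hJ hh hg hB hB' hs (hHol i))
  filter_upwards [h1] with e he heJ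
  have h2 : ∀ e' : M × ℝ, e'.2 ∈ J → (∫ t in Ioc (0 : ℝ) 1, ((t⁻¹ : ℝ) : ℂ) *
        ∑ i, ((p i).coeff : ℂ) * H.bilinear (H.stdDual (p i).X) (p i).Y (p i).Z h g t e')
      = ∑ i, ((p i).coeff : ℂ) * ∫ t in Ioc (0 : ℝ) 1, ((t⁻¹ : ℝ) : ℂ) *
        H.bilinear (H.stdDual (p i).X) (p i).Y (p i).Z h g t e' := by
    intro e' he'
    simp only [Finset.mul_sum, mul_left_comm _ (((p _).coeff : ℝ) : ℂ)]
    rw [integral_finsetSum]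
    · simp only [integral_const_mul]
    · exact fun i _ => (hS.integrableOn_term (p i).X (p i).Y (p i).Z hJ hh hg hB' hs (hHol i)
        he').const_mul _
  have h3 : H.resolution (fun e' => ∫ t in Ioc (0 : ℝ) 1, ((t⁻¹ : ℝ) : ℂ) *
        ∑ i, ((p i).coeff : ℂ) * H.bilinear (H.stdDual (p i).X) (p i).Y (p i).Z h g t e') e
      = act μ (volterra (H.left [])) (fun e' => ∑ i, ((p i).coeff : ℂ) *
        ∫ t in Ioc (0 : ℝ) 1, ((t⁻¹ : ℝ) : ℂ) *
        H.bilinear (H.stdDual (p i).X) (p i).Y (p i).Z h g t e') e :=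
    act_volterra_congr hJ (ae_of_all _ h2) heJ
  rw [h3, act]
  simp only [Finset.mul_sum, mul_left_comm _ (((p _).coeff : ℝ) : ℂ)]
  rw [integral_finsetSum]
  · refine Finset.sum_congr rfl fun i _ => ?_
    rw [integral_const_mul, he i heJ]
  · intro i _
    have h4 := (hS.integrable_heat_mul_term (p i).X (p i).Y (p i).Z hJ hh hg hB' hs (hHol i)
      heJ).integral_prod_left
    simp only [integral_const_mul] at h4
    exact h4.const_mul _

lemma act_std_congr (S : StdFamily d) {J : Set ℝ} (hJ : ∀ τ ∈ J, ∀ σ, 0 ≤ σ → σ ≤ τ → σ ∈ J)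
    {f f' : M × ℝ → ℂ} (hf : ∀ᵐ e ∂(μ.prod volume), e.2 ∈ J → f e = f' e) {t : ℝ} (ht : 0 < t)
    {e : M × ℝ} (he : e.2 ∈ J) : act μ (H.std S t) f e = act μ (H.std S t) f' e := by
  rw [std, family_eq_volterra S.isProfile S.J S.n S.c ht]
  exact act_volterra_congr hJ hf he

lemma bilinear_congr {k : ℝ → ℝ → M → M → ℂ} (Y Z : StdFamily d) {J : Set ℝ}
    (hJ : ∀ τ ∈ J, ∀ σ, 0 ≤ σ → σ ≤ τ → σ ∈ J) {f f' g : M × ℝ → ℂ}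
    (hf : ∀ᵐ e ∂(μ.prod volume), e.2 ∈ J → f e = f' e) {t : ℝ} (ht : 0 < t)
    {e : M × ℝ} (he : e.2 ∈ J) :
    H.bilinear (fun t => volterra (k t)) Y Z f g t e
      = H.bilinear (fun t => volterra (k t)) Y Z f' g t e :=
  act_volterra_congr hJ (ae_of_all _ fun z hz => by
    simp only [act_std_congr Y hJ hf ht hz]) he

end Ops

end HeatSystem

/-! ### Representation of the modified paraproduct -/

/-- The two families that replace `Y` once `h = ℒ f` is written in terms of `f`: `t∂_τ Y` and
`(tL) Y`. -/
def ParaTerm.lift {d : ℕ} (p : ParaTerm d) : Bool → StdFamily d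
  | true => p.Y.timeDeriv
  | false => p.Y.powSucc

lemma ParaTerm.order_lift {d : ℕ} (p : ParaTerm d) (β : Bool) :
    (p.lift β).order = p.Y.order + 2 := by
  cases β
  · exact p.Y.order_powSucc
  · exact p.Y.order_timeDeriv

lemma ParaTerm.c_lift {d : ℕ} (p : ParaTerm d) (β : Bool) : (p.lift β).c = p.Y.c := by
  cases β <;> rfl

namespace HeatSystem

section Ops

variable {M : Type*} [MetricSpace M] [ProperSpace M] [MeasurableSpace M] [BorelSpace M]
  {μ : Measure M} [SigmaFinite μ] [Nonempty M] {d : ℕ} {H : HeatSystem M μ d} {A : ℝ} {D : ℕ}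

/-- A paraproduct that is a finite sum of terms has the expected representation; `x` and `y` are
the factors that normalize the standard families. -/
theorem Setting.represents (hS : H.Setting A D) {b : ℕ} {φ : ℝ → ℝ} {E : LeibnizExpansion d b}
    {κ : Type*} [Fintype κ] (p : κ → ParaTerm d)
    (hp : ∀ g f e, H.paraproduct φ E g f e = ∫ t in Ioc (0 : ℝ) 1, ((t⁻¹ : ℝ) : ℂ) *
      ∑ i, ((p i).coeff : ℂ) * H.bilinear (H.stdDual (p i).X) (p i).Y (p i).Z f g t e)
    (hX : ∀ i, 4 ≤ (p i).X.order) (hY : ∀ i, 2 ≤ (p i).Y.order) (hY' : ∀ i, (p i).Y.order ≤ 2 * b)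
    (hc : ∀ i, 1 ≤ (p i).Y.c) (hc' : ∀ i, (p i).Y.c ≤ b)
    {x : κ → Bool → ℝ} {y : κ → ℝ} (hx : ∀ i β, 0 < x i β) (hy : ∀ i, 0 < y i)
    {J : Set ℝ} (hJ : ∀ τ ∈ J, ∀ σ, 0 ≤ σ → σ ≤ τ → σ ∈ J) {N : ℕ} (q : Fin N ≃ κ × Bool) :
    H.Represents φ E J (fun j => (p (q j).1).coeff * (x (q j).1 (q j).2 * y (q j).1)⁻¹)
      (fun j t => volterra (H.duhamel [] (p (q j).1).X.J (p (q j).1).X.n (p (q j).1).X.c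
        (p (q j).1).X.m t))
      (fun j => ((p (q j).1).lift (q j).2).scale (x (q j).1 (q j).2))
      (fun j => (p (q j).1).Z.scale (y (q j).1)) := by
  rintro f g u hg ⟨B', hB'⟩ ⟨s, hs, h, hh, hf, hu⟩
  obtain ⟨B, hB⟩ := hh.2.1
  choose C hC using fun i => hh.exists_act_std_le (p i).Y (hc i) (hc' i)
    (hs.2.trans_le (by exact_mod_cast (by norm_num : 1 ≤ 2).trans (hY i))) (hY' i)
  have hint : ∀ᵐ e ∂(μ.prod volume), ∀ i β, _ := ae_all_iff.2 fun i => ae_all_iff.2 fun β =>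
    hS.integrable_representation (p i).X ((p i).lift β) (p i).Z (hX i)
      (by rw [ParaTerm.order_lift]; have := hY i; omega) hh.1 hg hB hB'
  filter_upwards [hS.resolution_sum p hX hY hJ hh.1 hg hB hB' hs.1 hC, hint, hu]
    with e he hi heu heJ
  refine ⟨fun j => ?_, ?_⟩
  · have h1 := (hi (q j).1 (q j).2).const_mul
      ((x (q j).1 (q j).2 : ℂ) * (y (q j).1 : ℂ))
    refine h1.congr ?_
    have h2 : ∀ᵐ p ∂((volume.restrict (Ioc (0 : ℝ) 1)).prod (posMeasure μ)), p.1 ∈ Ioc (0 : ℝ) 1 :=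
      Measure.quasiMeasurePreserving_fst.ae (ae_restrict_mem measurableSet_Ioc)
    have h3 : ∀ᵐ p ∂((volume.restrict (Ioc (0 : ℝ) 1)).prod (posMeasure μ)), (0 : ℝ) ≤ p.2.2 :=
      Measure.quasiMeasurePreserving_snd.ae (ae_posMeasure_nonneg μ)
    filter_upwards [h2, h3] with z hz1 hz2
    rcases lt_or_ge z.2.2 e.2 with hlt | hle
    · simp only [act_std_scale]
      rw [act_std_congr _ hJ hf hz1.1 (hJ _ heJ _ hz2 hlt.le)]
      ring
    · simp only [volterra_eq_zero hle, zero_mul, mul_zero]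
  · have h1 : H.paraproduct φ E g h = fun e' => ∫ t in Ioc (0 : ℝ) 1, ((t⁻¹ : ℝ) : ℂ) *
        ∑ i, ((p i).coeff : ℂ) * H.bilinear (H.stdDual (p i).X) (p i).Y (p i).Z h g t e' :=
      funext fun e' => hp g h e'
    rw [heu heJ, h1, he heJ]
    have h2 : ∀ i β, ((((p i).coeff * (x i β * y i)⁻¹ : ℝ)) : ℂ) *
        (∫ t in Ioc (0 : ℝ) 1, ((t⁻¹ : ℝ) : ℂ) *
          H.bilinear (fun t => volterra (H.duhamel [] (p i).X.J (p i).X.n (p i).X.c (p i).X.m t))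
            (((p i).lift β).scale (x i β)) ((p i).Z.scale (y i)) f g t e)
        = ((p i).coeff : ℂ) * ∫ t in Ioc (0 : ℝ) 1, ((t⁻¹ : ℝ) : ℂ) *
          H.bilinear (fun t => volterra (H.duhamel [] (p i).X.J (p i).X.n (p i).X.c (p i).X.m t))
            ((p i).lift β) (p i).Z (H.resolution h) g t e := by
      intro i β
      have hx0 : (x i β : ℂ) ≠ 0 := by exact_mod_cast (hx i β).ne'
      have hy0 : (y i : ℂ) ≠ 0 := by exact_mod_cast (hy i).ne'
      rw [← integral_const_mul, ← integral_const_mul]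
      refine integral_congr_ae ?_
      filter_upwards [ae_restrict_mem measurableSet_Ioc] with t ht
      rw [bilinear_scale, bilinear_congr _ _ hJ hf ht.1 heJ]
      push_cast
      field_simp
    rw [Equiv.sum_comp q (fun r : κ × Bool => ((((p r.1).coeff * (x r.1 r.2 * y r.1)⁻¹ : ℝ)) : ℂ) *
        (∫ t in Ioc (0 : ℝ) 1, ((t⁻¹ : ℝ) : ℂ) *
          H.bilinear (fun t => volterra (H.duhamel [] (p r.1).X.J (p r.1).X.n (p r.1).X.c
            (p r.1).X.m t))
            (((p r.1).lift r.2).scale (x r.1 r.2)) ((p r.1).Z.scale (y r.1)) f g t e)),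
      Fintype.sum_prod_type]
    refine Finset.sum_congr rfl fun i _ => ?_
    rw [Fintype.sum_bool, h2, h2, mul_add]
    rfl

end Ops

end HeatSystem

/-- The orders and parameters of the families in the terms of a paraproduct. -/
lemma LeibnizExpansion.term_spec {d b : ℕ} (E : LeibnizExpansion d b) {φ : ℝ → ℝ}
    (hφ : IsProfile φ) (hb : 1 ≤ b) {i : Fin E.nA ⊕ Fin E.nB} (hi : E.IsHigh i) :
    (b ≤ 2 * (E.term hφ i).X.order ∧ (E.term hφ i).X.k ≤ b) ∧
    (b ≤ 2 * (E.term hφ i).Y.order ∧ (E.term hφ i).Y.order ≤ b ∧ 1 ≤ (E.term hφ i).Y.c ∧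
      (E.term hφ i).Y.c ≤ b) ∧
    (E.term hφ i).Z.order ≤ b ∧ 1 ≤ (E.term hφ i).Z.c ∧ (E.term hφ i).Z.c ≤ b := by
  rcases i with i | i
  · obtain ⟨-, -, h3, h4, -⟩ := StdFamily.mollified_fields b hφ (E.A i).I (E.A i).k
    obtain ⟨-, -, -, h4', -⟩ := StdFamily.mollified_fields b hφ (E.A i).J (E.A i).l
    have hI := StdFamily.order_mollified b hφ (E.A i).I (E.A i).k
    have hJ := StdFamily.order_mollified b hφ (E.A i).J (E.A i).l
    have h5 := (E.A i).balance
    have h6 := (E.A i).le_order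
    have h7 := (E.A i).order_le
    have h8 : b < 2 * (E.A i).I.length + 4 * (E.A i).k := hi
    simp only [LeibnizExpansion.term, Sum.elim_inl, h3, h4', hI, hJ]
    exact ⟨⟨by omega, by omega⟩, ⟨h6, h7, (E.A i).one_le_c, (E.A i).c_le⟩, by omega, hb, le_rfl⟩
  · obtain ⟨-, -, h3, h4, -⟩ := StdFamily.mollified_fields b hφ (E.B i).I (E.B i).k
    obtain ⟨-, -, -, h4', -⟩ := StdFamily.mollified_fields b hφ (E.B i).J (E.B i).l
    have hI := StdFamily.order_mollified b hφ (E.B i).I (E.B i).k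
    have hJ := StdFamily.order_mollified b hφ (E.B i).J (E.B i).l
    have h5 := (E.B i).balance
    have h6 := (E.B i).le_order
    have h7 := (E.B i).order_le
    have h8 : b < 2 * (E.B i).I.length + 4 * (E.B i).k := hi
    have h9 : (E.B i).S.k ≤ (E.B i).S.order := by unfold StdFamily.order; omega
    simp only [LeibnizExpansion.term, Sum.elim_inr, h4, h4', hI, hJ]
    exact ⟨⟨h6, by omega⟩, ⟨by omega, by omega, hb, le_rfl⟩, by omega, hb, le_rfl⟩

end Paracontrolled

end

theorem mainTheorem7 {M : Type*} [MetricSpace M] [ProperSpace M] [MeasurableSpace M]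
    [BorelSpace M] (μ : MeasureTheory.Measure M) (hμ : Paracontrolled.VolumeDoubling μ) {d : ℕ}
    (H : Paracontrolled.HeatSystem M μ d) (hH : H.AssumptionA) :
    ∃ ℓ₀ : ℕ, ∀ ℓ : ℕ, ℓ₀ ≤ ℓ → ∃ b₀ : ℕ, ∀ b : ℕ, b₀ ≤ b → 8 ∣ b →
      ∀ φ : ℝ → ℝ, Paracontrolled.IsMollifier b φ →
      ∀ E : Paracontrolled.LeibnizExpansion d b,
      ∃ (N : ℕ) (a : Fin N → ℝ) (Q1 Q1dual : Fin N → Paracontrolled.Family M)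
        (Q2 P1 : Fin N → Paracontrolled.StdFamily d),
        (∀ j, (Q1 j).IsMeasurable ∧ (Q1dual j).IsMeasurable ∧
          H.IsFormalDual (Q1 j) (Q1dual j) ∧
          (∃ a₂ : ℕ, b / 4 ≤ a₂ ∧ a₂ ≤ 2 * b ∧ (Q2 j).InStGC b a₂) ∧
          (∃ a₁ : ℕ, a₁ ≤ 2 * b ∧ (P1 j).InStGC b a₁)) ∧
        (Bornology.IsBounded (Set.univ : Set M) →
          (∀ j, H.InGC ℓ b (b / 8 - 2) (Set.Ici 0) (Q1 j)) ∧
          H.Represents φ E (Set.Ici 0) a Q1dual Q2 P1) ∧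
        ∀ T : ℝ, 0 < T →
          (∀ j, H.InGC ℓ b (b / 8 - 2) (Set.Icc 0 T) (Q1 j)) ∧
          H.Represents φ E (Set.Icc 0 T) a Q1dual Q2 P1 := by
  classical
  rcases isEmpty_or_nonempty M with hM | hM
  · -- On the empty space every statement about almost all points is void.
    have hrep : ∀ (b : ℕ) (φ : ℝ → ℝ) (E : Paracontrolled.LeibnizExpansion d b) (J : Set ℝ),
        H.Represents φ E J (N := 0) (fun j => j.elim0) (fun j => j.elim0) (fun j => j.elim0)
          (fun j => j.elim0) :=
      fun b φ E J f g u _ _ _ => ae_of_all _ fun e => isEmptyElim e.1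
    exact ⟨0, fun ℓ _ => ⟨0, fun b _ _ φ _ E => ⟨0, fun j => j.elim0, fun j => j.elim0,
      fun j => j.elim0, fun j => j.elim0, fun j => j.elim0, fun j => j.elim0,
      fun _ => ⟨fun j => j.elim0, hrep b φ E _⟩, fun T _ => ⟨fun j => j.elim0, hrep b φ E _⟩⟩⟩⟩
  obtain ⟨A, D, hV⟩ := hμ.exists_volGrowth
  have hσ : SigmaFinite μ := hV.sigmaFinite
  have hS : H.Setting A D := ⟨hH, hV⟩
  -- With `a = b/8 - 2`, this choice of `b₀` ensures `a + 2 (2 ℓ + 1) + 2 ≤ b / 2`, the cancellation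
  -- that the outer families are known to have.
  refine ⟨0, fun ℓ _ => ⟨16 * ℓ + 32, fun b hb h8 φ hφ E => ?_⟩⟩
  have hp : Paracontrolled.IsProfile φ := ⟨hφ.1, hφ.2.1⟩
  have hb1 : 1 ≤ b := by omega
  set κ := {i // E.IsHigh i}
  set p : κ → Paracontrolled.ParaTerm d := fun i => E.term hp i
  have hspec := fun i : κ => E.term_spec hp hb1 i.2
  -- Standard families are normalized; the normalizing factors `x`, `y` go into the coefficients.
  choose x hx hxn using fun (i : κ) (β : Bool) => ((p i).lift β).exists_scale_normalized (b := b)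
    (by rw [Paracontrolled.ParaTerm.c_lift]; exact (hspec i).2.1.2.2.1)
    (by rw [Paracontrolled.ParaTerm.c_lift]; exact (hspec i).2.1.2.2.2)
  choose y hy hyn using fun (i : κ) => (p i).Z.exists_scale_normalized (b := b)
    (hspec i).2.2.2.1 (hspec i).2.2.2.2
  let q : Fin (Fintype.card (κ × Bool)) ≃ κ × Bool := (Fintype.equivFin (κ × Bool)).symm
  have hrep : ∀ J : Set ℝ, (∀ τ ∈ J, ∀ σ, 0 ≤ σ → σ ≤ τ → σ ∈ J) → H.Represents φ E J _ _ _ _ :=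
    fun J hJ => hS.represents p (fun g f e => H.paraproduct_eq hp E g f e)
      (fun i => by have := (hspec i).1.1; show 4 ≤ (E.term hp i).X.order; omega)
      (fun i => by have := (hspec i).2.1.1; show 2 ≤ (E.term hp i).Y.order; omega)
      (fun i => by have := (hspec i).2.1.2.1; show (E.term hp i).Y.order ≤ 2 * b; omega)
      (fun i => (hspec i).2.1.2.2.1) (fun i => (hspec i).2.1.2.2.2) hx hy hJ q
  have hGC : ∀ J : Set ℝ, J ⊆ Ici 0 → ∀ R : ℝ, 0 < R →
      (∀ e e' : M × ℝ, e.2 ∈ J → e'.2 ∈ J → e.2 - e'.2 ≤ R ∨ dist e.1 e'.1 ≤ R) →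
      ∀ j, H.InGC ℓ b (b / 8 - 2) J (fun t => Paracontrolled.volterra
        (H.duhamel (p (q j).1).X.J [] (p (q j).1).X.n (p (q j).1).X.c (p (q j).1).X.m t)) :=
    fun J hJ0 R hR hJ j => hS.inGC_duhamel (p (q j).1).X.isProfile (hspec (q j).1).1.2 hb1
      (p (q j).1).X.moments _ _ _ (by
        have h1 : b ≤ 2 * ((p (q j).1).X.J.length + 2 * (p (q j).1).X.n
          + 2 * (p (q j).1).X.k) := (hspec (q j).1).1.1
        have h2 : b / 8 - 2 + 2 * (2 * ℓ + 1) + 2 ≤ (p (q j).1).X.J.length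
          + 2 * (p (q j).1).X.n + 2 * (p (q j).1).X.k := by omega
        exact h2) hJ0 hR hJ
  refine ⟨Fintype.card (κ × Bool), _, fun j t => Paracontrolled.volterra
    (H.duhamel (p (q j).1).X.J [] (p (q j).1).X.n (p (q j).1).X.c (p (q j).1).X.m t), _, _, _,
    fun j => ⟨?_, ?_, ?_, ⟨(p (q j).1).Y.order + 2, ?_, ?_, hxn (q j).1 (q j).2, ?_⟩,
      (p (q j).1).Z.order, ?_, hyn (q j).1, rfl⟩,
    fun hbd => ⟨?_, hrep (Ici 0) fun τ _ σ h0 _ => h0⟩,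
    fun T hT => ⟨?_, hrep (Icc 0 T) fun τ h σ h0 h1 => ⟨h0, h1.trans h.2⟩⟩⟩
  · exact hS.measurable_duhamel_family (p (q j).1).X.smooth.continuous.measurable _ _ _ _
  · exact hS.measurable_duhamel_family (p (q j).1).X.smooth.continuous.measurable _ _ _ _
  · exact hS.isFormalDual_duhamel (p (q j).1).X.isProfile _ _ _
  · have := (hspec (q j).1).2.1.1
    show b / 4 ≤ (E.term hp (q j).1).Y.order + 2
    omega
  · have := (hspec (q j).1).2.1.2.1
    show (E.term hp (q j).1).Y.order + 2 ≤ 2 * b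
    omega
  · rw [Paracontrolled.StdFamily.order_scale, Paracontrolled.ParaTerm.order_lift]
  · have := (hspec (q j).1).2.2.1
    show (E.term hp (q j).1).Z.order ≤ 2 * b
    omega
  · obtain ⟨R, hR⟩ := Metric.isBounded_iff.1 hbd
    exact hGC (Ici 0) subset_rfl (max R 1) (by positivity) fun e e' _ _ =>
      Or.inr ((hR (mem_univ _) (mem_univ _)).trans (le_max_left _ _))
  · exact hGC (Icc 0 T) (fun τ h => h.1) T hT fun e e' h h' => Or.inl (by
      have h1 := h.2
      have h2 := h'.1
      linarith)
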